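/- **Consistency around a hexagonal prism (CAHP).** All variables and parameters are complex. Write $Z(\alpha)=e^{\alpha}$, $\mathrm{sh}(\alpha)=\sinh\alpha$, $\phi=\alpha+\beta-\gamma$. *Quad polynomials* $Q(x_a;x_b;x_c;x_d;\alpha,\beta)$: - $Q3_{(\delta)}=\mathrm{sh}(\alpha)(x_ax_b+x_cx_d)-\mathrm{sh}(\beta)(x_ax_c+x_bx_d)-\mathrm{sh}(\alpha-\beta)(x_ax_d+x_bx_c)-\delta\,\mathrm{sh}(\alpha)\mathrm{sh}(\beta)\mathrm{sh}(\alpha-\beta)$; - $Q1_{(\delta)}=\alpha(x_a-x_c)(x_b-x_d)-\beta(x_a-x_b)(x_c-x_d)+\delta\alpha\beta(\alpha-\beta)$; - $Q2=Q1_{(0)}+\alpha\beta(\alpha-\beta)(x_a+x_b+x_c+x_d+\alpha\beta-\alpha^2-\beta^2)$; - $H3_{(\delta;\varepsilon)}=Z(\alpha)(x_ax_c+x_bx_d)-Z(\beta)(x_ax_b+x_cx_d)-\mathrm{sh}(\alpha-\beta)\bigl(\delta(2-\varepsilon)+\varepsilon Z(\alpha+\beta)x_ax_d\bigr)$; - $H2_{(\varepsilon)}=(x_a-x_d)(x_b-x_c)-(\alpha-\beta)(x_a+x_b+x_c+x_d)-(\alpha^2-\beta^2)+\tfrac{\varepsilon}{2}(\alpha-\beta)\bigl((2x_a+\alpha+\beta+1)(2x_d+\alpha+\beta+1)+(\alpha-\beta)^2-1\bigr)$;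 - $H1_{(\varepsilon)}=(x_a-x_d)(x_b-x_c)+2(\alpha-\beta)-\varepsilon(\alpha-\beta)(2+x_a+x_d)$; - for a lattice with Weierstrass function $\wp$: $Q4=\wp'(\alpha)\bigl((x_a-\wp(\beta))(x_c-\wp(\beta))-u\bigr)\bigl((x_d-\wp(\beta))(x_b-\wp(\beta))-u\bigr)+\wp'(\beta)\bigl((x_a-\wp(\alpha))(x_b-\wp(\alpha))-v\bigr)\bigl((x_c-\wp(\alpha))(x_d-\wp(\alpha))-v\bigr)+\wp'(\alpha)\wp'(\beta)\wp'(\alpha-\beta)(\wp(\alpha)-\wp(\beta))$, with $u=(\wp(\alpha)-\wp(\beta))(\wp(\alpha-\beta)-\wp(\beta))$, $v=(\wp(\beta)-\wp(\alpha))(\wp(\alpha-\beta)-\wp(\alpha))$. The trapezoidal version of $H$ is $H^*(x_a;x_b;x_c;x_d;\alpha,\beta)=H(x_a;x_d;x_c;x_b;\beta-\alpha,\beta)$, and $\widetilde H(x_a;x_b;x_c;x_d;\alpha,\beta)=H(x_b;x_a;x_d;x_c;\alpha,\beta)$. *Face-centered quad polynomials* $F(x;x_a,x_b,x_c,x_d;\alpha,\beta,\gamma)$: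 - $A3_{(\delta)}=xP+\mathrm{sh}(\beta)(x_ax^2-x_bx_cx_d)-\mathrm{sh}(\beta-\gamma)(x_bx^2-x_ax_cx_d)-\mathrm{sh}(\alpha)(x_cx^2-x_ax_bx_d)+\mathrm{sh}(\alpha-\gamma)(x_dx^2-x_ax_bx_c)+\delta\bigl(\mathrm{sh}(\beta-\gamma)\mathrm{sh}(\alpha-\gamma)(\mathrm{sh}(\alpha)x_a-\mathrm{sh}(\beta)x_c)+\mathrm{sh}(\alpha)\mathrm{sh}(\beta)(\mathrm{sh}(\gamma-\alpha)x_b-\mathrm{sh}(\gamma-\beta)x_d)\bigr)$, where $P=(x_ax_c-x_bx_d)\mathrm{sh}(\alpha-\beta)+(x_cx_d-x_ax_b)\mathrm{sh}(\gamma)+(x_bx_c-x_ax_d)\mathrm{sh}(\phi)+\delta\,\mathrm{sh}(\alpha-\beta)\mathrm{sh}(\phi)\mathrm{sh}(\gamma)$; - $A2_{(\delta_1;\delta_2)}=xP-\alpha(x_c-x_d)\bigl(x^2+x_ax_b-\delta_1\beta^2(x_a+x_b-\beta^2)^{\delta_2}\bigr)+\beta(x_a-x_b)\bigl(x^2+x_cx_d-\delta_1\alpha^2(x_c+x_d-\alpha^2)^{\delta_2}\bigr)+\gamma(x_b-x_d)\bigl(x^2+x_ax_c-\delta_1\alpha\beta(x_a+x_c-(\alpha-\beta)^2-\alpha\beta)^{\delta_2}\bigr)+\delta_1\gamma\phi\bigl((\alpha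 x_a-\beta x_c+\delta_2(\alpha-\beta)\alpha\beta)(x_b+x_d+(\alpha-\gamma)(\gamma-\beta))^{\delta_2}+\delta_2((\alpha-\beta)(x_ax_c-x^2)-\alpha^3x_a+\beta^3x_c)\bigr)$, where $P=\alpha(x_c-x_d)(x_a+x_b+2\delta_2\beta^2)-\beta(x_a-x_b)(x_c+x_d+2\delta_2\alpha^2)-\gamma(x_b-x_d)(x_a+x_c+2\delta_2\alpha\beta)-\delta_1\phi\gamma\bigl((\alpha-\beta)(x_a+x_b+x_c+x_d+\gamma\phi-\alpha^2-\beta^2)^{\delta_2}-2\delta_2(\alpha x_a-\beta x_c)\bigr)$; - $C3_{(\delta_1;\delta_2;\delta_3)}=xP+(x_ax_b+2\delta_2\mathrm{sh}(\beta)\mathrm{sh}(\beta-\gamma))(x_d-x_cZ(\gamma))+(x_dZ(\gamma)-x_c)x^2+\delta_1Z(-\alpha)(1+2\delta_2x_cx_dZ(2\alpha-\gamma))\bigl((Z(\beta)-2\delta_3Z(2\alpha-\beta)x^2)(x_bZ(\gamma)-x_a)+(x_aZ(\gamma)-x_b)(Z(\gamma-\beta)-2\delta_3Z(\alpha+\phi)x^2)\bigr)$,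 where $P=(x_ax_c-x_bx_d)Z(\beta)+(x_bx_c-x_ax_d)Z(\gamma-\beta)+\delta_1\bigl(Z(-\alpha)-2(\delta_3x_ax_b-\delta_2x_cx_d)Z(\alpha-\gamma)\bigr)(1-Z(2\gamma))$; - $C2_{(\delta_1;\delta_2;\delta_3)}=xP+(x^2-x_ax_b)\gamma(\gamma-2\alpha)^{\delta_3}-(x^2+x_ax_b)(x_c-x_d)+\delta_1\beta(\beta-\gamma)\bigl(\gamma(\gamma-2\alpha)^{\delta_3}+x_c-x_d\bigr)(\beta(\gamma-\beta)+x_a+x_b)^{\delta_2}-2\delta_3\gamma(x_a+x_b)x^2+\delta_1(\beta(x_a-x_b)-\gamma x_a)\bigl(x_c+x_d+(2\alpha-\gamma)(\gamma-2\alpha)^{\delta_3}+2\delta_3(\alpha(\alpha-\gamma)-x^2)\bigr)(\gamma-2\alpha)^{\delta_2}+2\delta_2\bigl(\beta\gamma(\beta-\gamma)(\alpha+x_c)(\alpha-\gamma+x_d)+(\gamma x_a-\beta(x_a-x_b))(\alpha(\gamma-\alpha)+x_cx_d)\bigr)$, where $P=(x_a+x_b+2\delta_2(\beta-\gamma)\beta)(x_c-x_d)+(x_a-x_b)(2\beta-\gamma)(\gamma-2\alpha)^{\delta_3}+\delta_1\gamma\bigl(x_c+x_d+(2\alpha-\gamma)(\gamma-2\alpha)^{\delta_3}\bigr)(\gamma-2\alpha)^{\delta_2}+2\delta_2\gamma((\alpha-\gamma)\alpha-x_cx_d)+2\delta_3\gamma((\alpha-\beta)\phi+x_ax_b)$;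 - $C1_{(\delta)}=xP+2(\beta(x_a-x_b)-\gamma x_a)(-x_c/2-x_d/2)^{\delta}+(x^2+x_ax_b+\delta\beta(\gamma-\beta))(x_c-x_d)$, where $P=2\gamma(-x_c/2-x_d/2)^{\delta}-(x_a+x_b)(x_c-x_d)$; - $A4$, for a lattice with invariants $g_2,g_3$: put $\dot x=4x^3-g_2x-g_3$, $q(a)=(x-\wp(a))^2$, $p_0(a)=2g_3+(x+\wp(a))(g_2-4x\wp(a))$, $p_1(a)=16(x+\wp(a))g_3+(4x\wp(a)+g_2)^2$, $p_2(a_1,a_2)=\wp'(a_2)p_0(a_1)+\wp'(a_1)p_0(a_2)$, $p_3(a_1,a_2,a_3)=-4\dot x\prod_j\wp'(a_j)-\sum_i\wp'(a_i)\prod_{j\ne i}p_0(a_j)$, $p_4(a_1,\dots,a_4)=\sum_i\bigl(4\dot x\,p_0(a_i)\prod_{j\ne i}\wp'(a_j)+\wp'(a_i)\prod_{j\ne i}p_0(a_j)\bigr)$, and $q_1(y;a_1,\dots,a_4)=p_2(a_1,a_2)\bigl(p_1(a_3)p_1(a_4)-256q(a_3)q(a_4)y\bigr)$, $q_2(y_1,y_2;a_1,\dots,a_4)=p_2(a_1,a_2)\bigl(p_1(a_3)q(a_4)y_1-p_1(a_4)q(a_3)y_2\bigr)$,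 $q_3(y_1,y_2;a_1,\dots,a_4)=p_3(a_1,a_2,a_3)\bigl(16q(a_4)y_1-p_1(a_4)y_2\bigr)$, $q_4(y;a_1,\dots,a_4)=p_1(a_1)q(a_2)\bigl(\wp'(a_3)(16q(a_4)y+p_1(a_4))+\wp'(a_4)(16q(a_3)y+p_1(a_3))\bigr)$. With $\bar\alpha=\alpha-\gamma$, $\bar\beta=\beta-\gamma$, $\Pi=x_ax_bx_cx_d$, $$\begin{aligned}A4={}&\bigl(32x^2g_3+(4x^2+g_2)^2-16\wp(\alpha-\beta)\dot x\bigr)\bigl(\wp(\gamma)-\wp(\phi)\bigr)\Bigl[q_1(\Pi;-\alpha,\beta,\bar\alpha,\bar\beta)+q_1(\Pi;\alpha,\bar\beta,\bar\alpha,\beta)-q_1(\Pi;\bar\alpha,\beta,\alpha,\bar\beta)-q_1(\Pi;-\bar\alpha,\bar\beta,\alpha,\beta)\\ &-16\bigl(p_4(\alpha,\bar\alpha,\beta,\bar\beta)(x_bx_c-x_ax_d)+q_2(x_d,x_c;\beta,\bar\beta,\alpha,\bar\alpha)(x_a+x_b)+p_4(-\alpha,-\bar\alpha,\beta,\bar\beta)(x_ax_c-x_bx_d)+q_2(x_a,x_b;\alpha,\bar\alpha,\bar\beta,\beta)(x_c+x_d)\\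 &\quad+q_2(x_ax_b,x_cx_d;\alpha,-\bar\beta,\bar\alpha,\beta)-q_2(x_ax_b,x_cx_d;\alpha,\beta,\bar\alpha,\bar\beta)+q_2(x_ax_b,x_cx_d;\bar\alpha,\bar\beta,\alpha,\beta)-q_2(x_ax_b,x_cx_d;\bar\alpha,-\beta,\alpha,\bar\beta)\bigr)\\ &+4\bigl(q_3(x_bx_cx_d,x_a;\alpha,\beta,\bar\beta,\bar\alpha)-q_3(x_bx_cx_d,x_a;-\bar\alpha,\beta,\bar\beta,\alpha)+q_3(x_ax_cx_d,x_b;-\alpha,\beta,\bar\beta,\bar\alpha)-q_3(x_ax_cx_d,x_b;\bar\alpha,\beta,\bar\beta,\alpha)\\ &\quad-q_3(x_ax_bx_d,x_c;\alpha,\bar\alpha,\beta,\bar\beta)+q_3(x_ax_bx_d,x_c;\alpha,\bar\alpha,-\bar\beta,\beta)-q_3(x_ax_bx_c,x_d;\alpha,\bar\alpha,-\beta,\bar\beta)+q_3(x_ax_bx_c,x_d;\alpha,\bar\alpha,\bar\beta,\beta)\\ &\quad-q_4(x_cx_d;\bar\beta,\beta,\alpha,\bar\alpha)x_a+q_4(x_cx_d;\beta,\bar\beta,\alpha,\bar\alpha)x_b+q_4(x_ax_b;\bar\alpha,\alpha,\beta,\bar\beta)x_c-q_4(x_ax_b;\alpha,\bar\alpha,\beta,\bar\beta)x_d\bigr)\Bigr].\end{aligned}$$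 *Hex systems.* The type-A hex system $\mathbf A(x_a,x_b,x_c,x_d,x_e,x_f;\alpha,\beta,\gamma)$ consists of the six equations $A(x_a;x_f,x_e,x_b,x_c;\gamma,\beta,\alpha)=0$, $A(x_b;x_c,x_d,x_a,x_f;\gamma,\alpha,\beta)=0$, $A(x_c;x_d,x_e,x_b,x_a;\alpha,\beta,\gamma)=0$, $A(x_d;x_c,x_b,x_e,x_f;\gamma,\beta,\alpha)=0$, $A(x_e;x_f,x_a,x_d,x_c;\gamma,\alpha,\beta)=0$, $A(x_f;x_a,x_b,x_e,x_d;\alpha,\beta,\gamma)=0$. The type-C hex system $\mathbf C(x_a,\dots,x_f;\alpha,\beta,\gamma)$ of a pair $(C,\overline C)$ consists of $\overline C(x_a;x_f,x_e,x_b,x_c;\gamma,\beta,\alpha)=0$, $C(x_b;x_c,x_d,x_a,x_f;\gamma,\alpha,\beta)=0$, $C(x_c;x_b,x_d,x_a,x_e;\gamma-\alpha,-\alpha,\beta-\alpha)=0$, $C(x_d;x_c,x_b,x_e,x_f;\gamma,\beta,\alpha)=0$, $\overline C(x_e;x_f,x_a,x_d,x_c;\gamma,\alpha,\beta)=0$,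 $\overline C(x_f;x_e,x_a,x_d,x_b;\gamma-\alpha,-\alpha,\beta-\alpha)=0$. *Genericity.* A set $E\subset\mathbb C^4$ is thin if near every point of $\mathbb C^4$ it is contained in the zero set of an analytic function that does not vanish identically near that point. A statement about parameters $(\alpha,\beta,\gamma,\rho)$ and five initial values holds *generically* if for all $(\alpha,\beta,\gamma,\rho)$ outside some thin set it holds for all initial values outside the zero set of some nonzero polynomial in the five initial values. **(1) Type C.** Let $(C,\overline C;H;Q,Q^*)$ be one of the ten combinations | $C$ | $\overline C$ | $H$ | $Q$ | $Q^*$ | |---|---|---|---|---| | $C3_{(1/2;1/2;0)}$ | $C3_{(1/2;0;1/2)}$ | $H3_{(1;1)}$ | $Q3_{(1)}$ | $Q3_{(0)}$ | | $C3_{(1/2;0;1/2)}$ | $C3_{(1/2;1/2;0)}$ | $\widetilde{H3}_{(1;1)}$ | $Q3_{(0)}$ | $Q3_{(1)}$ | | $C3_{(1;0;0)}$ | $C3_{(1;0;0)}$ | $H3_{(1;0)}$ | $Q3_{(0)}$ | $Q3_{(0)}$ | | $C3_{(0;0;0)}$ | $C3_{(0;0;0)}$ | $H3_{(0;0)}$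 | $Q3_{(0)}$ | $Q3_{(0)}$ | | $C2_{(1;1;0)}$ | $C2_{(1;0;1)}$ | $H2_{(1)}$ | $Q2$ | $Q1_{(1)}$ | | $C2_{(1;0;1)}$ | $C2_{(1;1;0)}$ | $\widetilde{H2}_{(1)}$ | $Q1_{(1)}$ | $Q2$ | | $C2_{(1;0;0)}$ | $C2_{(1;0;0)}$ | $H2_{(0)}$ | $Q1_{(1)}$ | $Q1_{(1)}$ | | $C1_{(1)}$ | $C2_{(0;0;0)}$ | $H1_{(1)}$ | $Q1_{(1)}$ | $Q1_{(0)}$ | | $C2_{(0;0;0)}$ | $C1_{(1)}$ | $\widetilde{H1}_{(1)}$ | $Q1_{(0)}$ | $Q1_{(1)}$ | | $C1_{(0)}$ | $C1_{(0)}$ | $H1_{(0)}$ | $Q1_{(0)}$ | $Q1_{(0)}$ | and consider one of the following two systems of eighteen equations on the hexagonal prism with bottom vertices $x_a,\dots,x_f$ and top vertices $y_a,\dots,y_f$. First arrangement: $\mathbf C(x_a,\dots,x_f;\alpha,\beta,\gamma)$, $\mathbf C(y_a,y_b,y_c,y_d,y_e,y_f;\alpha,\beta,\gamma)$, and (q1)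 $H^*(x_a;y_a;x_b;y_b;\rho,\gamma)=0$, (q2) $Q^*(y_a;y_f;x_a;x_f;\beta,\rho)=0$, (q3) $Q(y_b;y_c;x_b;x_c;\alpha,\rho)=0$, (q4) $Q^*(y_f;y_e;x_f;x_e;\alpha,\rho)=0$, (q5) $Q(y_c;y_d;x_c;x_d;\beta,\rho)=0$, (q6) $H^*(x_e;y_e;x_d;y_d;\rho,\gamma)=0$. Second arrangement: $\mathbf C(x_a,\dots,x_f;\alpha,\beta,\gamma)$, $\mathbf C(y_d,y_e,y_f,y_a,y_b,y_c;\alpha,\beta,\gamma)$, and (q1) $H(y_b;y_a;x_b;x_a;\gamma,\rho)=0$, (q2) $H^*(x_f;x_a;y_f;y_a;\beta,\rho)=0$, (q3) $H^*(y_b;y_c;x_b;x_c;\alpha,\rho)=0$, (q4) $H^*(x_e;x_f;y_e;y_f;\alpha,\rho)=0$, (q5) $H^*(y_c;y_d;x_c;x_d;\beta,\rho)=0$, (q6) $H(y_d;y_e;x_d;x_e;\gamma,\rho)=0$. Then, generically in $(\alpha,\beta,\gamma,\rho)$ and $(x_a,x_b,x_e,x_f,y_a)$, the eighteen equations have exactly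 one solution in the seven unknowns $x_c,x_d,y_b,y_c,y_d,y_e,y_f$. Moreover, generically this solution is obtained stepwise: (i) the hex system on the $x$'s has exactly one solution $(x_c,x_d)$, (q1) has exactly one solution $y_b$ and (q2) exactly one solution $y_f$; (ii) (q3) has exactly one solution $y_c$ and (q4) exactly one solution $y_e$; (iii) the hex system on the $y$'s, (q5) and (q6), each regarded as equations for $y_d$ alone, each have exactly one solution, and the three solutions agree. **(2) Type A.** Let $(A,Q)$ be one of $(A3_{(1)},Q3_{(1)})$, $(A3_{(0)},Q3_{(0)})$, $(A2_{(1;1)},Q2)$, $(A2_{(1;0)},Q1_{(1)})$, $(A2_{(0;0)},Q1_{(0)})$, or $(A4,Q4)$ for any lattice in $\mathbb C$. Consider the eighteen equations $\mathbf A(x_a,\dots,x_f;\alpha,\beta,\gamma)$, $\mathbf A(y_a,\dots,y_f;\alpha,\beta,\gamma)$ and $Q(y_a;y_b;x_a;x_b;\gamma,\rho)=0$, $Q(y_b;y_c;x_b;x_c;\alpha,\rho)=0$, $Q(y_c;y_d;x_c;x_d;\beta,\rho)=0$, $Q(y_d;y_e;x_d;x_e;\gamma,\rho)=0$, $Q(y_e;y_f;x_e;x_f;\alpha,\rho)=0$,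 $Q(y_f;y_a;x_f;x_a;\beta,\rho)=0$. Fix any four consecutive (cyclically) of the vertices $x_a,\dots,x_f$ and any one of $y_a,\dots,y_f$ as initial vertices. Then, generically in $(\alpha,\beta,\gamma,\rho)$ and in the five initial values, the eighteen equations have exactly one solution in the remaining seven unknowns. -/

import Mathlib

open scoped Topology

noncomputable section

namespace HexPrism

/-- A quad polynomial `Q(x_a; x_b; x_c; x_d; α, β)`, arguments in this order. -/
abbrev QuadPoly := ℂ → ℂ → ℂ → ℂ → ℂ → ℂ → ℂ

/-- A face-centered quad polynomial `A(x; x_a, x_b, x_c, x_d; α, β, γ)`, arguments in this order. -/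
abbrev FacePoly := ℂ → ℂ → ℂ → ℂ → ℂ → ℂ → ℂ → ℂ → ℂ

/-! ### Type-Q and type-H quad polynomials -/

/-- `Q4`, for the Weierstrass functions `℘, ℘'` of the lattice `L`. -/
def Q4 (L : PeriodPair) : QuadPoly := fun xa xb xc xd α β =>
  let pa := L.weierstrassP α
  let pb := L.weierstrassP β
  let pab := L.weierstrassP (α - β)
  let da := L.derivWeierstrassP α
  let db := L.derivWeierstrassP β
  let dab := L.derivWeierstrassP (α - β)
  da * ((xa - pb) * (xc - pb) - (pa - pb) * (pab - pb))
      * ((xd - pb) * (xb - pb) - (pa - pb) * (pab - pb))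
    + db * ((xa - pa) * (xb - pa) - (pb - pa) * (pab - pa))
      * ((xc - pa) * (xd - pa) - (pb - pa) * (pab - pa))
    + da * db * dab * (pa - pb)

def Q3 (δ : ℂ) : QuadPoly := fun xa xb xc xd α β =>
  Complex.sinh α * (xa * xb + xc * xd) - Complex.sinh β * (xa * xc + xb * xd)
    - Complex.sinh (α - β) * (xa * xd + xb * xc)
    - δ * Complex.sinh α * Complex.sinh β * Complex.sinh (α - β)

def Q1 (δ : ℂ) : QuadPoly := fun xa xb xc xd α β =>
  α * (xa - xc) * (xb - xd) - β * (xa - xb) * (xc - xd) + δ * α * β * (α - β)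

def Q2 : QuadPoly := fun xa xb xc xd α β =>
  Q1 0 xa xb xc xd α β
    + α * β * (α - β) * (xa + xb + xc + xd + α * β - α ^ 2 - β ^ 2)

def H3 (δ ε : ℂ) : QuadPoly := fun xa xb xc xd α β =>
  Complex.exp α * (xa * xc + xb * xd) - Complex.exp β * (xa * xb + xc * xd)
    - Complex.sinh (α - β) * (δ * (2 - ε) + ε * Complex.exp (α + β) * xa * xd)

def H2 (ε : ℂ) : QuadPoly := fun xa xb xc xd α β =>
  (xa - xd) * (xb - xc) - (α - β) * (xa + xb + xc + xd) - (α ^ 2 - β ^ 2)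
    + ε / 2 * (α - β) * ((2 * xa + α + β + 1) * (2 * xd + α + β + 1) + (α - β) ^ 2 - 1)

def H1 (ε : ℂ) : QuadPoly := fun xa xb xc xd α β =>
  (xa - xd) * (xb - xc) + 2 * (α - β) - ε * (α - β) * (2 + xa + xd)

/-- The exchange of variables `x_a ↔ x_b`, `x_c ↔ x_d` in a quad polynomial. -/
def swapped (H : QuadPoly) : QuadPoly := fun xa xb xc xd α β => H xb xa xd xc α β

/-- The trapezoidal version `H*` of a type-H polynomial `H`. -/
def trapezoidal (H : QuadPoly) : QuadPoly := fun xa xb xc xd α β => H xa xd xc xb (β - α) β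

/-! ### Type-A and type-C face-centered quad polynomials -/

def A3 (δ : ℂ) : FacePoly := fun x xa xb xc xd α β γ =>
  let φ := α + β - γ
  let P := (xa * xc - xb * xd) * Complex.sinh (α - β) + (xc * xd - xa * xb) * Complex.sinh γ
    + (xb * xc - xa * xd) * Complex.sinh φ
    + δ * Complex.sinh (α - β) * Complex.sinh φ * Complex.sinh γ
  x * P + Complex.sinh β * (xa * x ^ 2 - xb * xc * xd)
    - Complex.sinh (β - γ) * (xb * x ^ 2 - xa * xc * xd)
    - Complex.sinh α * (xc * x ^ 2 - xa * xb * xd)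
    + Complex.sinh (α - γ) * (xd * x ^ 2 - xa * xb * xc)
    + δ * (Complex.sinh (β - γ) * Complex.sinh (α - γ)
            * (Complex.sinh α * xa - Complex.sinh β * xc)
          + Complex.sinh α * Complex.sinh β
            * (Complex.sinh (γ - α) * xb - Complex.sinh (γ - β) * xd))

def A2 (δ₁ δ₂ : ℕ) : FacePoly := fun x xa xb xc xd α β γ =>
  let φ := α + β - γ
  let P := α * (xc - xd) * (xa + xb + 2 * δ₂ * β ^ 2) - β * (xa - xb) * (xc + xd + 2 * δ₂ * α ^ 2)
    - γ * (xb - xd) * (xa + xc + 2 * δ₂ * α * β)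
    - δ₁ * φ * γ * ((α - β) * (xa + xb + xc + xd + γ * φ - α ^ 2 - β ^ 2) ^ δ₂
        - 2 * δ₂ * (α * xa - β * xc))
  x * P
    - α * (xc - xd) * (x ^ 2 + xa * xb - δ₁ * β ^ 2 * (xa + xb - β ^ 2) ^ δ₂)
    + β * (xa - xb) * (x ^ 2 + xc * xd - δ₁ * α ^ 2 * (xc + xd - α ^ 2) ^ δ₂)
    + γ * (xb - xd) * (x ^ 2 + xa * xc
        - δ₁ * α * β * (xa + xc - (α - β) ^ 2 - α * β) ^ δ₂)
    + δ₁ * γ * φ * ((α * xa - β * xc + δ₂ * (α - β) * α * β)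
          * (xb + xd + (α - γ) * (γ - β)) ^ δ₂
        + δ₂ * ((α - β) * (xa * xc - x ^ 2) - α ^ 3 * xa + β ^ 3 * xc))

def C3 (δ₁ δ₂ δ₃ : ℂ) : FacePoly := fun x xa xb xc xd α β γ =>
  let φ := α + β - γ
  let P := (xa * xc - xb * xd) * Complex.exp β + (xb * xc - xa * xd) * Complex.exp (γ - β)
    + δ₁ * (Complex.exp (-α) - 2 * (δ₃ * xa * xb - δ₂ * xc * xd) * Complex.exp (α - γ))
      * (1 - Complex.exp (2 * γ))
  x * P
    + (xa * xb + 2 * δ₂ * Complex.sinh β * Complex.sinh (β - γ)) * (xd - xc * Complex.exp γ)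
    + (xd * Complex.exp γ - xc) * x ^ 2
    + δ₁ * Complex.exp (-α) * (1 + 2 * δ₂ * xc * xd * Complex.exp (2 * α - γ))
      * ((Complex.exp β - 2 * δ₃ * Complex.exp (2 * α - β) * x ^ 2) * (xb * Complex.exp γ - xa)
        + (xa * Complex.exp γ - xb)
          * (Complex.exp (γ - β) - 2 * δ₃ * Complex.exp (α + φ) * x ^ 2))

def C2 (δ₁ δ₂ δ₃ : ℕ) : FacePoly := fun x xa xb xc xd α β γ =>
  let φ := α + β - γ
  let P := (xa + xb + 2 * δ₂ * (β - γ) * β) * (xc - xd)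
    + (xa - xb) * (2 * β - γ) * (γ - 2 * α) ^ δ₃
    + δ₁ * γ * (xc + xd + (2 * α - γ) * (γ - 2 * α) ^ δ₃) * (γ - 2 * α) ^ δ₂
    + 2 * δ₂ * γ * ((α - γ) * α - xc * xd)
    + 2 * δ₃ * γ * ((α - β) * φ + xa * xb)
  x * P + (x ^ 2 - xa * xb) * γ * (γ - 2 * α) ^ δ₃ - (x ^ 2 + xa * xb) * (xc - xd)
    + δ₁ * β * (β - γ) * (γ * (γ - 2 * α) ^ δ₃ + (xc - xd)) * (β * (γ - β) + xa + xb) ^ δ₂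
    - 2 * δ₃ * γ * (xa + xb) * x ^ 2
    + δ₁ * (β * (xa - xb) - γ * xa)
      * (xc + xd + (2 * α - γ) * (γ - 2 * α) ^ δ₃ + 2 * δ₃ * (α * (α - γ) - x ^ 2))
      * (γ - 2 * α) ^ δ₂
    + 2 * δ₂ * (β * γ * (β - γ) * (α + xc) * (α - γ + xd)
        + (γ * xa - β * (xa - xb)) * (α * (γ - α) + xc * xd))

def C1 (δ : ℕ) : FacePoly := fun x xa xb xc xd _ β γ =>
  let P := 2 * γ * (-xc / 2 - xd / 2) ^ δ - (xa + xb) * (xc - xd)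
  x * P + 2 * (β * (xa - xb) - γ * xa) * (-xc / 2 - xd / 2) ^ δ
    + (x ^ 2 + xa * xb + δ * β * (γ - β)) * (xc - xd)

/-! ### The elliptic face-centered quad polynomial `A4` -/

section Elliptic

variable (L : PeriodPair)

/-- The polynomial `4 x ^ 3 - g₂ x - g₃`. -/
def xdot (x : ℂ) : ℂ := 4 * x ^ 3 - L.g₂ * x - L.g₃

def eqSq (x a : ℂ) : ℂ := (x - L.weierstrassP a) ^ 2

def ep0 (x a : ℂ) : ℂ :=
  2 * L.g₃ + (x + L.weierstrassP a) * (L.g₂ - 4 * x * L.weierstrassP a)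

def ep1 (x a : ℂ) : ℂ :=
  16 * (x + L.weierstrassP a) * L.g₃ + (4 * x * L.weierstrassP a + L.g₂) ^ 2

def ep2 (x a₁ a₂ : ℂ) : ℂ :=
  L.derivWeierstrassP a₂ * ep0 L x a₁ + L.derivWeierstrassP a₁ * ep0 L x a₂

def ep3 (x a₁ a₂ a₃ : ℂ) : ℂ :=
  let d := L.derivWeierstrassP
  let p := ep0 L x
  (-4) * xdot L x * (d a₁ * d a₂ * d a₃)
    - (d a₁ * (p a₂ * p a₃) + d a₂ * (p a₁ * p a₃) + d a₃ * (p a₁ * p a₂))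

def ep4 (x a₁ a₂ a₃ a₄ : ℂ) : ℂ :=
  let d := L.derivWeierstrassP
  let p := ep0 L x
  (4 * xdot L x * p a₁ * (d a₂ * d a₃ * d a₄) + d a₁ * (p a₂ * p a₃ * p a₄))
    + (4 * xdot L x * p a₂ * (d a₁ * d a₃ * d a₄) + d a₂ * (p a₁ * p a₃ * p a₄))
    + (4 * xdot L x * p a₃ * (d a₁ * d a₂ * d a₄) + d a₃ * (p a₁ * p a₂ * p a₄))
    + (4 * xdot L x * p a₄ * (d a₁ * d a₂ * d a₃) + d a₄ * (p a₁ * p a₂ * p a₃))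

def eq1 (x y a₁ a₂ a₃ a₄ : ℂ) : ℂ :=
  ep2 L x a₁ a₂ * (ep1 L x a₃ * ep1 L x a₄ - 256 * eqSq L x a₃ * eqSq L x a₄ * y)

def eq2 (x y₁ y₂ a₁ a₂ a₃ a₄ : ℂ) : ℂ :=
  ep2 L x a₁ a₂ * (ep1 L x a₃ * eqSq L x a₄ * y₁ - ep1 L x a₄ * eqSq L x a₃ * y₂)

def eq3 (x y₁ y₂ a₁ a₂ a₃ a₄ : ℂ) : ℂ :=
  ep3 L x a₁ a₂ a₃ * (16 * eqSq L x a₄ * y₁ - ep1 L x a₄ * y₂)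

def eq4 (x y a₁ a₂ a₃ a₄ : ℂ) : ℂ :=
  ep1 L x a₁ * eqSq L x a₂
    * (L.derivWeierstrassP a₃ * (16 * eqSq L x a₄ * y + ep1 L x a₄)
      + L.derivWeierstrassP a₄ * (16 * eqSq L x a₃ * y + ep1 L x a₃))

def A4 : FacePoly := fun x xa xb xc xd α β γ =>
  let φ := α + β - γ
  (32 * x ^ 2 * L.g₃ + (4 * x ^ 2 + L.g₂) ^ 2 - 16 * L.weierstrassP (α - β) * xdot L x)
  * (L.weierstrassP γ - L.weierstrassP φ)
  * (eq1 L x (xa * xb * xc * xd) (-α) β (α - γ) (β - γ)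
    + eq1 L x (xa * xb * xc * xd) α (β - γ) (α - γ) β
    - eq1 L x (xa * xb * xc * xd) (α - γ) β α (β - γ)
    - eq1 L x (xa * xb * xc * xd) (-(α - γ)) (β - γ) α β
    - 16 * (ep4 L x α (α - γ) β (β - γ) * (xb * xc - xa * xd)
      + eq2 L x xd xc β (β - γ) α (α - γ) * (xa + xb)
      + ep4 L x (-α) (-(α - γ)) β (β - γ) * (xa * xc - xb * xd)
      + eq2 L x xa xb α (α - γ) (β - γ) β * (xc + xd)
      + eq2 L x (xa * xb) (xc * xd) α (-(β - γ)) (α - γ) β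
      - eq2 L x (xa * xb) (xc * xd) α β (α - γ) (β - γ)
      + eq2 L x (xa * xb) (xc * xd) (α - γ) (β - γ) α β
      - eq2 L x (xa * xb) (xc * xd) (α - γ) (-β) α (β - γ))
    + 4 * (eq3 L x (xb * xc * xd) xa α β (β - γ) (α - γ)
      - eq3 L x (xb * xc * xd) xa (-(α - γ)) β (β - γ) α
      + eq3 L x (xa * xc * xd) xb (-α) β (β - γ) (α - γ)
      - eq3 L x (xa * xc * xd) xb (α - γ) β (β - γ) α
      - eq3 L x (xa * xb * xd) xc α (α - γ) β (β - γ)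
      + eq3 L x (xa * xb * xd) xc α (α - γ) (-(β - γ)) β
      - eq3 L x (xa * xb * xc) xd α (α - γ) (-β) (β - γ)
      + eq3 L x (xa * xb * xc) xd α (α - γ) (β - γ) β
      - eq4 L x (xc * xd) (β - γ) β α (α - γ) * xa
      + eq4 L x (xc * xd) β (β - γ) α (α - γ) * xb
      + eq4 L x (xa * xb) (α - γ) α β (β - γ) * xc
      - eq4 L x (xa * xb) α (α - γ) β (β - γ) * xd))

end Elliptic

/-! ### Systems of hex equations

The vertices `a, b, c, d, e, f` of a hexagon are indexed by `0, 1, 2, 3, 4, 5`. -/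

/-- The system of six type-A hex equations `(A.a), …, (A.f)`. -/
def HexA (A : FacePoly) (α β γ : ℂ) (x : Fin 6 → ℂ) : Prop :=
  A (x 0) (x 5) (x 4) (x 1) (x 2) γ β α = 0 ∧
  A (x 1) (x 2) (x 3) (x 0) (x 5) γ α β = 0 ∧
  A (x 2) (x 3) (x 4) (x 1) (x 0) α β γ = 0 ∧
  A (x 3) (x 2) (x 1) (x 4) (x 5) γ β α = 0 ∧
  A (x 4) (x 5) (x 0) (x 3) (x 2) γ α β = 0 ∧
  A (x 5) (x 0) (x 1) (x 4) (x 3) α β γ = 0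

/-- The system of six type-C hex equations `(C.a), …, (C.f)`. -/
def HexC (C Cbar : FacePoly) (α β γ : ℂ) (x : Fin 6 → ℂ) : Prop :=
  Cbar (x 0) (x 5) (x 4) (x 1) (x 2) γ β α = 0 ∧
  C (x 1) (x 2) (x 3) (x 0) (x 5) γ α β = 0 ∧
  C (x 2) (x 1) (x 3) (x 0) (x 4) (γ - α) (-α) (β - α) = 0 ∧
  C (x 3) (x 2) (x 1) (x 4) (x 5) γ β α = 0 ∧
  Cbar (x 4) (x 5) (x 0) (x 3) (x 2) γ α β = 0 ∧
  Cbar (x 5) (x 4) (x 0) (x 3) (x 1) (γ - α) (-α) (β - α) = 0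

/-! ### The combinations of equations -/

/-- A combination of type-C face-centered quad polynomials `C`, `Cbar`, a type-H quad polynomial
`H` and type-Q quad polynomials `Q`, `Qstar`. -/
structure TypeC where
  C : FacePoly
  Cbar : FacePoly
  H : QuadPoly
  Q : QuadPoly
  Qstar : QuadPoly

/-- The trapezoidal version of the type-H polynomial of a combination. -/
def TypeC.Hstar (T : TypeC) : QuadPoly := trapezoidal T.H

/-- The ten type-C combinations. -/
def typeCTable : Fin 10 → TypeC :=
  ![⟨C3 (1 / 2) (1 / 2) 0, C3 (1 / 2) 0 (1 / 2), H3 1 1, Q3 1, Q3 0⟩,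
    ⟨C3 (1 / 2) 0 (1 / 2), C3 (1 / 2) (1 / 2) 0, swapped (H3 1 1), Q3 0, Q3 1⟩,
    ⟨C3 1 0 0, C3 1 0 0, H3 1 0, Q3 0, Q3 0⟩,
    ⟨C3 0 0 0, C3 0 0 0, H3 0 0, Q3 0, Q3 0⟩,
    ⟨C2 1 1 0, C2 1 0 1, H2 1, Q2, Q1 1⟩,
    ⟨C2 1 0 1, C2 1 1 0, swapped (H2 1), Q1 1, Q2⟩,
    ⟨C2 1 0 0, C2 1 0 0, H2 0, Q1 1, Q1 1⟩,
    ⟨C1 1, C2 0 0 0, H1 1, Q1 1, Q1 0⟩,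
    ⟨C2 0 0 0, C1 1, swapped (H1 1), Q1 0, Q1 1⟩,
    ⟨C1 0, C1 0, H1 0, Q1 0, Q1 0⟩]

/-- The five non-elliptic type-A / type-Q pairs. -/
def typeATable : Fin 5 → FacePoly × QuadPoly :=
  ![(A3 1, Q3 1), (A3 0, Q3 0), (A2 1 1, Q2), (A2 1 0, Q1 1), (A2 0 0, Q1 0)]

/-! ### Equations on the hexagonal prism

`x : Fin 6 → ℂ` are the variables on the bottom hexagon and `y : Fin 6 → ℂ` those on the top
hexagon; `y i` lies above `x i`. -/

/-- The eighteen equations on the prism with a type-A pair. -/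
def PrismA (A : FacePoly) (Q : QuadPoly) (α β γ ρ : ℂ) (x y : Fin 6 → ℂ) : Prop :=
  HexA A α β γ x ∧ HexA A α β γ y ∧
  Q (y 0) (y 1) (x 0) (x 1) γ ρ = 0 ∧
  Q (y 1) (y 2) (x 1) (x 2) α ρ = 0 ∧
  Q (y 2) (y 3) (x 2) (x 3) β ρ = 0 ∧
  Q (y 3) (y 4) (x 3) (x 4) γ ρ = 0 ∧
  Q (y 4) (y 5) (x 4) (x 5) α ρ = 0 ∧
  Q (y 5) (y 0) (x 5) (x 0) β ρ = 0

/-- The eighteen equations on the prism with a type-C combination, first arrangement. -/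
def PrismC₁ (T : TypeC) (α β γ ρ : ℂ) (x y : Fin 6 → ℂ) : Prop :=
  HexC T.C T.Cbar α β γ x ∧ HexC T.C T.Cbar α β γ y ∧
  T.Hstar (x 0) (y 0) (x 1) (y 1) ρ γ = 0 ∧
  T.Qstar (y 0) (y 5) (x 0) (x 5) β ρ = 0 ∧
  T.Q (y 1) (y 2) (x 1) (x 2) α ρ = 0 ∧
  T.Qstar (y 5) (y 4) (x 5) (x 4) α ρ = 0 ∧
  T.Q (y 2) (y 3) (x 2) (x 3) β ρ = 0 ∧
  T.Hstar (x 4) (y 4) (x 3) (y 3) ρ γ = 0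

/-- The eighteen equations on the prism with a type-C combination, second arrangement: the top
system of hex equations is rotated by `π`. -/
def PrismC₂ (T : TypeC) (α β γ ρ : ℂ) (x y : Fin 6 → ℂ) : Prop :=
  HexC T.C T.Cbar α β γ x ∧ HexC T.C T.Cbar α β γ ![y 3, y 4, y 5, y 0, y 1, y 2] ∧
  T.H (y 1) (y 0) (x 1) (x 0) γ ρ = 0 ∧
  T.Hstar (x 5) (x 0) (y 5) (y 0) β ρ = 0 ∧
  T.Hstar (y 1) (y 2) (x 1) (x 2) α ρ = 0 ∧
  T.Hstar (x 4) (x 5) (y 4) (y 5) α ρ = 0 ∧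
  T.Hstar (y 2) (y 3) (x 2) (x 3) β ρ = 0 ∧
  T.H (y 3) (y 4) (x 3) (x 4) γ ρ = 0

/-- For the initial values `v = (x_a, x_b, x_e, x_f, y_a)`, the equations `S` have exactly one
solution for the seven remaining variables. -/
def UniquelySolvable (S : (Fin 6 → ℂ) → (Fin 6 → ℂ) → Prop) (v : Fin 5 → ℂ) : Prop :=
  ∃! z : (Fin 6 → ℂ) × (Fin 6 → ℂ), S z.1 z.2 ∧
    z.1 0 = v 0 ∧ z.1 1 = v 1 ∧ z.1 4 = v 2 ∧ z.1 5 = v 3 ∧ z.2 0 = v 4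

/-- The stepwise evolution for the first arrangement: each step determines its unknowns uniquely,
and in the last step the hex system and the two quad equations all determine the same `y_d`. -/
def Stepwise₁ (T : TypeC) (α β γ ρ xa xb xe xf ya : ℂ) : Prop :=
  ∃ xc xd yb yc yd ye yf : ℂ,
    (∀ s t, HexC T.C T.Cbar α β γ ![xa, xb, s, t, xe, xf] ↔ s = xc ∧ t = xd) ∧
    (∀ t, T.Hstar xa ya xb t ρ γ = 0 ↔ t = yb) ∧
    (∀ t, T.Qstar ya t xa xf β ρ = 0 ↔ t = yf) ∧
    (∀ t, T.Q yb t xb xc α ρ = 0 ↔ t = yc) ∧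
    (∀ t, T.Qstar yf t xf xe α ρ = 0 ↔ t = ye) ∧
    (∀ t, HexC T.C T.Cbar α β γ ![ya, yb, yc, t, ye, yf] ↔ t = yd) ∧
    (∀ t, T.Q yc t xc xd β ρ = 0 ↔ t = yd) ∧
    (∀ t, T.Hstar xe ye xd t ρ γ = 0 ↔ t = yd)

/-- The stepwise evolution for the second arrangement. -/
def Stepwise₂ (T : TypeC) (α β γ ρ xa xb xe xf ya : ℂ) : Prop :=
  ∃ xc xd yb yc yd ye yf : ℂ,
    (∀ s t, HexC T.C T.Cbar α β γ ![xa, xb, s, t, xe, xf] ↔ s = xc ∧ t = xd) ∧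
    (∀ t, T.H t ya xb xa γ ρ = 0 ↔ t = yb) ∧
    (∀ t, T.Hstar xf xa t ya β ρ = 0 ↔ t = yf) ∧
    (∀ t, T.Hstar yb t xb xc α ρ = 0 ↔ t = yc) ∧
    (∀ t, T.Hstar xe xf t yf α ρ = 0 ↔ t = ye) ∧
    (∀ t, HexC T.C T.Cbar α β γ ![t, ye, yf, ya, yb, yc] ↔ t = yd) ∧
    (∀ t, T.Hstar yc t xc xd β ρ = 0 ↔ t = yd) ∧
    (∀ t, T.H t ye xd xe γ ρ = 0 ↔ t = yd)

/-! ### Genericity -/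

/-- A thin set of parameters: near every point it is contained in the zero set of an analytic
function that does not vanish identically near that point. -/
def IsThin (E : Set (Fin 4 → ℂ)) : Prop :=
  ∀ a, ∃ f : (Fin 4 → ℂ) → ℂ, AnalyticAt ℂ f a ∧ ¬ (∀ᶠ q in 𝓝 a, f q = 0) ∧
    ∀ᶠ q in 𝓝 a, q ∈ E → f q = 0

/-- `S α β γ ρ v` holds for generic parameters `α, β, γ, ρ` and generic initial values `v`: for
all parameters outside a thin set, it holds for all `v` outside the zero set of a nonzero
polynomial. -/
def Generically (S : ℂ → ℂ → ℂ → ℂ → (Fin 5 → ℂ) → Prop) : Prop :=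
  ∃ E : Set (Fin 4 → ℂ), IsThin E ∧ ∀ q, q ∉ E →
    ∃ p : MvPolynomial (Fin 5) ℂ, p ≠ 0 ∧
      ∀ v : Fin 5 → ℂ, MvPolynomial.eval v p ≠ 0 → S (q 0) (q 1) (q 2) (q 3) v

/-- Consistency around the hexagonal prism, first arrangement. -/
def CAHP₁ (T : TypeC) : Prop :=
  Generically fun α β γ ρ v =>
    UniquelySolvable (PrismC₁ T α β γ ρ) v ∧
    Stepwise₁ T α β γ ρ (v 0) (v 1) (v 2) (v 3) (v 4)

/-- Consistency around the hexagonal prism, second arrangement. -/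
def CAHP₂ (T : TypeC) : Prop :=
  Generically fun α β γ ρ v =>
    UniquelySolvable (PrismC₂ T α β γ ρ) v ∧
    Stepwise₂ T α β γ ρ (v 0) (v 1) (v 2) (v 3) (v 4)

/-- Consistency around the hexagonal prism for a type-A pair: for each choice of four consecutive
bottom vertices `i, i+1, i+2, i+3` and of one top vertex `j` (indices mod 6), generic values at
these five vertices extend uniquely to a solution of the eighteen equations. -/
def CAHPA (A : FacePoly) (Q : QuadPoly) : Prop :=
  ∀ i j : Fin 6, Generically fun α β γ ρ v =>
    ∃! z : (Fin 6 → ℂ) × (Fin 6 → ℂ), PrismA A Q α β γ ρ z.1 z.2 ∧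
      z.1 i = v 0 ∧ z.1 (i + 1) = v 1 ∧ z.1 (i + 2) = v 2 ∧ z.1 (i + 3) = v 3 ∧ z.2 j = v 4

end HexPrism

end

/-!
# Consistency around a hexagonal prism

The six vertices of the hexagon are six of the eight vertices of a 3-cube with directions of
parameters `α`, `β`, `γ`; the two remaining vertices, which are opposite to each other, are hidden.
The five vertices of a face-centered quad equation lie on two faces of this cube that share an edge
from the central vertex to a hidden vertex, and the face-centered polynomial is, up to a factor, the
resultant of the two quad polynomials of these faces with respect to the hidden value
(`IsElimination`, `TypeC.isPair_of_resultant`). The prism therefore becomes a 4-cube with one more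
direction for `ρ`, and both the hex equations and the eighteen equations of the prism are
consequences of quad equations on the 2-faces of the 4-cube.

Such a system of quad equations is multidimensionally consistent as soon as it is consistent on
3-cubes (`CubeSystem`). Five values at suitable vertices are free, and for generic ones there is a
solution on the 4-cube that is regular: each value is determined by the other three values of each
face that contains it (`exists_isRegular`). Which quintuples of vertices are suitable is found by
moving one vertex at a time across a face. Genericity is that of the filter `gen n` of complements
of zero sets of polynomials. A move keeps it because the two values that it exchanges are related by
an invertible fractional linear map (`Moebius`, `exchange`). Regularity gives existence in the
theorem, and it gives uniqueness as well: once the hidden values are those of the regular solution,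
each hex or quad equation is equivalent to the statement that its last value is the one of that
solution (`IsPairA.slots`, `hexC_iff`). This needs no knowledge of hidden values for the
competitor, because a resultant with one factor satisfied amounts to the other factor.

Consistency on 3-cubes comes from *three-leg forms*. For a fixed value `x` at a vertex, the quad
polynomial of a face at this vertex is the difference of a product of three factors, the legs, and
its conjugate, where the factors depend on one of the other three values each. Multiplying the
equations of the three faces at a vertex cancels the legs to its neighbours and leaves an equation
for the vertices opposite to `x`, which is again a quad equation. This star relation at each vertex
implies consistency (`StarSystem.cubeSystem`).

* For the rational and hyperbolic polynomials, the legs are numbers `r + s √Δ`, and the cancellation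
  is the polynomial identity `elim₃_eq_zero`, applied in `HasLegs.star`; see `QuadLaws.cubeSystem`.
* For `Q4`, the conjugation is the change of sign of `Y`, where `Y ^ 2 = 4 x ^ 3 - g₂ x - g₃`, and a
  leg is the difference between a value and the `x`-coordinate of the sum of `(x, Y)` and a point
  of the curve (`Q4_threeLeg`). That the remaining factors cancel is a relation between
  four lines on the curve which follows from the addition theorem (`weierstrassP_add`,
  `lineVal_cocycle`, `star_Q4`). In terms of the same legs `A4` factorizes (`A4core_eq`), which
  exhibits it as a resultant of two polynomials `Q4` (`isElimination_A4`). The parameters that have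
  to be excluded form a thin set because `℘` takes no value identically along two independent linear
  forms (`isThin_weierstrassP_eq`).
* In type C, the vertices of the 4-cube are divided into two layers, which carry the type-Q
  polynomials of the combination, and the faces across the layers carry type-H equations. The legs
  inside a layer are the ones of the type-Q polynomial, and the type-H polynomial has such legs too
  (`HasLayerLegs`), so that the star relations hold again (`LayerLaws`, `TypeC.cubeSystem`). The two
  arrangements of the prism differ in whether the direction of `ρ` connects the layers (`cross₁`,
  `cross₂`).
-/

open scoped Topology

noncomputable section

namespace HexPrism

open Filter

/-! ### Generic points of affine space -/

/-- `g` is a polynomial function of `n` complex variables. -/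
def IsPoly {n : ℕ} (g : (Fin n → ℂ) → ℂ) : Prop :=
  ∃ p : MvPolynomial (Fin n) ℂ, ∀ v, g v = MvPolynomial.eval v p

namespace IsPoly

variable {n : ℕ} {f g : (Fin n → ℂ) → ℂ}

lemma const (c : ℂ) : IsPoly (fun _ : Fin n → ℂ => c) := ⟨MvPolynomial.C c, by simp⟩

lemma coord (i : Fin n) : IsPoly (fun v : Fin n → ℂ => v i) := ⟨MvPolynomial.X i, by simp⟩

lemma add (hf : IsPoly f) (hg : IsPoly g) : IsPoly fun v => f v + g v := by
  obtain ⟨p, hp⟩ := hf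
  obtain ⟨q, hq⟩ := hg
  exact ⟨p + q, fun v => by simp [hp, hq]⟩

lemma mul (hf : IsPoly f) (hg : IsPoly g) : IsPoly fun v => f v * g v := by
  obtain ⟨p, hp⟩ := hf
  obtain ⟨q, hq⟩ := hg
  exact ⟨p * q, fun v => by simp [hp, hq]⟩

lemma neg (hf : IsPoly f) : IsPoly fun v => -f v := by
  obtain ⟨p, hp⟩ := hf
  exact ⟨-p, fun v => by simp [hp]⟩

lemma sub (hf : IsPoly f) (hg : IsPoly g) : IsPoly fun v => f v - g v := by
  simpa only [sub_eq_add_neg] using hf.add hg.neg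

lemma pow (hf : IsPoly f) (k : ℕ) : IsPoly fun v => f v ^ k := by
  obtain ⟨p, hp⟩ := hf
  exact ⟨p ^ k, fun v => by simp [hp]⟩

end IsPoly

/-- The filter of generic points of `ℂⁿ`: its members are the sets that contain the complement of
the zero set of a nonzero polynomial. -/
def gen (n : ℕ) : Filter (Fin n → ℂ) where
  sets := {s | ∃ p : MvPolynomial (Fin n) ℂ, p ≠ 0 ∧ ∀ v, MvPolynomial.eval v p ≠ 0 → v ∈ s}
  univ_sets := ⟨1, one_ne_zero, fun _ _ => trivial⟩
  sets_of_superset := by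
    rintro s t ⟨p, hp, h⟩ hst
    exact ⟨p, hp, fun v hv => hst (h v hv)⟩
  inter_sets := by
    rintro s t ⟨p, hp, h⟩ ⟨q, hq, h'⟩
    refine ⟨p * q, mul_ne_zero hp hq, fun v hv => ?_⟩
    rw [map_mul] at hv
    exact ⟨h v (left_ne_zero_of_mul hv), h' v (right_ne_zero_of_mul hv)⟩

lemma eventually_gen {n : ℕ} {P : (Fin n → ℂ) → Prop} :
    (∀ᶠ v in gen n, P v) ↔
      ∃ p : MvPolynomial (Fin n) ℂ, p ≠ 0 ∧ ∀ v, MvPolynomial.eval v p ≠ 0 → P v := Iff.rfl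

instance (n : ℕ) : (gen n).NeBot := by
  refine ⟨fun h => ?_⟩
  have : ∀ᶠ v in gen n, False := by simp [h]
  obtain ⟨p, hp, h⟩ := eventually_gen.1 this
  exact hp (MvPolynomial.funext fun v => by simpa using not_not.1 (h v))

lemma IsPoly.eventually_ne {n : ℕ} {g : (Fin n → ℂ) → ℂ} (hg : IsPoly g) (h : ∃ v, g v ≠ 0) :
    ∀ᶠ v in gen n, g v ≠ 0 := by
  obtain ⟨p, hp⟩ := hg
  obtain ⟨v, hv⟩ := h
  refine eventually_gen.2 ⟨p, ?_, fun w hw => by rwa [hp]⟩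
  rintro rfl
  simp [hp] at hv

/-- Coordinate projections and inclusions preserve genericity. -/
lemma tendsto_gen_comp {m n : ℕ} (σ : Fin m → Fin n) (hσ : Function.Injective σ) :
    Tendsto (fun v : Fin n → ℂ => v ∘ σ) (gen n) (gen m) := by
  rintro s ⟨p, hp, h⟩
  refine ⟨MvPolynomial.rename σ p, ?_, fun v hv => h _ ?_⟩
  · exact fun h0 => hp (MvPolynomial.rename_injective σ hσ (h0.trans (map_zero _).symm))
  · rwa [MvPolynomial.eval_rename] at hv

/-- Clearing denominators after the substitution of a fraction for one variable. -/
lemma exists_isPoly_clear {n : ℕ} (k : Fin n) {N D : (Fin n → ℂ) → ℂ} (hN : IsPoly N)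
    (hD : IsPoly D) (p : MvPolynomial (Fin n) ℂ) :
    ∃ (m : ℕ) (P : (Fin n → ℂ) → ℂ), IsPoly P ∧ ∀ v, D v ≠ 0 →
      P v = D v ^ m * MvPolynomial.eval (Function.update v k (N v / D v)) p := by
  induction p using MvPolynomial.induction_on with
  | C a => exact ⟨0, fun _ => a, .const a, fun v _ => by simp⟩
  | add p q hp hq =>
    obtain ⟨m, P, hP, h⟩ := hp
    obtain ⟨l, Q, hQ, h'⟩ := hq
    refine ⟨m + l, fun v => D v ^ l * P v + D v ^ m * Q v,
      ((hD.pow l).mul hP).add ((hD.pow m).mul hQ), fun v hv => ?_⟩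
    simp only [h v hv, h' v hv, map_add]
    ring
  | mul_X p i hp =>
    obtain ⟨m, P, hP, h⟩ := hp
    by_cases hi : i = k
    · subst hi
      refine ⟨m + 1, fun v => P v * N v, hP.mul hN, fun v hv => ?_⟩
      simp only [h v hv, map_mul, MvPolynomial.eval_X, Function.update_self]
      field_simp
      ring
    · refine ⟨m, fun v => P v * v i, hP.mul (.coord i), fun v hv => ?_⟩
      simp only [h v hv, map_mul, MvPolynomial.eval_X, Function.update_of_ne hi]
      ring

/-- A function of four variables that is affine in each of them. -/
def MultiAffine (f : ℂ → ℂ → ℂ → ℂ → ℂ) : Prop :=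
  ∀ x u v w, f x u v w = (1 - x) * f 0 u v w + x * f 1 u v w ∧
    f x u v w = (1 - u) * f x 0 v w + u * f x 1 v w ∧
    f x u v w = (1 - v) * f x u 0 w + v * f x u 1 w ∧
    f x u v w = (1 - w) * f x u v 0 + w * f x u v 1

lemma MultiAffine.isPoly {f : ℂ → ℂ → ℂ → ℂ → ℂ} (hf : MultiAffine f) {n : ℕ}
    {a b c d : (Fin n → ℂ) → ℂ} (ha : IsPoly a) (hb : IsPoly b) (hc : IsPoly c) (hd : IsPoly d) :
    IsPoly fun v => f (a v) (b v) (c v) (d v) := by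
  have step : ∀ {g h t : (Fin n → ℂ) → ℂ}, IsPoly g → IsPoly h → IsPoly t →
      IsPoly fun v => (1 - t v) * g v + t v * h v := fun hg hh ht =>
    (((IsPoly.const 1).sub ht).mul hg).add (ht.mul hh)
  have h4 : ∀ x u v : ℂ, IsPoly fun z => f x u v (d z) := fun x u v => by
    have := step (IsPoly.const (f x u v 0)) (IsPoly.const (f x u v 1)) hd
    exact (funext fun z => (hf x u v (d z)).2.2.2) ▸ this
  have h3 : ∀ x u : ℂ, IsPoly fun z => f x u (c z) (d z) := fun x u => by
    have := step (h4 x u 0) (h4 x u 1) hc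
    exact (funext fun z => (hf x u (c z) (d z)).2.2.1) ▸ this
  have h2 : ∀ x : ℂ, IsPoly fun z => f x (b z) (c z) (d z) := fun x => by
    have := step (h3 x 0) (h3 x 1) hb
    exact (funext fun z => (hf x (b z) (c z) (d z)).2.1) ▸ this
  have := step (h2 0) (h2 1) ha
  exact (funext fun z => (hf (a z) (b z) (c z) (d z)).1) ▸ this

/-- A relation `g p s q r = 0` that, for generic `q` and `r`, is the graph of an invertible Möbius
transformation between `p` and `s`. -/
structure Moebius (g : ℂ → ℂ → ℂ → ℂ → ℂ) : Prop where
  multiAffine : MultiAffine g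
  det : ∃ q r, g 1 0 q r * g 0 1 q r ≠ g 0 0 q r * g 1 1 q r

/-- The root of an affine function. -/
def affRoot (h : ℂ → ℂ) : ℂ := -h 0 / (h 1 - h 0)

lemma eq_affRoot {h : ℂ → ℂ} (ha : ∀ t, h t = (1 - t) * h 0 + t * h 1) (h1 : h 1 - h 0 ≠ 0)
    {t : ℂ} : h t = 0 ↔ t = affRoot h := by
  rw [affRoot, eq_div_iff h1, ha]
  constructor <;> intro h <;> linear_combination h

lemma MultiAffine.flip {g : ℂ → ℂ → ℂ → ℂ → ℂ} (hg : MultiAffine g) :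
    MultiAffine fun s p q r => g p s q r := fun x u v w => by
  obtain ⟨h1, h2, h3, h4⟩ := hg u x v w
  exact ⟨h2, h1, h3, h4⟩

lemma MultiAffine.flip' {g : ℂ → ℂ → ℂ → ℂ → ℂ} (hg : MultiAffine g) :
    MultiAffine fun p s r q => g p s q r := fun x u v w => by
  obtain ⟨h1, h2, h3, h4⟩ := hg x u w v
  exact ⟨h1, h2, h4, h3⟩

lemma Moebius.flip {g : ℂ → ℂ → ℂ → ℂ → ℂ} (hg : Moebius g) :
    Moebius fun s p q r => g p s q r := by
  obtain ⟨q, r, h⟩ := hg.det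
  exact ⟨hg.multiAffine.flip, q, r, by rwa [mul_comm]⟩

lemma Moebius.flip' {g : ℂ → ℂ → ℂ → ℂ → ℂ} (hg : Moebius g) :
    Moebius fun p s r q => g p s q r := by
  obtain ⟨q, r, h⟩ := hg.det
  exact ⟨hg.multiAffine.flip', r, q, h⟩

/-- Replace the `k`-th coordinate `p` by the solution `s` of `g p s q r = 0`, where `q` and `r` are
the coordinates `l` and `m`. -/
def exchange {n : ℕ} (g : ℂ → ℂ → ℂ → ℂ → ℂ) (k l m : Fin n) (v : Fin n → ℂ) : Fin n → ℂ :=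
  Function.update v k (affRoot fun s => g (v k) s (v l) (v m))

section exchange

variable {n : ℕ} {g : ℂ → ℂ → ℂ → ℂ → ℂ} {k l m : Fin n}

/-- The slope in `s` of a Möbius relation does not vanish generically. -/
lemma Moebius.exists_slope_ne (hg : Moebius g) : ∃ p q r, g p 1 q r - g p 0 q r ≠ 0 := by
  obtain ⟨q, r, h⟩ := hg.det
  by_contra! h0
  refine h ?_
  rw [sub_eq_zero.1 (h0 1 q r), sub_eq_zero.1 (h0 0 q r)]
  ring

/-- Three coordinates of a point can be prescribed. -/
lemma exists_coords (hkl : k ≠ l) (hkm : k ≠ m) (hlm : l ≠ m) (a b c : ℂ) :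
    ∃ v : Fin n → ℂ, v k = a ∧ v l = b ∧ v m = c :=
  ⟨fun i => if i = k then a else if i = l then b else c,
    by simp, by simp [hkl.symm], by simp [hkm.symm, hlm.symm]⟩

lemma Moebius.eventually_slope_ne (hg : Moebius g) (hkl : k ≠ l) (hkm : k ≠ m) (hlm : l ≠ m) :
    ∀ᶠ v in gen n, g (v k) 1 (v l) (v m) - g (v k) 0 (v l) (v m) ≠ 0 := by
  refine IsPoly.eventually_ne ?_ ?_
  · exact (hg.multiAffine.isPoly (.coord k) (.const 1) (.coord l) (.coord m)).sub
      (hg.multiAffine.isPoly (.coord k) (.const 0) (.coord l) (.coord m))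
  · obtain ⟨p, q, r, h⟩ := hg.exists_slope_ne
    obtain ⟨v, hk, hl, hm⟩ := exists_coords hkl hkm hlm p q r
    exact ⟨v, by rwa [hk, hl, hm]⟩

/-- Exchanging back and forth is the identity wherever the transformation is invertible. -/
lemma exchange_exchange (hg : Moebius g) (hkl : k ≠ l) (hkm : k ≠ m) {u : Fin n → ℂ}
    (hdet : g 1 0 (u l) (u m) * g 0 1 (u l) (u m) - g 0 0 (u l) (u m) * g 1 1 (u l) (u m) ≠ 0)
    (hu : g 1 (u k) (u l) (u m) - g 0 (u k) (u l) (u m) ≠ 0) :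
    let v := exchange (fun s p q r => g p s q r) k l m u
    g (v k) 1 (v l) (v m) - g (v k) 0 (v l) (v m) ≠ 0 ∧ exchange g k l m v = u := by
  intro v
  have hvk : v k = affRoot fun p => g p (u k) (u l) (u m) := Function.update_self ..
  have hvl : v l = u l := Function.update_of_ne hkl.symm ..
  have hvm : v m = u m := Function.update_of_ne hkm.symm ..
  have h0 : g (v k) (u k) (u l) (u m) = 0 :=
    (eq_affRoot (h := fun p => g p (u k) (u l) (u m)) (fun t => (hg.multiAffine ..).1) hu).2 hvk
  have hne : g (v k) 1 (u l) (u m) - g (v k) 0 (u l) (u m) ≠ 0 := by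
    intro h
    have f0 := (hg.multiAffine (v k) 0 (u l) (u m)).1
    have f1 := (hg.multiAffine (v k) 1 (u l) (u m)).1
    have hs := (hg.multiAffine (v k) (u k) (u l) (u m)).2.1
    apply hdet
    have z0 : g (v k) 0 (u l) (u m) = 0 := by linear_combination h0 - hs - u k * h
    have z1 : g (v k) 1 (u l) (u m) = 0 := by linear_combination h + z0
    -- both specializations of the pencil vanish at the same point, so the determinant vanishes
    have p0 : g 0 1 (u l) (u m) * (1 - v k) + v k * g 1 1 (u l) (u m) = 0 := by
      linear_combination z1 - f1
    have p1 : g 0 0 (u l) (u m) * (1 - v k) + v k * g 1 0 (u l) (u m) = 0 := by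
      linear_combination z0 - f0
    by_cases hv : v k = 0
    · rw [hv] at p0 p1
      linear_combination g 1 0 (u l) (u m) * p0 - g 1 1 (u l) (u m) * p1
    · refine mul_left_cancel₀ hv ?_
      linear_combination g 0 1 (u l) (u m) * p1 - g 0 0 (u l) (u m) * p0
  refine ⟨by rwa [hvl, hvm], ?_⟩
  have : affRoot (fun s => g (v k) s (v l) (v m)) = u k := by
    rw [hvl, hvm]
    exact ((eq_affRoot (h := fun s => g (v k) s (u l) (u m))
      (fun t => (hg.multiAffine ..).2.1) hne).1 h0).symm
  rw [exchange, this]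
  simp only [v, exchange, Function.update_idem, Function.update_eq_self]

lemma Moebius.eventually_exchange (hg : Moebius g) (hkl : k ≠ l) (hkm : k ≠ m) (hlm : l ≠ m) :
    ∀ᶠ u in gen n,
      let v := exchange (fun s p q r => g p s q r) k l m u
      g (v k) 1 (v l) (v m) - g (v k) 0 (v l) (v m) ≠ 0 ∧ exchange g k l m v = u := by
  have h1 : ∀ᶠ u : Fin n → ℂ in gen n,
      g 1 0 (u l) (u m) * g 0 1 (u l) (u m) - g 0 0 (u l) (u m) * g 1 1 (u l) (u m) ≠ 0 := by
    refine IsPoly.eventually_ne ?_ ?_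
    · have h := fun a b : ℂ =>
        hg.multiAffine.isPoly (n := n) (.const a) (.const b) (.coord l) (.coord m)
      exact ((h 1 0).mul (h 0 1)).sub ((h 0 0).mul (h 1 1))
    · obtain ⟨q, r, h⟩ := hg.det
      obtain ⟨v, -, hl, hm⟩ := exists_coords hkl hkm hlm 0 q r
      exact ⟨v, by rw [hl, hm]; exact sub_ne_zero.2 h⟩
  filter_upwards [h1, hg.flip.eventually_slope_ne hkl hkm hlm] with u hu hu'
  exact exchange_exchange hg hkl hkm hu hu'

/-- Exchanging one coordinate along a Möbius relation maps generic points to generic points. -/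
lemma Moebius.tendsto_exchange (hg : Moebius g) (hkl : k ≠ l) (hkm : k ≠ m) (hlm : l ≠ m) :
    Tendsto (exchange g k l m) (gen n) (gen n) := by
  rintro s ⟨p, hp, h⟩
  have hN : IsPoly fun v : Fin n → ℂ => -g (v k) 0 (v l) (v m) :=
    (hg.multiAffine.isPoly (.coord k) (.const 0) (.coord l) (.coord m)).neg
  have hD : IsPoly fun v : Fin n → ℂ => g (v k) 1 (v l) (v m) - g (v k) 0 (v l) (v m) :=
    (hg.multiAffine.isPoly (.coord k) (.const 1) (.coord l) (.coord m)).sub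
      (hg.multiAffine.isPoly (.coord k) (.const 0) (.coord l) (.coord m))
  obtain ⟨e, P, hP, hPe⟩ := exists_isPoly_clear k hN hD p
  have hP0 : ∃ v, P v ≠ 0 := by
    have hp' : ∀ᶠ u in gen n, MvPolynomial.eval u p ≠ 0 := eventually_gen.2 ⟨p, hp, fun _ => id⟩
    obtain ⟨u, hu, h1, h2⟩ := (hp'.and (hg.eventually_exchange hkl hkm hlm)).exists
    refine ⟨exchange (fun s p q r => g p s q r) k l m u, ?_⟩
    rw [hPe _ h1]
    refine mul_ne_zero (pow_ne_zero _ h1) ?_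
    change MvPolynomial.eval (exchange g k l m _) p ≠ 0
    rwa [h2]
  change ∀ᶠ v in gen n, exchange g k l m v ∈ s
  filter_upwards [hP.eventually_ne hP0, hg.eventually_slope_ne hkl hkm hlm] with v hv hv'
  rw [hPe v hv'] at hv
  exact h _ (right_ne_zero_of_mul hv)

lemma Moebius.map_exchange (hg : Moebius g) (hkl : k ≠ l) (hkm : k ≠ m) (hlm : l ≠ m) :
    map (exchange g k l m) (gen n) = gen n := by
  refine le_antisymm (hg.tendsto_exchange hkl hkm hlm) ?_
  have h : map (exchange g k l m) (map (exchange (fun s p q r => g p s q r) k l m) (gen n)) =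
      gen n := by
    rw [map_map]
    conv_rhs => rw [← map_id (f := gen n)]
    exact map_congr ((hg.eventually_exchange hkl hkm hlm).mono fun u hu => hu.2)
  calc gen n = _ := h.symm
    _ ≤ _ := map_mono (hg.flip.tendsto_exchange hkl hkm hlm)

end exchange

/-! ### Multidimensional consistency on the four-dimensional cube -/

/-- The neighbour of the vertex `s` of the 4-cube in the direction `i`. The vertices of the 4-cube
are the numbers below 16, and the direction `i` is the `i`-th binary digit. -/
@[reducible] def nb (s : Fin 16) (i : Fin 4) : Fin 16 := s ^^^ ![1, 2, 4, 8] i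

/-- A quad equation `F s i j` for each vertex `s` and each pair of directions `i < j`, in the values
at `s`, `nb s i`, `nb s j` and the opposite vertex of the 2-face, such that the equations of the
four vertices of a face agree, each equation can generically be solved for each variable, and the
equations on each 3-face are consistent for generic initial values. -/
structure CubeSystem (F : Fin 16 → Fin 4 → Fin 4 → ℂ → ℂ → ℂ → ℂ → ℂ) : Prop where
  moebius : ∀ s i j, i < j → Moebius (F s i j) ∧ Moebius (fun x v u w => F s i j x u v w) ∧
    Moebius (fun x w u v => F s i j x u v w)
  flip₁ : ∀ s i j, i < j → ∀ x u v w, F s i j x u v w = F (nb s i) i j u x w v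
  flip₂ : ∀ s i j, i < j → ∀ x u v w, F s i j x u v w = F (nb s j) i j v w x u
  cube : ∀ s i j k, i < j → j < k → ∃ C₁ C₂ : (Fin 4 → ℂ) → Prop,
    (∀ᶠ v in gen 4, C₁ v) ∧ (∀ᶠ v in gen 4, C₂ v) ∧ ∀ x x₁ x₂ x₃ x₁₂ x₁₃ x₂₃ x₁₂₃,
      C₁ ![x, x₁, x₂, x₃] → C₂ ![x, x₁, x₁₂, x₁₃] →
      F s i j x x₁ x₂ x₁₂ = 0 → F s i k x x₁ x₃ x₁₃ = 0 → F s j k x x₂ x₃ x₂₃ = 0 →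
      F (nb s i) j k x₁ x₁₂ x₁₃ x₁₂₃ = 0 →
      F (nb s j) i k x₂ x₁₂ x₂₃ x₁₂₃ = 0 ∧ F (nb s k) i j x₃ x₁₃ x₂₃ x₁₂₃ = 0

variable (F : Fin 16 → Fin 4 → Fin 4 → ℂ → ℂ → ℂ → ℂ → ℂ)

/-- The values at all vertices of the 4-cube computed from the values `v` at the vertices
`0, 1, 2, 4, 8`. -/
def cubeSol (v : Fin 5 → ℂ) : Fin 16 → ℂ :=
  let x3 := affRoot (F 0 0 1 (v 0) (v 1) (v 2))
  let x5 := affRoot (F 0 0 2 (v 0) (v 1) (v 3))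
  let x6 := affRoot (F 0 1 2 (v 0) (v 2) (v 3))
  let x9 := affRoot (F 0 0 3 (v 0) (v 1) (v 4))
  let x10 := affRoot (F 0 1 3 (v 0) (v 2) (v 4))
  let x12 := affRoot (F 0 2 3 (v 0) (v 3) (v 4))
  let x7 := affRoot (F 1 1 2 (v 1) x3 x5)
  let x11 := affRoot (F 1 1 3 (v 1) x3 x9)
  let x13 := affRoot (F 1 2 3 (v 1) x5 x9)
  let x14 := affRoot (F 2 2 3 (v 2) x6 x10)
  let x15 := affRoot (F 3 2 3 x3 x7 x11)
  ![v 0, v 1, v 2, x3, v 3, x5, x6, x7, v 4, x9, x10, x11, x12, x13, x14, x15]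

/-- The equation of the face at `s` in the directions `i, j` is satisfied generically. -/
def Sat (s : Fin 16) (i j : Fin 4) : Prop := ∀ᶠ v in gen 5,
  F s i j (cubeSol F v s) (cubeSol F v (nb s i)) (cubeSol F v (nb s j))
    (cubeSol F v (nb (nb s i) j)) = 0

/-- The values at the vertices `p` and `t` generically determine each other, given those at `q` and
`r`. -/
def Linked (p t q r : Fin 16) : Prop := ∃ g, Moebius g ∧
  ∀ᶠ v in gen 5, g (cubeSol F v p) (cubeSol F v t) (cubeSol F v q) (cubeSol F v r) = 0

/-- The values at the vertices `J` are generic, and every generic tuple of values occurs. -/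
def IsBasis {m : ℕ} (J : Fin m → Fin 16) : Prop :=
  map (fun v i => cubeSol F v (J i)) (gen 5) = gen m

variable {F}

lemma Linked.symm {p t q r : Fin 16} (h : Linked F p t q r) : Linked F t p q r := by
  obtain ⟨g, hg, h⟩ := h
  exact ⟨_, hg.flip, h⟩

lemma Linked.comm {p t q r : Fin 16} (h : Linked F p t q r) : Linked F p t r q := by
  obtain ⟨g, hg, h⟩ := h
  exact ⟨_, hg.flip', h⟩

lemma nb_nb (s : Fin 16) (i : Fin 4) : nb (nb s i) i = s := by
  revert s i; decide

lemma nb_comm (s : Fin 16) (i j : Fin 4) : nb (nb s i) j = nb (nb s j) i := by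
  revert s i j; decide

lemma Sat.flip₁ (hF : CubeSystem F) {s : Fin 16} {i j : Fin 4} (hij : i < j) (h : Sat F s i j) :
    Sat F (nb s i) i j := by
  filter_upwards [h] with v hv
  rw [nb_nb, ← hF.flip₁ s i j hij]
  exact hv

lemma Sat.flip₂ (hF : CubeSystem F) {s : Fin 16} {i j : Fin 4} (hij : i < j) (h : Sat F s i j) :
    Sat F (nb s j) i j := by
  filter_upwards [h] with v hv
  rw [nb_comm (nb s j) i j, nb_nb, ← nb_comm s i j, ← hF.flip₂ s i j hij]
  exact hv

lemma Sat.linked₁ (hF : CubeSystem F) {s : Fin 16} {i j : Fin 4} (hij : i < j) (h : Sat F s i j) :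
    Linked F s (nb s i) (nb s j) (nb (nb s i) j) :=
  ⟨_, (hF.moebius s i j hij).1, h⟩

lemma Sat.linked₂ (hF : CubeSystem F) {s : Fin 16} {i j : Fin 4} (hij : i < j) (h : Sat F s i j) :
    Linked F s (nb s j) (nb s i) (nb (nb s i) j) :=
  ⟨_, (hF.moebius s i j hij).2.1, h⟩

lemma Sat.linked₃ (hF : CubeSystem F) {s : Fin 16} {i j : Fin 4} (hij : i < j) (h : Sat F s i j) :
    Linked F s (nb (nb s i) j) (nb s i) (nb s j) :=
  ⟨_, (hF.moebius s i j hij).2.2, h⟩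

/-- The four vertices of a face. -/
def faceVerts (f : Fin 16 × Fin 4 × Fin 4) : List (Fin 16) :=
  [f.1, nb f.1 f.2.1, nb f.1 f.2.2, nb (nb f.1 f.2.1) f.2.2]

lemma Sat.linked (hF : CubeSystem F) {s : Fin 16} {i j : Fin 4} (hij : i < j) (h : Sat F s i j)
    {p t q r : Fin 16} (hp : p ∈ faceVerts (s, i, j)) (ht : t ∈ faceVerts (s, i, j))
    (hq : q ∈ faceVerts (s, i, j)) (hr : r ∈ faceVerts (s, i, j)) (hn : [p, t, q, r].Nodup) :
    Linked F p t q r := by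
  have a₁ := h.linked₁ hF hij
  have a₂ := h.linked₂ hF hij
  have a₃ := h.linked₃ hF hij
  have b₁ := (h.flip₂ hF hij).linked₁ hF hij
  have b₂ := (h.flip₁ hF hij).linked₂ hF hij
  have b₃ := (h.flip₁ hF hij).linked₃ hF hij
  rw [nb_nb] at b₂ b₃
  rw [nb_comm (nb s j) i j, nb_nb, ← nb_comm s i j] at b₁
  simp only [faceVerts, List.mem_cons, List.not_mem_nil, or_false] at hp ht hq hr
  simp only [List.nodup_cons, List.mem_cons, List.not_mem_nil, or_false, not_or, not_false_eq_true,
    List.nodup_nil, and_true] at hn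
  obtain ⟨⟨n1, n2, n3⟩, ⟨n4, n5⟩, n6⟩ := hn
  rcases hp with rfl | rfl | rfl | rfl <;> rcases ht with rfl | rfl | rfl | rfl <;>
    first
    | exact absurd rfl n1
    | (rcases hq with rfl | rfl | rfl | rfl <;>
        first
        | exact absurd rfl n2
        | exact absurd rfl n4
        | (rcases hr with rfl | rfl | rfl | rfl <;>
            first
            | exact absurd rfl n3
            | exact absurd rfl n5
            | exact absurd rfl n6
            | assumption
            | exact Linked.symm ‹_›
            | exact Linked.comm ‹_›
            | exact (Linked.symm ‹_›).comm))

/-- Whether the four vertices are those of one of the listed faces. -/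
def linkedIn (Φ : List (Fin 16 × Fin 4 × Fin 4)) (p t q r : Fin 16) : Bool :=
  Φ.any (fun f => [p, t, q, r].all (· ∈ faceVerts f)) && [p, t, q, r].Nodup

lemma linked_of_linkedIn (hF : CubeSystem F) {Φ : List (Fin 16 × Fin 4 × Fin 4)}
    (hΦ : ∀ f ∈ Φ, f.2.1 < f.2.2 ∧ Sat F f.1 f.2.1 f.2.2) {p t q r : Fin 16}
    (h : linkedIn Φ p t q r = true) : Linked F p t q r := by
  simp only [linkedIn, Bool.and_eq_true, List.any_eq_true, List.all_eq_true, decide_eq_true_eq] at h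
  obtain ⟨⟨f, hf, hm⟩, hn⟩ := h
  obtain ⟨hij, hs⟩ := hΦ f hf
  exact hs.linked hF hij (hm _ (by simp)) (hm _ (by simp)) (hm _ (by simp)) (hm _ (by simp)) hn

lemma IsBasis.tendsto_self {n : ℕ} {J : Fin n → Fin 16} (hJ : IsBasis F J) :
    Tendsto (fun v i => cubeSol F v (J i)) (gen 5) (gen n) :=
  le_of_eq hJ

lemma IsBasis.comp {m n : ℕ} {J : Fin n → Fin 16} (hJ : IsBasis F J) {σ : Fin m → Fin n}
    (hσ : Function.Injective σ) :
    Tendsto (fun v i => cubeSol F v (J (σ i))) (gen 5) (gen m) :=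
  (tendsto_gen_comp σ hσ).comp hJ.tendsto_self

lemma IsBasis.perm {n : ℕ} {J : Fin n → Fin 16} (hJ : IsBasis F J) {σ : Fin n → Fin n}
    (hσ : Function.Injective σ) : IsBasis F fun i => J (σ i) := by
  refine le_antisymm (hJ.comp hσ) ?_
  let e := Equiv.ofBijective σ hσ.bijective_of_finite
  have h1 : map (fun v : Fin n → ℂ => v ∘ σ) (map (fun v => v ∘ e.symm) (gen n)) = gen n := by
    rw [map_map]
    convert map_id
    ext v i
    simp only [Function.comp_apply, id]
    exact congrArg v (e.symm_apply_apply i)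
  calc gen n = _ := h1.symm
    _ ≤ map (fun v => v ∘ σ) (gen n) := map_mono (tendsto_gen_comp _ e.symm.injective)
    _ = _ := by rw [← hJ, map_map]; rfl

lemma IsBasis.exchange {n : ℕ} {J : Fin n → Fin 16} (hJ : IsBasis F J) {k l m : Fin n}
    (hkl : k ≠ l) (hkm : k ≠ m) (hlm : l ≠ m) {t : Fin 16} (h : Linked F (J k) t (J l) (J m)) :
    IsBasis F (Function.update J k t) := by
  obtain ⟨g, hg, h⟩ := h
  have hs := hJ.tendsto_self.eventually (hg.eventually_slope_ne hkl hkm hlm)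
  have he : ∀ᶠ v in gen 5, (fun i => cubeSol F v (Function.update J k t i)) =
      HexPrism.exchange g k l m fun i => cubeSol F v (J i) := by
    filter_upwards [h, hs] with v hv hv'
    ext i
    by_cases hi : i = k
    · subst hi
      simp only [Function.update_self, HexPrism.exchange]
      exact (eq_affRoot (h := fun s => g (cubeSol F v (J i)) s (cubeSol F v (J l))
        (cubeSol F v (J m))) (fun t => (hg.multiAffine ..).2.1) hv').1 hv
    · simp [HexPrism.exchange, Function.update_of_ne hi]
  unfold IsBasis
  rw [map_congr he]
  change map (HexPrism.exchange g k l m ∘ _) _ = _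
  rw [← map_map, show map _ (gen 5) = gen n from hJ, hg.map_exchange hkl hkm hlm]

/-- A move `(k, l, m, t)` replaces the `k`-th vertex of a basis by `t`, along a face that also
contains the `l`-th and the `m`-th vertex. -/
abbrev Move := Fin 5 × Fin 5 × Fin 5 × Fin 16

/-- The result of a sequence of moves. -/
def run (J : Fin 5 → Fin 16) : List Move → Fin 5 → Fin 16
  | [] => J
  | (k, _, _, t) :: p => run (Function.update J k t) p

/-- Whether every move of the sequence is along one of the listed faces. -/
def legal (Φ : List (Fin 16 × Fin 4 × Fin 4)) (J : Fin 5 → Fin 16) : List Move → Bool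
  | [] => true
  | (k, l, m, t) :: p =>
    (k ≠ l ∧ k ≠ m ∧ l ≠ m) && linkedIn Φ (J k) t (J l) (J m) && legal Φ (Function.update J k t) p

/-- Whether a sequence of legal moves leads from `J` to a basis that contains `T`. -/
def reaches {n : ℕ} (Φ : List (Fin 16 × Fin 4 × Fin 4)) (J : Fin 5 → Fin 16) (p : List Move)
    (σ : Fin n → Fin 5) (T : Fin n → Fin 16) : Bool :=
  legal Φ J p && (∀ i j, σ i = σ j → i = j) && ∀ i, run J p (σ i) = T i

lemma IsBasis.run (hF : CubeSystem F) {Φ : List (Fin 16 × Fin 4 × Fin 4)}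
    (hΦ : ∀ f ∈ Φ, f.2.1 < f.2.2 ∧ Sat F f.1 f.2.1 f.2.2) {J : Fin 5 → Fin 16} (hJ : IsBasis F J)
    {p : List Move} (hp : legal Φ J p = true) : IsBasis F (run J p) := by
  induction p generalizing J with
  | nil => exact hJ
  | cons a p ih =>
    obtain ⟨k, l, m, t⟩ := a
    simp only [legal, Bool.and_eq_true, decide_eq_true_eq] at hp
    obtain ⟨⟨⟨hkl, hkm, hlm⟩, hl⟩, hp⟩ := hp
    exact ih (hJ.exchange hkl hkm hlm (linked_of_linkedIn hF hΦ hl)) hp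

lemma IsBasis.tendsto (hF : CubeSystem F) {Φ : List (Fin 16 × Fin 4 × Fin 4)}
    (hΦ : ∀ f ∈ Φ, f.2.1 < f.2.2 ∧ Sat F f.1 f.2.1 f.2.2) {J : Fin 5 → Fin 16} (hJ : IsBasis F J)
    {n : ℕ} (p : List Move) (σ : Fin n → Fin 5) (T : Fin n → Fin 16)
    (h : reaches Φ J p σ T = true) : Tendsto (fun v i => cubeSol F v (T i)) (gen 5) (gen n) := by
  simp only [reaches, Bool.and_eq_true, decide_eq_true_eq] at h
  obtain ⟨⟨hp, hσ⟩, hT⟩ := h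
  simpa only [hT] using (hJ.run hF hΦ hp).comp (σ := σ) fun i j => hσ i j

lemma IsBasis.reach (hF : CubeSystem F) {Φ : List (Fin 16 × Fin 4 × Fin 4)}
    (hΦ : ∀ f ∈ Φ, f.2.1 < f.2.2 ∧ Sat F f.1 f.2.1 f.2.2) {J : Fin 5 → Fin 16} (hJ : IsBasis F J)
    (p : List Move) (σ : Fin 5 → Fin 5) (T : Fin 5 → Fin 16)
    (h : reaches Φ J p σ T = true) : IsBasis F T := by
  simp only [reaches, Bool.and_eq_true, decide_eq_true_eq] at h
  obtain ⟨⟨hp, hσ⟩, hT⟩ := h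
  simpa only [hT] using (hJ.run hF hΦ hp).perm (σ := σ) fun i j => hσ i j

lemma isBasis_initial : IsBasis F ![0, 1, 2, 4, 8] := by
  have h : (fun v i => cubeSol F v ((![0, 1, 2, 4, 8] : Fin 5 → Fin 16) i)) = id := by
    funext v i
    fin_cases i <;> rfl
  rw [IsBasis, h, map_id]

/-- An equation by which a value is computed is satisfied. -/
lemma sat_of_eq_affRoot (hF : CubeSystem F) {s : Fin 16} {i j : Fin 4} (hij : i < j)
    (hT : Tendsto (fun v k => cubeSol F v ((![s, nb s i, nb s j] : Fin 3 → Fin 16) k))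
      (gen 5) (gen 3))
    (h : ∀ v, cubeSol F v (nb (nb s i) j) =
      affRoot (F s i j (cubeSol F v s) (cubeSol F v (nb s i)) (cubeSol F v (nb s j)))) :
    Sat F s i j := by
  have hm := (hF.moebius s i j hij).2.2
  filter_upwards [hT.eventually (hm.eventually_slope_ne (k := 0) (l := 1) (m := 2)
    (by decide) (by decide) (by decide))] with v hv
  rw [h]
  exact (eq_affRoot (h := F s i j _ _ _) (fun t => (hm.multiAffine _ t _ _).2.1) hv).2 rfl

lemma sat_of_cube (hF : CubeSystem F) {s : Fin 16} {i j k : Fin 4} (hij : i < j) (hjk : j < k)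
    (h₁ : Tendsto (fun v a => cubeSol F v ((![s, nb s i, nb s j, nb s k] : Fin 4 → Fin 16) a))
      (gen 5) (gen 4))
    (h₂ : Tendsto (fun v a =>
        cubeSol F v ((![s, nb s i, nb (nb s i) j, nb (nb s i) k] : Fin 4 → Fin 16) a))
      (gen 5) (gen 4))
    (e₁ : Sat F s i j) (e₂ : Sat F s i k) (e₃ : Sat F s j k) (e₄ : Sat F (nb s i) j k) :
    Sat F (nb s j) i k ∧ Sat F (nb s k) i j := by
  obtain ⟨C₁, C₂, hC₁, hC₂, H⟩ := hF.cube s i j k hij hjk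
  have key : ∀ᶠ v in gen 5,
      F (nb s j) i k (cubeSol F v (nb s j)) (cubeSol F v (nb (nb s i) j))
        (cubeSol F v (nb (nb s j) k)) (cubeSol F v (nb (nb (nb s i) j) k)) = 0 ∧
      F (nb s k) i j (cubeSol F v (nb s k)) (cubeSol F v (nb (nb s i) k))
        (cubeSol F v (nb (nb s j) k)) (cubeSol F v (nb (nb (nb s i) j) k)) = 0 := by
    filter_upwards [h₁.eventually hC₁, h₂.eventually hC₂, e₁, e₂, e₃, e₄]
      with v c₁ c₂ e₁ e₂ e₃ e₄
    refine H (cubeSol F v s) (cubeSol F v (nb s i)) _ _ _ _ _ _ ?_ ?_ e₁ e₂ e₃ e₄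
    · convert c₁ using 1
      ext a
      fin_cases a <;> rfl
    · convert c₂ using 1
      ext a
      fin_cases a <;> rfl
  constructor
  · filter_upwards [key] with v hv
    rw [nb_comm s j i]
    exact hv.1
  · filter_upwards [key] with v hv
    rw [nb_comm s k i, nb_comm s k j, nb_comm (nb s i) k j]
    exact hv.2

/-- The six faces at the vertex `0`. -/
def facesZero : List (Fin 16 × Fin 4 × Fin 4) :=
  [(0, 0, 1), (0, 0, 2), (0, 0, 3), (0, 1, 2), (0, 1, 3), (0, 2, 3)]

/-- The faces at the neighbours of `0` by which the values at distance three are computed. -/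
def facesOne : List (Fin 16 × Fin 4 × Fin 4) := [(1, 1, 2), (1, 1, 3), (1, 2, 3), (2, 2, 3)]

/-- The other faces at the neighbours of `0`. -/
def facesOne' : List (Fin 16 × Fin 4 × Fin 4) :=
  [(2, 0, 2), (4, 0, 1), (2, 0, 3), (8, 0, 1), (4, 0, 3), (8, 0, 2), (4, 1, 3), (8, 1, 2)]

/-- The six faces at the vertex `15`. -/
def facesTwo : List (Fin 16 × Fin 4 × Fin 4) :=
  [(3, 2, 3), (5, 1, 3), (9, 1, 2), (6, 0, 3), (10, 0, 2), (12, 0, 1)]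

/-- All faces of the 4-cube. -/
def allFaces : List (Fin 16 × Fin 4 × Fin 4) := facesZero ++ facesOne ++ facesOne' ++ facesTwo

lemma sat_facesZero (hF : CubeSystem F) :
    ∀ f ∈ facesZero, f.2.1 < f.2.2 ∧ Sat F f.1 f.2.1 f.2.2 := by
  have h0 : ∀ f ∈ ([] : List (Fin 16 × Fin 4 × Fin 4)),
    f.2.1 < f.2.2 ∧ Sat F f.1 f.2.1 f.2.2 := by simp
  simp only [facesZero, List.forall_mem_cons]
  refine ⟨⟨by decide, ?_⟩, ⟨by decide, ?_⟩, ⟨by decide, ?_⟩, ⟨by decide, ?_⟩, ⟨by decide, ?_⟩,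
    ⟨by decide, ?_⟩, by simp⟩
  · exact sat_of_eq_affRoot hF (by decide)
      (isBasis_initial.tendsto hF h0 [] ![0, 1, 2] _ (by decide)) fun _ => rfl
  · exact sat_of_eq_affRoot hF (by decide)
      (isBasis_initial.tendsto hF h0 [] ![0, 1, 3] _ (by decide)) fun _ => rfl
  · exact sat_of_eq_affRoot hF (by decide)
      (isBasis_initial.tendsto hF h0 [] ![0, 1, 4] _ (by decide)) fun _ => rfl
  · exact sat_of_eq_affRoot hF (by decide)
      (isBasis_initial.tendsto hF h0 [] ![0, 2, 3] _ (by decide)) fun _ => rfl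
  · exact sat_of_eq_affRoot hF (by decide)
      (isBasis_initial.tendsto hF h0 [] ![0, 2, 4] _ (by decide)) fun _ => rfl
  · exact sat_of_eq_affRoot hF (by decide)
      (isBasis_initial.tendsto hF h0 [] ![0, 3, 4] _ (by decide)) fun _ => rfl

lemma sat_facesOne (hF : CubeSystem F) :
    ∀ f ∈ facesZero ++ facesOne, f.2.1 < f.2.2 ∧ Sat F f.1 f.2.1 f.2.2 := by
  have h0 := sat_facesZero hF
  refine List.forall_mem_append.2 ⟨h0, ?_⟩
  simp only [facesOne, List.forall_mem_cons]
  refine ⟨⟨by decide, ?_⟩, ⟨by decide, ?_⟩, ⟨by decide, ?_⟩, ⟨by decide, ?_⟩, by simp⟩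
  · exact sat_of_eq_affRoot hF (by decide) (isBasis_initial.tendsto hF h0
      [(2, 0, 1, 3), (0, 1, 3, 5)] ![1, 2, 0] _ (by decide)) fun _ => rfl
  · exact sat_of_eq_affRoot hF (by decide) (isBasis_initial.tendsto hF h0
      [(2, 0, 1, 3), (0, 1, 4, 9)] ![1, 2, 0] _ (by decide)) fun _ => rfl
  · exact sat_of_eq_affRoot hF (by decide) (isBasis_initial.tendsto hF h0
      [(3, 0, 1, 5), (0, 1, 4, 9)] ![1, 3, 0] _ (by decide)) fun _ => rfl
  · exact sat_of_eq_affRoot hF (by decide) (isBasis_initial.tendsto hF h0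
      [(3, 0, 2, 6), (0, 2, 4, 10)] ![2, 3, 0] _ (by decide)) fun _ => rfl

lemma sat_facesOne' (hF : CubeSystem F) :
    ∀ f ∈ facesZero ++ facesOne ++ facesOne', f.2.1 < f.2.2 ∧ Sat F f.1 f.2.1 f.2.2 := by
  have h0 := sat_facesOne hF
  have hs : ∀ f ∈ facesZero ++ facesOne, Sat F f.1 f.2.1 f.2.2 := fun f hf => (h0 f hf).2
  obtain ⟨a1, a2⟩ := sat_of_cube hF (s := 0) (i := 0) (j := 1) (k := 2) (by decide) (by decide)
    (isBasis_initial.tendsto hF h0 [] ![0, 1, 2, 3] _ (by decide))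
    (isBasis_initial.tendsto hF h0 [(2, 0, 1, 3), (3, 0, 1, 5)] ![0, 1, 2, 3] _ (by decide))
    (hs (0, 0, 1) (by decide)) (hs (0, 0, 2) (by decide)) (hs (0, 1, 2) (by decide))
    (hs (1, 1, 2) (by decide))
  obtain ⟨b1, b2⟩ := sat_of_cube hF (s := 0) (i := 0) (j := 1) (k := 3) (by decide) (by decide)
    (isBasis_initial.tendsto hF h0 [] ![0, 1, 2, 4] _ (by decide))
    (isBasis_initial.tendsto hF h0 [(2, 0, 1, 3), (4, 0, 1, 9)] ![0, 1, 2, 4] _ (by decide))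
    (hs (0, 0, 1) (by decide)) (hs (0, 0, 3) (by decide)) (hs (0, 1, 3) (by decide))
    (hs (1, 1, 3) (by decide))
  obtain ⟨c1, c2⟩ := sat_of_cube hF (s := 0) (i := 0) (j := 2) (k := 3) (by decide) (by decide)
    (isBasis_initial.tendsto hF h0 [] ![0, 1, 3, 4] _ (by decide))
    (isBasis_initial.tendsto hF h0 [(3, 0, 1, 5), (4, 0, 1, 9)] ![0, 1, 3, 4] _ (by decide))
    (hs (0, 0, 2) (by decide)) (hs (0, 0, 3) (by decide)) (hs (0, 2, 3) (by decide))
    (hs (1, 2, 3) (by decide))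
  obtain ⟨d1, d2⟩ := sat_of_cube hF (s := 0) (i := 1) (j := 2) (k := 3) (by decide) (by decide)
    (isBasis_initial.tendsto hF h0 [] ![0, 2, 3, 4] _ (by decide))
    (isBasis_initial.tendsto hF h0 [(3, 0, 2, 6), (4, 0, 2, 10)] ![0, 2, 3, 4] _ (by decide))
    (hs (0, 1, 2) (by decide)) (hs (0, 1, 3) (by decide)) (hs (0, 2, 3) (by decide))
    (hs (2, 2, 3) (by decide))
  refine List.forall_mem_append.2 ⟨h0, ?_⟩
  simp only [facesOne', List.forall_mem_cons]
  exact ⟨⟨by decide, a1⟩, ⟨by decide, a2⟩, ⟨by decide, b1⟩, ⟨by decide, b2⟩, ⟨by decide, c1⟩,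
    ⟨by decide, c2⟩, ⟨by decide, d1⟩, ⟨by decide, d2⟩, by simp⟩

lemma sat_allFaces (hF : CubeSystem F) :
    ∀ f ∈ allFaces, f.2.1 < f.2.2 ∧ Sat F f.1 f.2.1 f.2.2 := by
  have h0 := sat_facesOne' hF
  have hs : ∀ f ∈ facesZero ++ facesOne ++ facesOne', Sat F f.1 f.2.1 f.2.2 :=
    fun f hf => (h0 f hf).2
  have a : Sat F 3 2 3 := sat_of_eq_affRoot hF (by decide) (isBasis_initial.tendsto hF h0
    [(1, 0, 2, 3), (3, 0, 2, 6), (0, 2, 4, 10), (0, 1, 2, 11), (2, 1, 3, 7)] ![1, 2, 0] _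
    (by decide)) fun _ => rfl
  obtain ⟨b1, b2⟩ := sat_of_cube hF (s := 1) (i := 1) (j := 2) (k := 3) (by decide) (by decide)
    (isBasis_initial.tendsto hF h0 [(2, 0, 1, 3), (3, 0, 1, 5), (0, 1, 4, 9)] ![1, 2, 3, 0] _
      (by decide))
    (isBasis_initial.tendsto hF h0
      [(2, 0, 1, 3), (3, 0, 1, 5), (0, 1, 4, 9), (0, 1, 2, 11), (3, 1, 2, 7)] ![1, 2, 3, 0] _
      (by decide))
    (hs (1, 1, 2) (by decide)) (hs (1, 1, 3) (by decide)) (hs (1, 2, 3) (by decide)) a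
  obtain ⟨c1, c2⟩ := sat_of_cube hF (s := 2) (i := 0) (j := 2) (k := 3) (by decide) (by decide)
    (isBasis_initial.tendsto hF h0 [(1, 0, 2, 3), (3, 0, 2, 6), (0, 2, 4, 10)] ![2, 1, 3, 0] _
      (by decide))
    (isBasis_initial.tendsto hF h0
      [(1, 0, 2, 3), (3, 0, 2, 6), (0, 2, 4, 10), (0, 1, 2, 11), (3, 1, 2, 7)] ![2, 1, 3, 0] _
      (by decide))
    (hs (2, 0, 2) (by decide)) (hs (2, 0, 3) (by decide)) (hs (2, 2, 3) (by decide)) a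
  obtain ⟨d1, d2⟩ := sat_of_cube hF (s := 4) (i := 0) (j := 1) (k := 3) (by decide) (by decide)
    (isBasis_initial.tendsto hF h0 [(1, 0, 3, 5), (2, 0, 3, 6), (0, 3, 4, 12)] ![3, 1, 2, 0] _
      (by decide))
    (isBasis_initial.tendsto hF h0
      [(1, 0, 3, 5), (2, 0, 3, 6), (0, 3, 4, 12), (0, 1, 3, 13), (2, 1, 3, 7)] ![3, 1, 2, 0] _
      (by decide))
    (hs (4, 0, 1) (by decide)) (hs (4, 0, 3) (by decide)) (hs (4, 1, 3) (by decide)) b1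
  refine List.forall_mem_append.2 ⟨h0, ?_⟩
  simp only [facesTwo, List.forall_mem_cons]
  exact ⟨⟨by decide, a⟩, ⟨by decide, b1⟩, ⟨by decide, b2⟩, ⟨by decide, c1⟩, ⟨by decide, c2⟩,
    ⟨by decide, d2⟩, by simp⟩

lemma sat_all (hF : CubeSystem F) (s : Fin 16) {i j : Fin 4} (hij : i < j) : Sat F s i j := by
  have h := sat_allFaces hF
  have key : ∀ (s : Fin 16) (i j : Fin 4), i < j →
      ([s, nb s i, nb s j, nb (nb s i) j].any fun s => allFaces.contains (s, i, j)) = true := by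
    decide
  have h2 := key s i j hij
  simp only [List.any_eq_true, List.contains_iff_mem, List.mem_cons, List.not_mem_nil,
    or_false] at h2
  obtain ⟨a, rfl | rfl | rfl | rfl, h'⟩ := h2
  · exact (h _ h').2
  · simpa only [nb_nb] using (h _ h').2.flip₁ hF hij
  · simpa only [nb_nb] using (h _ h').2.flip₂ hF hij
  · simpa only [nb_nb] using ((h _ h').2.flip₂ hF hij).flip₁ hF hij

/-- A vertex together with its neighbours. -/
def star (s : Fin 16) : Fin 5 → Fin 16 := ![s, nb s 0, nb s 1, nb s 2, nb s 3]

/-- The moves from the star of a vertex to the star of its neighbour in the direction `i`. -/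
def starMoves (s : Fin 16) (i : Fin 4) : List Move :=
  ([0, 1, 2, 3].filter (· ≠ i)).map fun j => (j.succ, 0, i.succ, nb (nb s i) j)

lemma isBasis_star (hF : CubeSystem F) (s : Fin 16) : IsBasis F (star s) := by
  have hstep : ∀ s i, IsBasis F (star s) → IsBasis F (star (nb s i)) := fun s i h => by
    refine h.reach hF (sat_allFaces hF) (starMoves s i) (Equiv.swap 0 i.succ) _ ?_
    clear h hF
    revert s i
    decide
  have h0 : IsBasis F (star 0) := isBasis_initial
  have key : ∀ s : Fin 16, s = 0 ∨ ∃ i, nb s i < s := by decide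
  induction s using WellFoundedLT.induction with
  | ind s ih =>
    rcases key s with rfl | ⟨i, hi⟩
    · exact h0
    · simpa only [nb_nb] using hstep _ i (ih _ hi)

/-- A solution of all equations on the 4-cube in which each value is determined by the other three
values of each face that contains it. -/
def IsRegular (F : Fin 16 → Fin 4 → Fin 4 → ℂ → ℂ → ℂ → ℂ → ℂ) (X : Fin 16 → ℂ) : Prop :=
  ∀ s i j, i < j → ∀ t,
    F s i j (X s) (X (nb s i)) (X (nb s j)) t = 0 ↔ t = X (nb (nb s i) j)

lemma eventually_isRegular (hF : CubeSystem F) : ∀ᶠ v in gen 5, IsRegular F (cubeSol F v) := by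
  refine eventually_all.2 fun s => eventually_all.2 fun i => eventually_all.2 fun j => ?_
  by_cases hij : i < j
  · have hm := (hF.moebius s i j hij).2.2
    have hn : (0 : Fin 5) ≠ i.succ ∧ (0 : Fin 5) ≠ j.succ ∧ i.succ ≠ j.succ := by
      refine ⟨(Fin.succ_ne_zero i).symm, (Fin.succ_ne_zero j).symm, fun h => hij.ne ?_⟩
      exact Fin.succ_injective _ h
    have hst : ∀ s i, star s (Fin.succ i) = nb s i := by decide
    filter_upwards [sat_all hF s hij,
      (isBasis_star hF s).tendsto_self.eventually (hm.eventually_slope_ne hn.1 hn.2.1 hn.2.2)]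
      with v h1 h2 _ t
    rw [hst, hst] at h2
    have e := fun t => eq_affRoot (h := F s i j (cubeSol F v s) (cubeSol F v (nb s i))
      (cubeSol F v (nb s j))) (t := t) (fun t => (hm.multiAffine _ t _ _).2.1) h2
    rw [e, (e _).1 h1]
  · exact .of_forall fun v h => absurd h hij

/-- Generic values on a set of five vertices that is reached from the initial one extend to a
regular solution on the 4-cube. Each of its values may be required to satisfy a condition `K` that
holds generically. -/
theorem exists_isRegular (hF : CubeSystem F) {K : Fin 16 → ℂ → Prop}
    (hK : ∀ s, ∀ᶠ v in gen 1, K s (v 0)) (p : List Move) (σ : Fin 5 → Fin 5) (T : Fin 5 → Fin 16)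
    (h : reaches allFaces ![0, 1, 2, 4, 8] p σ T = true) :
    ∀ᶠ w in gen 5, ∃ X, IsRegular F X ∧ (∀ s, K s (X s)) ∧ ∀ i, X (T i) = w i := by
  have hT : map (fun v i => cubeSol F v (T i)) (gen 5) = gen 5 :=
    isBasis_initial.reach hF (sat_allFaces hF) p σ T h
  rw [← hT, eventually_map]
  have hk : ∀ s, ∀ᶠ v in gen 5, K s (cubeSol F v s) := fun s =>
    ((isBasis_star hF s).comp (σ := fun _ : Fin 1 => 0)
      (Function.injective_of_subsingleton _)).eventually (hK s)
  filter_upwards [eventually_isRegular hF, eventually_all.2 hk] with v h1 h2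
  exact ⟨_, h1, h2, fun i => rfl⟩

/-! ### Equations on hexagons -/

namespace IsRegular

variable {F : Fin 16 → Fin 4 → Fin 4 → ℂ → ℂ → ℂ → ℂ → ℂ} {X : Fin 16 → ℂ}

lemma slot₄ (hX : IsRegular F X) (s : Fin 16) {i j : Fin 4} (hij : i < j) (t : ℂ) :
    F s i j (X s) (X (nb s i)) (X (nb s j)) t = 0 ↔ t = X (nb (nb s i) j) :=
  hX s i j hij t

lemma slot₃ (hF : CubeSystem F) (hX : IsRegular F X) (s : Fin 16) {i j : Fin 4} (hij : i < j)
    (t : ℂ) : F s i j (X s) (X (nb s i)) t (X (nb (nb s i) j)) = 0 ↔ t = X (nb s j) := by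
  rw [hF.flip₁ s i j hij]
  simpa only [nb_nb] using hX (nb s i) i j hij t

lemma slot₂ (hF : CubeSystem F) (hX : IsRegular F X) (s : Fin 16) {i j : Fin 4} (hij : i < j)
    (t : ℂ) : F s i j (X s) t (X (nb s j)) (X (nb (nb s i) j)) = 0 ↔ t = X (nb s i) := by
  rw [hF.flip₂ s i j hij]
  simpa only [nb_nb, nb_comm s i j, nb_comm (nb s j) i j] using hX (nb s j) i j hij t

lemma slot₁ (hF : CubeSystem F) (hX : IsRegular F X) (s : Fin 16) {i j : Fin 4} (hij : i < j)
    (t : ℂ) : F s i j t (X (nb s i)) (X (nb s j)) (X (nb (nb s i) j)) = 0 ↔ t = X s := by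
  rw [hF.flip₁ s i j hij]
  simpa only [nb_nb] using slot₂ hF hX (nb s i) hij t

end IsRegular

/-- A face-centered equation `G = 0` at a vertex with value `x` results from the two equations
`f = 0` and `g = 0` by elimination of the value `o` of a vertex that they share. -/
def IsElimination (G : ℂ → ℂ → ℂ → ℂ → ℂ → ℂ) (f g : ℂ → ℂ → ℂ → ℂ → ℂ) (x : ℂ) : Prop :=
  ∀ x₁ x₂ x₃ x₄ o,
    (f x x₁ o x₂ = 0 → (∃ o', f x x₁ o' x₂ ≠ 0) → (G x x₁ x₂ x₃ x₄ = 0 ↔ g x x₃ o x₄ = 0)) ∧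
    (g x x₃ o x₄ = 0 → (∃ o', g x x₃ o' x₄ ≠ 0) → (G x x₁ x₂ x₃ x₄ = 0 ↔ f x x₁ o x₂ = 0))

lemma eq_zero_iff_of_mul_eq {a b c d : ℂ} (ha : a ≠ 0) (hc : c ≠ 0) (h : a * b = c * d) :
    b = 0 ↔ d = 0 := by
  simpa [ha, hc] using congrArg (· = 0) h

/-- A polynomial proportional to the resultant of `f` and `g` is an elimination. -/
lemma IsElimination.of_resultant {G : ℂ → ℂ → ℂ → ℂ → ℂ → ℂ} {f g : ℂ → ℂ → ℂ → ℂ → ℂ} {x : ℂ}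
    (hf : MultiAffine f) (hg : MultiAffine g) {κ : ℂ} (hκ : κ ≠ 0)
    (h : ∀ x₁ x₂ x₃ x₄, κ * G x x₁ x₂ x₃ x₄ =
      (f x x₁ 1 x₂ - f x x₁ 0 x₂) * g x x₃ 0 x₄ - (g x x₃ 1 x₄ - g x x₃ 0 x₄) * f x x₁ 0 x₂) :
    IsElimination G f g x := by
  intro x₁ x₂ x₃ x₄ o
  have ef := fun o => (hf x x₁ o x₂).2.2.1
  have eg := fun o => (hg x x₃ o x₄).2.2.1
  have h' := h x₁ x₂ x₃ x₄
  constructor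
  · rintro h0 ⟨o', h1⟩
    have hs : f x x₁ 1 x₂ - f x x₁ 0 x₂ ≠ 0 := fun hs => h1 (by
      linear_combination ef o' - ef o + h0 + (o' - o) * hs)
    have e : κ * G x x₁ x₂ x₃ x₄ = (f x x₁ 1 x₂ - f x x₁ 0 x₂) * g x x₃ o x₄ := by
      linear_combination h' - (f x x₁ 1 x₂ - f x x₁ 0 x₂) * eg o +
        (g x x₃ 1 x₄ - g x x₃ 0 x₄) * (ef o - h0)
    exact eq_zero_iff_of_mul_eq hκ hs e
  · rintro h0 ⟨o', h1⟩
    have hs : g x x₃ 1 x₄ - g x x₃ 0 x₄ ≠ 0 := fun hs => h1 (by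
      linear_combination eg o' - eg o + h0 + (o' - o) * hs)
    have e : κ * G x x₁ x₂ x₃ x₄ = -(g x x₃ 1 x₄ - g x x₃ 0 x₄) * f x x₁ o x₂ := by
      linear_combination h' - (f x x₁ 1 x₂ - f x x₁ 0 x₂) * (eg o - h0) +
        (g x x₃ 1 x₄ - g x x₃ 0 x₄) * ef o
    exact eq_zero_iff_of_mul_eq hκ (neg_ne_zero.2 hs) e

/-- The vertices of the 4-cube that carry the bottom hexagon. The remaining two vertices of the
3-cube are `0` and `11`. -/
def hexVert : Fin 6 → Fin 16 := ![1, 9, 8, 10, 2, 3]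

/-- The parameters of the four directions of the 4-cube. -/
@[reducible] def dirParam (α β γ ρ : ℂ) : Fin 4 → ℂ := ![α, β, ρ, γ]

/-! ### Type-A equations -/

/-- A quad polynomial `Q` and a face-centered quad polynomial `A` for which, at the given values of
the parameters, the equations on the 4-cube are consistent and `A` arises by elimination. -/
structure IsPairA (A : FacePoly) (Q : QuadPoly) (α β γ ρ : ℂ) : Prop where
  system : CubeSystem fun _ i j x u v w =>
    Q x u v w (dirParam α β γ ρ i) (dirParam α β γ ρ j)
  swap : ∀ x u v w a b, Q x v u w b a = 0 ↔ Q x u v w a b = 0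
  elim : ∀ p ∈ [(γ, β, α), (γ, α, β), (α, β, γ)], ∀ᶠ v in gen 1,
    IsElimination (fun x x₁ x₂ x₃ x₄ => A x x₁ x₂ x₃ x₄ p.1 p.2.1 p.2.2)
      (fun x x₁ o x₂ => Q x x₁ o x₂ p.2.1 p.2.2) (fun x x₃ o x₄ => Q x x₃ o x₄ p.1 p.2.2) (v 0)

section

variable {A : FacePoly} {Q : QuadPoly} {a : Fin 4 → ℂ} {X : Fin 16 → ℂ}

/-- A type-A equation at the vertex `s` determines the values at two of its vertices. -/
lemma eq_zero_iff_of_isElimination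
    (h : ∀ s i j, i ≠ j → ∀ t,
      (Q (X s) (X (nb s i)) (X (nb s j)) t (a i) (a j) = 0 ↔ t = X (nb (nb s i) j)) ∧
      (Q (X s) (X (nb s i)) t (X (nb (nb s i) j)) (a i) (a j) = 0 ↔ t = X (nb s j)))
    {s : Fin 16} {i j k : Fin 4} (hik : i ≠ k) (hjk : j ≠ k)
    (hE : IsElimination (fun x x₁ x₂ x₃ x₄ => A x x₁ x₂ x₃ x₄ (a i) (a j) (a k))
      (fun x x₁ o x₂ => Q x x₁ o x₂ (a j) (a k)) (fun x x₃ o x₄ => Q x x₃ o x₄ (a i) (a k))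
      (X s)) :
    (∀ t, A (X s) (X (nb s j)) (X (nb (nb s j) k)) (X (nb s i)) t (a i) (a j) (a k) = 0 ↔
      t = X (nb (nb s i) k)) ∧
    (∀ t, A (X s) (X (nb s j)) t (X (nb s i)) (X (nb (nb s i) k)) (a i) (a j) (a k) = 0 ↔
      t = X (nb (nb s j) k)) := by
  constructor
  · intro t
    rw [← (h s i k hik t).1]
    refine (hE _ _ _ _ (X (nb s k))).1 (((h s j k hjk _).1).2 rfl) ⟨X (nb s k) + 1, fun h0 => ?_⟩
    simpa using ((h s j k hjk _).2).1 h0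
  · intro t
    rw [← (h s j k hjk t).1]
    refine (hE _ _ _ _ (X (nb s k))).2 (((h s i k hik _).1).2 rfl) ⟨X (nb s k) + 1, fun h0 => ?_⟩
    simpa using ((h s i k hik _).2).1 h0

variable {α β γ ρ : ℂ}

lemma IsPairA.slots (h : IsPairA A Q α β γ ρ) (hX : IsRegular (fun _ i j x u v w =>
      Q x u v w (dirParam α β γ ρ i) (dirParam α β γ ρ j)) X) (s : Fin 16) (i j : Fin 4)
    (hij : i ≠ j) (t : ℂ) :
    let q := fun x u v w => Q x u v w (dirParam α β γ ρ i) (dirParam α β γ ρ j) = 0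
    (q (X s) (X (nb s i)) (X (nb s j)) t ↔ t = X (nb (nb s i) j)) ∧
    (q (X s) (X (nb s i)) t (X (nb (nb s i) j)) ↔ t = X (nb s j)) ∧
    (q (X s) t (X (nb s j)) (X (nb (nb s i) j)) ↔ t = X (nb s i)) ∧
    (q t (X (nb s i)) (X (nb s j)) (X (nb (nb s i) j)) ↔ t = X s) := by
  rcases hij.lt_or_gt with h' | h'
  · exact ⟨hX.slot₄ s h' t, hX.slot₃ h.system s h' t, hX.slot₂ h.system s h' t,
      hX.slot₁ h.system s h' t⟩
  · simp only [nb_comm s i j]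
    exact ⟨(h.swap ..).symm.trans (hX.slot₄ s h' t),
      (h.swap ..).symm.trans (hX.slot₂ h.system s h' t),
      (h.swap ..).symm.trans (hX.slot₃ h.system s h' t),
      (h.swap ..).symm.trans (hX.slot₁ h.system s h' t)⟩

/-- The hex equations on six vertices of a 3-cube of a regular solution hold, and they determine the
values at the two vertices next to four consecutive ones. -/
lemma IsPairA.hex (h : IsPairA A Q α β γ ρ) (hX : IsRegular (fun _ i j x u v w =>
      Q x u v w (dirParam α β γ ρ i) (dirParam α β γ ρ j)) X)
    (hE : ∀ s, ∀ p ∈ [(γ, β, α), (γ, α, β), (α, β, γ)],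
      IsElimination (fun x x₁ x₂ x₃ x₄ => A x x₁ x₂ x₃ x₄ p.1 p.2.1 p.2.2)
        (fun x x₁ o x₂ => Q x x₁ o x₂ p.2.1 p.2.2) (fun x x₃ o x₄ => Q x x₃ o x₄ p.1 p.2.2) (X s))
    (z : Fin 16) (hz : z = 0 ∨ z = 4) :
    HexA A α β γ (fun k => X (hexVert k ^^^ z)) ∧
    ∀ x : Fin 6 → ℂ, HexA A α β γ x → ∀ i : Fin 6,
      x i = X (hexVert i ^^^ z) → x (i + 1) = X (hexVert (i + 1) ^^^ z) →
      x (i + 2) = X (hexVert (i + 2) ^^^ z) → x (i + 3) = X (hexVert (i + 3) ^^^ z) →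
      x = fun k => X (hexVert k ^^^ z) := by
  have hs := fun s i j hij t => (⟨(h.slots hX s i j hij t).1, (h.slots hX s i j hij t).2.1⟩ :
    _ ∧ _)
  have ha := fun s => eq_zero_iff_of_isElimination (s := s) (i := 3) (j := 1) (k := 0) hs
    (by decide) (by decide) (hE s (γ, β, α) (by simp))
  have hb := fun s => eq_zero_iff_of_isElimination (s := s) (i := 3) (j := 0) (k := 1) hs
    (by decide) (by decide) (hE s (γ, α, β) (by simp))
  have hc := fun s => eq_zero_iff_of_isElimination (s := s) (i := 0) (j := 1) (k := 3) hs
    (by decide) (by decide) (hE s (α, β, γ) (by simp))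
  have A0 := ha (hexVert 0 ^^^ z)
  have A1 := hb (hexVert 1 ^^^ z)
  have A2 := hc (hexVert 2 ^^^ z)
  have A3 := ha (hexVert 3 ^^^ z)
  have A4 := hb (hexVert 4 ^^^ z)
  have A5 := hc (hexVert 5 ^^^ z)
  clear ha hb hc hs hE hX h
  constructor
  · rcases hz with rfl | rfl <;>
      exact ⟨(A0.1 _).2 rfl, (A1.1 _).2 rfl, (A2.1 _).2 rfl, (A3.1 _).2 rfl, (A4.1 _).2 rfl,
        (A5.1 _).2 rfl⟩
  · intro x hx
    -- the value at `k + 2` and the one at `k - 2` determine each other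
    have key : ∀ k : Fin 6, x k = X (hexVert k ^^^ z) → x (k + 1) = X (hexVert (k + 1) ^^^ z) →
        x (k - 1) = X (hexVert (k - 1) ^^^ z) →
        (x (k + 2) = X (hexVert (k + 2) ^^^ z) ↔ x (k - 2) = X (hexVert (k - 2) ^^^ z)) := by
      obtain ⟨e0, e1, e2, e3, e4, e5⟩ := hx
      intro k
      fin_cases k <;> intro h0 h1 h2
      · change x 0 = _ at h0; change x 1 = _ at h1; change x 5 = _ at h2
        change x 2 = _ ↔ x 4 = _
        rw [h0, h1, h2] at e0
        constructor <;> intro h3 <;> rw [h3] at e0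
        · rcases hz with rfl | rfl <;> exact (A0.2 _).1 e0
        · rcases hz with rfl | rfl <;> exact (A0.1 _).1 e0
      · change x 1 = _ at h0; change x 2 = _ at h1; change x 0 = _ at h2
        change x 3 = _ ↔ x 5 = _
        rw [h0, h1, h2] at e1
        constructor <;> intro h3 <;> rw [h3] at e1
        · rcases hz with rfl | rfl <;> exact (A1.1 _).1 e1
        · rcases hz with rfl | rfl <;> exact (A1.2 _).1 e1
      · change x 2 = _ at h0; change x 3 = _ at h1; change x 1 = _ at h2
        change x 4 = _ ↔ x 0 = _
        rw [h0, h1, h2] at e2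
        constructor <;> intro h3 <;> rw [h3] at e2
        · rcases hz with rfl | rfl <;> exact (A2.1 _).1 e2
        · rcases hz with rfl | rfl <;> exact (A2.2 _).1 e2
      · change x 3 = _ at h0; change x 4 = _ at h1; change x 2 = _ at h2
        change x 5 = _ ↔ x 1 = _
        rw [h0, h1, h2] at e3
        constructor <;> intro h3 <;> rw [h3] at e3
        · rcases hz with rfl | rfl <;> exact (A3.2 _).1 e3
        · rcases hz with rfl | rfl <;> exact (A3.1 _).1 e3
      · change x 4 = _ at h0; change x 5 = _ at h1; change x 3 = _ at h2
        change x 0 = _ ↔ x 2 = _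
        rw [h0, h1, h2] at e4
        constructor <;> intro h3 <;> rw [h3] at e4
        · rcases hz with rfl | rfl <;> exact (A4.1 _).1 e4
        · rcases hz with rfl | rfl <;> exact (A4.2 _).1 e4
      · change x 5 = _ at h0; change x 0 = _ at h1; change x 4 = _ at h2
        change x 1 = _ ↔ x 3 = _
        rw [h0, h1, h2] at e5
        constructor <;> intro h3 <;> rw [h3] at e5
        · rcases hz with rfl | rfl <;> exact (A5.1 _).1 e5
        · rcases hz with rfl | rfl <;> exact (A5.2 _).1 e5
    intro i h0 h1 h2 h3
    have i1 : ∀ i : Fin 6,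
      i + 1 + 1 = i + 2 ∧ i + 1 - 1 = i ∧ i + 1 + 2 = i + 3 ∧ i + 1 - 2 = i + 5 := by decide
    have i2 : ∀ i : Fin 6,
      i + 2 + 1 = i + 3 ∧ i + 2 - 1 = i + 1 ∧ i + 2 + 2 = i + 4 ∧ i + 2 - 2 = i := by decide
    replace i1 := i1 i
    replace i2 := i2 i
    have k1 := key (i + 1)
    have k2 := key (i + 2)
    rw [i1.1, i1.2.1, i1.2.2.1, i1.2.2.2] at k1
    rw [i2.1, i2.2.1, i2.2.2.1, i2.2.2.2] at k2
    have h5 := (k1 h1 h2 h0).1 h3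
    have h4 := (k2 h2 h3 h1).2 h0
    have hall : ∀ i k : Fin 6,
      k = i ∨ k = i + 1 ∨ k = i + 2 ∨ k = i + 3 ∨ k = i + 4 ∨ k = i + 5 := by decide
    funext k
    rcases hall i k with rfl | rfl | rfl | rfl | rfl | rfl <;> assumption

/-- Exact determination of the top hexagon by the quad equations, from any of its values. -/
lemma IsPairA.ring (h : IsPairA A Q α β γ ρ) (hX : IsRegular (fun _ i j x u v w =>
      Q x u v w (dirParam α β γ ρ i) (dirParam α β γ ρ j)) X) :
    let Eqs := fun y : Fin 6 → ℂ =>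
      Q (y 0) (y 1) (X 1) (X 9) γ ρ = 0 ∧ Q (y 1) (y 2) (X 9) (X 8) α ρ = 0 ∧
      Q (y 2) (y 3) (X 8) (X 10) β ρ = 0 ∧ Q (y 3) (y 4) (X 10) (X 2) γ ρ = 0 ∧
      Q (y 4) (y 5) (X 2) (X 3) α ρ = 0 ∧ Q (y 5) (y 0) (X 3) (X 1) β ρ = 0
    Eqs (fun k => X (hexVert k ^^^ 4)) ∧ ∀ y, Eqs y → ∀ j, y j = X (hexVert j ^^^ 4) →
      y = fun k => X (hexVert k ^^^ 4) := by
  intro Eqs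
  have hs := fun s i hi t => h.slots hX (nb s 2) i 2 hi t
  simp only [nb_comm _ _ (2 : Fin 4), nb_nb] at hs
  have hab := hs 1 3 (by decide)
  have hbc := hs 9 0 (by decide)
  have hcd := hs 8 1 (by decide)
  have hde := hs 10 3 (by decide)
  have hef := hs 2 0 (by decide)
  have hfa := hs 3 1 (by decide)
  refine ⟨⟨((hab _).2.2.2).2 rfl, ((hbc _).2.2.2).2 rfl, ((hcd _).2.2.2).2 rfl,
    ((hde _).2.2.2).2 rfl, ((hef _).2.2.2).2 rfl, ((hfa _).2.2.2).2 rfl⟩, ?_⟩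
  rintro y ⟨e0, e1, e2, e3, e4, e5⟩ j hj
  have key : ∀ k : Fin 6, y k = X (hexVert k ^^^ 4) → y (k + 1) = X (hexVert (k + 1) ^^^ 4) := by
    intro k hk
    fin_cases k
    · change y 0 = _ at hk; rw [hk] at e0; exact ((hab _).2.2.1).1 e0
    · change y 1 = _ at hk; rw [hk] at e1; exact ((hbc _).2.2.1).1 e1
    · change y 2 = _ at hk; rw [hk] at e2; exact ((hcd _).2.2.1).1 e2
    · change y 3 = _ at hk; rw [hk] at e3; exact ((hde _).2.2.1).1 e3
    · change y 4 = _ at hk; rw [hk] at e4; exact ((hef _).2.2.1).1 e4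
    · change y 5 = _ at hk; rw [hk] at e5; exact ((hfa _).2.2.1).1 e5
  have h1 := key _ hj
  have h2 := key _ h1
  have h3 := key _ h2
  have h4 := key _ h3
  have h5 := key _ h4
  have hall : ∀ j k : Fin 6, k = j ∨ k = j + 1 ∨ k = j + 1 + 1 ∨ k = j + 1 + 1 + 1 ∨
      k = j + 1 + 1 + 1 + 1 ∨ k = j + 1 + 1 + 1 + 1 + 1 := by decide
  funext k
  rcases hall j k with rfl | rfl | rfl | rfl | rfl | rfl <;> assumption

end

/-- Moves from the vertices `0, 1, 2, 4, 8` to a basis that contains the four bottom vertices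
`i, i + 1, i + 2, i + 3` and the `j`-th top vertex of the prism. -/
def initialMoves : Fin 6 → Fin 6 → List Move :=
  ![
    ![[(2, 0, 4, 10), (3, 0, 1, 5), (0, 1, 4, 9)],
      [(2, 0, 4, 10), (3, 0, 1, 5), (0, 1, 4, 9), (3, 0, 1, 13)],
      [(2, 0, 4, 10), (3, 0, 4, 12), (0, 1, 4, 9)],
      [(2, 0, 4, 10), (3, 0, 4, 12), (0, 1, 4, 9), (3, 2, 4, 14)],
      [(3, 0, 2, 6), (2, 0, 4, 10), (0, 1, 4, 9)],
      [(1, 0, 2, 3), (3, 0, 2, 6), (3, 1, 2, 7), (1, 0, 2, 1), (2, 0, 4, 10), (0, 1, 4, 9)]],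
    ![[(3, 0, 1, 5), (1, 0, 4, 9), (0, 2, 4, 10)],
      [(1, 0, 4, 9), (3, 0, 4, 12), (0, 2, 4, 10), (3, 1, 4, 13)],
      [(1, 0, 4, 9), (3, 0, 4, 12), (0, 2, 4, 10)],
      [(1, 0, 4, 9), (3, 0, 2, 6), (0, 2, 4, 10), (3, 0, 2, 14)],
      [(1, 0, 4, 9), (3, 0, 2, 6), (0, 2, 4, 10)],
      [(1, 0, 2, 3), (3, 0, 2, 6), (0, 2, 4, 10), (3, 1, 2, 7), (1, 0, 2, 11), (1, 0, 4, 9)]],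
    ![[(3, 0, 1, 5), (1, 0, 2, 3), (0, 2, 4, 10)],
      [(1, 0, 4, 9), (3, 0, 4, 12), (0, 2, 4, 10), (3, 1, 4, 13), (1, 0, 4, 11), (1, 0, 2, 3)],
      [(1, 0, 2, 3), (3, 0, 4, 12), (0, 2, 4, 10)],
      [(1, 0, 2, 3), (3, 0, 2, 6), (0, 2, 4, 10), (3, 0, 2, 14)],
      [(1, 0, 2, 3), (3, 0, 2, 6), (0, 2, 4, 10)],
      [(1, 0, 2, 3), (3, 0, 2, 6), (0, 2, 4, 10), (3, 1, 2, 7)]],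
    ![[(3, 0, 1, 5), (4, 0, 2, 10), (0, 1, 2, 3)],
      [(1, 0, 4, 9), (3, 0, 4, 12), (3, 1, 4, 13), (1, 0, 4, 1), (4, 0, 2, 10), (0, 1, 2, 3)],
      [(3, 0, 4, 12), (4, 0, 2, 10), (0, 1, 2, 3)],
      [(3, 0, 2, 6), (4, 0, 2, 10), (0, 1, 2, 3), (3, 2, 4, 14)],
      [(3, 0, 2, 6), (4, 0, 2, 10), (0, 1, 2, 3)],
      [(3, 0, 1, 5), (4, 0, 2, 10), (0, 1, 2, 3), (3, 0, 1, 7)]],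
    ![[(3, 0, 1, 5), (4, 0, 1, 9), (0, 1, 2, 3)],
      [(3, 0, 1, 5), (4, 0, 1, 9), (0, 1, 2, 3), (3, 1, 4, 13)],
      [(3, 0, 4, 12), (4, 0, 1, 9), (0, 1, 2, 3)],
      [(2, 0, 4, 10), (3, 0, 4, 12), (3, 2, 4, 14), (2, 0, 4, 2), (4, 0, 1, 9), (0, 1, 2, 3)],
      [(3, 0, 2, 6), (4, 0, 1, 9), (0, 1, 2, 3)],
      [(3, 0, 1, 5), (4, 0, 1, 9), (0, 1, 2, 3), (3, 0, 1, 7)]],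
    ![[(2, 0, 1, 3), (3, 0, 1, 5), (0, 1, 4, 9)],
      [(2, 0, 1, 3), (3, 0, 1, 5), (0, 1, 4, 9), (3, 0, 1, 13)],
      [(2, 0, 1, 3), (3, 0, 4, 12), (0, 1, 4, 9)],
      [(2, 0, 4, 10), (3, 0, 4, 12), (0, 1, 4, 9), (3, 2, 4, 14), (2, 0, 4, 11), (2, 0, 1, 3)],
      [(3, 0, 2, 6), (2, 0, 1, 3), (0, 1, 4, 9)],
      [(2, 0, 1, 3), (3, 0, 1, 5), (0, 1, 4, 9), (3, 1, 2, 7)]]]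

/-- The positions of these five vertices in the basis reached by `initialMoves`. -/
def initialOrder : Fin 6 → Fin 5 → Fin 5 :=
  ![![1, 0, 4, 2, 3], ![1, 4, 0, 2, 3], ![4, 0, 2, 1, 3],
    ![4, 2, 0, 1, 3], ![2, 0, 1, 4, 3], ![2, 1, 0, 4, 3]]

/-- Four consecutive bottom vertices and one top vertex of the prism. -/
def initialVert (i j : Fin 6) : Fin 5 → Fin 16 :=
  ![hexVert i, hexVert (i + 1), hexVert (i + 2), hexVert (i + 3), hexVert j ^^^ 4]

lemma reaches_initialVert (i j : Fin 6) :
    reaches allFaces ![0, 1, 2, 4, 8] (initialMoves i j) (initialOrder i) (initialVert i j) =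
      true := by
  revert i j
  decide +kernel

/-- Consistency around the hexagonal prism follows from multidimensional consistency and
elimination. -/
theorem cahpA_of_isPairA {A : FacePoly} {Q : QuadPoly} {E : Set (Fin 4 → ℂ)} (hE : IsThin E)
    (h : ∀ q, q ∉ E → IsPairA A Q (q 0) (q 1) (q 2) (q 3)) : CAHPA A Q := by
  refine fun i j => ⟨E, hE, fun q hq => ?_⟩
  replace h := h q hq
  refine eventually_gen.1 ?_
  filter_upwards [exists_isRegular h.system
    (K := fun _ x => ∀ p ∈ [(q 2, q 1, q 0), (q 2, q 0, q 1), (q 0, q 1, q 2)],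
      IsElimination (fun x x₁ x₂ x₃ x₄ => A x x₁ x₂ x₃ x₄ p.1 p.2.1 p.2.2)
        (fun x x₁ o x₂ => Q x x₁ o x₂ p.2.1 p.2.2) (fun x x₃ o x₄ => Q x x₃ o x₄ p.1 p.2.2) x)
    (fun _ => by
      simp only [List.forall_mem_cons]
      have := h.elim
      simp only [List.forall_mem_cons] at this
      filter_upwards [this.1, this.2.1, this.2.2.1] with v h1 h2 h3
      exact ⟨h1, h2, h3, by simp⟩) _ _ _ (reaches_initialVert i j)] with v hv
  obtain ⟨X, hX, hK, hv⟩ := hv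
  obtain ⟨hbot, hbot'⟩ := h.hex hX hK 0 (.inl rfl)
  obtain ⟨htop, -⟩ := h.hex hX hK 4 (.inr rfl)
  obtain ⟨hring, hring'⟩ := h.ring hX
  have hz : ∀ k, hexVert k ^^^ 0 = hexVert k := by decide
  simp only [hz] at hbot hbot'
  refine ⟨(fun k => X (hexVert k), fun k => X (hexVert k ^^^ 4)),
    ⟨⟨hbot, htop, hring⟩, hv 0, hv 1, hv 2, hv 3, hv 4⟩, ?_⟩
  rintro ⟨x, y⟩ ⟨⟨hx, -, hr⟩, h0, h1, h2, h3, h4⟩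
  have ex := hbot' x hx i (h0.trans (hv 0).symm) (h1.trans (hv 1).symm) (h2.trans (hv 2).symm)
    (h3.trans (hv 3).symm)
  simp only at hr
  subst ex
  rw [hring' y hr j (h4.trans (hv 4).symm)]

/-! ### The addition theorem of the Weierstrass function -/

section Addition

variable {L : PeriodPair}

lemma isOpen_compl_lattice (L : PeriodPair) : IsOpen (L.lattice : Set ℂ)ᶜ :=
  L.isClosed_lattice.isOpen_compl

lemma countable_lattice (L : PeriodPair) : (L.lattice : Set ℂ).Countable :=
  have : Countable L.lattice := L.latticeEquivProd.toEquiv.countable_iff.2 inferInstance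
  Set.to_countable _

lemma isPreconnected_compl_of_countable {s : Set ℂ} (hs : s.Countable) : IsPreconnected sᶜ :=
  (hs.isPathConnected_compl_of_one_lt_rank
    (Complex.rank_real_complex ▸ Nat.one_lt_ofNat)).isConnected.isPreconnected

lemma eventually_nhdsNE_notMem_lattice (L : PeriodPair) (a : ℂ) :
    ∀ᶠ z in 𝓝[≠] a, z ∉ L.lattice := by
  have h := L.compl_lattice_sdiff_singleton_mem_nhds a
  filter_upwards [mem_nhdsWithin_of_mem_nhds h, self_mem_nhdsWithin] with z h1 h2 h3
  exact h1 ⟨h3, h2⟩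

lemma hasDerivAt_weierstrassP {z : ℂ} (hz : z ∉ L.lattice) :
    HasDerivAt L.weierstrassP (L.derivWeierstrassP z) z := by
  rw [← L.deriv_weierstrassP]
  exact (L.analyticOnNhd_weierstrassP z hz).differentiableAt.hasDerivAt

lemma tendsto_sq_mul_weierstrassP (L : PeriodPair) :
    Tendsto (fun z => z ^ 2 * L.weierstrassP z) (𝓝[≠] 0) (𝓝 1) := by
  have h1 : ContinuousAt (L.weierstrassPExcept 0) 0 :=
    (L.analyticAt_weierstrassPExcept 0).continuousAt
  have h2 : Tendsto (fun z : ℂ => z ^ 2 * L.weierstrassPExcept 0 z + 1) (𝓝 0) (𝓝 1) := by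
    have : ContinuousAt (fun z : ℂ => z ^ 2 * L.weierstrassPExcept 0 z + 1) 0 := by fun_prop
    simpa [ContinuousAt] using this
  refine (h2.mono_left nhdsWithin_le_nhds).congr' ?_
  filter_upwards [self_mem_nhdsWithin] with z hz
  have h := L.ite_eq_one_sub_sq_mul_weierstrassP 0 (zero_mem _) z
  rw [if_neg (show z ≠ 0 from hz)] at h
  simpa using h.symm

/-- The Weierstrass function is not locally constant. -/
lemma not_eventually_weierstrassP_eq {a : ℂ} (ha : a ∉ L.lattice) (c : ℂ) :
    ¬ ∀ᶠ z in 𝓝 a, L.weierstrassP z = c := by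
  intro h
  have hc : Set.EqOn L.weierstrassP (fun _ => c) (L.lattice : Set ℂ)ᶜ :=
    L.analyticOnNhd_weierstrassP.eqOn_of_preconnected_of_eventuallyEq
      (fun _ _ => analyticAt_const) (isPreconnected_compl_of_countable (countable_lattice L)) ha h
  have h0 : Tendsto (fun z : ℂ => z ^ 2 * c) (𝓝[≠] 0) (𝓝 0) := by
    have : ContinuousAt (fun z : ℂ => z ^ 2 * c) 0 := by fun_prop
    simpa [ContinuousAt] using this.mono_left nhdsWithin_le_nhds
  refine zero_ne_one (tendsto_nhds_unique (h0.congr' ?_) (tendsto_sq_mul_weierstrassP L))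
  filter_upwards [eventually_nhdsNE_notMem_lattice L 0] with z hz
  rw [hc hz]

lemma not_eventually_derivWeierstrassP_eq_zero {a : ℂ} (ha : a ∉ L.lattice) :
    ¬ ∀ᶠ z in 𝓝 a, L.derivWeierstrassP z = 0 := by
  intro h
  obtain ⟨r, hr, hb⟩ := Metric.eventually_nhds_iff_ball.1
    (h.and ((isOpen_compl_lattice L).mem_nhds ha))
  refine not_eventually_weierstrassP_eq ha (L.weierstrassP a) ?_
  filter_upwards [Metric.ball_mem_nhds a hr] with z hz
  refine Metric.isOpen_ball.is_const_of_deriv_eq_zero (convex_ball a r).isPreconnected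
    (fun w hw => (hasDerivAt_weierstrassP (hb w hw).2).differentiableAt.differentiableWithinAt)
    (fun w hw => ?_) hz (Metric.mem_ball_self hr)
  simpa using (hb w hw).1

/-- The second derivative of the Weierstrass function. -/
lemma hasDerivAt_derivWeierstrassP {z : ℂ} (hz : z ∉ L.lattice) :
    HasDerivAt L.derivWeierstrassP (6 * L.weierstrassP z ^ 2 - L.g₂ / 2) z := by
  have hd : ∀ z ∉ L.lattice, HasDerivAt L.derivWeierstrassP (deriv L.derivWeierstrassP z) z :=
    fun z hz => (L.analyticOnNhd_derivWeierstrassP z hz).differentiableAt.hasDerivAt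
  have key := AnalyticOnNhd.eq_zero_or_eq_zero_of_mul_eq_zero (f := L.derivWeierstrassP)
    (g := fun z => 2 * deriv L.derivWeierstrassP z - 12 * L.weierstrassP z ^ 2 + L.g₂)
    (U := (L.lattice : Set ℂ)ᶜ) L.analyticOnNhd_derivWeierstrassP
    (fun z hz => by
      have h1 := (L.analyticOnNhd_derivWeierstrassP z hz).deriv
      have h2 := L.analyticOnNhd_weierstrassP z hz
      fun_prop)
    (fun z hz => by
      have h1 := (hd z hz).pow 2
      have h2 := (((hasDerivAt_weierstrassP hz).pow 3).const_mul 4).sub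
        ((hasDerivAt_weierstrassP hz).const_mul L.g₂) |>.sub_const L.g₃
      have h3 := h1.unique (h2.congr_of_eventuallyEq (by
        filter_upwards [(isOpen_compl_lattice L).mem_nhds hz] with w hw
        exact L.derivWeierstrassP_sq w hw))
      norm_num at h3
      linear_combination h3)
    (isPreconnected_compl_of_countable (countable_lattice L))
  rcases key with h | h
  · refine absurd ?_ (not_eventually_derivWeierstrassP_eq_zero hz)
    filter_upwards [(isOpen_compl_lattice L).mem_nhds hz] with w hw using h w hw
  · convert hd z hz using 1
    linear_combination (-1 / 2 : ℂ) * h z hz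

/-- An analytic function is locally constant if its derivative vanishes off the base point. -/
lemma eventually_eq_of_hasDerivAt_zero {f : ℂ → ℂ} {a : ℂ} (hf : AnalyticAt ℂ f a)
    (h : ∀ᶠ z in 𝓝[≠] a, HasDerivAt f 0 z) : ∀ᶠ z in 𝓝 a, f z = f a := by
  have hd : ∀ᶠ z in 𝓝 a, deriv f z = 0 := by
    rcases hf.deriv.eventually_eq_zero_or_eventually_ne_zero with h' | h'
    · exact h'
    · obtain ⟨z, hz, hz'⟩ := (h.and h').exists
      exact absurd hz.deriv hz'
  obtain ⟨r, hr, hb⟩ := Metric.eventually_nhds_iff_ball.1 (hd.and hf.eventually_analyticAt)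
  filter_upwards [Metric.ball_mem_nhds a hr] with z hz
  exact Metric.isOpen_ball.is_const_of_deriv_eq_zero (convex_ball a r).isPreconnected
    (fun w hw => (hb w hw).2.differentiableAt.differentiableWithinAt)
    (fun w hw => (hb w hw).1) hz (Metric.mem_ball_self hr)

/-- The expression that the addition theorem identifies with `℘ c`. -/
def additionExpr (L : PeriodPair) (c u : ℂ) : ℂ :=
  ((L.derivWeierstrassP u - L.derivWeierstrassP (c - u)) /
    (L.weierstrassP u - L.weierstrassP (c - u))) ^ 2 / 4 - L.weierstrassP u - L.weierstrassP (c - u)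

lemma hasDerivAt_additionExpr {c u : ℂ} (hu : u ∉ L.lattice) (hv : c - u ∉ L.lattice)
    (hne : L.weierstrassP u ≠ L.weierstrassP (c - u)) :
    HasDerivAt (additionExpr L c) 0 u := by
  have hs : HasDerivAt (fun w => c - w) (-1) u := by
    simpa using (hasDerivAt_id u).const_sub c
  have p1 := hasDerivAt_weierstrassP hu
  have p2 := (hasDerivAt_weierstrassP hv).comp u hs
  have d1 := hasDerivAt_derivWeierstrassP hu
  have d2 := (hasDerivAt_derivWeierstrassP hv).comp u hs
  have hne' := sub_ne_zero.2 hne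
  have key := ((((d1.sub d2).div (p1.sub p2) hne').pow 2).div_const 4).sub p1 |>.sub p2
  refine key.congr_deriv ?_
  have e1 := L.derivWeierstrassP_sq u hu
  have e2 := L.derivWeierstrassP_sq _ hv
  simp only [Pi.sub_apply, Function.comp_apply, Pi.div_apply]
  generalize L.weierstrassP u = a at *
  generalize L.weierstrassP (c - u) = b at *
  generalize L.derivWeierstrassP u = a' at *
  generalize L.derivWeierstrassP (c - u) = b' at *
  have h3 : ((6 * a ^ 2 - L.g₂ / 2 - (6 * b ^ 2 - L.g₂ / 2) * -1) * (a - b) -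
      (a' - b') * (a' - b' * -1)) = 2 * (a - b) ^ 3 := by
    linear_combination e2 - e1
  rw [h3]
  norm_num
  field_simp
  ring

/-- The addition formula holds at small arguments, where the singularity at `0` is removable. -/
lemma eventually_additionExpr_eq {c : ℂ} (hc : c ∉ L.lattice) :
    ∀ᶠ u in 𝓝[≠] 0, L.weierstrassP u ≠ L.weierstrassP (c - u) ∧
      additionExpr L c u = L.weierstrassP c := by
  set e := L.weierstrassPExcept 0 with he
  set e' := L.derivWeierstrassPExcept 0 with he'
  set b := fun u => L.weierstrassP (c - u) with hb
  set b' := fun u => L.derivWeierstrassP (c - u) with hb'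
  have ae : AnalyticAt ℂ e 0 := L.analyticAt_weierstrassPExcept 0
  have ae' : AnalyticAt ℂ e' 0 := L.analyticAt_derivWeierstrassPExcept 0
  have hc0 : c - 0 ∉ L.lattice := by simpa using hc
  have as : AnalyticAt ℂ (fun u => c - u) 0 := by fun_prop
  have ab : AnalyticAt ℂ b 0 := (L.analyticOnNhd_weierstrassP _ hc0).comp as
  have ab' : AnalyticAt ℂ b' 0 := (L.analyticOnNhd_derivWeierstrassP _ hc0).comp as
  -- the regular form of the expression, obtained from `℘ u = u⁻² + e u`, `℘' u = -2 u⁻³ + e' u`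
  set f : ℂ → ℂ := fun u => (-u * (e' u - b' u) + u ^ 4 * (e' u - b' u) ^ 2 / 4 - 2 * (e u - b u)
    - u ^ 2 * (e u - b u) ^ 2) / (1 + u ^ 2 * (e u - b u)) ^ 2 - e u - b u with hf
  have hden : ∀ᶠ u in 𝓝 0, 1 + u ^ 2 * (e u - b u) ≠ 0 := by
    have : ContinuousAt (fun u => 1 + u ^ 2 * (e u - b u)) 0 := by
      have := ae.continuousAt; have := ab.continuousAt
      fun_prop
    exact this.eventually_ne (by simp)
  have af : AnalyticAt ℂ f 0 := by
    refine ((AnalyticAt.div ?_ ?_ ?_).sub ae).sub ab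
    · fun_prop
    · fun_prop
    · simp
  have hfe : ∀ u, u ≠ 0 → 1 + u ^ 2 * (e u - b u) ≠ 0 →
      L.weierstrassP u ≠ L.weierstrassP (c - u) ∧ additionExpr L c u = f u := by
    intro u hu hd
    have h1 : L.weierstrassP u = e u + 1 / u ^ 2 := by
      simpa using (L.weierstrassPExcept_add ⟨0, zero_mem _⟩ u).symm
    have h2 : L.derivWeierstrassP u = e' u - 2 / u ^ 3 := by
      simpa using (L.derivWeierstrassPExcept_sub ⟨0, zero_mem _⟩ u).symm
    have h3 : L.weierstrassP u - L.weierstrassP (c - u) = (1 + u ^ 2 * (e u - b u)) / u ^ 2 := by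
      rw [h1]; field_simp; ring
    refine ⟨fun h => ?_, ?_⟩
    · rw [h, sub_self] at h3
      exact div_ne_zero hd (pow_ne_zero 2 hu) h3.symm
    · have h4 : L.weierstrassP (c - u) = b u := rfl
      have h5 : L.derivWeierstrassP (c - u) = b' u := rfl
      rw [additionExpr, h3, h4, h5, h1, h2]
      simp only [hf]
      generalize e u = E at *
      generalize e' u = E' at *
      generalize b u = B at *
      generalize b' u = B' at *
      obtain ⟨D, hD⟩ : ∃ D, D = 1 + u ^ 2 * (E - B) := ⟨_, rfl⟩
      obtain rfl : E = B + (D - 1) / u ^ 2 := by rw [hD]; field_simp; ring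
      rw [← hD] at hd ⊢
      field_simp
      ring
  have hlat : ∀ᶠ u in 𝓝[≠] 0, c - u ∉ L.lattice :=
    nhdsWithin_le_nhds (as.continuousAt.eventually_mem ((isOpen_compl_lattice L).mem_nhds hc0))
  have hder : ∀ᶠ u in 𝓝[≠] 0, HasDerivAt f 0 u := by
    have hden' := eventually_eventually_nhds.2 hden
    filter_upwards [nhdsWithin_le_nhds hden', hlat, self_mem_nhdsWithin,
      eventually_nhdsNE_notMem_lattice L 0] with u h1 h2 h3 h4
    refine (hasDerivAt_additionExpr h4 h2 (hfe u h3 h1.self_of_nhds).1).congr_of_eventuallyEq ?_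
    filter_upwards [h1, isOpen_ne.mem_nhds h3] with w hw hw'
    exact ((hfe w hw' hw).2).symm
  have hconst := eventually_eq_of_hasDerivAt_zero af hder
  have h0 : f 0 = L.weierstrassP c := by
    have : e 0 = 0 := L.weierstrassPExcept_zero 0
    simp only [hf, hb, this]
    norm_num
    ring
  filter_upwards [nhdsWithin_le_nhds hconst, nhdsWithin_le_nhds hden, self_mem_nhdsWithin]
    with u h1 h2 h3
  exact ⟨(hfe u h3 h2).1, ((hfe u h3 h2).2.trans h1).trans h0⟩

/-- The addition theorem for the values of the Weierstrass function. -/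
theorem weierstrassP_add {u v : ℂ} (hu : u ∉ L.lattice) (hv : v ∉ L.lattice)
    (huv : u + v ∉ L.lattice) :
    (L.derivWeierstrassP u - L.derivWeierstrassP v) ^ 2 =
      4 * (L.weierstrassP u + L.weierstrassP v + L.weierstrassP (u + v)) *
        (L.weierstrassP u - L.weierstrassP v) ^ 2 := by
  obtain ⟨c, rfl⟩ : ∃ c, v = c - u := ⟨u + v, by ring⟩
  rw [add_sub_cancel] at huv ⊢
  set N : ℂ → ℂ := fun u => (L.derivWeierstrassP u - L.derivWeierstrassP (c - u)) ^ 2 -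
    4 * (L.weierstrassP u + L.weierstrassP (c - u) + L.weierstrassP c) *
        (L.weierstrassP u - L.weierstrassP (c - u)) ^ 2 with hN
  set S : Set ℂ := L.lattice ∪ (fun w => c - w) ⁻¹' L.lattice with hS
  have hScount : S.Countable :=
    (countable_lattice L).union ((countable_lattice L).preimage sub_right_injective)
  have aN : AnalyticOnNhd ℂ N Sᶜ := by
    intro w hw
    simp only [hS, Set.mem_compl_iff, Set.mem_union, not_or] at hw
    have as : AnalyticAt ℂ (fun u => c - u) w := by fun_prop
    have h1 := L.analyticOnNhd_weierstrassP _ hw.1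
    have h2 := L.analyticOnNhd_derivWeierstrassP _ hw.1
    have h3 : AnalyticAt ℂ (fun u => L.weierstrassP (c - u)) w :=
      (L.analyticOnNhd_weierstrassP (c - w) hw.2).comp as
    have h4 : AnalyticAt ℂ (fun u => L.derivWeierstrassP (c - u)) w :=
      (L.analyticOnNhd_derivWeierstrassP (c - w) hw.2).comp as
    fun_prop
  have h0 : ∀ᶠ w in 𝓝[≠] 0, N w = 0 := by
    filter_upwards [eventually_additionExpr_eq huv] with w ⟨h1, h2⟩
    rw [additionExpr] at h2
    have h1' := sub_ne_zero.2 h1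
    simp only [hN, ← h2]
    field_simp
    ring
  have hlat : ∀ᶠ u in 𝓝[≠] 0, c - u ∉ L.lattice := by
    have hc0 : c - 0 ∉ L.lattice := by simpa using huv
    have as : ContinuousAt (fun u => c - u) 0 := by fun_prop
    exact nhdsWithin_le_nhds (as.eventually_mem ((isOpen_compl_lattice L).mem_nhds hc0))
  obtain ⟨z, h1, h2, h3, h4⟩ := ((eventually_eventually_nhdsWithin.2 h0).and
    (hlat.and ((eventually_nhdsNE_notMem_lattice L 0).and self_mem_nhdsWithin))).exists
  rw [isOpen_compl_singleton.nhdsWithin_eq h4] at h1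
  have := aN.eqOn_zero_of_preconnected_of_eventuallyEq_zero
    (isPreconnected_compl_of_countable hScount) (by simpa [hS] using ⟨h3, h2⟩) h1
    (show u ∈ Sᶜ by simpa [hS] using ⟨hu, hv⟩)
  exact sub_eq_zero.1 this

/-- The addition theorem for the values of the derivative: the points with the arguments `u`, `v`
and `-(u + v)` are collinear. -/
theorem derivWeierstrassP_add {u v : ℂ} (hu : u ∉ L.lattice) (hv : v ∉ L.lattice)
    (huv : u + v ∉ L.lattice) (hne : L.weierstrassP u ≠ L.weierstrassP v) :
    (L.weierstrassP u - L.weierstrassP v) * (-L.derivWeierstrassP (u + v) - L.derivWeierstrassP u) =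
      (L.derivWeierstrassP u - L.derivWeierstrassP v) *
        (L.weierstrassP (u + v) - L.weierstrassP u) := by
  have hs : HasDerivAt (fun w => w + v) 1 u := (hasDerivAt_id u).add_const v
  have p1 := hasDerivAt_weierstrassP hu
  have d1 := hasDerivAt_derivWeierstrassP hu
  have p3 := (hasDerivAt_weierstrassP huv).comp u hs
  have key1 := (d1.sub_const (L.derivWeierstrassP v)).pow 2
  have key2 := (((p1.add_const (L.weierstrassP v)).add p3).const_mul 4).mul
    ((p1.sub_const (L.weierstrassP v)).pow 2)
  have h := key1.unique (key2.congr_of_eventuallyEq (by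
    filter_upwards [(isOpen_compl_lattice L).mem_nhds hu, hs.continuousAt.eventually_mem
      ((isOpen_compl_lattice L).mem_nhds huv)] with w h1 h2
    simpa using weierstrassP_add h1 hv h2))
  have e0 := weierstrassP_add hu hv huv
  have e1 := L.derivWeierstrassP_sq u hu
  have e2 := L.derivWeierstrassP_sq v hv
  simp only [Pi.add_apply, Function.comp_apply, Pi.pow_apply] at h
  generalize L.weierstrassP (u + v) = c at *
  generalize L.derivWeierstrassP (u + v) = c' at *
  generalize L.weierstrassP u = a at *
  generalize L.weierstrassP v = b at *
  generalize L.derivWeierstrassP u = a' at *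
  generalize L.derivWeierstrassP v = b' at *
  norm_num at h
  have hab : (a - b) ^ 2 ≠ 0 := pow_ne_zero 2 (sub_ne_zero.2 hne)
  refine mul_left_cancel₀ hab ?_
  linear_combination (1 / 4) * ((a - b) * h - 2 * a' * e0 + (a' - b') * e0) +
    (a' - b') / 4 * (e1 - e2)

end Addition

/-! ### The elliptic face-centered polynomial in factorized form -/

/-- The second solution of the symmetric biquadratic relation: the first coordinate of the third
point on the line through `(x, Y)` and `(p, y)` of a curve `y² = 4 x³ - g₂ x - g₃`. -/
def rot (x Y p y : ℂ) : ℂ := ((Y - y) / (x - p)) ^ 2 / 4 - x - p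

/-- The building blocks of `A4` at the argument `a`, in terms of the values `s`, `t` of `℘` at the
sum and the difference of `a` and an argument of the point `(x, Y)`. -/
structure Leg (L : PeriodPair) (x Y a s t : ℂ) : Prop where
  deriv : L.derivWeierstrassP a * Y = -(eqSq L x a * (s - t))
  ep0 : ep0 L x a = -2 * (eqSq L x a * (s + t))
  ep1 : ep1 L x a = 16 * (eqSq L x a * (s * t))

section

variable {L : PeriodPair} {x Y : ℂ}

lemma leg_rot (hY : Y ^ 2 = xdot L x) {a : ℂ} (ha : a ∉ L.lattice) (hx : x ≠ L.weierstrassP a) :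
    Leg L x Y a (rot x Y (L.weierstrassP a) (L.derivWeierstrassP a))
      (rot x (-Y) (L.weierstrassP a) (L.derivWeierstrassP a)) := by
  have h := L.derivWeierstrassP_sq a ha
  have hx' := sub_ne_zero.2 hx
  rw [xdot] at hY
  constructor <;> simp only [HexPrism.ep0, HexPrism.ep1, eqSq, rot] <;>
    generalize L.weierstrassP a = p at * <;> generalize L.derivWeierstrassP a = y at *
  · field_simp
    ring
  · field_simp
    linear_combination 4 * (hY + h)
  · field_simp
    linear_combination
      -16 * (Y ^ 2 - y ^ 2 + (x - p) * (4 * (x ^ 2 + x * p + p ^ 2) - L.g₂)) * (hY - h) +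
        128 * (x - p) ^ 2 * (x + p) * (hY + h)

namespace Leg

lemma neg {a s t : ℂ} (h : Leg L x Y a s t) : Leg L x Y (-a) t s := by
  obtain ⟨h1, h2, h3⟩ := h
  constructor <;> simp only [HexPrism.ep0, HexPrism.ep1, eqSq, L.weierstrassP_neg,
    L.derivWeierstrassP_neg] at *
  · linear_combination -h1
  · linear_combination h2
  · linear_combination h3

variable {a₁ a₂ a₃ a₄ s₁ s₂ s₃ s₄ t₁ t₂ t₃ t₄ : ℂ}

/-- The common factor of the terms of `A4`. -/
def scale (L : PeriodPair) (x a₁ a₂ a₃ a₄ : ℂ) : ℂ :=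
  eqSq L x a₁ * eqSq L x a₂ * eqSq L x a₃ * eqSq L x a₄

lemma eq1 (h₁ : Leg L x Y a₁ s₁ t₁) (h₂ : Leg L x Y a₂ s₂ t₂)
    (h₃ : Leg L x Y a₃ s₃ t₃) (h₄ : Leg L x Y a₄ s₄ t₄) (y : ℂ) :
    eq1 L x y a₁ a₂ a₃ a₄ * Y = 1024 * scale L x a₁ a₂ a₃ a₄ *
      ((s₁ * s₂ - t₁ * t₂) * (s₃ * t₃ * (s₄ * t₄) - y)) := by
  simp only [HexPrism.eq1, ep2, h₁.ep0, h₂.ep0, h₃.ep1, h₄.ep1, scale]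
  linear_combination (256 * eqSq L x a₃ * eqSq L x a₄ * (s₃ * t₃ * (s₄ * t₄) - y)) *
    (-2 * (eqSq L x a₁ * (s₁ + t₁)) * h₂.deriv - 2 * (eqSq L x a₂ * (s₂ + t₂)) * h₁.deriv)

lemma eq2 (h₁ : Leg L x Y a₁ s₁ t₁) (h₂ : Leg L x Y a₂ s₂ t₂)
    (h₃ : Leg L x Y a₃ s₃ t₃) (h₄ : Leg L x Y a₄ s₄ t₄) (y z : ℂ) :
    eq2 L x y z a₁ a₂ a₃ a₄ * Y = 64 * scale L x a₁ a₂ a₃ a₄ *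
      ((s₁ * s₂ - t₁ * t₂) * (s₃ * t₃ * y - s₄ * t₄ * z)) := by
  simp only [HexPrism.eq2, ep2, h₁.ep0, h₂.ep0, h₃.ep1, h₄.ep1, scale]
  linear_combination (16 * eqSq L x a₃ * eqSq L x a₄ * (s₃ * t₃ * y - s₄ * t₄ * z)) *
    (-2 * (eqSq L x a₁ * (s₁ + t₁)) * h₂.deriv - 2 * (eqSq L x a₂ * (s₂ + t₂)) * h₁.deriv)

lemma eq3 (hY : Y ^ 2 = xdot L x) (h₁ : Leg L x Y a₁ s₁ t₁) (h₂ : Leg L x Y a₂ s₂ t₂)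
    (h₃ : Leg L x Y a₃ s₃ t₃) (h₄ : Leg L x Y a₄ s₄ t₄) (y z : ℂ) :
    eq3 L x y z a₁ a₂ a₃ a₄ * Y = 256 * scale L x a₁ a₂ a₃ a₄ *
      ((s₁ * s₂ * s₃ - t₁ * t₂ * t₃) * (y - s₄ * t₄ * z)) := by
  simp only [HexPrism.eq3, ep3, h₁.ep0, h₂.ep0, h₃.ep0, h₄.ep1, scale, ← hY]
  have e₁ := h₁.deriv
  have e₂ := h₂.deriv
  have e₃ := h₃.deriv
  generalize L.derivWeierstrassP a₁ = d₁ at *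
  generalize L.derivWeierstrassP a₂ = d₂ at *
  generalize L.derivWeierstrassP a₃ = d₃ at *
  generalize eqSq L x a₁ = q₁ at *
  generalize eqSq L x a₂ = q₂ at *
  generalize eqSq L x a₃ = q₃ at *
  have e : (-4) * Y ^ 2 * (d₁ * d₂ * d₃) * Y = 4 * (q₁ * q₂ * q₃) *
      ((s₁ - t₁) * (s₂ - t₂) * (s₃ - t₃)) := by
    calc _ = (-4) * ((d₁ * Y) * (d₂ * Y) * (d₃ * Y)) := by ring
      _ = _ := by rw [e₁, e₂, e₃]; ring
  linear_combination (16 * eqSq L x a₄ * (y - s₄ * t₄ * z)) * (e - 4 * q₂ * q₃ * (s₂ + t₂) *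
    (s₃ + t₃) * e₁ - 4 * q₁ * q₃ * (s₁ + t₁) * (s₃ + t₃) * e₂ - 4 * q₁ * q₂ * (s₁ + t₁) *
    (s₂ + t₂) * e₃)

lemma ep4 (hY : Y ^ 2 = xdot L x) (h₁ : Leg L x Y a₁ s₁ t₁) (h₂ : Leg L x Y a₂ s₂ t₂)
    (h₃ : Leg L x Y a₃ s₃ t₃) (h₄ : Leg L x Y a₄ s₄ t₄) :
    ep4 L x a₁ a₂ a₃ a₄ * Y = 64 * scale L x a₁ a₂ a₃ a₄ *
      (s₁ * s₂ * s₃ * s₄ - t₁ * t₂ * t₃ * t₄) := by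
  simp only [HexPrism.ep4, h₁.ep0, h₂.ep0, h₃.ep0, h₄.ep0, scale, ← hY]
  have e₁ := h₁.deriv
  have e₂ := h₂.deriv
  have e₃ := h₃.deriv
  have e₄ := h₄.deriv
  generalize L.derivWeierstrassP a₁ = d₁ at *
  generalize L.derivWeierstrassP a₂ = d₂ at *
  generalize L.derivWeierstrassP a₃ = d₃ at *
  generalize L.derivWeierstrassP a₄ = d₄ at *
  generalize eqSq L x a₁ = q₁ at *
  generalize eqSq L x a₂ = q₂ at *
  generalize eqSq L x a₃ = q₃ at *
  generalize eqSq L x a₄ = q₄ at *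
  have e : ∀ {d d' d'' q q' q'' D D' D'' : ℂ}, d * Y = -(q * D) → d' * Y = -(q' * D') →
      d'' * Y = -(q'' * D'') → Y ^ 2 * (d * d' * d'') * Y = -(q * q' * q'' * (D * D' * D'')) := by
    intro d d' d'' q q' q'' D D' D'' h h' h''
    calc _ = (d * Y) * (d' * Y) * (d'' * Y) := by ring
      _ = _ := by rw [h, h', h'']; ring
  linear_combination (-8 * q₁ * (s₁ + t₁)) * e e₂ e₃ e₄ + (-8 * q₂ * (s₂ + t₂)) * e e₁ e₃ e₄ +
    (-8 * q₃ * (s₃ + t₃)) * e e₁ e₂ e₄ + (-8 * q₄ * (s₄ + t₄)) * e e₁ e₂ e₃ -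
    8 * q₂ * q₃ * q₄ * (s₂ + t₂) * (s₃ + t₃) * (s₄ + t₄) * e₁ -
    8 * q₁ * q₃ * q₄ * (s₁ + t₁) * (s₃ + t₃) * (s₄ + t₄) * e₂ -
    8 * q₁ * q₂ * q₄ * (s₁ + t₁) * (s₂ + t₂) * (s₄ + t₄) * e₃ -
    8 * q₁ * q₂ * q₃ * (s₁ + t₁) * (s₂ + t₂) * (s₃ + t₃) * e₄

lemma eq4 (h₁ : Leg L x Y a₁ s₁ t₁) (h₃ : Leg L x Y a₃ s₃ t₃) (h₄ : Leg L x Y a₄ s₄ t₄) (y : ℂ) :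
    eq4 L x y a₁ a₂ a₃ a₄ * Y = -256 * scale L x a₁ a₂ a₃ a₄ *
      (s₁ * t₁ * ((s₃ - t₃) * (y + s₄ * t₄) + (s₄ - t₄) * (y + s₃ * t₃))) := by
  simp only [HexPrism.eq4, h₁.ep1, h₃.ep1, h₄.ep1, scale]
  linear_combination (256 * eqSq L x a₁ * eqSq L x a₂ * s₁ * t₁) *
    (eqSq L x a₄ * (y + s₄ * t₄) * h₃.deriv + eqSq L x a₃ * (y + s₃ * t₃) * h₄.deriv)

end Leg

/-- The part of `A4` that depends on the variables other than `x`. -/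
def A4core (L : PeriodPair) (x xa xb xc xd α β γ : ℂ) : ℂ :=
  (eq1 L x (xa * xb * xc * xd) (-α) β (α - γ) (β - γ)
    + eq1 L x (xa * xb * xc * xd) α (β - γ) (α - γ) β
    - eq1 L x (xa * xb * xc * xd) (α - γ) β α (β - γ)
    - eq1 L x (xa * xb * xc * xd) (-(α - γ)) (β - γ) α β
    - 16 * (ep4 L x α (α - γ) β (β - γ) * (xb * xc - xa * xd)
      + eq2 L x xd xc β (β - γ) α (α - γ) * (xa + xb)
      + ep4 L x (-α) (-(α - γ)) β (β - γ) * (xa * xc - xb * xd)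
      + eq2 L x xa xb α (α - γ) (β - γ) β * (xc + xd)
      + eq2 L x (xa * xb) (xc * xd) α (-(β - γ)) (α - γ) β
      - eq2 L x (xa * xb) (xc * xd) α β (α - γ) (β - γ)
      + eq2 L x (xa * xb) (xc * xd) (α - γ) (β - γ) α β
      - eq2 L x (xa * xb) (xc * xd) (α - γ) (-β) α (β - γ))
    + 4 * (eq3 L x (xb * xc * xd) xa α β (β - γ) (α - γ)
      - eq3 L x (xb * xc * xd) xa (-(α - γ)) β (β - γ) α
      + eq3 L x (xa * xc * xd) xb (-α) β (β - γ) (α - γ)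
      - eq3 L x (xa * xc * xd) xb (α - γ) β (β - γ) α
      - eq3 L x (xa * xb * xd) xc α (α - γ) β (β - γ)
      + eq3 L x (xa * xb * xd) xc α (α - γ) (-(β - γ)) β
      - eq3 L x (xa * xb * xc) xd α (α - γ) (-β) (β - γ)
      + eq3 L x (xa * xb * xc) xd α (α - γ) (β - γ) β
      - eq4 L x (xc * xd) (β - γ) β α (α - γ) * xa
      + eq4 L x (xc * xd) β (β - γ) α (α - γ) * xb
      + eq4 L x (xa * xb) (α - γ) α β (β - γ) * xc
      - eq4 L x (xa * xb) α (α - γ) β (β - γ) * xd))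

lemma A4_eq (L : PeriodPair) (x xa xb xc xd α β γ : ℂ) : A4 L x xa xb xc xd α β γ =
    (32 * x ^ 2 * L.g₃ + (4 * x ^ 2 + L.g₂) ^ 2 - 16 * L.weierstrassP (α - β) * xdot L x) *
      (L.weierstrassP γ - L.weierstrassP (α + β - γ)) * A4core L x xa xb xc xd α β γ := rfl

lemma eqSq_neg (L : PeriodPair) (x a : ℂ) : eqSq L x (-a) = eqSq L x a := by
  rw [eqSq, eqSq, L.weierstrassP_neg]

set_option maxRecDepth 10000 in
/-- The factorized form of `A4`. -/
lemma A4core_eq (hY : Y ^ 2 = xdot L x) {α β γ s₁ t₁ s₂ t₂ s₃ t₃ s₄ t₄ : ℂ}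
    (h₁ : Leg L x Y α s₁ t₁) (h₂ : Leg L x Y β s₂ t₂) (h₃ : Leg L x Y (α - γ) s₃ t₃)
    (h₄ : Leg L x Y (β - γ) s₄ t₄) (xa xb xc xd : ℂ) :
    A4core L x xa xb xc xd α β γ * Y = 1024 * Leg.scale L x α β (α - γ) (β - γ) *
      ((s₁ - t₃) * (t₂ - s₄) * ((xa - s₂) * (xb - t₄) * (xc - t₁) * (xd - s₃)) -
        (t₁ - s₃) * (s₂ - t₄) * ((xa - t₂) * (xb - s₄) * (xc - s₁) * (xd - t₃))) := by
  have e1 := (h₁.neg.eq1 h₂ h₃ h₄ (xa * xb * xc * xd))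
  have e2 := (h₁.eq1 h₄ h₃ h₂ (xa * xb * xc * xd))
  have e3 := (h₃.eq1 h₂ h₁ h₄ (xa * xb * xc * xd))
  have e4 := (h₃.neg.eq1 h₄ h₁ h₂ (xa * xb * xc * xd))
  have f1 := Leg.ep4 hY h₁ h₃ h₂ h₄
  have f2 := h₂.eq2 h₄ h₁ h₃ xd xc
  have f3 := Leg.ep4 hY h₁.neg h₃.neg h₂ h₄
  have f4 := h₁.eq2 h₃ h₄ h₂ xa xb
  have f5 := h₁.eq2 h₄.neg h₃ h₂ (xa * xb) (xc * xd)
  have f6 := h₁.eq2 h₂ h₃ h₄ (xa * xb) (xc * xd)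
  have f7 := h₃.eq2 h₄ h₁ h₂ (xa * xb) (xc * xd)
  have f8 := h₃.eq2 h₂.neg h₁ h₄ (xa * xb) (xc * xd)
  have g1 := Leg.eq3 hY h₁ h₂ h₄ h₃ (xb * xc * xd) xa
  have g2 := Leg.eq3 hY h₃.neg h₂ h₄ h₁ (xb * xc * xd) xa
  have g3 := Leg.eq3 hY h₁.neg h₂ h₄ h₃ (xa * xc * xd) xb
  have g4 := Leg.eq3 hY h₃ h₂ h₄ h₁ (xa * xc * xd) xb
  have g5 := Leg.eq3 hY h₁ h₃ h₂ h₄ (xa * xb * xd) xc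
  have g6 := Leg.eq3 hY h₁ h₃ h₄.neg h₂ (xa * xb * xd) xc
  have g7 := Leg.eq3 hY h₁ h₃ h₂.neg h₄ (xa * xb * xc) xd
  have g8 := Leg.eq3 hY h₁ h₃ h₄ h₂ (xa * xb * xc) xd
  have k1 := Leg.eq4 (a₂ := β) h₄ h₁ h₃ (xc * xd)
  have k2 := Leg.eq4 (a₂ := β - γ) h₂ h₁ h₃ (xc * xd)
  have k3 := Leg.eq4 (a₂ := α) h₃ h₂ h₄ (xa * xb)
  have k4 := Leg.eq4 (a₂ := α - γ) h₁ h₂ h₄ (xa * xb)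
  simp only [Leg.scale, eqSq_neg] at *
  rw [A4core]
  linear_combination e1 + e2 - e3 - e4 - 16 * (f1 * (xb * xc - xa * xd) + f2 * (xa + xb) +
      f3 * (xa * xc - xb * xd) + f4 * (xc + xd) + f5 - f6 + f7 - f8) +
    4 * (g1 - g2 + g3 - g4 - g5 + g6 - g7 + g8 - k1 * xa + k2 * xb + k3 * xc - k4 * xd)

/-! ### The three-leg form of `Q4` -/

/-- The value at `x` of the line through the points with arguments `u` and `v`. -/
def lineVal (L : PeriodPair) (u v x : ℂ) : ℂ :=
  L.derivWeierstrassP u + (L.derivWeierstrassP u - L.derivWeierstrassP v) /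
    (L.weierstrassP u - L.weierstrassP v) * (x - L.weierstrassP u)

/-- `rot` at the point with the argument `a`. -/
def rotAt (L : PeriodPair) (x Y a : ℂ) : ℂ := rot x Y (L.weierstrassP a) (L.derivWeierstrassP a)

lemma rotAt_neg (L : PeriodPair) (x Y a : ℂ) : rotAt L x Y (-a) = rotAt L x (-Y) a := by
  rw [rotAt, rotAt, L.weierstrassP_neg, L.derivWeierstrassP_neg, rot, rot]
  rw [show Y - -L.derivWeierstrassP a = -(-Y - L.derivWeierstrassP a) by ring, neg_div, neg_sq]

lemma rotAt_neg' (L : PeriodPair) (x Y a : ℂ) : rotAt L x (-Y) (-a) = rotAt L x Y a := by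
  rw [rotAt_neg, neg_neg]

/-- Three collinear points `(x + τᵢ, Y + k + m τᵢ)` of a curve `y² = 4 x³ - g₂ x - g₃` that
contains `(x, Y)`. -/
structure Chord (x Y k m τ₁ τ₂ τ₃ : ℂ) : Prop where
  prod : k * (k + 2 * Y) = 4 * (τ₁ * τ₂ * τ₃)
  sum : 4 * (3 * x + τ₁ + τ₂ + τ₃) = m ^ 2

/-- The chord through the points with the arguments `u`, `v` and `-(u + v)`. -/
lemma exists_chord (hY : Y ^ 2 = xdot L x) {u v w : ℂ} (hu : u ∉ L.lattice) (hv : v ∉ L.lattice)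
    (hw : w ∉ L.lattice) (h0 : u + v + w = 0) (hne : L.weierstrassP u ≠ L.weierstrassP v) :
    ∃ m, Chord x Y (lineVal L u v x - Y) m (L.weierstrassP u - x) (L.weierstrassP v - x)
        (L.weierstrassP w - x) ∧
      L.derivWeierstrassP u = lineVal L u v x + m * (L.weierstrassP u - x) ∧
      L.derivWeierstrassP v = lineVal L u v x + m * (L.weierstrassP v - x) ∧
      L.derivWeierstrassP w = lineVal L u v x + m * (L.weierstrassP w - x) := by
  have huv : u + v ∉ L.lattice := by
    rw [show u + v = -w by linear_combination h0]
    exact fun h => hw (by simpa using neg_mem h)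
  have e1 := weierstrassP_add hu hv huv
  have e2 := derivWeierstrassP_add hu hv huv hne
  have hpw : L.weierstrassP (u + v) = L.weierstrassP w := by
    rw [show u + v = -w by linear_combination h0, L.weierstrassP_neg]
  have hdw : L.derivWeierstrassP (u + v) = -L.derivWeierstrassP w := by
    rw [show u + v = -w by linear_combination h0, L.derivWeierstrassP_neg]
  rw [hpw] at e1 e2
  rw [hdw] at e2
  have c1 := L.derivWeierstrassP_sq u hu
  have c2 := L.derivWeierstrassP_sq v hv
  rw [xdot] at hY
  refine ⟨(L.derivWeierstrassP u - L.derivWeierstrassP v) /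
    (L.weierstrassP u - L.weierstrassP v), ?_⟩
  have hne' := sub_ne_zero.2 hne
  rw [lineVal]
  obtain ⟨m, hm⟩ : ∃ m, m = (L.derivWeierstrassP u - L.derivWeierstrassP v) /
    (L.weierstrassP u - L.weierstrassP v) := ⟨_, rfl⟩
  rw [← hm]
  rw [eq_div_iff hne'] at hm
  generalize L.weierstrassP u = a at *
  generalize L.weierstrassP v = b at *
  generalize L.weierstrassP w = c at *
  generalize L.derivWeierstrassP u = a' at *
  generalize L.derivWeierstrassP v = b' at *
  obtain rfl : b' = a' - m * (a - b) := by linear_combination hm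
  generalize L.derivWeierstrassP w = c' at *
  have hs : m ^ 2 = 4 * (a + b + c) := by
    refine mul_right_cancel₀ (pow_ne_zero 2 hne') ?_
    linear_combination e1
  refine ⟨⟨?_, ?_⟩, ?_, ?_, ?_⟩
  · refine mul_left_cancel₀ hne' ?_
    linear_combination (x - b) * c1 - (x - a) * c2 - (a - b) * hY +
      (a - b) * (x - a) * (x - b) * hs
  · linear_combination -hs
  · ring
  · ring
  · refine mul_left_cancel₀ hne' ?_
    linear_combination e2

/-- The value of `rot` at the first point of a chord. -/
lemma Chord.rot_eq {k m τ₁ τ₂ τ₃ : ℂ} (h : Chord x Y k m τ₁ τ₂ τ₃) (h₁ : τ₁ ≠ 0) :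
    rot x Y (x + τ₁) (Y + k + m * τ₁) = x + ((k ^ 2 / τ₁ ^ 2 + 2 * m * k / τ₁) / 4 + τ₂ + τ₃) := by
  rw [rot]
  have : x - (x + τ₁) ≠ 0 := by simpa using h₁
  rw [show x - (x + τ₁) = -τ₁ by ring, show Y - (Y + k + m * τ₁) = -(k + m * τ₁) by ring,
    neg_div_neg_eq]
  field_simp
  linear_combination (-τ₁ ^ 2) * h.sum

lemma Chord.neg {k m τ₁ τ₂ τ₃ : ℂ} (h : Chord x Y k m τ₁ τ₂ τ₃) :
    Chord x (-Y) (k + 2 * Y) m τ₁ τ₂ τ₃ :=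
  ⟨by linear_combination h.prod, h.sum⟩

lemma Chord.rotate {k m τ₁ τ₂ τ₃ : ℂ} (h : Chord x Y k m τ₁ τ₂ τ₃) : Chord x Y k m τ₂ τ₃ τ₁ :=
  ⟨by linear_combination h.prod, by linear_combination h.sum⟩

/-- The factors of the three-leg form of `Q4`. -/
lemma threeLeg_identity {k k' m τ₁ τ₂ τ₃ T₁ T₂ T₃ y₁ y₂ y₃ e₁ e₂ e₃ e₁' e₂' e₃' : ℂ}
    (hk : k * k' = 4 * (τ₁ * τ₂ * τ₃)) (hk0 : k ≠ 0) (h₁ : τ₁ ≠ 0) (h₂ : τ₂ ≠ 0) (h₃ : τ₃ ≠ 0)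
    (hy₁ : y₁ = (k + k') / 2 + m * τ₁) (hy₂ : y₂ = (k + k') / 2 + m * τ₂)
    (hy₃ : y₃ = (k + k') / 2 + m * τ₃)
    (he₁ : e₁ = (k ^ 2 / τ₁ ^ 2 + 2 * m * k / τ₁) / 4 + τ₂ + τ₃)
    (he₂ : e₂ = (k ^ 2 / τ₂ ^ 2 + 2 * m * k / τ₂) / 4 + τ₃ + τ₁)
    (he₃ : e₃ = (k ^ 2 / τ₃ ^ 2 + 2 * m * k / τ₃) / 4 + τ₁ + τ₂)
    (he₁' : e₁' = (k' ^ 2 / τ₁ ^ 2 + 2 * m * k' / τ₁) / 4 + τ₂ + τ₃)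
    (he₂' : e₂' = (k' ^ 2 / τ₂ ^ 2 + 2 * m * k' / τ₂) / 4 + τ₃ + τ₁)
    (he₃' : e₃' = (k' ^ 2 / τ₃ ^ 2 + 2 * m * k' / τ₃) / 4 + τ₁ + τ₂) :
    2 * (k' - k) * (y₁ * (-τ₂ * (T₂ - τ₂) - (τ₁ - τ₂) * (τ₃ - τ₂)) *
        ((T₃ - τ₂) * (T₁ - τ₂) - (τ₁ - τ₂) * (τ₃ - τ₂)) +
      -y₂ * (-τ₁ * (T₁ - τ₁) - (τ₂ - τ₁) * (τ₃ - τ₁)) *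
        ((T₂ - τ₁) * (T₃ - τ₁) - (τ₂ - τ₁) * (τ₃ - τ₁)) + y₁ * -y₂ * -y₃ * (τ₁ - τ₂)) =
    (τ₁ - τ₂) * (k' ^ 2 * ((T₁ - e₁) * (T₂ - e₂) * (T₃ - e₃)) -
      k ^ 2 * ((T₁ - e₁') * (T₂ - e₂') * (T₃ - e₃'))) := by
  obtain rfl : k' = 4 * (τ₁ * τ₂ * τ₃) / k := by rw [eq_div_iff hk0, ← hk, mul_comm]
  subst hy₁ hy₂ hy₃ he₁ he₂ he₃ he₁' he₂' he₃'
  field_simp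
  ring

lemma Chord.rotAt_eq {k m τ₁ τ₂ τ₃ a : ℂ} (h : Chord x Y k m τ₁ τ₂ τ₃) (h₁ : τ₁ ≠ 0)
    (ha : L.weierstrassP a = x + τ₁) (hd : L.derivWeierstrassP a = Y + k + m * τ₁) :
    rotAt L x Y a = x + ((k ^ 2 / τ₁ ^ 2 + 2 * m * k / τ₁) / 4 + τ₂ + τ₃) := by
  rw [rotAt, ha, hd, h.rot_eq h₁]

/-- The multiplicative three-leg form of `Q4`. -/
lemma Q4_threeLeg (hY : Y ^ 2 = xdot L x) {α β : ℂ} (hα : α ∉ L.lattice) (hβ : β ∉ L.lattice)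
    (hαβ : α - β ∉ L.lattice) (hne : L.weierstrassP α ≠ L.weierstrassP β)
    (h₁ : x ≠ L.weierstrassP α) (h₂ : x ≠ L.weierstrassP β) (h₃ : x ≠ L.weierstrassP (α - β))
    (xb xc xd : ℂ) :
    4 * Y * Q4 L x xb xc xd α β = (L.weierstrassP α - L.weierstrassP β) *
      ((lineVal L α (-β) x + Y) ^ 2 * ((xb - rotAt L x Y α) * (xc - rotAt L x Y (-β)) *
          (xd - rotAt L x Y (β - α))) -
        (lineVal L α (-β) x - Y) ^ 2 * ((xb - rotAt L x (-Y) α) * (xc - rotAt L x (-Y) (-β)) *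
          (xd - rotAt L x (-Y) (β - α)))) := by
  have hβα : β - α ∉ L.lattice := fun h => hαβ (by simpa using neg_mem h)
  obtain ⟨m, hc, hd₁, hd₂, hd₃⟩ := exists_chord hY hα (v := -β) (w := β - α) (by simpa using hβ) hβα
    (by ring) (by simpa using hne)
  have hp : L.weierstrassP (β - α) = L.weierstrassP (α - β) := by
    rw [← neg_sub, L.weierstrassP_neg]
  have hp' : L.derivWeierstrassP (α - β) = -L.derivWeierstrassP (β - α) := by
    rw [← neg_sub, L.derivWeierstrassP_neg]
  have hp'' : L.derivWeierstrassP β = -L.derivWeierstrassP (-β) := by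
    rw [L.derivWeierstrassP_neg, neg_neg]
  have hl : L.weierstrassP (-β) = L.weierstrassP β := L.weierstrassP_neg β
  have t₁ := sub_ne_zero.2 h₁.symm
  have t₂ := sub_ne_zero.2 h₂.symm
  have t₃ := sub_ne_zero.2 h₃.symm
  rw [hl, hp] at hc
  rw [hl] at hd₂
  rw [hp] at hd₃
  have r₁ := hc.rotAt_eq (a := α) t₁ (by ring) (by rw [hd₁]; ring)
  have r₂ := hc.rotate.rotAt_eq (a := -β) t₂ (by rw [hl]; ring) (by rw [hd₂]; ring)
  have r₃ := hc.rotate.rotate.rotAt_eq (a := β - α) t₃ (by rw [hp]; ring) (by rw [hd₃]; ring)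
  have r₁' := hc.neg.rotAt_eq (a := α) t₁ (by ring) (by rw [hd₁]; ring)
  have r₂' := hc.neg.rotate.rotAt_eq (a := -β) t₂ (by rw [hl]; ring) (by rw [hd₂]; ring)
  have r₃' := hc.neg.rotate.rotate.rotAt_eq (a := β - α) t₃ (by rw [hp]; ring)
    (by rw [hd₃]; ring)
  have hk0 : lineVal L α (-β) x - Y ≠ 0 := fun h => by
    have := hc.prod
    rw [h, zero_mul] at this
    exact mul_ne_zero (by norm_num) (mul_ne_zero (mul_ne_zero t₁ t₂) t₃) this.symm
  have key := threeLeg_identity (m := m) (T₁ := xb - x) (T₂ := xc - x) (T₃ := xd - x)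
    hc.prod hk0 t₁ t₂ t₃
    (y₁ := L.derivWeierstrassP α) (y₂ := L.derivWeierstrassP (-β))
    (y₃ := L.derivWeierstrassP (β - α))
    (by linear_combination hd₁) (by linear_combination hd₂) (by linear_combination hd₃)
    (e₁ := rotAt L x Y α - x) (e₂ := rotAt L x Y (-β) - x) (e₃ := rotAt L x Y (β - α) - x)
    (e₁' := rotAt L x (-Y) α - x) (e₂' := rotAt L x (-Y) (-β) - x)
    (e₃' := rotAt L x (-Y) (β - α) - x) (sub_eq_of_eq_add' r₁) (sub_eq_of_eq_add' r₂)
    (sub_eq_of_eq_add' r₃) (sub_eq_of_eq_add' r₁') (sub_eq_of_eq_add' r₂') (sub_eq_of_eq_add' r₃')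
  clear r₁ r₂ r₃ r₁' r₂' r₃' hd₁ hd₂ hd₃
  rw [Q4]
  simp only [hp', hp'']
  linear_combination key

end

/-! ### Consistency on a 3-face from the relations at one vertex -/

/-- Equations `F` on the faces of the 4-cube together with relations `T` between the values at the
vertices of the tetrahedra inscribed in its 3-faces, such that any three of the four relations in
the star of a vertex imply the fourth one. -/
structure StarSystem (F : Fin 16 → Fin 4 → Fin 4 → ℂ → ℂ → ℂ → ℂ → ℂ)
    (T : Fin 16 → Fin 4 → Fin 4 → Fin 4 → ℂ → ℂ → ℂ → ℂ → Prop) : Prop where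
  moebius : ∀ s i j, i < j → Moebius (F s i j) ∧ Moebius (fun x v u w => F s i j x u v w) ∧
    Moebius (fun x w u v => F s i j x u v w)
  flip₁ : ∀ s i j, i < j → ∀ x u v w, F s i j x u v w = F (nb s i) i j u x w v
  flip₂ : ∀ s i j, i < j → ∀ x u v w, F s i j x u v w = F (nb s j) i j v w x u
  tetra₁ : ∀ s i j k, i < j → j < k → ∀ x d₁₂ d₁₃ d₂₃, T s i j k x d₁₂ d₁₃ d₂₃ →
    T (nb (nb s i) j) i j k d₁₂ x d₂₃ d₁₃
  tetra₂ : ∀ s i j k, i < j → j < k → ∀ x d₁₂ d₁₃ d₂₃, T s i j k x d₁₂ d₁₃ d₂₃ →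
    T (nb (nb s i) k) i j k d₁₃ d₂₃ x d₁₂
  star₁ : ∀ s i j k, i < j → j < k → ∀ᶠ v : Fin 4 → ℂ in gen 4, ∀ d₁₂ d₁₃ d₂₃,
    F s i j (v 0) (v 1) (v 2) d₁₂ = 0 → F s i k (v 0) (v 1) (v 3) d₁₃ = 0 →
    F s j k (v 0) (v 2) (v 3) d₂₃ = 0 → T s i j k (v 0) d₁₂ d₁₃ d₂₃
  star₂ : ∀ s i j k, i < j → j < k → ∀ᶠ v : Fin 4 → ℂ in gen 4, ∀ b₁ b₃ d₁₃,
    F s i j (v 0) b₁ (v 1) (v 2) = 0 → F s j k (v 0) (v 1) b₃ (v 3) = 0 →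
    T s i j k (v 0) (v 2) d₁₃ (v 3) → F s i k (v 0) b₁ b₃ d₁₃ = 0
  star₃ : ∀ s i j k, i < j → j < k → ∀ᶠ v : Fin 4 → ℂ in gen 4, ∀ b₁ b₂ d₁₂,
    F s i k (v 0) b₁ (v 1) (v 2) = 0 → F s j k (v 0) b₂ (v 1) (v 3) = 0 →
    T s i j k (v 0) d₁₂ (v 2) (v 3) → F s i j (v 0) b₁ b₂ d₁₂ = 0

theorem StarSystem.cubeSystem {F : Fin 16 → Fin 4 → Fin 4 → ℂ → ℂ → ℂ → ℂ → ℂ}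
    {T : Fin 16 → Fin 4 → Fin 4 → Fin 4 → ℂ → ℂ → ℂ → ℂ → Prop} (h : StarSystem F T) :
    CubeSystem F where
  moebius := h.moebius
  flip₁ := h.flip₁
  flip₂ := h.flip₂
  cube s i j k hij hjk := by
    have hik := hij.trans hjk
    refine ⟨_, _, h.star₁ s i j k hij hjk,
      ((tendsto_gen_comp ![2, 1, 0, 3] (by decide)).eventually
        (h.star₂ (nb (nb s i) j) i j k hij hjk)).and
      ((tendsto_gen_comp ![3, 1, 0, 2] (by decide)).eventually
        (h.star₃ (nb (nb s i) k) i j k hij hjk)), ?_⟩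
    rintro x x₁ x₂ x₃ x₁₂ x₁₃ x₂₃ x₁₂₃ c₁ ⟨c₂, c₃⟩ e₁ e₂ e₃ e₄
    have t := c₁ x₁₂ x₁₃ x₂₃ e₁ e₂ e₃
    constructor
    · rw [h.flip₁ _ _ _ hik, nb_comm s j i]
      refine c₂ x₂ x₁₂₃ x₂₃ ?_ ?_ (h.tetra₁ s i j k hij hjk _ _ _ _ t)
      · rw [h.flip₁ s i j hij, h.flip₂ _ _ _ hij] at e₁
        exact e₁
      · rw [h.flip₁ _ _ _ hjk] at e₄
        exact e₄
    · rw [h.flip₁ _ _ _ hij, nb_comm s k i]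
      refine c₃ x₃ x₁₂₃ x₂₃ ?_ ?_ (h.tetra₂ s i j k hij hjk _ _ _ _ t)
      · rw [h.flip₁ s i k hik, h.flip₂ _ _ _ hik] at e₂
        exact e₂
      · rw [h.flip₂ _ _ _ hjk] at e₄
        exact e₄

/-! ### Consistency of `Q4` -/

section

variable {L : PeriodPair} {x Y : ℂ}

/-- The parameters `a`, `b`, `c` and their differences are no lattice points, and the values of `℘`
at these six arguments are distinct. -/
structure EdgeGeneric (L : PeriodPair) (a b c : ℂ) : Prop where
  notMem : ∀ i, (![a, b, c, a - b, b - c, a - c] : Fin 6 → ℂ) i ∉ L.lattice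
  inj : Function.Injective fun i => L.weierstrassP ((![a, b, c, a - b, b - c, a - c] : Fin 6 → ℂ) i)

lemma lineVal_left (L : PeriodPair) (u v : ℂ) :
    lineVal L u v (L.weierstrassP u) = L.derivWeierstrassP u := by
  simp [lineVal]

lemma lineVal_right {u v : ℂ} (h : L.weierstrassP u ≠ L.weierstrassP v) :
    lineVal L u v (L.weierstrassP v) = L.derivWeierstrassP v := by
  have := sub_ne_zero.2 h
  rw [lineVal]
  field_simp
  ring

lemma lineVal_third {u v w : ℂ} (hu : u ∉ L.lattice) (hv : v ∉ L.lattice)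
    (hw : w ∉ L.lattice) (h0 : u + v + w = 0) (hne : L.weierstrassP u ≠ L.weierstrassP v) :
    lineVal L u v (L.weierstrassP w) = L.derivWeierstrassP w := by
  obtain ⟨m, -, -, -, h⟩ := exists_chord (L.derivWeierstrassP_sq w hw) hu hv hw h0 hne
  rw [sub_self, mul_zero, add_zero] at h
  exact h.symm

/-- The values of the line through the points with arguments `u` and `-v` at its three points. -/
lemma lineVal_edges {u v : ℂ} (hu : u ∉ L.lattice) (hv : v ∉ L.lattice) (huv : u - v ∉ L.lattice)
    (hne : L.weierstrassP u ≠ L.weierstrassP v) :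
    lineVal L u (-v) (L.weierstrassP u) = L.derivWeierstrassP u ∧
      lineVal L u (-v) (L.weierstrassP v) = -L.derivWeierstrassP v ∧
      lineVal L u (-v) (L.weierstrassP (u - v)) = -L.derivWeierstrassP (u - v) := by
  have hne' : L.weierstrassP u ≠ L.weierstrassP (-v) := by rwa [L.weierstrassP_neg]
  have h₂ := lineVal_right hne'
  have h₃ := lineVal_third (v := -v) (w := -(u - v)) hu (fun h => hv (by simpa using neg_mem h))
    (fun h => huv (by simpa using neg_mem h)) (by ring) hne'
  rw [L.weierstrassP_neg, L.derivWeierstrassP_neg] at h₂ h₃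
  exact ⟨lineVal_left L u _, h₂, h₃⟩

/-- The line through two points is a polynomial of degree at most one. -/
lemma exists_lineVal_eq (L : PeriodPair) (u v : ℂ) :
    ∃ m n, ∀ x, lineVal L u v x = m * x + n := by
  refine ⟨(L.derivWeierstrassP u - L.derivWeierstrassP v) /
    (L.weierstrassP u - L.weierstrassP v), L.derivWeierstrassP u -
    (L.derivWeierstrassP u - L.derivWeierstrassP v) / (L.weierstrassP u - L.weierstrassP v) *
    L.weierstrassP u, fun x => ?_⟩
  rw [lineVal]
  ring

/-- The four lines of a tetrahedron: each of the six edges is the argument of a point on two of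
them. -/
lemma lineVal_cocycle (hY : Y ^ 2 = xdot L x) {a b c : ℂ} (h : EdgeGeneric L a b c) :
    (lineVal L a (-b) x + Y) * (lineVal L b (-c) x + Y) * (lineVal L a (-c) x - Y) *
        (lineVal L (a - c) (-(a - b)) x - Y) =
      (lineVal L a (-b) x - Y) * (lineVal L b (-c) x - Y) * (lineVal L a (-c) x + Y) *
        (lineVal L (a - c) (-(a - b)) x + Y) := by
  have hmem := h.notMem
  have hne : ∀ i j : Fin 6, i ≠ j → _ := fun i j hij => h.inj.ne hij
  obtain ⟨m₁, n₁, e₁⟩ := exists_lineVal_eq L a (-b)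
  obtain ⟨m₂, n₂, e₂⟩ := exists_lineVal_eq L b (-c)
  obtain ⟨m₃, n₃, e₃⟩ := exists_lineVal_eq L a (-c)
  obtain ⟨m₄, n₄, e₄⟩ := exists_lineVal_eq L (a - c) (-(a - b))
  have ha : a ∉ L.lattice := hmem 0
  have hb : b ∉ L.lattice := hmem 1
  have hc : c ∉ L.lattice := hmem 2
  have hab : a - b ∉ L.lattice := hmem 3
  have hbc : b - c ∉ L.lattice := hmem 4
  have hac : a - c ∉ L.lattice := hmem 5
  obtain ⟨f₁, f₂, f₃⟩ := lineVal_edges ha hb hab (hne 0 1 (by decide))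
  obtain ⟨g₁, g₂, g₃⟩ := lineVal_edges hb hc hbc (hne 1 2 (by decide))
  obtain ⟨h₁, h₂, h₃⟩ := lineVal_edges ha hc hac (hne 0 2 (by decide))
  have hbc' : a - c - (a - b) = b - c := by ring
  obtain ⟨k₁, k₂, k₃⟩ := lineVal_edges hac hab (by rwa [hbc']) (hne 5 3 (by decide))
  rw [hbc'] at k₃
  -- `E x = 0` is the difference of the two sides, divided by `2 Y`
  obtain ⟨E, hE⟩ : ∃ E : Polynomial ℂ, E =
      (.C m₁ * .X + .C n₁) * (.C m₂ * .X + .C n₂) * (-(.C m₃ * .X + .C n₃) - (.C m₄ * .X + .C n₄)) +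
      (.C m₁ * .X + .C n₁ + (.C m₂ * .X + .C n₂)) * ((.C m₃ * .X + .C n₃) * (.C m₄ * .X + .C n₄)) +
      (4 * .X ^ 3 - .C L.g₂ * .X - .C L.g₃) * (.C m₁ * .X + .C n₁ + (.C m₂ * .X + .C n₂) -
        (.C m₃ * .X + .C n₃) - (.C m₄ * .X + .C n₄)) := ⟨_, rfl⟩
  have hev : ∀ z, E.eval z = lineVal L a (-b) z * lineVal L b (-c) z *
        (-lineVal L a (-c) z - lineVal L (a - c) (-(a - b)) z) +
      (lineVal L a (-b) z + lineVal L b (-c) z) *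
        (lineVal L a (-c) z * lineVal L (a - c) (-(a - b)) z) +
      xdot L z * (lineVal L a (-b) z + lineVal L b (-c) z - lineVal L a (-c) z -
        lineVal L (a - c) (-(a - b)) z) := by
    intro z
    simp only [hE, e₁, e₂, e₃, e₄, xdot, Polynomial.eval_add, Polynomial.eval_mul,
      Polynomial.eval_sub, Polynomial.eval_neg, Polynomial.eval_C, Polynomial.eval_X,
      Polynomial.eval_pow, Polynomial.eval_ofNat]
  have hdeg : E.natDegree < 5 := by
    refine Nat.lt_succ_of_le ?_
    rw [hE]
    compute_degree
  have hzero : E = 0 := by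
    refine Polynomial.eq_zero_of_natDegree_lt_card_of_eval_eq_zero E
      (f := fun i : Fin 5 =>
        L.weierstrassP ((![a, b, c, a - b, b - c, a - c] : Fin 6 → ℂ) i.castSucc))
      (h.inj.comp (Fin.castSucc_injective 5)) (fun i => ?_) (by simpa using hdeg)
    have hx : ∀ z, z ∉ L.lattice → xdot L (L.weierstrassP z) = L.derivWeierstrassP z ^ 2 :=
      fun z hz => (L.derivWeierstrassP_sq z hz).symm
    fin_cases i
    · change E.eval (L.weierstrassP a) = 0
      rw [hev, f₁, h₁, hx a ha]
      ring
    · change E.eval (L.weierstrassP b) = 0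
      rw [hev, f₂, g₁, hx b hb]
      ring
    · change E.eval (L.weierstrassP c) = 0
      rw [hev, g₂, h₂, hx c hc]
      ring
    · change E.eval (L.weierstrassP (a - b)) = 0
      rw [hev, f₃, k₂, hx _ hab]
      ring
    · change E.eval (L.weierstrassP (b - c)) = 0
      rw [hev, g₃, k₃, hx _ hbc]
      ring
  have h0 := hev x
  rw [hzero, Polynomial.eval_zero, ← hY] at h0
  linear_combination (-2 * Y) * h0

/-- In a product of three relations the factors on the shared edges cancel. -/
lemma star_cancel {P₁ P₁' P₂ P₂' P₃ P₃' P₄ P₄' u u' v v' w w' p p' q q' r r' : ℂ}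
    (h₁ : P₁ * (u * v * p) = P₁' * (u' * v' * p')) (h₂ : P₂ * (u' * w * q) = P₂' * (u * w' * q'))
    (h₃ : P₃ * (v' * w' * r) = P₃' * (v * w * r'))
    (hP : P₁ * P₂ * P₃ * P₄ = P₁' * P₂' * P₃' * P₄')
    (hu : u ≠ 0 ∧ u' ≠ 0) (hv : v ≠ 0 ∧ v' ≠ 0) (hw : w ≠ 0 ∧ w' ≠ 0)
    (hP' : P₁' ≠ 0 ∧ P₂' ≠ 0 ∧ P₃' ≠ 0) : P₄ * (p' * q' * r') = P₄' * (p * q * r) := by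
  have hE : u * v * w * (u' * v' * w') ≠ 0 :=
    mul_ne_zero (mul_ne_zero (mul_ne_zero hu.1 hv.1) hw.1)
      (mul_ne_zero (mul_ne_zero hu.2 hv.2) hw.2)
  have hF : P₁' * P₂' * P₃' ≠ 0 := mul_ne_zero (mul_ne_zero hP'.1 hP'.2.1) hP'.2.2
  refine mul_left_cancel₀ (mul_ne_zero hE hF) ?_
  have key : (P₁ * (u * v * p)) * (P₂ * (u' * w * q)) * (P₃ * (v' * w' * r)) =
      (P₁' * (u' * v' * p')) * (P₂' * (u * w' * q')) * (P₃' * (v * w * r')) := by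
    rw [h₁, h₂, h₃]
  linear_combination (-P₄) * key + (u * v * w * (u' * v' * w') * (p * q * r)) * hP

/-- The symmetric biquadratic polynomial whose roots in `b` are the values of `℘` at the sum and the
difference of `a` and an argument of `x`. -/
def biq (L : PeriodPair) (a x b : ℂ) : ℂ :=
  eqSq L x a * b ^ 2 + b * ep0 L x a / 2 + ep1 L x a / 16

lemma biq_eq (hY : Y ^ 2 = xdot L x) {a : ℂ} (ha : a ∉ L.lattice) (hx : x ≠ L.weierstrassP a)
    (b : ℂ) : biq L a x b = eqSq L x a * ((b - rotAt L x Y a) * (b - rotAt L x (-Y) a)) := by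
  have h := leg_rot hY ha hx
  rw [biq, h.ep0, h.ep1, rotAt, rotAt]
  ring

lemma sub_rotAt_ne_zero (hY : Y ^ 2 = xdot L x) {a b : ℂ} (ha : a ∉ L.lattice)
    (hx : x ≠ L.weierstrassP a) (h : biq L a x b ≠ 0) :
    b - rotAt L x Y a ≠ 0 ∧ b - rotAt L x (-Y) a ≠ 0 := by
  rw [biq_eq hY ha hx] at h
  exact ⟨left_ne_zero_of_mul (right_ne_zero_of_mul h),
    right_ne_zero_of_mul (right_ne_zero_of_mul h)⟩

lemma Q4_eq_zero_iff (hY : Y ^ 2 = xdot L x) (hY0 : Y ≠ 0) {α β : ℂ} (hα : α ∉ L.lattice)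
    (hβ : β ∉ L.lattice) (hαβ : α - β ∉ L.lattice) (hne : L.weierstrassP α ≠ L.weierstrassP β)
    (h₁ : x ≠ L.weierstrassP α) (h₂ : x ≠ L.weierstrassP β) (h₃ : x ≠ L.weierstrassP (α - β))
    (xb xc xd : ℂ) :
    Q4 L x xb xc xd α β = 0 ↔
      (lineVal L α (-β) x + Y) ^ 2 * ((xb - rotAt L x Y α) * (xc - rotAt L x (-Y) β) *
          (xd - rotAt L x Y (β - α))) =
        (lineVal L α (-β) x - Y) ^ 2 * ((xb - rotAt L x (-Y) α) * (xc - rotAt L x Y β) *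
          (xd - rotAt L x (-Y) (β - α))) := by
  rw [← sub_eq_zero (b := (lineVal L α (-β) x - Y) ^ 2 * _)]
  refine eq_zero_iff_of_mul_eq (mul_ne_zero (by norm_num) hY0 : 4 * Y ≠ 0) (sub_ne_zero.2 hne) ?_
  rw [Q4_threeLeg hY hα hβ hαβ hne h₁ h₂ h₃, rotAt_neg, rotAt_neg']

lemma lineVal_ne (hY : Y ^ 2 = xdot L x) {u v w : ℂ} (hu : u ∉ L.lattice) (hv : v ∉ L.lattice)
    (hw : w ∉ L.lattice) (h0 : u + v + w = 0) (hne : L.weierstrassP u ≠ L.weierstrassP v)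
    (h₁ : x ≠ L.weierstrassP u) (h₂ : x ≠ L.weierstrassP v) (h₃ : x ≠ L.weierstrassP w) :
    lineVal L u v x + Y ≠ 0 ∧ lineVal L u v x - Y ≠ 0 := by
  obtain ⟨m, hc, -⟩ := exists_chord hY hu hv hw h0 hne
  have := hc.prod
  have h : (lineVal L u v x - Y) * (lineVal L u v x + Y) ≠ 0 := by
    rw [show lineVal L u v x + Y = lineVal L u v x - Y + 2 * Y by ring, this]
    exact mul_ne_zero (by norm_num) (mul_ne_zero (mul_ne_zero (sub_ne_zero.2 h₁.symm)
      (sub_ne_zero.2 h₂.symm)) (sub_ne_zero.2 h₃.symm))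
  exact ⟨right_ne_zero_of_mul h, left_ne_zero_of_mul h⟩

end

section

variable {L : PeriodPair} {a b c x : ℂ}

/-- `x` is a value of `℘` at none of the six edges of a tetrahedron and at no half period. -/
structure OffEdges (L : PeriodPair) (a b c x : ℂ) : Prop where
  ne : ∀ i, x ≠ L.weierstrassP ((![a, b, c, a - b, b - c, a - c] : Fin 6 → ℂ) i)
  xdot_ne : xdot L x ≠ 0

/-- The four equations of the star of `x` in three-leg form, up to the choice of a root of
`xdot L x`. -/
lemma OffEdges.exists_threeLeg (h : EdgeGeneric L a b c) (hx : OffEdges L a b c x) :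
    ∃ Y, Y ^ 2 = xdot L x ∧
    (∀ b₁ b₂ d, Q4 L x b₁ b₂ d a b = 0 ↔
      (lineVal L a (-b) x + Y) ^ 2 * ((b₁ - rotAt L x Y a) * (b₂ - rotAt L x (-Y) b) *
          (d - rotAt L x Y (b - a))) =
        (lineVal L a (-b) x - Y) ^ 2 * ((b₁ - rotAt L x (-Y) a) * (b₂ - rotAt L x Y b) *
          (d - rotAt L x (-Y) (b - a)))) ∧
    (∀ b₁ b₃ d, Q4 L x b₁ b₃ d a c = 0 ↔
      (lineVal L a (-c) x + Y) ^ 2 * ((b₁ - rotAt L x Y a) * (b₃ - rotAt L x (-Y) c) *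
          (d - rotAt L x Y (c - a))) =
        (lineVal L a (-c) x - Y) ^ 2 * ((b₁ - rotAt L x (-Y) a) * (b₃ - rotAt L x Y c) *
          (d - rotAt L x (-Y) (c - a)))) ∧
    (∀ b₂ b₃ d, Q4 L x b₂ b₃ d b c = 0 ↔
      (lineVal L b (-c) x + Y) ^ 2 * ((b₂ - rotAt L x Y b) * (b₃ - rotAt L x (-Y) c) *
          (d - rotAt L x Y (c - b))) =
        (lineVal L b (-c) x - Y) ^ 2 * ((b₂ - rotAt L x (-Y) b) * (b₃ - rotAt L x Y c) *
          (d - rotAt L x (-Y) (c - b)))) ∧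
    (∀ d₁₃ d₁₂ d₂₃, Q4 L x d₁₃ d₁₂ d₂₃ (a - c) (a - b) = 0 ↔
      (lineVal L (a - c) (-(a - b)) x + Y) ^ 2 * ((d₁₃ - rotAt L x (-Y) (c - a)) *
          (d₁₂ - rotAt L x Y (b - a)) * (d₂₃ - rotAt L x Y (c - b))) =
        (lineVal L (a - c) (-(a - b)) x - Y) ^ 2 * ((d₁₃ - rotAt L x Y (c - a)) *
          (d₁₂ - rotAt L x (-Y) (b - a)) * (d₂₃ - rotAt L x (-Y) (c - b)))) ∧
    ((lineVal L a (-b) x + Y ≠ 0 ∧ lineVal L a (-b) x - Y ≠ 0) ∧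
      (lineVal L a (-c) x + Y ≠ 0 ∧ lineVal L a (-c) x - Y ≠ 0) ∧
      (lineVal L b (-c) x + Y ≠ 0 ∧ lineVal L b (-c) x - Y ≠ 0) ∧
      (lineVal L (a - c) (-(a - b)) x + Y ≠ 0 ∧ lineVal L (a - c) (-(a - b)) x - Y ≠ 0)) := by
  obtain ⟨Y, hY⟩ := IsAlgClosed.exists_pow_nat_eq (xdot L x) two_pos
  have hY0 : Y ≠ 0 := by
    rintro rfl
    exact hx.xdot_ne (by simpa using hY.symm)
  have hne : ∀ i j : Fin 6, i ≠ j → _ := fun i j hij => h.inj.ne hij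
  have hbc' : a - c - (a - b) = b - c := by ring
  have hneg : ∀ {z : ℂ}, z ∉ L.lattice → -z ∉ L.lattice := fun hz h => hz (by simpa using neg_mem h)
  have hl : ∀ {u v : ℂ}, u ∉ L.lattice → v ∉ L.lattice → u - v ∉ L.lattice →
      L.weierstrassP u ≠ L.weierstrassP v → x ≠ L.weierstrassP u → x ≠ L.weierstrassP v →
      x ≠ L.weierstrassP (u - v) → lineVal L u (-v) x + Y ≠ 0 ∧ lineVal L u (-v) x - Y ≠ 0 := by
    intro u v hu hv huv h1 h2 h3 h4
    refine lineVal_ne hY hu (hneg hv) (w := -(u - v)) (hneg huv) (by ring) ?_ h2 ?_ ?_ <;>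
      rwa [L.weierstrassP_neg]
  refine ⟨Y, hY, ?_, ?_, ?_, ?_, ?_, ?_, ?_, ?_⟩
  · exact fun _ _ _ => Q4_eq_zero_iff hY hY0 (h.notMem 0) (h.notMem 1) (h.notMem 3)
      (hne 0 1 (by decide)) (hx.ne 0) (hx.ne 1) (hx.ne 3) _ _ _
  · exact fun _ _ _ => Q4_eq_zero_iff hY hY0 (h.notMem 0) (h.notMem 2) (h.notMem 5)
      (hne 0 2 (by decide)) (hx.ne 0) (hx.ne 2) (hx.ne 5) _ _ _
  · exact fun _ _ _ => Q4_eq_zero_iff hY hY0 (h.notMem 1) (h.notMem 2) (h.notMem 4)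
      (hne 1 2 (by decide)) (hx.ne 1) (hx.ne 2) (hx.ne 4) _ _ _
  · intro d₁₃ d₁₂ d₂₃
    rw [Q4_eq_zero_iff (α := a - c) (β := a - b) hY hY0 (h.notMem 5) (h.notMem 3)
      (by rw [hbc']; exact h.notMem 4)
      (hne 5 3 (by decide)) (hx.ne 5) (hx.ne 3) (by rw [hbc']; exact hx.ne 4),
      show a - b - (a - c) = c - b by ring, ← neg_sub c a, ← neg_sub b a]
    simp only [rotAt_neg, neg_neg]
  · exact hl (h.notMem 0) (h.notMem 1) (h.notMem 3)
      (hne 0 1 (by decide)) (hx.ne 0) (hx.ne 1) (hx.ne 3)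
  · exact hl (h.notMem 0) (h.notMem 2) (h.notMem 5)
      (hne 0 2 (by decide)) (hx.ne 0) (hx.ne 2) (hx.ne 5)
  · exact hl (h.notMem 1) (h.notMem 2) (h.notMem 4)
      (hne 1 2 (by decide)) (hx.ne 1) (hx.ne 2) (hx.ne 4)
  · exact hl (h.notMem 5) (h.notMem 3) (by rw [hbc']; exact h.notMem 4)
      (hne 5 3 (by decide)) (hx.ne 5) (hx.ne 3) (by rw [hbc']; exact hx.ne 4)

/-- The argument `i` of the six edges gives a leg that does not vanish. -/
lemma OffEdges.sub_rotAt_ne_zero (h : EdgeGeneric L a b c) (hx : OffEdges L a b c x) {Y : ℂ}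
    (hY : Y ^ 2 = xdot L x) (i : Fin 6) {d : ℂ}
    (hd : biq L ((![a, b, c, a - b, b - c, a - c] : Fin 6 → ℂ) i) x d ≠ 0) :
    d - rotAt L x Y ((![a, b, c, a - b, b - c, a - c] : Fin 6 → ℂ) i) ≠ 0 ∧
      d - rotAt L x (-Y) ((![a, b, c, a - b, b - c, a - c] : Fin 6 → ℂ) i) ≠ 0 :=
  HexPrism.sub_rotAt_ne_zero hY (h.notMem i) (hx.ne i) hd

/-- Any three of the four equations in the star of `x` imply the fourth one. -/
lemma star_Q4 (h : EdgeGeneric L a b c) (hx : OffEdges L a b c x) {b₁ b₂ b₃ d₁₂ d₁₃ d₂₃ : ℂ} :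
    (biq L a x b₁ ≠ 0 → biq L b x b₂ ≠ 0 → biq L c x b₃ ≠ 0 →
      Q4 L x b₁ b₂ d₁₂ a b = 0 → Q4 L x b₁ b₃ d₁₃ a c = 0 → Q4 L x b₂ b₃ d₂₃ b c = 0 →
      Q4 L x d₁₃ d₁₂ d₂₃ (a - c) (a - b) = 0) ∧
    (biq L b x b₂ ≠ 0 → biq L (a - b) x d₁₂ ≠ 0 → biq L (b - c) x d₂₃ ≠ 0 →
      Q4 L x b₁ b₂ d₁₂ a b = 0 → Q4 L x b₂ b₃ d₂₃ b c = 0 →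
      Q4 L x d₁₃ d₁₂ d₂₃ (a - c) (a - b) = 0 → Q4 L x b₁ b₃ d₁₃ a c = 0) ∧
    (biq L c x b₃ ≠ 0 → biq L (a - c) x d₁₃ ≠ 0 → biq L (b - c) x d₂₃ ≠ 0 →
      Q4 L x b₁ b₃ d₁₃ a c = 0 → Q4 L x b₂ b₃ d₂₃ b c = 0 →
      Q4 L x d₁₃ d₁₂ d₂₃ (a - c) (a - b) = 0 → Q4 L x b₁ b₂ d₁₂ a b = 0) := by
  obtain ⟨Y, hY, e12, e13, e23, eT, n12, n13, n23, nT⟩ := hx.exists_threeLeg h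
  have hP := lineVal_cocycle hY h
  have hP2 := congrArg (fun z => z ^ 2) hP
  beta_reduce at hP2
  have hl := fun i d => hx.sub_rotAt_ne_zero h hY i (d := d)
  have l1 := hl 0 b₁
  have l2 := hl 1 b₂
  have l3 := hl 2 b₃
  have l12 : biq L (a - b) x d₁₂ ≠ 0 → _ := hl 3 d₁₂
  have l23 : biq L (b - c) x d₂₃ ≠ 0 → _ := hl 4 d₂₃
  have l13 : biq L (a - c) x d₁₃ ≠ 0 → _ := hl 5 d₁₃
  simp only [Matrix.cons_val] at l1 l2 l3 l12 l23 l13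
  rw [← neg_sub b a, rotAt_neg, rotAt_neg'] at l12
  rw [← neg_sub c b, rotAt_neg, rotAt_neg'] at l23
  rw [← neg_sub c a, rotAt_neg, rotAt_neg'] at l13
  rw [e12, e13, e23, eT]
  refine ⟨fun h1 h2 h3 => ?_, fun h1 h2 h3 => ?_, fun h1 h2 h3 => ?_⟩ <;> intro f1 f2 f3
  · have := star_cancel f1 f2.symm f3
      (P₄ := (lineVal L (a - c) (-(a - b)) x - Y) ^ 2)
      (P₄' := (lineVal L (a - c) (-(a - b)) x + Y) ^ 2)
      (by linear_combination hP2)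
      (l1 h1) (l2 h2).symm (l3 h3) ⟨pow_ne_zero 2 n12.2, pow_ne_zero 2 n13.1, pow_ne_zero 2 n23.2⟩
    linear_combination -this
  · have := star_cancel (u := b₂ - rotAt L x (-Y) b) (u' := b₂ - rotAt L x Y b)
      (v := d₁₂ - rotAt L x Y (b - a)) (v' := d₁₂ - rotAt L x (-Y) (b - a))
      (p := b₁ - rotAt L x Y a) (p' := b₁ - rotAt L x (-Y) a)
      (w := d₂₃ - rotAt L x Y (c - b)) (w' := d₂₃ - rotAt L x (-Y) (c - b))
      (q := b₃ - rotAt L x (-Y) c) (q' := b₃ - rotAt L x Y c)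
      (r := d₁₃ - rotAt L x Y (c - a)) (r' := d₁₃ - rotAt L x (-Y) (c - a))
      (P₁ := (lineVal L a (-b) x + Y) ^ 2) (P₁' := (lineVal L a (-b) x - Y) ^ 2)
      (P₂ := (lineVal L b (-c) x + Y) ^ 2) (P₂' := (lineVal L b (-c) x - Y) ^ 2)
      (P₃ := (lineVal L (a - c) (-(a - b)) x - Y) ^ 2)
      (P₃' := (lineVal L (a - c) (-(a - b)) x + Y) ^ 2)
      (P₄ := (lineVal L a (-c) x - Y) ^ 2)
      (P₄' := (lineVal L a (-c) x + Y) ^ 2)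
      (by linear_combination f1) (by linear_combination f2) (by linear_combination -f3)
      (by linear_combination hP2)
      (l2 h1).symm (l12 (by rwa [neg_sub])).symm (l23 (by rwa [neg_sub])).symm
      ⟨pow_ne_zero 2 n12.2, pow_ne_zero 2 n23.2, pow_ne_zero 2 nT.1⟩
    linear_combination -this
  · have := star_cancel (u := b₃ - rotAt L x (-Y) c) (u' := b₃ - rotAt L x Y c)
      (v := d₁₃ - rotAt L x Y (c - a)) (v' := d₁₃ - rotAt L x (-Y) (c - a))
      (p := b₁ - rotAt L x Y a) (p' := b₁ - rotAt L x (-Y) a)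
      (w := d₂₃ - rotAt L x (-Y) (c - b)) (w' := d₂₃ - rotAt L x Y (c - b))
      (q := b₂ - rotAt L x (-Y) b) (q' := b₂ - rotAt L x Y b)
      (r := d₁₂ - rotAt L x Y (b - a)) (r' := d₁₂ - rotAt L x (-Y) (b - a))
      (P₁ := (lineVal L a (-c) x + Y) ^ 2) (P₁' := (lineVal L a (-c) x - Y) ^ 2)
      (P₂ := (lineVal L b (-c) x - Y) ^ 2) (P₂' := (lineVal L b (-c) x + Y) ^ 2)
      (P₃ := (lineVal L (a - c) (-(a - b)) x + Y) ^ 2)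
      (P₃' := (lineVal L (a - c) (-(a - b)) x - Y) ^ 2)
      (P₄ := (lineVal L a (-b) x - Y) ^ 2)
      (P₄' := (lineVal L a (-b) x + Y) ^ 2)
      (by linear_combination f1) (by linear_combination -f2) (by linear_combination f3)
      (by linear_combination -hP2)
      (l3 h1).symm (l13 (by rwa [neg_sub])).symm (l23 (by rwa [neg_sub]))
      ⟨pow_ne_zero 2 n13.2, pow_ne_zero 2 n23.1, pow_ne_zero 2 nT.2⟩
    linear_combination -this

end

/-- Eight values of a multi-affine polynomial whose `qr`-coefficients do not satisfy the determinant
relation. -/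
lemma Moebius.of_coeff {g : ℂ → ℂ → ℂ → ℂ → ℂ} (hg : MultiAffine g)
    {G : ℂ → ℂ → ℂ} (hG : ∀ p s, G p s = g p s 1 1 - g p s 1 0 - g p s 0 1 + g p s 0 0)
    (h : G 1 0 * G 0 1 - G 0 0 * G 1 1 ≠ 0) : Moebius g := by
  refine ⟨hg, ?_⟩
  by_contra! h0
  have e : ∀ p s q r, g p s q r = g p s 0 0 + q * (g p s 1 0 - g p s 0 0) +
      r * (g p s 0 1 - g p s 0 0) + q * r * G p s := by
    intro p s q r
    linear_combination (hg p s q r).2.2.1 + (1 - q) * (hg p s 0 r).2.2.2 +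
      q * (hg p s 1 r).2.2.2 - q * r * hG p s
  have d : ∀ q r, (g 1 0 0 0 + q * (g 1 0 1 0 - g 1 0 0 0) + r * (g 1 0 0 1 - g 1 0 0 0) +
        q * r * G 1 0) * (g 0 1 0 0 + q * (g 0 1 1 0 - g 0 1 0 0) +
        r * (g 0 1 0 1 - g 0 1 0 0) + q * r * G 0 1) -
      (g 0 0 0 0 + q * (g 0 0 1 0 - g 0 0 0 0) + r * (g 0 0 0 1 - g 0 0 0 0) + q * r * G 0 0) *
        (g 1 1 0 0 + q * (g 1 1 1 0 - g 1 1 0 0) + r * (g 1 1 0 1 - g 1 1 0 0) +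
          q * r * G 1 1) = 0 := fun q r => by
    rw [← e, ← e, ← e, ← e]
    exact sub_eq_zero.2 (h0 q r)
  generalize g 1 0 0 0 = a at d
  generalize g 1 0 1 0 = a' at d
  generalize g 1 0 0 1 = a'' at d
  generalize g 0 1 0 0 = b at d
  generalize g 0 1 1 0 = b' at d
  generalize g 0 1 0 1 = b'' at d
  generalize g 0 0 0 0 = c at d
  generalize g 0 0 1 0 = c' at d
  generalize g 0 0 0 1 = c'' at d
  generalize g 1 1 0 0 = e at d
  generalize g 1 1 1 0 = e' at d
  generalize g 1 1 0 1 = e'' at d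
  -- the second difference in both variables
  refine h ?_
  linear_combination (1 / 4 : ℂ) * (d 0 0 - 2 * d 0 1 + d 0 2 - 2 * d 1 0 + 4 * d 1 1 - 2 * d 1 2 +
    d 2 0 - 2 * d 2 1 + d 2 2)

section

variable {L : PeriodPair}

lemma Q4_flip₁ (L : PeriodPair) (x u v w α β : ℂ) : Q4 L x u v w α β = Q4 L u x w v α β := by
  simp only [Q4]; ring

lemma Q4_flip₂ (L : PeriodPair) (x u v w α β : ℂ) : Q4 L x u v w α β = Q4 L v w x u α β := by
  simp only [Q4]; ring

lemma Q4_swap (L : PeriodPair) (x u v w α β : ℂ) : Q4 L x v u w β α = Q4 L x u v w α β := by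
  have h₁ : L.weierstrassP (β - α) = L.weierstrassP (α - β) := by rw [← neg_sub, L.weierstrassP_neg]
  have h₂ : L.derivWeierstrassP (β - α) = -L.derivWeierstrassP (α - β) := by
    rw [← neg_sub, L.derivWeierstrassP_neg]
  simp only [Q4, h₁, h₂]; ring

lemma multiAffine_Q4 (L : PeriodPair) (α β : ℂ) :
    MultiAffine fun x u v w => Q4 L x u v w α β := by
  intro x u v w
  simp only [Q4]
  refine ⟨?_, ?_, ?_, ?_⟩ <;> ring

lemma moebius_Q4 {α β : ℂ} (hα : α ∉ L.lattice) (hβ : β ∉ L.lattice) (hαβ : α - β ∉ L.lattice)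
    (hne : L.weierstrassP α ≠ L.weierstrassP β) (h₁ : L.derivWeierstrassP α ≠ 0)
    (h₂ : L.derivWeierstrassP β ≠ 0) (h₃ : L.derivWeierstrassP (α - β) ≠ 0) :
    Moebius (fun x u v w => Q4 L x u v w α β) ∧ Moebius (fun x v u w => Q4 L x u v w α β) ∧
      Moebius (fun x w u v => Q4 L x u v w α β) := by
  have hm := multiAffine_Q4 L α β
  have hline := (lineVal_edges hα hβ hαβ hne).2.2
  have hs := sub_ne_zero.2 hne
  -- the third point on the line through the points with arguments `α` and `-β`
  have key : (L.derivWeierstrassP α + L.derivWeierstrassP β) *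
      (L.weierstrassP (α - β) - L.weierstrassP α) = -(L.derivWeierstrassP (α - β) +
      L.derivWeierstrassP α) * (L.weierstrassP α - L.weierstrassP β) := by
    rw [lineVal, L.weierstrassP_neg, L.derivWeierstrassP_neg] at hline
    field_simp at hline
    linear_combination hline
  refine ⟨.of_coeff hm (fun _ _ => rfl) ?_, .of_coeff (fun x v u w => ?_) (fun _ _ => rfl) ?_,
    .of_coeff (fun x w u v => ?_) (fun _ _ => rfl) ?_⟩
  · have : L.derivWeierstrassP β * L.derivWeierstrassP (α - β) *
      (L.weierstrassP α - L.weierstrassP β) ^ 2 ≠ 0 :=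
      mul_ne_zero (mul_ne_zero h₂ h₃) (pow_ne_zero 2 hs)
    convert this using 1
    simp only [Q4]
    linear_combination (-L.derivWeierstrassP β * (L.weierstrassP α - L.weierstrassP β)) * key
  · exact ⟨(hm x u v w).1, (hm x u v w).2.2.1, (hm x u v w).2.1, (hm x u v w).2.2.2⟩
  · have : L.derivWeierstrassP α * L.derivWeierstrassP (α - β) *
      (L.weierstrassP α - L.weierstrassP β) ^ 2 ≠ 0 :=
      mul_ne_zero (mul_ne_zero h₁ h₃) (pow_ne_zero 2 hs)
    convert neg_ne_zero.2 this using 1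
    simp only [Q4]
    linear_combination (L.derivWeierstrassP α * (L.weierstrassP α - L.weierstrassP β)) * key
  · exact ⟨(hm x u v w).1, (hm x u v w).2.2.2, (hm x u v w).2.1, (hm x u v w).2.2.1⟩
  · have : L.derivWeierstrassP α * L.derivWeierstrassP β *
      (L.weierstrassP α - L.weierstrassP β) ^ 2 ≠ 0 :=
      mul_ne_zero (mul_ne_zero h₁ h₂) (pow_ne_zero 2 hs)
    convert neg_ne_zero.2 this using 1
    simp only [Q4]
    ring

lemma eventually_coord_ne {n : ℕ} (i : Fin n) (c : ℂ) : ∀ᶠ v in gen n, v i ≠ c := by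
  have := ((IsPoly.coord i).sub (.const c)).eventually_ne ⟨fun _ => c + 1, by simp⟩
  filter_upwards [this] with v hv using sub_ne_zero.1 hv

lemma eventually_offEdges (L : PeriodPair) (a b c : ℂ) {n : ℕ} (i : Fin n) :
    ∀ᶠ v in gen n, OffEdges L a b c (v i) := by
  have h₁ := Filter.eventually_all.2 fun k => eventually_coord_ne i
    (L.weierstrassP ((![a, b, c, a - b, b - c, a - c] : Fin 6 → ℂ) k))
  have h₂ : ∀ᶠ v in gen n, xdot L (v i) ≠ 0 := by
    refine IsPoly.eventually_ne ((((IsPoly.const 4).mul ((IsPoly.coord i).pow 3)).sub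
      ((IsPoly.const _).mul (.coord i))).sub (.const _)) ?_
    by_contra! h
    have d : ∀ t, xdot L t = 0 := fun t => h fun _ => t
    simp only [xdot] at d
    have : (24 : ℂ) = 0 := by linear_combination d 3 - 3 * d 2 + 3 * d 1 - d 0
    norm_num at this
  filter_upwards [h₁, h₂] with v h h' using ⟨h, h'⟩

lemma isPoly_biq (L : PeriodPair) (a : ℂ) {n : ℕ} {f g : (Fin n → ℂ) → ℂ} (hf : IsPoly f)
    (hg : IsPoly g) : IsPoly fun v => biq L a (f v) (g v) := by
  have c := fun z : ℂ => IsPoly.const (n := n) z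
  have h := ((((hf.sub (c (L.weierstrassP a))).pow 2).mul (hg.pow 2)).add
    ((hg.mul ((c (2 * L.g₃)).add ((hf.add (c (L.weierstrassP a))).mul
      ((c L.g₂).sub ((c (4 * L.weierstrassP a)).mul hf))))).mul (c (1 / 2)))).add
    ((((c (16 * L.g₃)).mul (hf.add (c (L.weierstrassP a)))).add
      ((((c (4 * L.weierstrassP a)).mul hf).add (c L.g₂)).pow 2)).mul (c (1 / 16)))
  convert h using 2
  simp only [biq, eqSq, ep0, ep1]
  ring

lemma eventually_biq_ne (L : PeriodPair) (a : ℂ) {n : ℕ} {i j : Fin n} (hij : i ≠ j) :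
    ∀ᶠ v in gen n, biq L a (v i) (v j) ≠ 0 := by
  refine (isPoly_biq L a (.coord i) (.coord j)).eventually_ne ?_
  by_contra! h
  have d : ∀ t, biq L a (L.weierstrassP a + 1) t = 0 := fun t => by
    simpa [hij.symm] using h fun k => if k = i then L.weierstrassP a + 1 else t
  simp only [biq, eqSq] at d
  have : (2 : ℂ) = 0 := by linear_combination d 2 - 2 * d 1 + d 0
  norm_num at this

/-- The parameters of four directions that are generic with respect to the lattice. -/
structure QuadGeneric (L : PeriodPair) (a : Fin 4 → ℂ) : Prop where
  edge : ∀ i j k, i < j → j < k → EdgeGeneric L (a i) (a j) (a k)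
  deriv : ∀ i, L.derivWeierstrassP (a i) ≠ 0
  deriv_sub : ∀ i j, i < j → L.derivWeierstrassP (a i - a j) ≠ 0
  pair : ∀ i j, i < j → a i ∉ L.lattice ∧ a j ∉ L.lattice ∧ a i - a j ∉ L.lattice ∧
    L.weierstrassP (a i) ≠ L.weierstrassP (a j)

theorem cubeSystem_Q4 {a : Fin 4 → ℂ} (h : QuadGeneric L a) :
    CubeSystem fun _ i j x u v w => Q4 L x u v w (a i) (a j) := by
  refine StarSystem.cubeSystem (T := fun _ i j k x d₁₂ d₁₃ d₂₃ =>
    Q4 L x d₁₃ d₁₂ d₂₃ (a i - a k) (a i - a j) = 0) ⟨?_, ?_, ?_, ?_, ?_, ?_, ?_, ?_⟩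
  · intro _ i j hij
    obtain ⟨h1, h2, h3, h4⟩ := h.pair i j hij
    exact moebius_Q4 h1 h2 h3 h4 (h.deriv i) (h.deriv j) (h.deriv_sub i j hij)
  · exact fun _ i j _ x u v w => Q4_flip₁ ..
  · exact fun _ i j _ x u v w => Q4_flip₂ ..
  · intro _ i j k _ _ x d₁₂ d₁₃ d₂₃ h
    rwa [Q4_flip₂] at h
  · intro _ i j k _ _ x d₁₂ d₁₃ d₂₃ h
    rwa [Q4_flip₁] at h
  · intro _ i j k hij hjk
    filter_upwards [eventually_offEdges L (a i) (a j) (a k) 0,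
      eventually_biq_ne L (a i) (show (0 : Fin 4) ≠ 1 by decide),
      eventually_biq_ne L (a j) (show (0 : Fin 4) ≠ 2 by decide),
      eventually_biq_ne L (a k) (show (0 : Fin 4) ≠ 3 by decide)] with v h0 h1 h2 h3 d₁₂ d₁₃ d₂₃
    exact (star_Q4 (h.edge i j k hij hjk) h0).1 h1 h2 h3
  · intro _ i j k hij hjk
    filter_upwards [eventually_offEdges L (a i) (a j) (a k) 0,
      eventually_biq_ne L (a j) (show (0 : Fin 4) ≠ 1 by decide),
      eventually_biq_ne L (a i - a j) (show (0 : Fin 4) ≠ 2 by decide),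
      eventually_biq_ne L (a j - a k) (show (0 : Fin 4) ≠ 3 by decide)] with v h0 h1 h2 h3 b₁ b₃ d₁₃
    exact (star_Q4 (h.edge i j k hij hjk) h0).2.1 h1 h2 h3
  · intro _ i j k hij hjk
    filter_upwards [eventually_offEdges L (a i) (a j) (a k) 0,
      eventually_biq_ne L (a k) (show (0 : Fin 4) ≠ 1 by decide),
      eventually_biq_ne L (a i - a k) (show (0 : Fin 4) ≠ 2 by decide),
      eventually_biq_ne L (a j - a k) (show (0 : Fin 4) ≠ 3 by decide)] with v h0 h1 h2 h3 b₁ b₂ d₁₂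
    exact (star_Q4 (h.edge i j k hij hjk) h0).2.2 h1 h2 h3

end

/-! ### Elimination for the elliptic pair -/

section

variable {L : PeriodPair} {x Y : ℂ}

lemma leg_sub_leg {k k' m τ₁ τ₂ τ₃ : ℂ} (hk : k * k' = 4 * (τ₁ * τ₂ * τ₃)) (h₁ : τ₁ ≠ 0)
    (h₂ : τ₂ ≠ 0) (h₃ : τ₃ ≠ 0) :
    4 * (τ₁ ^ 2 * τ₃ ^ 2) * (((k ^ 2 / τ₁ ^ 2 + 2 * m * k / τ₁) / 4 + τ₂ + τ₃) -
        ((k ^ 2 / τ₃ ^ 2 + 2 * m * k / τ₃) / 4 + τ₁ + τ₂)) =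
      (τ₃ - τ₁) * (k ^ 2 * ((k' ^ 2 / τ₂ ^ 2 + 2 * m * k' / τ₂) / 4 + τ₃ + τ₁)) := by
  field_simp
  linear_combination (-(τ₃ - τ₁) * (k * k' + 4 * (τ₁ * τ₂ * τ₃) + 2 * m * k * τ₂)) * hk

/-- The first and third legs of the three-leg form, on a chord that also contains the point with
argument `-v`. -/
lemma rotAt_sub_rotAt (hY : Y ^ 2 = xdot L x) {u v : ℂ} (hu : u ∉ L.lattice) (hv : v ∉ L.lattice)
    (huv : u - v ∉ L.lattice) (hne : L.weierstrassP u ≠ L.weierstrassP v)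
    (h₁ : x ≠ L.weierstrassP u) (h₂ : x ≠ L.weierstrassP v) (h₃ : x ≠ L.weierstrassP (u - v)) :
    4 * ((L.weierstrassP u - x) ^ 2 * (L.weierstrassP (u - v) - x) ^ 2) *
        (rotAt L x Y u - rotAt L x (-Y) (u - v)) =
      (L.weierstrassP (u - v) - L.weierstrassP u) *
        ((lineVal L u (-v) x - Y) ^ 2 * (rotAt L x Y v - x)) := by
  have hvu : v - u ∉ L.lattice := fun h => huv (by simpa using neg_mem h)
  obtain ⟨m, hc, hd₁, hd₂, hd₃⟩ := exists_chord hY hu (v := -v) (w := v - u) (by simpa using hv) hvu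
    (by ring) (by simpa using hne)
  have hp : L.weierstrassP (v - u) = L.weierstrassP (u - v) := by
    rw [← neg_sub, L.weierstrassP_neg]
  have hl : L.weierstrassP (-v) = L.weierstrassP v := L.weierstrassP_neg v
  have t₁ := sub_ne_zero.2 h₁.symm
  have t₂ := sub_ne_zero.2 h₂.symm
  have t₃ := sub_ne_zero.2 h₃.symm
  rw [hl, hp] at hc
  rw [hl] at hd₂
  rw [hp] at hd₃
  have r₁ := hc.rotAt_eq (a := u) t₁ (by ring) (by rw [hd₁]; ring)
  have r₂ := hc.neg.rotate.rotAt_eq (a := -v) t₂ (by rw [hl]; ring) (by rw [hd₂]; ring)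
  have r₃ := hc.rotate.rotate.rotAt_eq (a := v - u) t₃ (by rw [hp]; ring) (by rw [hd₃]; ring)
  rw [rotAt_neg'] at r₂
  rw [← neg_sub, rotAt_neg] at r₃
  rw [r₁, r₂, r₃]
  have hprod := hc.prod
  rw [show lineVal L u (-v) x - Y + 2 * Y = lineVal L u (-v) x + Y by ring] at hprod ⊢
  have key := leg_sub_leg (m := m) hprod t₁ t₂ t₃
  linear_combination key

lemma rotAt_sub_self_ne_zero (hY : Y ^ 2 = xdot L x) {a : ℂ} (ha : a ∉ L.lattice)
    (hx : x ≠ L.weierstrassP a) (h : biq L a x x ≠ 0) :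
    rotAt L x Y a - x ≠ 0 ∧ rotAt L x (-Y) a - x ≠ 0 := by
  obtain ⟨h1, h2⟩ := sub_rotAt_ne_zero hY ha hx h
  exact ⟨fun h => h1 (by linear_combination -h), fun h => h2 (by linear_combination -h)⟩

/-- The first factor of `A4`. -/
def A4front (L : PeriodPair) (x α β : ℂ) : ℂ :=
  32 * x ^ 2 * L.g₃ + (4 * x ^ 2 + L.g₂) ^ 2 - 16 * L.weierstrassP (α - β) * xdot L x

/-- Parameters for which the elimination that leads to `A4` does not degenerate. -/
structure ElimGeneric (L : PeriodPair) (p q r : ℂ) : Prop where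
  notMem : p ∉ L.lattice ∧ q ∉ L.lattice ∧ r ∉ L.lattice ∧ p - r ∉ L.lattice ∧ q - r ∉ L.lattice
  left : L.weierstrassP p ≠ L.weierstrassP r ∧ L.weierstrassP (p - r) ≠ L.weierstrassP p
  right : L.weierstrassP q ≠ L.weierstrassP r ∧ L.weierstrassP (q - r) ≠ L.weierstrassP q
  deriv : L.derivWeierstrassP r ≠ 0
  front : L.weierstrassP r ≠ L.weierstrassP (p + q - r)

/-- The resultant of `f = a (o - ρ) - a' (o - ρ')` and `g = b (o - ρ) - b' (o - ρ')` is
`(a b' - a' b) (ρ' - ρ)`; it is proportional to `A` if the ratio of its two terms is. -/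
lemma resultant_threeLeg {Y f₀ f₁ g₀ g₁ A Δ₁ Δ₂ S Φ ρ ρ' W₁ W₁' W₂ W₂' X₁ X₁' X₂ X₂' X₃ X₃' X₄ X₄'
      k₁ k₁' k₂ k₂' : ℂ}
    (F₀ : 4 * Y * f₀ = Δ₂ * (k₁ * (X₁ * (0 - ρ) * X₂) - k₁' * (X₁' * (0 - ρ') * X₂')))
    (F₁ : 4 * Y * f₁ = Δ₂ * (k₁ * (X₁ * (1 - ρ) * X₂) - k₁' * (X₁' * (1 - ρ') * X₂')))
    (G₀ : 4 * Y * g₀ = Δ₁ * (k₂ * (X₃ * (0 - ρ) * X₄) - k₂' * (X₃' * (0 - ρ') * X₄')))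
    (G₁ : 4 * Y * g₁ = Δ₁ * (k₂ * (X₃ * (1 - ρ) * X₄) - k₂' * (X₃' * (1 - ρ') * X₄')))
    (core : A * Y = 1024 * S * (W₁ * W₂' * (X₁ * X₂ * X₃' * X₄') -
      W₁' * W₂ * (X₁' * X₂' * X₃ * X₄)))
    (ratio : k₁ * k₂' * (W₁' * W₂) = k₁' * k₂ * (W₁ * W₂')) :
    Y * (Δ₂ * Δ₁ * (k₁ * k₂') * (ρ' - ρ) * (Φ * A)) =
      Y * (((f₁ - f₀) * g₀ - (g₁ - g₀) * f₀) * (16 * Y * Φ * (1024 * S * (W₁ * W₂')))) := by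
  have res : 16 * Y ^ 2 * ((f₁ - f₀) * g₀ - (g₁ - g₀) * f₀) = Δ₂ * Δ₁ * ((ρ' - ρ) *
      (k₁ * k₂' * (X₁ * X₂ * (X₃' * X₄')) - k₁' * k₂ * (X₁' * X₂' * (X₃ * X₄)))) := by
    calc _ = (4 * Y * f₁ - 4 * Y * f₀) * (4 * Y * g₀) -
          (4 * Y * g₁ - 4 * Y * g₀) * (4 * Y * f₀) := by
          ring
      _ = _ := by
        rw [F₀, F₁, G₀, G₁]
        ring
  linear_combination (Δ₂ * Δ₁ * (k₁ * k₂') * (ρ' - ρ) * Φ) * core -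
    (Φ * (1024 * S * (W₁ * W₂'))) * res -
    (Δ₂ * Δ₁ * (ρ' - ρ) * Φ * (1024 * S * (X₁' * X₂' * X₃ * X₄))) * ratio

/-- The ratio of the two terms of the resultant equals the one of the two terms of `A4`. -/
lemma ratio_of_legs {C₁ C₂ Δ₁ Δ₂ W₁ W₁' W₂ W₂' k₁ k₁' k₂ k₂' ρ ρ' : ℂ}
    (e₁ : C₁ * W₁ = Δ₁ * (k₂' * ρ')) (e₁' : C₁ * W₁' = Δ₁ * (k₂ * ρ))
    (e₂ : C₂ * W₂ = Δ₂ * (k₁' * ρ')) (e₂' : C₂ * W₂' = Δ₂ * (k₁ * ρ))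
    (h₁ : C₁ ≠ 0) (h₂ : C₂ ≠ 0) (h : ρ' ≠ 0) (h' : ρ ≠ 0) :
    k₁ * k₂' * (W₁' * W₂) = k₁' * k₂ * (W₁ * W₂') := by
  refine mul_left_cancel₀ (mul_ne_zero (mul_ne_zero h₁ h₂) (mul_ne_zero h h')) ?_
  calc _ = k₁ * k₂' * (ρ' * ρ) * ((C₁ * W₁') * (C₂ * W₂)) := by ring
    _ = k₁' * k₂ * (ρ' * ρ) * ((C₁ * W₁) * (C₂ * W₂')) := by
      rw [e₁, e₂, e₁', e₂']
      ring
    _ = _ := by ring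

lemma eqSq_ne_zero {a : ℂ} (h : x ≠ L.weierstrassP a) : eqSq L x a ≠ 0 :=
  pow_ne_zero 2 (sub_ne_zero.2 h)

lemma isElimination_A4 {p q r : ℂ} (h : ElimGeneric L p q r) (hx : xdot L x ≠ 0)
    (h₁ : x ≠ L.weierstrassP p) (h₂ : x ≠ L.weierstrassP q) (h₃ : x ≠ L.weierstrassP (p - r))
    (h₄ : x ≠ L.weierstrassP (q - r)) (h₅ : x ≠ L.weierstrassP r) (h₆ : biq L r x x ≠ 0)
    (h₇ : A4front L x p q ≠ 0) :
    IsElimination (fun x x₁ x₂ x₃ x₄ => A4 L x x₁ x₂ x₃ x₄ p q r)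
      (fun x x₁ o x₂ => Q4 L x x₁ o x₂ q r) (fun x x₃ o x₄ => Q4 L x x₃ o x₄ p r) x := by
  obtain ⟨Y, hY⟩ := IsAlgClosed.exists_pow_nat_eq (xdot L x) two_pos
  have hY0 : Y ≠ 0 := by
    rintro rfl
    exact hx (by simpa using hY.symm)
  have hY' : (-Y) ^ 2 = xdot L x := by rw [neg_sq, hY]
  obtain ⟨hp, hq, hr, hpr, hqr⟩ := h.notMem
  obtain ⟨n₁, n₁'⟩ := rotAt_sub_self_ne_zero hY hr h₅ h₆
  have hneg : ∀ {z : ℂ}, z ∉ L.lattice → -z ∉ L.lattice := fun hz h => hz (by simpa using neg_mem h)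
  have hl : ∀ {u : ℂ}, u ∉ L.lattice → u - r ∉ L.lattice →
      L.weierstrassP u ≠ L.weierstrassP r → x ≠ L.weierstrassP u →
      x ≠ L.weierstrassP (u - r) → lineVal L u (-r) x + Y ≠ 0 ∧ lineVal L u (-r) x - Y ≠ 0 := by
    intro u hu huv h1 h2 h4
    refine lineVal_ne hY hu (hneg hr) (w := -(u - r)) (hneg huv) (by ring) ?_ h2 ?_ ?_ <;>
      rwa [L.weierstrassP_neg]
  have lp := hl hp hpr h.left.1 h₁ h₃
  have lq := hl hq hqr h.right.1 h₂ h₄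
  have core := fun xa xb xc xd => A4core_eq hY (leg_rot hY hp h₁) (leg_rot hY hq h₂)
    (leg_rot hY hpr h₃) (leg_rot hY hqr h₄) xa xb xc xd
  simp only [← rotAt.eq_1] at core
  have e₁ := rotAt_sub_rotAt hY hp hr hpr h.left.1 h₁ h₅ h₃
  have e₁' := rotAt_sub_rotAt hY' hp hr hpr h.left.1 h₁ h₅ h₃
  have e₂ := rotAt_sub_rotAt hY hq hr hqr h.right.1 h₂ h₅ h₄
  have e₂' := rotAt_sub_rotAt hY' hq hr hqr h.right.1 h₂ h₅ h₄
  rw [neg_neg, sub_neg_eq_add] at e₁' e₂'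
  have c₁ : (4 : ℂ) * ((L.weierstrassP p - x) ^ 2 * (L.weierstrassP (p - r) - x) ^ 2) ≠ 0 :=
    mul_ne_zero (by norm_num) (mul_ne_zero (pow_ne_zero 2 (sub_ne_zero.2 h₁.symm))
      (pow_ne_zero 2 (sub_ne_zero.2 h₃.symm)))
  have c₂ : (4 : ℂ) * ((L.weierstrassP q - x) ^ 2 * (L.weierstrassP (q - r) - x) ^ 2) ≠ 0 :=
    mul_ne_zero (by norm_num) (mul_ne_zero (pow_ne_zero 2 (sub_ne_zero.2 h₂.symm))
      (pow_ne_zero 2 (sub_ne_zero.2 h₄.symm)))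
  have w₁ : rotAt L x Y p - rotAt L x (-Y) (p - r) ≠ 0 := by
    refine right_ne_zero_of_mul (a := 4 * ((L.weierstrassP p - x) ^ 2 *
      (L.weierstrassP (p - r) - x) ^ 2)) ?_
    rw [e₁]
    exact mul_ne_zero (sub_ne_zero.2 h.left.2) (mul_ne_zero (pow_ne_zero 2 lp.2) n₁)
  have w₂ : rotAt L x (-Y) q - rotAt L x Y (q - r) ≠ 0 := by
    refine right_ne_zero_of_mul (a := 4 * ((L.weierstrassP q - x) ^ 2 *
      (L.weierstrassP (q - r) - x) ^ 2)) ?_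
    rw [e₂']
    exact mul_ne_zero (sub_ne_zero.2 h.right.2) (mul_ne_zero (pow_ne_zero 2 lq.1) n₁')
  have hρ : rotAt L x Y r - rotAt L x (-Y) r ≠ 0 := by
    have := (leg_rot hY hr h₅).deriv
    intro h0
    rw [rotAt, rotAt] at h0
    rw [h0, mul_zero, neg_zero] at this
    exact mul_ne_zero h.deriv hY0 this
  have ratio := ratio_of_legs e₁ e₁' e₂ e₂' c₁ c₂ n₁ n₁'
  have tf := fun xb xc xd => Q4_threeLeg hY hq hr hqr h.right.1 h₂ h₅ h₄ xb xc xd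
  have tg := fun xb xc xd => Q4_threeLeg hY hp hr hpr h.left.1 h₁ h₅ h₃ xb xc xd
  have s₁ : r - q = -(q - r) := by ring
  have s₂ : r - p = -(p - r) := by ring
  simp only [s₁, rotAt_neg, neg_neg] at tf
  simp only [s₂, rotAt_neg, neg_neg] at tg
  have hsc : Leg.scale L x p q (p - r) (q - r) ≠ 0 := mul_ne_zero (mul_ne_zero (mul_ne_zero
    (eqSq_ne_zero h₁) (eqSq_ne_zero h₂)) (eqSq_ne_zero h₃)) (eqSq_ne_zero h₄)
  have hΔ₁ := sub_ne_zero.2 h.left.1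
  have hΔ₂ := sub_ne_zero.2 h.right.1
  have hfr := mul_ne_zero h₇ (sub_ne_zero.2 h.front)
  have hA := fun xa xb xc xd => A4_eq L x xa xb xc xd p q r
  rw [← A4front.eq_1] at hA
  generalize A4front L x p q * (L.weierstrassP r - L.weierstrassP (p + q - r)) = Φ at *
  generalize Leg.scale L x p q (p - r) (q - r) = S at *
  generalize L.weierstrassP q - L.weierstrassP r = Δ₂ at *
  generalize L.weierstrassP p - L.weierstrassP r = Δ₁ at *
  have hD : 16 * Y * Φ * (1024 * S * ((rotAt L x Y p - rotAt L x (-Y) (p - r)) *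
      (rotAt L x (-Y) q - rotAt L x Y (q - r)))) ≠ 0 :=
    mul_ne_zero (mul_ne_zero (mul_ne_zero (by norm_num) hY0) hfr)
      (mul_ne_zero (mul_ne_zero (by norm_num) hsc) (mul_ne_zero w₁ w₂))
  refine IsElimination.of_resultant (multiAffine_Q4 L q r) (multiAffine_Q4 L p r)
    (κ := Δ₂ * Δ₁ * ((lineVal L q (-r) x + Y) ^ 2 * (lineVal L p (-r) x - Y) ^ 2) *
      (rotAt L x Y r - rotAt L x (-Y) r) / _)
    (div_ne_zero (mul_ne_zero (mul_ne_zero (mul_ne_zero hΔ₂ hΔ₁)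
      (mul_ne_zero (pow_ne_zero 2 lq.1) (pow_ne_zero 2 lp.2))) hρ) hD) fun x₁ x₂ x₃ x₄ => ?_
  rw [div_mul_eq_mul_div, div_eq_iff hD, hA]
  refine mul_left_cancel₀ hY0 ?_
  exact resultant_threeLeg (tf x₁ 0 x₂) (tf x₁ 1 x₂) (tg x₃ 0 x₄) (tg x₃ 1 x₄) (core x₁ x₂ x₃ x₄)
    ratio

end

/-! ### Thin sets of parameters -/

lemma IsThin.union {E F : Set (Fin 4 → ℂ)} (hE : IsThin E) (hF : IsThin F) : IsThin (E ∪ F) := by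
  intro a
  obtain ⟨f, hf, hf0, hfE⟩ := hE a
  obtain ⟨g, hg, hg0, hgF⟩ := hF a
  refine ⟨fun q => f q * g q, hf.mul hg, fun h => ?_, ?_⟩
  · -- the ring of germs of analytic functions is an integral domain
    obtain ⟨s, hs, hsa⟩ := hf.exists_ball_analyticOnNhd
    obtain ⟨t, ht, hta⟩ := hg.exists_ball_analyticOnNhd
    obtain ⟨r, hr, hball⟩ := Metric.eventually_nhds_iff_ball.1 h
    obtain ⟨δ, hδ, h1, h2, h3⟩ : ∃ δ > 0, δ ≤ s ∧ δ ≤ t ∧ δ ≤ r :=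
      ⟨min s (min t r), by positivity, min_le_left .., (min_le_right ..).trans (min_le_left ..),
        (min_le_right ..).trans (min_le_right ..)⟩
    by_cases hf1 : ∃ p ∈ Metric.ball a δ, f p ≠ 0
    · obtain ⟨p, hp, hfp⟩ := hf1
      have hg1 : g =ᶠ[𝓝 p] 0 := by
        filter_upwards [(hsa p (Metric.ball_subset_ball h1 hp)).continuousAt.eventually_ne hfp,
          Metric.isOpen_ball.mem_nhds hp] with z hz hz'
        exact (mul_eq_zero.1 (hball z (Metric.ball_subset_ball h3 hz'))).resolve_left hz
      have := (hta.mono (Metric.ball_subset_ball h2)).eqOn_zero_of_preconnected_of_eventuallyEq_zero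
        (convex_ball a δ).isPreconnected hp hg1
      exact hg0 (eventually_of_mem (Metric.ball_mem_nhds a hδ) this)
    · push Not at hf1
      exact hf0 (eventually_of_mem (Metric.ball_mem_nhds a hδ) hf1)
  · filter_upwards [hfE, hgF] with q h1 h2 hq
    rcases hq with hq | hq
    · rw [h1 hq, zero_mul]
    · rw [h2 hq, mul_zero]

lemma IsThin.mono {E F : Set (Fin 4 → ℂ)} (hE : IsThin E) (h : F ⊆ E) : IsThin F := by
  intro a
  obtain ⟨f, hf, hf0, hfE⟩ := hE a
  exact ⟨f, hf, hf0, hfE.mono fun q hq hF => hq (h hF)⟩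

lemma isThin_empty : IsThin ∅ := fun a =>
  ⟨fun _ => 1, analyticAt_const, fun h => by simpa using h.self_of_nhds, by simp⟩

lemma isThin_iUnion {ι : Type*} [Finite ι] {E : ι → Set (Fin 4 → ℂ)} (h : ∀ i, IsThin (E i)) :
    IsThin (⋃ i, E i) := by
  have key : ∀ s : Finset ι, IsThin (⋃ i ∈ s, E i) := by
    classical
    intro s
    induction s using Finset.induction_on with
    | empty => simpa using isThin_empty
    | insert i s _ ih =>
      rw [Finset.set_biUnion_insert]
      exact (h i).union ih
  have := Fintype.ofFinite ι
  exact (key Finset.univ).mono (by simp)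

/-- A function that does not vanish along a line does not vanish identically. -/
lemma not_eventually_of_line {f : (Fin 4 → ℂ) → ℂ} {a v : Fin 4 → ℂ}
    (h : ¬ ∀ᶠ t : ℂ in 𝓝 0, f (a + t • v) = 0) : ¬ ∀ᶠ q in 𝓝 a, f q = 0 := by
  intro h'
  refine h ?_
  have : Tendsto (fun t : ℂ => a + t • v) (𝓝 0) (𝓝 a) := by
    have : Continuous fun t : ℂ => a + t • v := by fun_prop
    simpa using this.tendsto 0
  exact this.eventually h'

section

variable {L : PeriodPair}

lemma exists_regular_weierstrassP {l : ℂ} (hl : l ∈ L.lattice) :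
    ∃ g : ℂ → ℂ, AnalyticAt ℂ g l ∧ g l = 1 ∧
      ∀ z, z ≠ l → (z - l) ^ 2 * L.weierstrassP z = g z := by
  have := L.analyticAt_weierstrassPExcept l
  refine ⟨fun z => (z - l) ^ 2 * (L.weierstrassPExcept l z - 1 / l ^ 2) + 1, by fun_prop, by simp,
    fun z hz => ?_⟩
  have hz' := sub_ne_zero.2 hz
  rw [← L.weierstrassPExcept_add ⟨l, hl⟩]
  simp only
  generalize (1 / l ^ 2 : ℂ) = c
  field_simp
  ring

lemma exists_regular_derivWeierstrassP {l : ℂ} (hl : l ∈ L.lattice) :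
    ∃ g : ℂ → ℂ, AnalyticAt ℂ g l ∧ g l ≠ 0 ∧
      ∀ z, z ≠ l → (z - l) ^ 3 * L.derivWeierstrassP z = g z := by
  have := L.analyticAt_derivWeierstrassPExcept l
  refine ⟨fun z => (z - l) ^ 3 * L.derivWeierstrassPExcept l z - 2, by fun_prop, by simp,
    fun z hz => ?_⟩
  have hz' := sub_ne_zero.2 hz
  rw [← L.derivWeierstrassPExcept_sub ⟨l, hl⟩]
  field_simp

lemma isThin_lattice (L : PeriodPair) {l : (Fin 4 → ℂ) →L[ℂ] ℂ} {v : Fin 4 → ℂ} (hv : l v ≠ 0) :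
    IsThin {q | l q ∈ L.lattice ∨ L.derivWeierstrassP (l q) = 0} := by
  intro a
  have hl : ∀ q, AnalyticAt ℂ l q := fun q => l.analyticAt q
  have hc : Tendsto l (𝓝 a) (𝓝 (l a)) := l.continuous.tendsto a
  have hline : ∀ t : ℂ, l (a + t • v) = l a + t * l v := fun t => by simp
  by_cases h : l a ∈ L.lattice
  · obtain ⟨g, hg, hg0, hgz⟩ := exists_regular_derivWeierstrassP h
    refine ⟨fun q => (l q - l a) * g (l q), ((hl a).sub analyticAt_const).mul
      (hg.comp (hl a)), not_eventually_of_line (v := v) fun h' => ?_, ?_⟩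
    · have hd : Tendsto (fun t : ℂ => l (a + t • v)) (𝓝 0) (𝓝 (l a)) := by
        have : Continuous fun t : ℂ => l (a + t • v) := by fun_prop
        simpa using this.tendsto 0
      have h2 := hd.eventually (hg.continuousAt.eventually_ne hg0)
      obtain ⟨t, ⟨h3, h4⟩, h5⟩ := (((h'.and h2).filter_mono nhdsWithin_le_nhds).and
        (self_mem_nhdsWithin (a := (0 : ℂ)) (s := {0}ᶜ))).exists
      rcases mul_eq_zero.1 h3 with h6 | h6
      · rw [hline, add_sub_cancel_left] at h6
        exact mul_ne_zero h5 hv h6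
      · exact h4 h6
    · filter_upwards [hc.eventually (L.compl_lattice_sdiff_singleton_mem_nhds (l a))] with q h1 h2
      by_cases h3 : l q = l a
      · rw [h3, sub_self, zero_mul]
      · rcases h2 with h2 | h2
        · exact absurd ⟨h2, h3⟩ h1
        · rw [← hgz _ h3, h2, mul_zero, mul_zero]
  · refine ⟨fun q => L.derivWeierstrassP (l q), (L.analyticOnNhd_derivWeierstrassP _ h).comp (hl a),
      not_eventually_of_line (v := v) fun h' => ?_, ?_⟩
    · refine not_eventually_derivWeierstrassP_eq_zero h ?_
      have : Tendsto (fun z : ℂ => (z - l a) / l v) (𝓝 (l a)) (𝓝 0) := by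
        have : Continuous fun z : ℂ => (z - l a) / l v := by fun_prop
        simpa using this.tendsto (l a)
      filter_upwards [this.eventually h'] with z hz
      rwa [hline, div_mul_cancel₀ _ hv, add_sub_cancel] at hz
    · filter_upwards [hc.eventually ((isOpen_compl_lattice L).mem_nhds h)] with q h1 h2
      exact h2.resolve_left h1

lemma isThin_weierstrassP_eq (L : PeriodPair) {l m : (Fin 4 → ℂ) →L[ℂ] ℂ} {v : Fin 4 → ℂ}
    (hv : l v ≠ 0) (hm : m v = 0) :
    IsThin {q | l q ∉ L.lattice ∧ m q ∉ L.lattice ∧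
      L.weierstrassP (l q) = L.weierstrassP (m q)} := by
  intro a
  have hl : ∀ q, AnalyticAt ℂ l q := fun q => l.analyticAt q
  have hm' : ∀ q, AnalyticAt ℂ m q := fun q => m.analyticAt q
  have hc : Tendsto l (𝓝 a) (𝓝 (l a)) := l.continuous.tendsto a
  have hline : ∀ t : ℂ, l (a + t • v) = l a + t * l v := fun t => by simp
  have hline' : ∀ t : ℂ, m (a + t • v) = m a := fun t => by simp [hm]
  have hne : ∀ {c : ℂ}, c ∈ L.lattice → ∀ {z}, z ∉ L.lattice → z ≠ c := by
    rintro c hc z hz rfl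
    exact hz hc
  by_cases h : l a ∈ L.lattice <;> by_cases h' : m a ∈ L.lattice
  · obtain ⟨g, hg, hg1, hgz⟩ := exists_regular_weierstrassP h
    obtain ⟨k, hk, hk1, hkz⟩ := exists_regular_weierstrassP h'
    refine ⟨fun q => (m q - m a) ^ 2 * g (l q) - (l q - l a) ^ 2 * k (m q),
      ((((hm' a).sub analyticAt_const).pow 2).mul (hg.comp (hl a))).sub
        ((((hl a).sub analyticAt_const).pow 2).mul (hk.comp (hm' a))),
      not_eventually_of_line (v := v) fun h0 => ?_, .of_forall ?_⟩
    · obtain ⟨t, h3, h5⟩ := ((h0.filter_mono nhdsWithin_le_nhds).and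
        (self_mem_nhdsWithin (a := (0 : ℂ)) (s := {0}ᶜ))).exists
      rw [hline, hline', hk1] at h3
      have : (t * l v) ^ 2 = 0 := by linear_combination -h3
      exact pow_ne_zero 2 (mul_ne_zero h5 hv) this
    · rintro q ⟨h1, h2, h3⟩
      beta_reduce
      rw [← hgz _ (hne h h1), ← hkz _ (hne h' h2), h3]
      ring
  · obtain ⟨g, hg, hg1, hgz⟩ := exists_regular_weierstrassP h
    refine ⟨fun q => g (l q) - (l q - l a) ^ 2 * L.weierstrassP (m q), (hg.comp (hl a)).sub
      ((((hl a).sub analyticAt_const).pow 2).mul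
        ((L.analyticOnNhd_weierstrassP _ h').comp (hm' a))),
      fun h0 => ?_, .of_forall ?_⟩
    · have := h0.self_of_nhds
      simp [hg1] at this
    · rintro q ⟨h1, h2, h3⟩
      beta_reduce
      rw [← hgz _ (hne h h1), h3]
      ring
  · obtain ⟨k, hk, hk1, hkz⟩ := exists_regular_weierstrassP h'
    refine ⟨fun q => k (m q) - (m q - m a) ^ 2 * L.weierstrassP (l q), (hk.comp (hm' a)).sub
      ((((hm' a).sub analyticAt_const).pow 2).mul ((L.analyticOnNhd_weierstrassP _ h).comp (hl a))),
      fun h0 => ?_, .of_forall ?_⟩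
    · have := h0.self_of_nhds
      simp [hk1] at this
    · rintro q ⟨h1, h2, h3⟩
      beta_reduce
      rw [← hkz _ (hne h' h2), h3]
      ring
  · refine ⟨fun q => L.weierstrassP (l q) - L.weierstrassP (m q),
      ((L.analyticOnNhd_weierstrassP _ h).comp (hl a)).sub
        ((L.analyticOnNhd_weierstrassP _ h').comp (hm' a)),
      not_eventually_of_line (v := v) fun h0 => ?_, .of_forall fun q hq => sub_eq_zero.2 hq.2.2⟩
    refine not_eventually_weierstrassP_eq h (L.weierstrassP (m a)) ?_
    have : Tendsto (fun z : ℂ => (z - l a) / l v) (𝓝 (l a)) (𝓝 0) := by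
      have : Continuous fun z : ℂ => (z - l a) / l v := by fun_prop
      simpa using this.tendsto (l a)
    filter_upwards [this.eventually h0] with z hz
    rw [hline, hline', div_mul_cancel₀ _ hv, add_sub_cancel] at hz
    exact sub_eq_zero.1 hz

end

/-! ### Consistency of the elliptic pair -/

section

variable {L : PeriodPair}

lemma eventually_isElimination_A4 {p q r : ℂ} (h : ElimGeneric L p q r) :
    ∀ᶠ v : Fin 1 → ℂ in gen 1, IsElimination (fun x x₁ x₂ x₃ x₄ => A4 L x x₁ x₂ x₃ x₄ p q r)
      (fun x x₁ o x₂ => Q4 L x x₁ o x₂ q r) (fun x x₃ o x₄ => Q4 L x x₃ o x₄ p r) (v 0) := by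
  have h₆ : ∀ᶠ v : Fin 1 → ℂ in gen 1, biq L r (v 0) (v 0) ≠ 0 := by
    refine (isPoly_biq L r (.coord 0) (.coord 0)).eventually_ne ?_
    by_contra! h
    have d : ∀ t, biq L r t t = 0 := fun t => h fun _ => t
    simp only [biq, eqSq, ep0, ep1] at d
    have : (24 : ℂ) = 0 := by linear_combination d 4 - 4 * d 3 + 6 * d 2 - 4 * d 1 + d 0
    norm_num at this
  have h₇ : ∀ᶠ v : Fin 1 → ℂ in gen 1, A4front L (v 0) p q ≠ 0 := by
    have c := fun z : ℂ => IsPoly.const (n := 1) z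
    have X := IsPoly.coord (0 : Fin 1)
    refine IsPoly.eventually_ne (((((c 32).mul (X.pow 2)).mul (c L.g₃)).add
      ((((c 4).mul (X.pow 2)).add (c L.g₂)).pow 2)).sub
      (((c 16).mul (c (L.weierstrassP (p - q)))).mul
        ((((c 4).mul (X.pow 3)).sub ((c L.g₂).mul X)).sub (c L.g₃)))) ?_
    by_contra! h
    have d : ∀ t, A4front L t p q = 0 := fun t => h fun _ => t
    simp only [A4front, xdot] at d
    have : (384 : ℂ) = 0 := by linear_combination d 4 - 4 * d 3 + 6 * d 2 - 4 * d 1 + d 0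
    norm_num at this
  filter_upwards [h₆, h₇, eventually_offEdges L p q r 0, eventually_coord_ne 0 _,
    eventually_coord_ne 0 _, eventually_coord_ne 0 _, eventually_coord_ne 0 _,
    eventually_coord_ne 0 _] with v h₆ h₇ hx h₁ h₂ h₃ h₄ h₅
  exact isElimination_A4 h hx.xdot_ne h₁ h₂ h₃ h₄ h₅ h₆ h₇

/-- The vector with entries `1` on `s` and `-1` on `t`. -/
def signVec (s t : List (Fin 4)) (i : Fin 4) : SignType :=
  if i ∈ s then 1 else if i ∈ t then -1 else 0

/-- The linear combination of the parameters `α, β, ρ, γ` with the coefficients `c`. -/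
def signForm (c : Fin 4 → SignType) : (Fin 4 → ℂ) →L[ℂ] ℂ :=
  ∑ i, ((c i : ℤ) : ℂ) • ContinuousLinearMap.proj (![0, 1, 3, 2] i)

lemma signForm_apply (c : Fin 4 → SignType) (q : Fin 4 → ℂ) : signForm c q =
    ∑ i, ((c i : ℤ) : ℂ) * dirParam (q 0) (q 1) (q 2) (q 3) i := by
  simp [signForm, Fin.sum_univ_four]

/-- Two vectors with entries `0, 1, -1` are linearly independent. -/
abbrev SignIndep (c d : Fin 4 → SignType) : Prop :=
  ∃ i j, (c i : ℤ) * d j ≠ c j * d i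

/-- The parameters that are excluded for a lattice. -/
def ellipticBad (L : PeriodPair) : Set (Fin 4 → ℂ) :=
  (⋃ c : {c : Fin 4 → SignType // c ≠ 0},
    {q | signForm c q ∈ L.lattice ∨ L.derivWeierstrassP (signForm c q) = 0}) ∪
  ⋃ c : {c : (Fin 4 → SignType) × (Fin 4 → SignType) // SignIndep c.1 c.2},
    {q | signForm c.1.1 q ∉ L.lattice ∧ signForm c.1.2 q ∉ L.lattice ∧
      L.weierstrassP (signForm c.1.1 q) = L.weierstrassP (signForm c.1.2 q)}

lemma signForm_single (c : Fin 4 → SignType) (i : Fin 4) (z : ℂ) :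
    signForm c (Pi.single (![0, 1, 3, 2] i) z) = (c i : ℤ) * z := by
  fin_cases i <;> simp [signForm, Fin.sum_univ_four]

lemma isThin_ellipticBad (L : PeriodPair) : IsThin (ellipticBad L) := by
  refine (isThin_iUnion ?_).union (isThin_iUnion ?_)
  · rintro ⟨c, hc⟩
    obtain ⟨i, hi⟩ := Function.ne_iff.1 hc
    refine isThin_lattice L (v := Pi.single (![0, 1, 3, 2] i) 1) ?_
    rw [signForm_single, mul_one, Int.cast_ne_zero]
    have h0 : ∀ s : SignType, (s : ℤ) = 0 → s = 0 := by decide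
    exact fun h => hi (h0 _ h)
  · rintro ⟨⟨c, d⟩, i, j, h⟩
    refine isThin_weierstrassP_eq L (v := Pi.single (![0, 1, 3, 2] i) ((d j : ℤ) : ℂ) -
      Pi.single (![0, 1, 3, 2] j) ((d i : ℤ) : ℂ)) ?_ ?_
    · rw [map_sub, signForm_single, signForm_single, sub_ne_zero]
      exact_mod_cast h
    · rw [map_sub, signForm_single, signForm_single]
      ring

lemma ne_zero_of_signIndep {c d : Fin 4 → SignType} (h : SignIndep c d) : c ≠ 0 ∧ d ≠ 0 := by
  obtain ⟨i, j, h⟩ := h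
  constructor <;> rintro rfl <;> simp at h

section

variable {q : Fin 4 → ℂ}

lemma signForm_of_notMem (hq : q ∉ ellipticBad L) {c : Fin 4 → SignType} (hc : c ≠ 0) :
    signForm c q ∉ L.lattice ∧ L.derivWeierstrassP (signForm c q) ≠ 0 := by
  simp only [ellipticBad, Set.mem_union, Set.mem_iUnion, Set.mem_ofPred_eq, not_or,
    not_exists] at hq
  exact hq.1 ⟨c, hc⟩

lemma weierstrassP_signForm_ne (hq : q ∉ ellipticBad L) {c d : Fin 4 → SignType}
    (h : SignIndep c d) : L.weierstrassP (signForm c q) ≠ L.weierstrassP (signForm d q) := by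
  obtain ⟨hc, hd⟩ := ne_zero_of_signIndep h
  have h1 := (signForm_of_notMem hq hc).1
  have h2 := (signForm_of_notMem hq hd).1
  simp only [ellipticBad, Set.mem_union, Set.mem_iUnion, Set.mem_ofPred_eq, not_or,
    not_exists] at hq
  exact fun h3 => hq.2 ⟨(c, d), h⟩ ⟨h1, h2, h3⟩

variable (q) in
lemma signForm_vec₁ (i : Fin 4) :
    signForm (signVec [i] []) q = dirParam (q 0) (q 1) (q 2) (q 3) i := by
  fin_cases i <;> simp [signForm_apply, Fin.sum_univ_four, signVec]

variable (q) in
lemma signForm_vec₂ {i j : Fin 4} (hij : i ≠ j) : signForm (signVec [i] [j]) q =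
    dirParam (q 0) (q 1) (q 2) (q 3) i - dirParam (q 0) (q 1) (q 2) (q 3) j := by
  rw [signForm_apply]
  generalize dirParam (q 0) (q 1) (q 2) (q 3) = a
  revert hij
  fin_cases i <;> fin_cases j <;> simp [Fin.sum_univ_four, signVec] <;> ring

variable (q) in
lemma signForm_vec₃ {i j k : Fin 4} (hij : i ≠ j) (hik : i ≠ k) (hjk : j ≠ k) :
    signForm (signVec [i, j] [k]) q = dirParam (q 0) (q 1) (q 2) (q 3) i +
      dirParam (q 0) (q 1) (q 2) (q 3) j - dirParam (q 0) (q 1) (q 2) (q 3) k := by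
  rw [signForm_apply]
  generalize dirParam (q 0) (q 1) (q 2) (q 3) = a
  revert hij hik hjk
  fin_cases i <;> fin_cases j <;> fin_cases k <;> simp [Fin.sum_univ_four, signVec] <;> ring

/-- The linear forms of the six edges of a tetrahedron. -/
def edgeVec (i j k : Fin 4) : Fin 6 → Fin 4 → SignType :=
  ![signVec [i] [], signVec [j] [], signVec [k] [], signVec [i] [j], signVec [j] [k],
    signVec [i] [k]]

lemma edgeGeneric_of_notMem (hq : q ∉ ellipticBad L) {i j k : Fin 4} (hij : i < j) (hjk : j < k) :
    EdgeGeneric L (dirParam (q 0) (q 1) (q 2) (q 3) i) (dirParam (q 0) (q 1) (q 2) (q 3) j)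
      (dirParam (q 0) (q 1) (q 2) (q 3) k) := by
  have key : ∀ m, ![dirParam (q 0) (q 1) (q 2) (q 3) i, dirParam (q 0) (q 1) (q 2) (q 3) j,
      dirParam (q 0) (q 1) (q 2) (q 3) k,
      dirParam (q 0) (q 1) (q 2) (q 3) i - dirParam (q 0) (q 1) (q 2) (q 3) j,
      dirParam (q 0) (q 1) (q 2) (q 3) j - dirParam (q 0) (q 1) (q 2) (q 3) k,
      dirParam (q 0) (q 1) (q 2) (q 3) i - dirParam (q 0) (q 1) (q 2) (q 3) k] m =
      signForm (edgeVec i j k m) q := by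
    intro m
    fin_cases m
    · exact (signForm_vec₁ q i).symm
    · exact (signForm_vec₁ q j).symm
    · exact (signForm_vec₁ q k).symm
    · exact (signForm_vec₂ q hij.ne).symm
    · exact (signForm_vec₂ q hjk.ne).symm
    · exact (signForm_vec₂ q (hij.trans hjk).ne).symm
  have indep : ∀ i j k : Fin 4, i < j → j < k → ∀ m n : Fin 6, m ≠ n →
      SignIndep (edgeVec i j k m) (edgeVec i j k n) := by
    decide +kernel
  refine ⟨fun m => ?_, fun m n h => ?_⟩
  · rw [key]
    obtain ⟨n, hn⟩ : ∃ n, m ≠ n := ⟨m + 1, by simp⟩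
    exact (signForm_of_notMem hq (ne_zero_of_signIndep (indep i j k hij hjk m n hn)).1).1
  · simp only [key] at h
    by_contra hmn
    exact weierstrassP_signForm_ne hq (indep i j k hij hjk m n hmn) h

lemma quadGeneric_of_notMem (hq : q ∉ ellipticBad L) :
    QuadGeneric L (dirParam (q 0) (q 1) (q 2) (q 3)) := by
  have d₁ : ∀ i, signVec [i] [] ≠ 0 := by decide
  have d₂ : ∀ i j, i < j → signVec [i] [j] ≠ 0 := by decide
  have d₃ : ∀ i j, i < j → SignIndep (signVec [i] []) (signVec [j] []) := by decide
  refine ⟨fun i j k => edgeGeneric_of_notMem hq, fun i => ?_, fun i j hij => ?_, fun i j hij =>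
    ⟨?_, ?_, ?_, ?_⟩⟩
  · rw [← signForm_vec₁]
    exact (signForm_of_notMem hq (d₁ i)).2
  · rw [← signForm_vec₂ q hij.ne]
    exact (signForm_of_notMem hq (d₂ i j hij)).2
  · rw [← signForm_vec₁]
    exact (signForm_of_notMem hq (d₁ i)).1
  · rw [← signForm_vec₁]
    exact (signForm_of_notMem hq (d₁ j)).1
  · rw [← signForm_vec₂ q hij.ne]
    exact (signForm_of_notMem hq (d₂ i j hij)).1
  · rw [← signForm_vec₁, ← signForm_vec₁]
    exact weierstrassP_signForm_ne hq (d₃ i j hij)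

lemma elimGeneric_of_notMem (hq : q ∉ ellipticBad L) {i j k : Fin 4} (hij : i ≠ j) (hik : i ≠ k)
    (hjk : j ≠ k) : ElimGeneric L (dirParam (q 0) (q 1) (q 2) (q 3) i)
      (dirParam (q 0) (q 1) (q 2) (q 3) j) (dirParam (q 0) (q 1) (q 2) (q 3) k) := by
  have d₁ : ∀ i, signVec [i] [] ≠ 0 := by decide
  have d₂ : ∀ i j, i ≠ j → signVec [i] [j] ≠ 0 ∧ SignIndep (signVec [i] []) (signVec [j] []) ∧
    SignIndep (signVec [i] [j]) (signVec [i] []) := by decide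
  have d₃ : ∀ i j k, i ≠ j → i ≠ k → j ≠ k → SignIndep (signVec [k] []) (signVec [i, j] [k]) := by
    decide +kernel
  rw [← signForm_vec₁, ← signForm_vec₁, ← signForm_vec₁]
  have e₁ : signForm (signVec [i] []) q - signForm (signVec [k] []) q =
      signForm (signVec [i] [k]) q := by
    rw [signForm_vec₁, signForm_vec₁, signForm_vec₂ q hik]
  have e₂ : signForm (signVec [j] []) q - signForm (signVec [k] []) q =
      signForm (signVec [j] [k]) q := by
    rw [signForm_vec₁, signForm_vec₁, signForm_vec₂ q hjk]
  have e₃ : signForm (signVec [i] []) q + signForm (signVec [j] []) q -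
      signForm (signVec [k] []) q = signForm (signVec [i, j] [k]) q := by
    rw [signForm_vec₁, signForm_vec₁, signForm_vec₁, signForm_vec₃ q hij hik hjk]
  refine ⟨?_, ?_, ?_, ?_, ?_⟩
  · rw [e₁, e₂]
    exact ⟨(signForm_of_notMem hq (d₁ i)).1, (signForm_of_notMem hq (d₁ j)).1,
      (signForm_of_notMem hq (d₁ k)).1, (signForm_of_notMem hq (d₂ i k hik).1).1,
      (signForm_of_notMem hq (d₂ j k hjk).1).1⟩
  · rw [e₁]
    exact ⟨weierstrassP_signForm_ne hq (d₂ i k hik).2.1,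
      weierstrassP_signForm_ne hq (d₂ i k hik).2.2⟩
  · rw [e₂]
    exact ⟨weierstrassP_signForm_ne hq (d₂ j k hjk).2.1,
      weierstrassP_signForm_ne hq (d₂ j k hjk).2.2⟩
  · exact (signForm_of_notMem hq (d₁ k)).2
  · rw [e₃]
    exact weierstrassP_signForm_ne hq (d₃ i j k hij hik hjk)

end

theorem cahpA_A4 (L : PeriodPair) : CAHPA (A4 L) (Q4 L) := by
  refine cahpA_of_isPairA (isThin_ellipticBad L) fun q hq => ⟨?_, fun x u v w a b => ?_, ?_⟩
  · exact cubeSystem_Q4 (quadGeneric_of_notMem hq)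
  · rw [Q4_swap]
  · simp only [List.forall_mem_cons]
    refine ⟨?_, ?_, ?_, by simp⟩
    · exact eventually_isElimination_A4
        (elimGeneric_of_notMem hq (i := 3) (j := 1) (k := 0) (by decide) (by decide) (by decide))
    · exact eventually_isElimination_A4
        (elimGeneric_of_notMem hq (i := 3) (j := 0) (k := 1) (by decide) (by decide) (by decide))
    · exact eventually_isElimination_A4
        (elimGeneric_of_notMem hq (i := 0) (j := 1) (k := 3) (by decide) (by decide) (by decide))

end

/-! ### Consistency from the equations at one vertex -/

lemma Moebius.neg {g : ℂ → ℂ → ℂ → ℂ → ℂ} (hg : Moebius g) : Moebius fun p s q r => -g p s q r := by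
  obtain ⟨q, r, h⟩ := hg.det
  refine ⟨fun x u v w => ?_, q, r, by simpa using h⟩
  obtain ⟨h1, h2, h3, h4⟩ := hg.multiAffine x u v w
  exact ⟨by linear_combination -h1, by linear_combination -h2, by linear_combination -h3,
    by linear_combination -h4⟩

/-- The result of the elimination of three variables from `f` by means of `g₁`, `g₂`, `g₃`. -/
def elim₃ (f : ℂ → ℂ → ℂ → ℂ) (g₁ g₂ g₃ : ℂ → ℂ) : ℂ :=
  g₁ 1 * (g₂ 1 * (g₃ 1 * f 0 0 0 - g₃ 0 * f 0 0 1) - g₂ 0 * (g₃ 1 * f 0 1 0 - g₃ 0 * f 0 1 1)) -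
    g₁ 0 * (g₂ 1 * (g₃ 1 * f 1 0 0 - g₃ 0 * f 1 0 1) - g₂ 0 * (g₃ 1 * f 1 1 0 - g₃ 0 * f 1 1 1))

/-- A function that is affine in each of three variables vanishes at the common root of three affine
functions if the result of the substitution, cleared of denominators, does. -/
lemma eq_zero_of_affine₃ {f : ℂ → ℂ → ℂ → ℂ} {g₁ g₂ g₃ : ℂ → ℂ} {c₁ c₂ c₃ : ℂ}
    (hf : ∀ x y z, f x y z = (1 - x) * f 0 y z + x * f 1 y z ∧
      f x y z = (1 - y) * f x 0 z + y * f x 1 z ∧ f x y z = (1 - z) * f x y 0 + z * f x y 1)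
    (a₁ : g₁ c₁ = (1 - c₁) * g₁ 0 + c₁ * g₁ 1) (a₂ : g₂ c₂ = (1 - c₂) * g₂ 0 + c₂ * g₂ 1)
    (a₃ : g₃ c₃ = (1 - c₃) * g₃ 0 + c₃ * g₃ 1)
    (s₁ : g₁ 1 - g₁ 0 ≠ 0) (s₂ : g₂ 1 - g₂ 0 ≠ 0) (s₃ : g₃ 1 - g₃ 0 ≠ 0)
    (h : elim₃ f g₁ g₂ g₃ = 0) (h₁ : g₁ c₁ = 0) (h₂ : g₂ c₂ = 0) (h₃ : g₃ c₃ = 0) :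
    f c₁ c₂ c₃ = 0 := by
  have key : ∀ {g h : ℂ → ℂ} {c : ℂ}, h c = (1 - c) * h 0 + c * h 1 →
      g c = (1 - c) * g 0 + c * g 1 → g c = 0 → (g 1 - g 0) * h c = g 1 * h 0 - g 0 * h 1 := by
    intro g h c hh hg h0
    linear_combination (g 1 - g 0) * hh + (h 1 - h 0) * h0 - (h 1 - h 0) * hg
  have e₁ : ∀ y z, (g₁ 1 - g₁ 0) * f c₁ y z = g₁ 1 * f 0 y z - g₁ 0 * f 1 y z :=
    fun y z => key (h := fun x => f x y z) (hf _ _ _).1 a₁ h₁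
  have e₂ : ∀ x z, (g₂ 1 - g₂ 0) * f x c₂ z = g₂ 1 * f x 0 z - g₂ 0 * f x 1 z :=
    fun x z => key (h := fun y => f x y z) (hf _ _ _).2.1 a₂ h₂
  have e₃ : ∀ x y, (g₃ 1 - g₃ 0) * f x y c₃ = g₃ 1 * f x y 0 - g₃ 0 * f x y 1 :=
    fun x y => key (hf _ _ _).2.2 a₃ h₃
  refine mul_left_cancel₀ (mul_ne_zero s₁ (mul_ne_zero s₂ s₃)) ?_
  rw [elim₃] at h
  linear_combination h + (g₂ 1 - g₂ 0) * (g₃ 1 - g₃ 0) * e₁ c₂ c₃ +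
    (g₃ 1 - g₃ 0) * (g₁ 1 * e₂ 0 c₃ - g₁ 0 * e₂ 1 c₃) +
    g₁ 1 * (g₂ 1 * e₃ 0 0 - g₂ 0 * e₃ 0 1) - g₁ 0 * (g₂ 1 * e₃ 1 0 - g₂ 0 * e₃ 1 1)

/-- The properties of a type-Q polynomial on which consistency rests: its symmetries, solvability,
and `star`, by which the equations of three faces at a vertex `x` imply one between the vertices
opposite to `x`. The parameters with `nd` are the nondegenerate ones. -/
structure QuadLaws (Q : QuadPoly) (nd : ℂ → Prop) : Prop where
  nd_neg : ∀ θ, nd θ → nd (-θ)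
  multiAffine : ∀ α β, MultiAffine fun x u v w => Q x u v w α β
  flip : ∀ x u v w α β, Q x u v w α β = Q u x w v α β
  swap : ∀ x u v w α β, Q x v u w β α = -Q x u v w α β
  rotate : ∀ x u v w α β, Q x u w v α (α - β) = Q x u v w α β
  even : ∀ x u v w α β, Q x u v w (-α) (-β) = -Q x u v w α β
  moebius : ∀ α β, nd α → nd β → nd (α - β) → Moebius fun x u v w => Q x u v w α β
  star : ∀ x b₁ b₂ b₃ a b c,
    Q x b₁ b₂ 1 a b - Q x b₁ b₂ 0 a b ≠ 0 → Q x b₁ b₃ 1 a c - Q x b₁ b₃ 0 a c ≠ 0 →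
    Q x b₂ b₃ 1 b c - Q x b₂ b₃ 0 b c ≠ 0 → ∀ d₁₂ d₁₃ d₂₃,
    Q x b₁ b₂ d₁₂ a b = 0 → Q x b₁ b₃ d₁₃ a c = 0 → Q x b₂ b₃ d₂₃ b c = 0 →
    Q x d₁₃ d₁₂ d₂₃ (a - c) (a - b) = 0

namespace QuadLaws

variable {Q : QuadPoly} {nd : ℂ → Prop}

lemma flip' (h : QuadLaws Q nd) (x u v w α β : ℂ) : Q x u v w α β = Q v w x u α β := by
  rw [← neg_neg (Q x u v w α β), ← h.swap, h.flip, h.swap, neg_neg]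

/-- The exchange of the first and the third leg. -/
lemma turn (h : QuadLaws Q nd) (x u v w α β : ℂ) : Q x w v u (β - α) β = Q x u v w α β := by
  rw [← neg_neg (Q x w v u (β - α) β), ← h.swap, h.rotate, h.swap, neg_neg]

lemma moebius₂ (h : QuadLaws Q nd) {α β : ℂ} (hα : nd α) (hβ : nd β) (hαβ : nd (α - β)) :
    Moebius fun x v u w => Q x u v w α β := by
  have := (h.moebius β α hβ hα (by rw [← neg_sub]; exact h.nd_neg _ hαβ)).neg
  refine cast (congrArg Moebius ?_) this
  funext x v u w
  rw [h.swap x u v w, neg_neg]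

lemma moebius₃ (h : QuadLaws Q nd) {α β : ℂ} (hα : nd α) (hβ : nd β) (hαβ : nd (α - β)) :
    Moebius fun x w u v => Q x u v w α β := by
  have := h.moebius₂ hα hαβ (by rwa [sub_sub_cancel])
  simpa only [h.rotate] using this

lemma eventually_slope (h : QuadLaws Q nd) {α β : ℂ} (hα : nd α) (hβ : nd β) (hαβ : nd (α - β))
    {n : ℕ} {k l m : Fin n} (hkl : k ≠ l) (hkm : k ≠ m) (hlm : l ≠ m) :
    ∀ᶠ v in gen n, Q (v k) (v l) (v m) 1 α β - Q (v k) (v l) (v m) 0 α β ≠ 0 :=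
  (h.moebius₃ hα hβ hαβ).eventually_slope_ne hkl hkm hlm

section

variable (h : QuadLaws Q nd) {a b c : ℂ} (ha : nd a) (hb : nd b) (hc : nd c) (hab : nd (a - b))
  (hac : nd (a - c)) (hbc : nd (b - c))
include h ha hb hc hab hac hbc

lemma star₁ : ∀ᶠ v : Fin 4 → ℂ in gen 4, ∀ d₁₂ d₁₃ d₂₃, Q (v 0) (v 1) (v 2) d₁₂ a b = 0 →
    Q (v 0) (v 1) (v 3) d₁₃ a c = 0 → Q (v 0) (v 2) (v 3) d₂₃ b c = 0 →
    Q (v 0) d₁₃ d₁₂ d₂₃ (a - c) (a - b) = 0 := by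
  filter_upwards [h.eventually_slope ha hb hab (show (0 : Fin 4) ≠ 1 by decide)
      (show (0 : Fin 4) ≠ 2 by decide) (by decide),
    h.eventually_slope ha hc hac (show (0 : Fin 4) ≠ 1 by decide)
      (show (0 : Fin 4) ≠ 3 by decide) (by decide),
    h.eventually_slope hb hc hbc (show (0 : Fin 4) ≠ 2 by decide)
      (show (0 : Fin 4) ≠ 3 by decide) (by decide)] with v h1 h2 h3
  exact h.star _ _ _ _ _ _ _ h1 h2 h3

lemma star₂ : ∀ᶠ v : Fin 4 → ℂ in gen 4, ∀ b₁ b₃ d₁₃, Q (v 0) b₁ (v 1) (v 2) a b = 0 →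
    Q (v 0) (v 1) b₃ (v 3) b c = 0 → Q (v 0) d₁₃ (v 2) (v 3) (a - c) (a - b) = 0 →
    Q (v 0) b₁ b₃ d₁₃ a c = 0 := by
  have hba : nd (b - a) := by rw [← neg_sub]; exact h.nd_neg _ hab
  have := h.star₁ hba hb hbc (by rw [sub_sub_cancel_left]; exact h.nd_neg _ ha)
    (by rw [sub_sub_sub_cancel_left, ← neg_sub]; exact h.nd_neg _ hac) (by rwa [sub_sub_cancel])
  filter_upwards [(tendsto_gen_comp ![0, 2, 1, 3] (by decide)).eventually this] with v hv b₁ b₃ d₁₃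
    h1 h2 h3
  have := hv b₁ d₁₃ b₃ (by simpa [h.turn] using h1)
    (by
      rw [← neg_sub a b, show b - c = -((a - b) - (a - c)) by ring, h.even, h.rotate,
        ← h.swap]
      simpa using h3)
    (by simpa [h.rotate] using h2)
  rw [sub_sub_sub_cancel_left, sub_sub_cancel_left, ← neg_sub a c, h.even, ← h.swap, h.rotate]
    at this
  exact this

lemma star₃ : ∀ᶠ v : Fin 4 → ℂ in gen 4, ∀ b₁ b₂ d₁₂, Q (v 0) b₁ (v 1) (v 2) a c = 0 →
    Q (v 0) b₂ (v 1) (v 3) b c = 0 → Q (v 0) (v 2) d₁₂ (v 3) (a - c) (a - b) = 0 →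
    Q (v 0) b₁ b₂ d₁₂ a b = 0 := by
  have hca : nd (c - a) := by rw [← neg_sub]; exact h.nd_neg _ hac
  have hcb : nd (c - b) := by rw [← neg_sub]; exact h.nd_neg _ hbc
  have := h.star₁ hca hc hcb (by rw [sub_sub_cancel_left]; exact h.nd_neg _ ha)
    (by rw [sub_sub_sub_cancel_left, ← neg_sub]; exact h.nd_neg _ hab) (by rwa [sub_sub_cancel])
  filter_upwards [(tendsto_gen_comp ![0, 2, 1, 3] (by decide)).eventually this] with v hv b₁ b₂ d₁₂
    h1 h2 h3
  have := hv b₁ d₁₂ b₂ (by simpa [h.turn] using h1)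
    (by
      rw [← neg_sub a c, show c - b = -((a - c) - (a - b)) by ring, h.even, h.rotate]
      simpa using h3)
    (by
      rw [h.rotate, h.swap]
      simpa using h2)
  rw [sub_sub_sub_cancel_left, sub_sub_cancel_left, ← neg_sub a b, h.even, ← h.swap, h.rotate]
    at this
  exact this

end

/-- The quad equations of a type-Q polynomial on the 4-cube are consistent. -/
theorem cubeSystem (h : QuadLaws Q nd) {a : Fin 4 → ℂ} (ha : ∀ i, nd (a i))
    (ha' : ∀ i j, i < j → nd (a i - a j)) :
    CubeSystem fun _ i j x u v w => Q x u v w (a i) (a j) := by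
  refine StarSystem.cubeSystem (T := fun _ i j k x d₁₂ d₁₃ d₂₃ =>
    Q x d₁₃ d₁₂ d₂₃ (a i - a k) (a i - a j) = 0) ⟨?_, ?_, ?_, ?_, ?_, ?_, ?_, ?_⟩
  · exact fun _ i j hij => ⟨h.moebius _ _ (ha i) (ha j) (ha' i j hij),
      h.moebius₂ (ha i) (ha j) (ha' i j hij), h.moebius₃ (ha i) (ha j) (ha' i j hij)⟩
  · exact fun _ i j _ x u v w => h.flip ..
  · exact fun _ i j _ x u v w => h.flip' ..
  · intro _ i j k _ _ x d₁₂ d₁₃ d₂₃ h'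
    rwa [h.flip'] at h'
  · intro _ i j k _ _ x d₁₂ d₁₃ d₂₃ h'
    rwa [h.flip] at h'
  · exact fun _ i j k hij hjk => h.star₁ (ha i) (ha j) (ha k) (ha' i j hij)
      (ha' i k (hij.trans hjk)) (ha' j k hjk)
  · exact fun _ i j k hij hjk => h.star₂ (ha i) (ha j) (ha k) (ha' i j hij)
      (ha' i k (hij.trans hjk)) (ha' j k hjk)
  · exact fun _ i j k hij hjk => h.star₃ (ha i) (ha j) (ha k) (ha' i j hij)
      (ha' i k (hij.trans hjk)) (ha' j k hjk)

end QuadLaws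

/-! ### Three-leg forms -/

/-- The coefficient of `√Δ` in the product of `r₁ + s₁ √Δ`, `r₂ - s₂ √Δ` and `r₃ - s₃ √Δ`. -/
def leg₃ (Δ r₁ s₁ r₂ s₂ r₃ s₃ : ℂ) : ℂ :=
  s₁ * r₂ * r₃ - r₁ * s₂ * r₃ - r₁ * r₂ * s₃ + Δ * s₁ * s₂ * s₃

/-- Elimination of the three legs `r + s √Δ` from `leg₃` by means of equations which say that they
are proportional to `a + b √Δ`. -/
lemma elim₃_eq_zero {f : ℂ → ℂ → ℂ → ℂ} {g₁ g₂ g₃ r₁ s₁ r₂ s₂ r₃ s₃ : ℂ → ℂ}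
    {Δ k l₁ l₂ l₃ a₁ b₁ a₂ b₂ a₃ b₃ : ℂ}
    (hf : ∀ x y z, f x y z = k * leg₃ Δ (r₁ x) (s₁ x) (r₂ y) (s₂ y) (r₃ z) (s₃ z))
    (h₁ : ∀ x, g₁ x = l₁ * (b₁ * r₁ x - a₁ * s₁ x)) (h₂ : ∀ x, g₂ x = l₂ * (b₂ * r₂ x - a₂ * s₂ x))
    (h₃ : ∀ x, g₃ x = l₃ * (b₃ * r₃ x - a₃ * s₃ x)) (h : leg₃ Δ a₁ b₁ a₂ b₂ a₃ b₃ = 0) :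
    elim₃ f g₁ g₂ g₃ = 0 := by
  have key : elim₃ f g₁ g₂ g₃ = k * l₁ * l₂ * l₃ * (r₁ 1 * s₁ 0 - r₁ 0 * s₁ 1) *
      (r₂ 1 * s₂ 0 - r₂ 0 * s₂ 1) * (r₃ 1 * s₃ 0 - r₃ 0 * s₃ 1) * leg₃ Δ a₁ b₁ a₂ b₂ a₃ b₃ := by
    simp only [elim₃, hf, h₁, h₂, h₃]
    -- each elimination replaces a leg `(r, s)` by the numbers `(a, b)`: `F` is linear in `(r, s)`
    have e : ∀ (p q : ℂ → ℂ) (l a b : ℂ) (F : ℂ → ℂ → ℂ),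
      (∀ c, F (p c) (q c) = p c * F 1 0 + q c * F 0 1) → F a b = a * F 1 0 + b * F 0 1 →
      l * (b * p 1 - a * q 1) * F (p 0) (q 0) - l * (b * p 0 - a * q 0) * F (p 1) (q 1) =
        l * (p 1 * q 0 - p 0 * q 1) * F a b := by
      intro p q l a b F hF hab
      rw [hF, hF, hab]; ring
    have e₃ : ∀ x y, _ := fun x y => e r₃ s₃ l₃ a₃ b₃
      (fun r s => k * leg₃ Δ (r₁ x) (s₁ x) (r₂ y) (s₂ y) r s)
      (fun _ => by simp only [leg₃]; ring) (by simp only [leg₃]; ring)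
    have e₂ : ∀ x, _ := fun x => e r₂ s₂ l₂ a₂ b₂
      (fun r s => k * leg₃ Δ (r₁ x) (s₁ x) r s a₃ b₃)
      (fun _ => by simp only [leg₃]; ring) (by simp only [leg₃]; ring)
    have e₁ := e r₁ s₁ l₁ a₁ b₁
      (fun r s => k * leg₃ Δ r s a₂ b₂ a₃ b₃)
      (fun _ => by simp only [leg₃]; ring) (by simp only [leg₃]; ring)
    simp only [e₃]
    linear_combination (l₃ * (r₃ 1 * s₃ 0 - r₃ 0 * s₃ 1)) * (l₁ * (b₁ * r₁ 1 - a₁ * s₁ 1)) * e₂ 0 -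
      (l₃ * (r₃ 1 * s₃ 0 - r₃ 0 * s₃ 1)) * (l₁ * (b₁ * r₁ 0 - a₁ * s₁ 0)) * e₂ 1 +
      (l₃ * (r₃ 1 * s₃ 0 - r₃ 0 * s₃ 1)) * (l₂ * (r₂ 1 * s₂ 0 - r₂ 0 * s₂ 1)) * e₁
  rw [key, h, mul_zero]

/-- For a given value at `x`, the polynomial `Q` is a coefficient of the product of three numbers,
its *legs*, which depend on the values at `u`, `v` and `w`. -/
def HasLegs (Q : QuadPoly) : Prop := ∀ x, ∃ (Δ : ℂ) (r s : ℂ → ℂ → ℂ),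
  (∀ u θ, r u (-θ) = r u θ) ∧ (∀ u θ, s u (-θ) = -s u θ) ∧
  ∀ u v w α β, Q x u v w α β = leg₃ Δ (r u α) (s u α) (r v β) (s v β) (r w (α - β)) (s w (α - β))

/-! ### The type-Q polynomials -/

lemma multiAffine_Q1 (δ α β : ℂ) : MultiAffine fun x u v w => Q1 δ x u v w α β := by
  intro x u v w
  simp only [Q1]
  refine ⟨?_, ?_, ?_, ?_⟩ <;> ring

lemma multiAffine_Q2 (α β : ℂ) : MultiAffine fun x u v w => Q2 x u v w α β := by
  intro x u v w
  simp only [Q2, Q1]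
  refine ⟨?_, ?_, ?_, ?_⟩ <;> ring

lemma multiAffine_Q3 (δ α β : ℂ) : MultiAffine fun x u v w => Q3 δ x u v w α β := by
  intro x u v w
  simp only [Q3]
  refine ⟨?_, ?_, ?_, ?_⟩ <;> ring

lemma hasLegs_Q1 (δ : ℂ) : HasLegs (Q1 δ) := fun x =>
  ⟨δ, fun u _ => x - u, fun _ θ => θ, fun _ _ => rfl, fun _ _ => rfl, fun _ _ _ _ _ => by
    simp only [Q1, leg₃]; ring⟩

lemma hasLegs_Q2 : HasLegs Q2 := fun x =>
  ⟨4 * x, fun u θ => x + θ ^ 2 - u, fun _ θ => θ, fun _ _ => by ring, fun _ _ => rfl,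
    fun _ _ _ _ _ => by simp only [Q2, Q1, leg₃]; ring⟩

lemma hasLegs_Q3 (δ : ℂ) : HasLegs (Q3 δ) := fun x =>
  ⟨x ^ 2 - δ, fun u θ => x * Complex.cosh θ - u, fun _ θ => Complex.sinh θ,
    fun _ _ => by simp only [Complex.cosh_neg], fun _ _ => Complex.sinh_neg _, fun u v w α β => by
    simp only [Q3, leg₃, Complex.cosh, Complex.sinh, Complex.exp_sub, Complex.exp_neg]
    have hA := Complex.exp_ne_zero α
    have hB := Complex.exp_ne_zero β
    generalize Complex.exp α = A at *
    generalize Complex.exp β = B at *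
    field_simp
    ring⟩

/-- The equations of three faces at `x` imply one between the vertices opposite to `x`, because the
legs of the former cancel. -/
lemma HasLegs.star {Q : QuadPoly} (h : HasLegs Q)
    (hQ : ∀ α β, MultiAffine fun x u v w => Q x u v w α β) {x b₁ b₂ b₃ a b c : ℂ}
    (s₁ : Q x b₁ b₂ 1 a b - Q x b₁ b₂ 0 a b ≠ 0) (s₂ : Q x b₁ b₃ 1 a c - Q x b₁ b₃ 0 a c ≠ 0)
    (s₃ : Q x b₂ b₃ 1 b c - Q x b₂ b₃ 0 b c ≠ 0) (d₁₂ d₁₃ d₂₃ : ℂ)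
    (h₁ : Q x b₁ b₂ d₁₂ a b = 0) (h₂ : Q x b₁ b₃ d₁₃ a c = 0) (h₃ : Q x b₂ b₃ d₂₃ b c = 0) :
    Q x d₁₃ d₁₂ d₂₃ (a - c) (a - b) = 0 := by
  refine eq_zero_of_affine₃ (f := fun d₁₃ d₁₂ d₂₃ => Q x d₁₃ d₁₂ d₂₃ (a - c) (a - b))
    (g₁ := fun d => Q x b₁ b₃ d a c) (g₂ := fun d => Q x b₁ b₂ d a b)
    (g₃ := fun d => Q x b₂ b₃ d b c) (fun _ _ _ => (hQ _ _ _ _ _ _).2) (hQ _ _ _ _ _ _).2.2.2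
    (hQ _ _ _ _ _ _).2.2.2 (hQ _ _ _ _ _ _).2.2.2 s₂ s₁ s₃ ?_ h₂ h₁ h₃
  obtain ⟨Δ, r, s, -, -, h⟩ := h x
  refine elim₃_eq_zero (Δ := Δ) (r₁ := fun d => r d (a - c)) (s₁ := fun d => s d (a - c))
    (r₂ := fun d => r d (a - b)) (s₂ := fun d => s d (a - b)) (r₃ := fun d => r d (b - c))
    (s₃ := fun d => s d (b - c)) (k := 1) (l₁ := 1) (l₂ := 1) (l₃ := 1)
    (a₁ := r b₁ a * r b₃ c - Δ * s b₁ a * s b₃ c) (b₁ := s b₁ a * r b₃ c - r b₁ a * s b₃ c)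
    (a₂ := r b₁ a * r b₂ b - Δ * s b₁ a * s b₂ b) (b₂ := s b₁ a * r b₂ b - r b₁ a * s b₂ b)
    (a₃ := r b₂ b * r b₃ c - Δ * s b₂ b * s b₃ c) (b₃ := s b₂ b * r b₃ c - r b₂ b * s b₃ c)
    (fun _ _ _ => ?_) (fun _ => ?_) (fun _ => ?_) (fun _ => ?_) ?_
  · simp only [h, one_mul, sub_sub_sub_cancel_left]
  all_goals simp only [h, leg₃]; ring

lemma quadLaws_Q1 (δ : ℂ) : QuadLaws (Q1 δ) (· ≠ 0) where
  nd_neg _ := neg_ne_zero.2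
  multiAffine := multiAffine_Q1 δ
  flip _ _ _ _ _ _ := by simp only [Q1]; ring
  swap _ _ _ _ _ _ := by simp only [Q1]; ring
  rotate _ _ _ _ _ _ := by simp only [Q1]; ring
  even _ _ _ _ _ _ := by simp only [Q1]; ring
  moebius α β _ hβ hαβ := by
    refine ⟨multiAffine_Q1 δ α β, ?_⟩
    by_contra! d
    refine mul_ne_zero hβ hαβ ?_
    have d₀ := d 0 0
    have d₁ := d 1 0
    simp only [Q1] at d₀ d₁
    linear_combination d₁ - d₀
  star _ _ _ _ _ _ _ := (hasLegs_Q1 δ).star (multiAffine_Q1 δ)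

lemma quadLaws_Q2 : QuadLaws Q2 (· ≠ 0) where
  nd_neg _ := neg_ne_zero.2
  multiAffine := multiAffine_Q2
  flip _ _ _ _ _ _ := by simp only [Q2, Q1]; ring
  swap _ _ _ _ _ _ := by simp only [Q2, Q1]; ring
  rotate _ _ _ _ _ _ := by simp only [Q2, Q1]; ring
  even _ _ _ _ _ _ := by simp only [Q2, Q1]; ring
  moebius α β _ hβ hαβ := by
    refine ⟨multiAffine_Q2 α β, ?_⟩
    by_contra! d
    refine mul_ne_zero hβ hαβ ?_
    have d₀ := d 0 0
    have d₁ := d 1 0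
    have d₂ := d 2 0
    simp only [Q2, Q1] at d₀ d₁ d₂
    linear_combination (1 / 2 : ℂ) * (d₂ - 2 * d₁ + d₀)
  star _ _ _ _ _ _ _ := hasLegs_Q2.star multiAffine_Q2

lemma quadLaws_Q3 (δ : ℂ) : QuadLaws (Q3 δ) (Complex.sinh · ≠ 0) where
  nd_neg θ h := by rwa [Complex.sinh_neg, neg_ne_zero]
  multiAffine := multiAffine_Q3 δ
  flip _ _ _ _ _ _ := by simp only [Q3]; ring
  swap _ _ _ _ α β := by
    simp only [Q3, ← neg_sub α β, Complex.sinh_neg]; ring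
  rotate _ _ _ _ _ _ := by simp only [Q3, sub_sub_cancel]; ring
  even _ _ _ _ α β := by
    simp only [Q3, show -α - -β = -(α - β) by ring, Complex.sinh_neg]; ring
  moebius α β _ hβ hαβ := by
    refine ⟨multiAffine_Q3 δ α β, ?_⟩
    by_contra! d
    refine mul_ne_zero hβ hαβ ?_
    have d₀ := d 0 0
    have d₁ := d 1 0
    simp only [Q3] at d₀ d₁
    linear_combination d₁ - d₀
  star _ _ _ _ _ _ _ := (hasLegs_Q3 δ).star (multiAffine_Q3 δ)

/-! ### The non-elliptic type-A pairs -/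

/-- The zero set of an entire function along a linear form is thin if the function and its
derivative have no common zero. -/
lemma isThin_zeros {φ φ' : ℂ → ℂ} (hφ : ∀ z, AnalyticAt ℂ φ z) (hd : ∀ z, HasDerivAt φ (φ' z) z)
    (h : ∀ z, φ z = 0 → φ' z ≠ 0) {l : (Fin 4 → ℂ) →L[ℂ] ℂ} {v : Fin 4 → ℂ} (hv : l v ≠ 0) :
    IsThin {q | φ (l q) = 0} := by
  intro a
  refine ⟨fun q => φ (l q), (hφ _).comp (l.analyticAt a), not_eventually_of_line (v := v)
    fun h' => ?_, .of_forall fun _ => id⟩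
  have h0 := h'.self_of_nhds
  simp only [map_add, map_smul, smul_eq_mul, zero_mul, add_zero] at h' h0
  have h1 : HasDerivAt (fun t : ℂ => φ (l a + t * l v)) (φ' (l a + 0 * l v) * l v) 0 := by
    have : HasDerivAt (fun t : ℂ => l a + t * l v) (l v) 0 := by
      simpa using ((hasDerivAt_id (0 : ℂ)).mul_const (l v)).const_add (l a)
    exact (hd _).comp (0 : ℂ) this
  have h2 : HasDerivAt (fun _ : ℂ => (0 : ℂ)) (φ' (l a + 0 * l v) * l v) 0 :=
    h1.congr_of_eventuallyEq (h'.mono fun _ h => h.symm)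
  rw [zero_mul, add_zero] at h2
  exact mul_ne_zero (h _ h0) hv (h2.unique (hasDerivAt_const _ _))

/-- The parameters for which a nontrivial combination of `α, β, ρ, γ` with coefficients `0, 1, -1`
is degenerate. -/
def degenerate (nd : ℂ → Prop) : Set (Fin 4 → ℂ) :=
  ⋃ c : {c : Fin 4 → SignType // c ≠ 0}, {q | ¬ nd (signForm c q)}

lemma isThin_degenerate {φ φ' : ℂ → ℂ} (hφ : ∀ z, AnalyticAt ℂ φ z)
    (hd : ∀ z, HasDerivAt φ (φ' z) z) (h : ∀ z, φ z = 0 → φ' z ≠ 0) :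
    IsThin (degenerate (φ · ≠ 0)) := by
  refine isThin_iUnion ?_
  rintro ⟨c, hc⟩
  obtain ⟨i, hi⟩ := Function.ne_iff.1 hc
  simp only [ne_eq, not_not]
  refine isThin_zeros hφ hd h (v := Pi.single (![0, 1, 3, 2] i) 1) ?_
  rw [signForm_single, mul_one, Int.cast_ne_zero]
  have h0 : ∀ s : SignType, (s : ℤ) = 0 → s = 0 := by decide
  exact fun h => hi (h0 _ h)

lemma isThin_degenerate_id : IsThin (degenerate (· ≠ 0)) :=
  isThin_degenerate (φ := fun z => z) (φ' := fun _ => 1) (fun _ => analyticAt_id)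
    hasDerivAt_id (by simp)

lemma isThin_degenerate_sinh : IsThin (degenerate (Complex.sinh · ≠ 0)) := by
  refine isThin_degenerate (φ' := Complex.cosh)
    (fun z => (Complex.differentiable_sinh.analyticAt z)) Complex.hasDerivAt_sinh fun z hz h => ?_
  have := Complex.cosh_sq_sub_sinh_sq z
  rw [hz, h] at this
  norm_num at this

lemma nd_of_notMem {nd : ℂ → Prop} {q : Fin 4 → ℂ} (hq : q ∉ degenerate nd) :
    (∀ i, nd (dirParam (q 0) (q 1) (q 2) (q 3) i)) ∧ ∀ i j, i ≠ j →
      nd (dirParam (q 0) (q 1) (q 2) (q 3) i - dirParam (q 0) (q 1) (q 2) (q 3) j) := by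
  simp only [degenerate, Set.mem_iUnion, Set.mem_ofPred_eq, not_exists, not_not] at hq
  have d₁ : ∀ i, signVec [i] [] ≠ 0 := by decide
  have d₂ : ∀ i j, i ≠ j → signVec [i] [j] ≠ 0 := by decide
  refine ⟨fun i => ?_, fun i j hij => ?_⟩
  · rw [← signForm_vec₁]
    exact hq ⟨_, d₁ i⟩
  · rw [← signForm_vec₂ q hij]
    exact hq ⟨_, d₂ i j hij⟩

/-- Consistency of a type-A pair from the laws of the type-Q polynomial and a resultant identity. -/
lemma QuadLaws.cahpA {A : FacePoly} {Q : QuadPoly} {nd : ℂ → Prop} (h : QuadLaws Q nd)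
    (hnd : IsThin (degenerate nd)) {κ : ℂ → ℂ} (hκ : ∀ z, nd z → κ z ≠ 0)
    (hA : ∀ x x₁ x₂ x₃ x₄ p q r, κ r * A x x₁ x₂ x₃ x₄ p q r =
      (Q x x₁ 1 x₂ q r - Q x x₁ 0 x₂ q r) * Q x x₃ 0 x₄ p r -
        (Q x x₃ 1 x₄ p r - Q x x₃ 0 x₄ p r) * Q x x₁ 0 x₂ q r) : CAHPA A Q := by
  refine cahpA_of_isPairA hnd fun q hq => ?_
  obtain ⟨h₁, h₂⟩ := nd_of_notMem hq
  refine ⟨h.cubeSystem h₁ fun i j hij => h₂ i j hij.ne, fun x u v w a b => ?_, ?_⟩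
  · rw [h.swap, neg_eq_zero]
  · have key : ∀ p q r : ℂ, nd r → ∀ᶠ v : Fin 1 → ℂ in gen 1,
        IsElimination (fun x x₁ x₂ x₃ x₄ => A x x₁ x₂ x₃ x₄ p q r)
          (fun x x₁ o x₂ => Q x x₁ o x₂ q r) (fun x x₃ o x₄ => Q x x₃ o x₄ p r) (v 0) :=
      fun p q r hr => .of_forall fun v => .of_resultant (h.multiAffine q r) (h.multiAffine p r)
        (hκ r hr) fun x₁ x₂ x₃ x₄ => hA _ _ _ _ _ _ _ _
    simp only [List.forall_mem_cons]
    exact ⟨key _ _ _ (h₁ 0), key _ _ _ (h₁ 1), key _ _ _ (h₁ 3), by simp⟩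

lemma resultant_Q3 (δ : ℂ) (x x₁ x₂ x₃ x₄ p q r : ℂ) : Complex.sinh r * A3 δ x x₁ x₂ x₃ x₄ p q r =
    (Q3 δ x x₁ 1 x₂ q r - Q3 δ x x₁ 0 x₂ q r) * Q3 δ x x₃ 0 x₄ p r -
      (Q3 δ x x₃ 1 x₄ p r - Q3 δ x x₃ 0 x₄ p r) * Q3 δ x x₁ 0 x₂ q r := by
  simp only [A3, Q3, Complex.sinh, Complex.exp_sub, Complex.exp_neg, Complex.exp_add]
  have hp := Complex.exp_ne_zero p
  have hq := Complex.exp_ne_zero q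
  have hr := Complex.exp_ne_zero r
  generalize Complex.exp p = P at *
  generalize Complex.exp q = Q at *
  generalize Complex.exp r = R at *
  field_simp
  ring

lemma resultant_Q2 (x x₁ x₂ x₃ x₄ p q r : ℂ) : r * A2 1 1 x x₁ x₂ x₃ x₄ p q r =
    (Q2 x x₁ 1 x₂ q r - Q2 x x₁ 0 x₂ q r) * Q2 x x₃ 0 x₄ p r -
      (Q2 x x₃ 1 x₄ p r - Q2 x x₃ 0 x₄ p r) * Q2 x x₁ 0 x₂ q r := by
  simp only [A2, Q2, Q1, pow_one, Nat.cast_one]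
  ring

lemma resultant_Q1_one (x x₁ x₂ x₃ x₄ p q r : ℂ) : r * A2 1 0 x x₁ x₂ x₃ x₄ p q r =
    (Q1 1 x x₁ 1 x₂ q r - Q1 1 x x₁ 0 x₂ q r) * Q1 1 x x₃ 0 x₄ p r -
      (Q1 1 x x₃ 1 x₄ p r - Q1 1 x x₃ 0 x₄ p r) * Q1 1 x x₁ 0 x₂ q r := by
  simp only [A2, Q1, pow_zero, Nat.cast_one, Nat.cast_zero]
  ring

lemma resultant_Q1_zero (x x₁ x₂ x₃ x₄ p q r : ℂ) : r * A2 0 0 x x₁ x₂ x₃ x₄ p q r =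
    (Q1 0 x x₁ 1 x₂ q r - Q1 0 x x₁ 0 x₂ q r) * Q1 0 x x₃ 0 x₄ p r -
      (Q1 0 x x₃ 1 x₄ p r - Q1 0 x x₃ 0 x₄ p r) * Q1 0 x x₁ 0 x₂ q r := by
  simp only [A2, Q1, pow_zero, Nat.cast_zero]
  ring

theorem cahpA_nonelliptic (k : Fin 5) : CAHPA (typeATable k).1 (typeATable k).2 := by
  fin_cases k
  · exact (quadLaws_Q3 1).cahpA isThin_degenerate_sinh (fun _ => id) (resultant_Q3 1)
  · exact (quadLaws_Q3 0).cahpA isThin_degenerate_sinh (fun _ => id) (resultant_Q3 0)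
  · exact quadLaws_Q2.cahpA isThin_degenerate_id (fun _ => id) resultant_Q2
  · exact (quadLaws_Q1 1).cahpA isThin_degenerate_id (fun _ => id) resultant_Q1_one
  · exact (quadLaws_Q1 0).cahpA isThin_degenerate_id (fun _ => id) resultant_Q1_zero

/-! ### Type-H polynomials -/

/-- The properties of a type-H polynomial `H` and a type-Q polynomial `Q` on which consistency of
two-layer systems rests. In such a system `Q` holds on faces inside a layer, and `H` on faces with
two vertices `x, w` in the layer of `Q` and two vertices `u, v` in the other layer. The last three
fields say which equation between neighbours of `x` follows from the equations at `x`: the values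
`c` belong to the other layer, the values `s` and `t` to the layer of `x`. -/
structure LayerLaws (Q H : QuadPoly) (nd : ℂ → Prop) : Prop extends QuadLaws Q nd where
  multiAffineH : ∀ α β, MultiAffine fun x u v w => H x u v w α β
  flipH : ∀ x u v w α β, H x u v w α β = H w v u x α β
  swapH : ∀ x u v w α β, H x v u w β α = -H x u v w α β
  moebiusH : ∀ α β, nd (α - β) → Moebius fun x u v w => H x u v w α β
  moebiusH' : ∀ α β, nd (α - β) → Moebius fun x w u v => H x u v w α β
  trans : ∀ x c₀ s₁ s₂ p₀ p₁ p₂,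
    H x c₀ 1 s₁ p₀ p₁ - H x c₀ 0 s₁ p₀ p₁ ≠ 0 → H x c₀ 1 s₂ p₀ p₂ - H x c₀ 0 s₂ p₀ p₂ ≠ 0 →
    Q x s₁ s₂ 1 (p₀ - p₁) (p₀ - p₂) - Q x s₁ s₂ 0 (p₀ - p₁) (p₀ - p₂) ≠ 0 → ∀ c₁ c₂ s₁₂,
    H x c₀ c₁ s₁ p₀ p₁ = 0 → H x c₀ c₂ s₂ p₀ p₂ = 0 → Q x s₁ s₂ s₁₂ (p₀ - p₁) (p₀ - p₂) = 0 →
    H x c₁ c₂ s₁₂ p₁ p₂ = 0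
  triangle : ∀ x c₀ c₁ c₂ p₀ p₁ p₂,
    H x c₀ c₁ 1 p₀ p₁ - H x c₀ c₁ 0 p₀ p₁ ≠ 0 → H x c₀ c₂ 1 p₀ p₂ - H x c₀ c₂ 0 p₀ p₂ ≠ 0 →
    H x c₁ c₂ 1 p₁ p₂ - H x c₁ c₂ 0 p₁ p₂ ≠ 0 → ∀ s₁ s₂ s₁₂,
    H x c₀ c₁ s₁ p₀ p₁ = 0 → H x c₀ c₂ s₂ p₀ p₂ = 0 → H x c₁ c₂ s₁₂ p₁ p₂ = 0 →
    Q x s₁ s₂ s₁₂ (p₀ - p₁) (p₀ - p₂) = 0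
  shift : ∀ x c₀ c₁ t p₀ p₁ θ,
    H x c₀ c₁ 1 p₀ p₁ - H x c₀ c₁ 0 p₀ p₁ ≠ 0 →
    H x c₀ 1 t p₀ (p₀ - θ) - H x c₀ 0 t p₀ (p₀ - θ) ≠ 0 →
    H x c₁ 1 t p₁ (p₁ - θ) - H x c₁ 0 t p₁ (p₁ - θ) ≠ 0 → ∀ s c₂ c₃,
    H x c₀ c₁ s p₀ p₁ = 0 → H x c₀ c₂ t p₀ (p₀ - θ) = 0 → H x c₁ c₃ t p₁ (p₁ - θ) = 0 →
    H x c₂ c₃ s (p₀ - θ) (p₁ - θ) = 0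

/-- For a given nonzero value at `x`, the polynomials `Q` and `H` are coefficients of products of
three legs, where the legs in the layer of `x` are the same for `Q` and `H`: these are
`r u θ + s u θ √Δ`, and the legs to the other layer are `R u α + S u α √Δ`. The value `x = 0` is
left out because some of these expressions have `x` in a denominator. -/
def HasLayerLegs (Q H : QuadPoly) : Prop := ∀ x, x ≠ 0 → ∃ (Δ k : ℂ) (r s R S : ℂ → ℂ → ℂ),
  (∀ u θ, r u (-θ) = r u θ) ∧ (∀ u θ, s u (-θ) = -s u θ) ∧
  (∀ u v w α β, Q x u v w α β =
    leg₃ Δ (r u α) (s u α) (r v β) (s v β) (r w (α - β)) (s w (α - β))) ∧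
  ∀ u v w α β, H x u v w α β =
    k * leg₃ Δ (R u α) (S u α) (R v β) (S v β) (r w (α - β)) (s w (α - β))

/-- This recovers the value `x = 0`, which is left out in `HasLayerLegs`, because the result of an
elimination is continuous in `x`. -/
lemma eq_zero_of_continuous {f : ℂ → ℂ} (hf : Continuous f) (h : ∀ x, x ≠ 0 → f x = 0) (x : ℂ) :
    f x = 0 :=
  congrFun (Continuous.ext_on (dense_compl_singleton (0 : ℂ)) hf continuous_const h) x

lemma MultiAffine.continuous {f : ℂ → ℂ → ℂ → ℂ → ℂ} (hf : MultiAffine f) (u v w : ℂ) :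
    Continuous fun x => f x u v w := by
  have h : Continuous fun x : ℂ => (1 - x) * f 0 u v w + x * f 1 u v w := by fun_prop
  exact h.congr fun x => (hf x u v w).1.symm

namespace HasLayerLegs

variable {Q H : QuadPoly} (h : HasLayerLegs Q H)
  (hH : ∀ α β, MultiAffine fun x u v w => H x u v w α β)
include h hH

lemma shift (x c₀ c₁ t p₀ p₁ θ : ℂ) :
    elim₃ (fun c₂ c₃ s => H x c₂ c₃ s (p₀ - θ) (p₁ - θ)) (fun c₂ => H x c₀ c₂ t p₀ (p₀ - θ))
      (fun c₃ => H x c₁ c₃ t p₁ (p₁ - θ)) (fun s => H x c₀ c₁ s p₀ p₁) = 0 := by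
  have cH := fun u v w α β => (hH α β).continuous u v w
  revert x
  refine eq_zero_of_continuous (by unfold elim₃; fun_prop) fun x hx => ?_
  obtain ⟨Δ, k, r, s, R, S, -, -, -, hh⟩ := h x hx
  refine elim₃_eq_zero (Δ := Δ) (r₁ := fun c => R c (p₀ - θ)) (s₁ := fun c => S c (p₀ - θ))
    (r₂ := fun c => R c (p₁ - θ)) (s₂ := fun c => S c (p₁ - θ))
    (r₃ := fun c => r c (p₀ - p₁)) (s₃ := fun c => s c (p₀ - p₁))
    (k := k) (l₁ := k) (l₂ := k) (l₃ := k)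
    (a₁ := R c₀ p₀ * r t θ - Δ * S c₀ p₀ * s t θ) (b₁ := S c₀ p₀ * r t θ - R c₀ p₀ * s t θ)
    (a₂ := R c₁ p₁ * r t θ - Δ * S c₁ p₁ * s t θ) (b₂ := S c₁ p₁ * r t θ - R c₁ p₁ * s t θ)
    (a₃ := R c₀ p₀ * R c₁ p₁ - Δ * S c₀ p₀ * S c₁ p₁)
    (b₃ := S c₀ p₀ * R c₁ p₁ - R c₀ p₀ * S c₁ p₁)
    (fun _ _ _ => ?_) (fun _ => ?_) (fun _ => ?_) (fun _ => ?_) ?_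
  · simp only [hh, sub_sub_sub_cancel_right]
  · simp only [hh, leg₃, sub_sub_cancel]; ring
  · simp only [hh, leg₃, sub_sub_cancel]; ring
  · simp only [hh, leg₃]; ring
  · simp only [leg₃]; ring

variable (hQ : ∀ α β, MultiAffine fun x u v w => Q x u v w α β)
include hQ

lemma trans (x c₀ s₁ s₂ p₀ p₁ p₂ : ℂ) : elim₃ (fun c₁ c₂ s₁₂ => H x c₁ c₂ s₁₂ p₁ p₂)
    (fun c₁ => H x c₀ c₁ s₁ p₀ p₁) (fun c₂ => H x c₀ c₂ s₂ p₀ p₂)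
    (fun s₁₂ => Q x s₁ s₂ s₁₂ (p₀ - p₁) (p₀ - p₂)) = 0 := by
  have cQ := fun u v w α β => (hQ α β).continuous u v w
  have cH := fun u v w α β => (hH α β).continuous u v w
  revert x
  refine eq_zero_of_continuous (by unfold elim₃; fun_prop) fun x hx => ?_
  obtain ⟨Δ, k, r, s, R, S, hr, hs, hq, hh⟩ := h x hx
  refine elim₃_eq_zero (Δ := Δ) (r₁ := fun c => R c p₁) (s₁ := fun c => S c p₁)
    (r₂ := fun c => R c p₂) (s₂ := fun c => S c p₂) (r₃ := fun c => r c (p₁ - p₂))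
    (s₃ := fun c => s c (p₁ - p₂)) (k := k) (l₁ := k) (l₂ := k) (l₃ := -1)
    (a₁ := R c₀ p₀ * r s₁ (p₀ - p₁) - Δ * S c₀ p₀ * s s₁ (p₀ - p₁))
    (b₁ := S c₀ p₀ * r s₁ (p₀ - p₁) - R c₀ p₀ * s s₁ (p₀ - p₁))
    (a₂ := R c₀ p₀ * r s₂ (p₀ - p₂) - Δ * S c₀ p₀ * s s₂ (p₀ - p₂))
    (b₂ := S c₀ p₀ * r s₂ (p₀ - p₂) - R c₀ p₀ * s s₂ (p₀ - p₂))
    (a₃ := r s₁ (p₀ - p₁) * r s₂ (p₀ - p₂) - Δ * s s₁ (p₀ - p₁) * s s₂ (p₀ - p₂))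
    (b₃ := r s₁ (p₀ - p₁) * s s₂ (p₀ - p₂) - s s₁ (p₀ - p₁) * r s₂ (p₀ - p₂))
    (fun _ _ _ => hh ..) (fun _ => ?_) (fun _ => ?_) (fun _ => ?_) ?_
  · simp only [hh, leg₃]; ring
  · simp only [hh, leg₃]; ring
  · simp only [hq, leg₃, sub_sub_sub_cancel_left]
    rw [← neg_sub p₁ p₂, hr, hs]
    ring
  · simp only [leg₃]; ring

lemma triangle (x c₀ c₁ c₂ p₀ p₁ p₂ : ℂ) :
    elim₃ (fun s₁ s₂ s₁₂ => Q x s₁ s₂ s₁₂ (p₀ - p₁) (p₀ - p₂))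
      (fun s₁ => H x c₀ c₁ s₁ p₀ p₁) (fun s₂ => H x c₀ c₂ s₂ p₀ p₂)
      (fun s₁₂ => H x c₁ c₂ s₁₂ p₁ p₂) = 0 := by
  have cQ := fun u v w α β => (hQ α β).continuous u v w
  have cH := fun u v w α β => (hH α β).continuous u v w
  revert x
  refine eq_zero_of_continuous (by unfold elim₃; fun_prop) fun x hx => ?_
  obtain ⟨Δ, k, r, s, R, S, hr, hs, hq, hh⟩ := h x hx
  refine elim₃_eq_zero (Δ := Δ) (r₁ := fun c => r c (p₀ - p₁)) (s₁ := fun c => s c (p₀ - p₁))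
    (r₂ := fun c => r c (p₀ - p₂)) (s₂ := fun c => s c (p₀ - p₂))
    (r₃ := fun c => r c (p₂ - p₁)) (s₃ := fun c => s c (p₂ - p₁))
    (k := 1) (l₁ := k) (l₂ := k) (l₃ := -k)
    (a₁ := R c₀ p₀ * R c₁ p₁ - Δ * S c₀ p₀ * S c₁ p₁)
    (b₁ := S c₀ p₀ * R c₁ p₁ - R c₀ p₀ * S c₁ p₁)
    (a₂ := R c₀ p₀ * R c₂ p₂ - Δ * S c₀ p₀ * S c₂ p₂)
    (b₂ := S c₀ p₀ * R c₂ p₂ - R c₀ p₀ * S c₂ p₂)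
    (a₃ := R c₁ p₁ * R c₂ p₂ - Δ * S c₁ p₁ * S c₂ p₂)
    (b₃ := R c₁ p₁ * S c₂ p₂ - S c₁ p₁ * R c₂ p₂)
    (fun _ _ _ => ?_) (fun _ => ?_) (fun _ => ?_) (fun _ => ?_) ?_
  · simp only [hq, one_mul, sub_sub_sub_cancel_left]
  · simp only [hh, leg₃]; ring
  · simp only [hh, leg₃]; ring
  · rw [hh, ← neg_sub p₂ p₁, hr, hs]
    simp only [leg₃]; ring
  · simp only [leg₃]; ring

end HasLayerLegs

/-- Consistency of two-layer systems from legs. By `m` and `m'`, for some values of the other two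
variables, the values at `x` and `u`, and those at `x` and `w`, are related by an invertible
fractional linear map. -/
lemma QuadLaws.layerLaws {Q H : QuadPoly} {nd : ℂ → Prop} (hQ : QuadLaws Q nd)
    (hH : ∀ α β, MultiAffine fun x u v w => H x u v w α β)
    (flip : ∀ x u v w α β, H x u v w α β = H w v u x α β)
    (swap : ∀ x u v w α β, H x v u w β α = -H x u v w α β) (h : HasLayerLegs Q H)
    (m : ∀ α β, nd (α - β) → ∃ q r,
      H 1 0 q r α β * H 0 1 q r α β ≠ H 0 0 q r α β * H 1 1 q r α β)
    (m' : ∀ α β, nd (α - β) → ∃ q r,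
      H 1 q r 0 α β * H 0 q r 1 α β ≠ H 0 q r 0 α β * H 1 q r 1 α β) : LayerLaws Q H nd where
  toQuadLaws := hQ
  multiAffineH := hH
  flipH := flip
  swapH := swap
  moebiusH α β hαβ := ⟨hH α β, m α β hαβ⟩
  moebiusH' α β hαβ := ⟨fun x w u v => ⟨(hH α β x u v w).1, (hH α β x u v w).2.2.2,
    (hH α β x u v w).2.1, (hH α β x u v w).2.2.1⟩, m' α β hαβ⟩
  trans x c₀ s₁ s₂ p₀ p₁ p₂ n₁ n₂ n₃ _ _ _ :=
    eq_zero_of_affine₃ (f := fun c₁ c₂ s₁₂ => H x c₁ c₂ s₁₂ p₁ p₂)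
      (g₁ := fun c₁ => H x c₀ c₁ s₁ p₀ p₁) (g₂ := fun c₂ => H x c₀ c₂ s₂ p₀ p₂)
      (g₃ := fun s₁₂ => Q x s₁ s₂ s₁₂ (p₀ - p₁) (p₀ - p₂))
      (fun _ _ _ => (hH _ _ _ _ _ _).2) (hH _ _ _ _ _ _).2.2.1
      (hH _ _ _ _ _ _).2.2.1 (hQ.multiAffine _ _ _ _ _ _).2.2.2 n₁ n₂ n₃
      (h.trans hH hQ.multiAffine ..)
  triangle x c₀ c₁ c₂ p₀ p₁ p₂ n₁ n₂ n₃ _ _ _ :=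
    eq_zero_of_affine₃ (f := fun s₁ s₂ s₁₂ => Q x s₁ s₂ s₁₂ (p₀ - p₁) (p₀ - p₂))
      (g₁ := fun s₁ => H x c₀ c₁ s₁ p₀ p₁) (g₂ := fun s₂ => H x c₀ c₂ s₂ p₀ p₂)
      (g₃ := fun s₁₂ => H x c₁ c₂ s₁₂ p₁ p₂)
      (fun _ _ _ => (hQ.multiAffine _ _ _ _ _ _).2) (hH _ _ _ _ _ _).2.2.2
      (hH _ _ _ _ _ _).2.2.2 (hH _ _ _ _ _ _).2.2.2 n₁ n₂ n₃ (h.triangle hH hQ.multiAffine ..)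
  shift x c₀ c₁ t p₀ p₁ θ n₁ n₂ n₃ _ _ _ h₁ h₂ h₃ :=
    eq_zero_of_affine₃ (f := fun c₂ c₃ s => H x c₂ c₃ s (p₀ - θ) (p₁ - θ))
      (g₁ := fun c₂ => H x c₀ c₂ t p₀ (p₀ - θ)) (g₂ := fun c₃ => H x c₁ c₃ t p₁ (p₁ - θ))
      (g₃ := fun s => H x c₀ c₁ s p₀ p₁) (fun _ _ _ => (hH _ _ _ _ _ _).2)
      (hH _ _ _ _ _ _).2.2.1 (hH _ _ _ _ _ _).2.2.1 (hH _ _ _ _ _ _).2.2.2 n₂ n₃ n₁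
      (h.shift hH ..) h₂ h₃ h₁

/-! ### Consistency of the type-H polynomials -/

lemma hasLayerLegs_H1_zero : HasLayerLegs (Q1 0) (H1 0) := fun x _ =>
  ⟨0, -1 / 2, fun u _ => x - u, fun _ θ => θ, fun _ _ => -2,
    fun u _ => u, fun _ _ => by ring, fun _ _ => by ring,
    fun _ _ _ _ _ => by simp only [Q1, leg₃]; ring,
    fun _ _ _ _ _ => by simp only [H1, leg₃]; ring⟩

lemma hasLayerLegs_H1_one : HasLayerLegs (Q1 0) (H1 1) := fun x hx =>
  ⟨0, 1 / (2 * x), fun u _ => x - u, fun _ θ => θ, fun _ _ => -2 * x,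
    fun u α => -(u + α), fun _ _ => by ring, fun _ _ => by ring,
    fun _ _ _ _ _ => by simp only [Q1, leg₃]; ring,
    fun _ _ _ _ _ => by simp only [H1, leg₃]; field_simp; ring⟩

lemma hasLayerLegs_H1_swapped : HasLayerLegs (Q1 1) (swapped (H1 1)) := fun x _ =>
  ⟨1, 1 / 2, fun u _ => x - u, fun _ θ => θ, fun u _ => u + 1,
    fun u _ => u - 1, fun _ _ => by ring, fun _ _ => by ring,
    fun _ _ _ _ _ => by simp only [Q1, leg₃]; ring,
    fun _ _ _ _ _ => by simp only [swapped, H1, leg₃]; ring⟩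

lemma hasLayerLegs_H2_zero : HasLayerLegs (Q1 1) (H2 0) := fun x _ =>
  ⟨1, 1 / 2, fun u _ => x - u, fun _ θ => θ, fun u α => x + u + α + 1,
    fun u α => x + u + α - 1, fun _ _ => by ring, fun _ _ => by ring,
    fun _ _ _ _ _ => by simp only [Q1, leg₃]; ring,
    fun _ _ _ _ _ => by simp only [H2, leg₃]; ring⟩

lemma hasLayerLegs_H2_one : HasLayerLegs (Q1 1) (H2 1) := fun x _ =>
  ⟨1, -1 / 2, fun u _ => x - u, fun _ θ => θ, fun u α => (x + α) ^ 2 - u + 1,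
    fun u α => (x + α) ^ 2 - u - 1, fun _ _ => by ring, fun _ _ => by ring,
    fun _ _ _ _ _ => by simp only [Q1, leg₃]; ring,
    fun _ _ _ _ _ => by simp only [H2, leg₃]; ring⟩

lemma hasLayerLegs_H2_swapped : HasLayerLegs Q2 (swapped (H2 1)) := fun x _ =>
  ⟨4 * x, -2, fun u θ => x + θ ^ 2 - u, fun _ θ => θ, fun u α => u + α,
    fun _ _ => 1 / 2, fun _ _ => by ring, fun _ _ => by ring,
    fun _ _ _ _ _ => by simp only [Q2, Q1, leg₃]; ring,
    fun _ _ _ _ _ => by simp only [swapped, H2, leg₃]; ring⟩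

lemma hasLayerLegs_H3 (δ ε : ℂ) : HasLayerLegs (Q3 0) (H3 δ ε) := fun x hx =>
  ⟨x ^ 2 - 0, -1 / 4, fun u θ => x * Complex.cosh θ - u, fun _ θ => Complex.sinh θ,
    fun u α => x * (2 * Complex.exp α * u - ε * x * Complex.exp α ^ 2) - δ * (2 - ε) + 1,
    fun u α => (x * (2 * Complex.exp α * u - ε * x * Complex.exp α ^ 2) - δ * (2 - ε) - 1) / x,
    fun _ _ => by simp only [Complex.cosh_neg], fun _ _ => Complex.sinh_neg _,
    fun u v w α β => by
      simp only [Q3, leg₃, Complex.cosh, Complex.sinh, Complex.exp_sub, Complex.exp_neg]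
      have hA := Complex.exp_ne_zero α
      have hB := Complex.exp_ne_zero β
      generalize Complex.exp α = A at *
      generalize Complex.exp β = B at *
      field_simp
      ring,
    fun u v w α β => by
      simp only [H3, leg₃, Complex.cosh, Complex.sinh, Complex.exp_sub, Complex.exp_neg,
        Complex.exp_add]
      have hA := Complex.exp_ne_zero α
      have hB := Complex.exp_ne_zero β
      generalize Complex.exp α = A at *
      generalize Complex.exp β = B at *
      field_simp
      ring⟩

lemma hasLayerLegs_H3_swapped : HasLayerLegs (Q3 1) (swapped (H3 1 1)) := fun x _ =>
  ⟨x ^ 2 - 1, 1, fun u θ => x * Complex.cosh θ - u, fun _ θ => Complex.sinh θ,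
    fun u α => Complex.exp α * u - x,
    fun _ _ => 1,
    fun _ _ => by simp only [Complex.cosh_neg], fun _ _ => Complex.sinh_neg _,
    fun u v w α β => by
      simp only [Q3, leg₃, Complex.cosh, Complex.sinh, Complex.exp_sub, Complex.exp_neg]
      have hA := Complex.exp_ne_zero α
      have hB := Complex.exp_ne_zero β
      generalize Complex.exp α = A at *
      generalize Complex.exp β = B at *
      field_simp
      ring,
    fun u v w α β => by
      simp only [swapped, H3, leg₃, Complex.cosh, Complex.sinh, Complex.exp_sub, Complex.exp_neg,
        Complex.exp_add]
      have hA := Complex.exp_ne_zero α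
      have hB := Complex.exp_ne_zero β
      generalize Complex.exp α = A at *
      generalize Complex.exp β = B at *
      field_simp
      ring⟩

lemma layerLaws_H1_zero : LayerLaws (Q1 0) (H1 0) (· ≠ 0) := by
  refine (quadLaws_Q1 0).layerLaws (fun _ _ _ _ _ _ => ?_)
    (fun _ _ _ _ _ _ => ?_) (fun _ _ _ _ _ _ => ?_)
    hasLayerLegs_H1_zero (fun α β hαβ => ?_) fun α β _ => ?_
  · simp only [H1]
    refine ⟨?_, ?_, ?_, ?_⟩ <;> ring
  · simp only [H1]
    ring
  · simp only [H1]
    ring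
  · by_contra! d
    refine hαβ ?_
    have d₀ := d 0 0
    simp only [H1] at d₀
    linear_combination -1 / 2 * d₀
  · by_contra! d
    have d₀ := d 0 0
    have d₁ := d 1 0
    have d₂ := d (-1) 0
    simp only [H1] at d₀ d₁ d₂
    exact two_ne_zero (α := ℂ) (by linear_combination -d₁ - d₂ + 2 * d₀)

lemma layerLaws_H1_one : LayerLaws (Q1 0) (H1 1) (· ≠ 0) := by
  refine (quadLaws_Q1 0).layerLaws (fun _ _ _ _ _ _ => ?_)
    (fun _ _ _ _ _ _ => ?_) (fun _ _ _ _ _ _ => ?_)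
    hasLayerLegs_H1_one (fun α β hαβ => ?_) fun α β _ => ?_
  · simp only [H1]
    refine ⟨?_, ?_, ?_, ?_⟩ <;> ring
  · simp only [H1]
    ring
  · simp only [H1]
    ring
  · by_contra! d
    refine hαβ ?_
    have d₀ := d 0 (-1)
    simp only [H1] at d₀
    linear_combination -1 / 2 * d₀
  · by_contra! d
    have d₀ := d 0 0
    have d₁ := d 1 0
    have d₂ := d (-1) 0
    simp only [H1] at d₀ d₁ d₂
    exact two_ne_zero (α := ℂ) (by linear_combination -d₁ - d₂ + 2 * d₀)

lemma layerLaws_H1_swapped : LayerLaws (Q1 1) (swapped (H1 1)) (· ≠ 0) := by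
  refine (quadLaws_Q1 1).layerLaws (fun _ _ _ _ _ _ => ?_)
    (fun _ _ _ _ _ _ => ?_) (fun _ _ _ _ _ _ => ?_)
    hasLayerLegs_H1_swapped (fun α β hαβ => ?_) fun α β _ => ?_
  · simp only [swapped, H1]
    refine ⟨?_, ?_, ?_, ?_⟩ <;> ring
  · simp only [swapped, H1]
    ring
  · simp only [swapped, H1]
    ring
  · by_contra! d
    refine hαβ ?_
    have d₀ := d 1 0
    simp only [swapped, H1] at d₀
    linear_combination 1 / 2 * d₀
  · by_contra! d
    have d₀ := d 0 0
    have d₁ := d 1 0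
    have d₂ := d (-1) 0
    simp only [swapped, H1] at d₀ d₁ d₂
    exact two_ne_zero (α := ℂ) (by linear_combination -d₁ - d₂ + 2 * d₀)

lemma layerLaws_H2_zero : LayerLaws (Q1 1) (H2 0) (· ≠ 0) := by
  refine (quadLaws_Q1 1).layerLaws (fun _ _ _ _ _ _ => ?_)
    (fun _ _ _ _ _ _ => ?_) (fun _ _ _ _ _ _ => ?_)
    hasLayerLegs_H2_zero (fun α β hαβ => ?_) fun α β _ => ?_
  · simp only [H2]
    refine ⟨?_, ?_, ?_, ?_⟩ <;> ring
  · simp only [H2]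
    ring
  · simp only [H2]
    ring
  · by_contra! d
    refine hαβ ?_
    have d₀ := d 0 0
    have d₁ := d 1 0
    simp only [H2] at d₀ d₁
    linear_combination 1 / 2 * (d₁ - d₀)
  · by_contra! d
    have d₀ := d 0 0
    have d₁ := d 1 0
    have d₂ := d (-1) 0
    simp only [H2] at d₀ d₁ d₂
    exact two_ne_zero (α := ℂ) (by linear_combination -d₁ - d₂ + 2 * d₀)

lemma layerLaws_H2_one : LayerLaws (Q1 1) (H2 1) (· ≠ 0) := by
  refine (quadLaws_Q1 1).layerLaws (fun _ _ _ _ _ _ => ?_)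
    (fun _ _ _ _ _ _ => ?_) (fun _ _ _ _ _ _ => ?_)
    hasLayerLegs_H2_one (fun α β hαβ => ?_) fun α β _ => ?_
  · simp only [H2]
    refine ⟨?_, ?_, ?_, ?_⟩ <;> ring
  · simp only [H2]
    ring
  · simp only [H2]
    ring
  · by_contra! d
    refine hαβ ?_
    have d₀ := d 0 0
    have d₁ := d 1 0
    simp only [H2] at d₀ d₁
    linear_combination 1 / 2 * (d₁ - d₀)
  · by_contra! d
    have d₀ := d 0 0
    have d₁ := d 1 0
    have d₂ := d (-1) 0
    simp only [H2] at d₀ d₁ d₂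
    exact two_ne_zero (α := ℂ) (by linear_combination -d₁ - d₂ + 2 * d₀)

lemma layerLaws_H2_swapped : LayerLaws Q2 (swapped (H2 1)) (· ≠ 0) := by
  refine quadLaws_Q2.layerLaws (fun _ _ _ _ _ _ => ?_)
    (fun _ _ _ _ _ _ => ?_) (fun _ _ _ _ _ _ => ?_)
    hasLayerLegs_H2_swapped (fun α β hαβ => ?_) fun α β _ => ?_
  · simp only [swapped, H2]
    refine ⟨?_, ?_, ?_, ?_⟩ <;> ring
  · simp only [swapped, H2]
    ring
  · simp only [swapped, H2]
    ring
  · by_contra! d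
    refine hαβ ?_
    have d₀ := d 0 0
    have d₁ := d 0 1
    simp only [swapped, H2] at d₀ d₁
    linear_combination 1 / 2 * (d₁ - d₀)
  · by_contra! d
    have d₀ := d 0 0
    have d₁ := d 1 0
    have d₂ := d (-1) 0
    simp only [swapped, H2] at d₀ d₁ d₂
    exact two_ne_zero (α := ℂ) (by linear_combination -d₁ - d₂ + 2 * d₀)

lemma layerLaws_H3 (δ ε : ℂ) : LayerLaws (Q3 0) (H3 δ ε) (Complex.sinh · ≠ 0) := by
  refine (quadLaws_Q3 0).layerLaws (fun _ _ _ _ _ _ => ?_)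
    (fun _ _ _ _ _ _ => ?_) (fun _ _ _ _ α β => ?_)
    (hasLayerLegs_H3 δ ε) (fun α β hαβ => ?_) fun α β _ => ?_
  · simp only [H3]
    refine ⟨?_, ?_, ?_, ?_⟩ <;> ring
  · simp only [H3]
    ring
  · simp only [H3, ← neg_sub α β, Complex.sinh_neg, add_comm β α]
    ring
  · by_contra! d
    refine hαβ ?_
    have d₀ := d 0 0
    have d₁ := d 1 0
    have d₂ := d 0 1
    have d₃ := d 1 1
    simp only [H3] at d₀ d₁ d₂ d₃
    have h : Complex.exp α ^ 2 - Complex.exp β ^ 2 = 0 := by linear_combination d₃ - d₁ - d₂ + d₀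
    rw [Complex.sinh, neg_sub, Complex.exp_sub, Complex.exp_sub]
    have hα := Complex.exp_ne_zero α
    have hβ := Complex.exp_ne_zero β
    field_simp
    linear_combination h
  · by_contra! d
    have d₀ := d 0 0
    have d₁ := d 1 0
    have d₂ := d (-1) 0
    simp only [H3] at d₀ d₁ d₂
    refine mul_ne_zero (mul_ne_zero (two_ne_zero (α := ℂ)) (Complex.exp_ne_zero α))
      (Complex.exp_ne_zero β) ?_
    linear_combination -d₁ - d₂ + 2 * d₀

lemma layerLaws_H3_swapped : LayerLaws (Q3 1) (swapped (H3 1 1)) (Complex.sinh · ≠ 0) := by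
  refine (quadLaws_Q3 1).layerLaws (fun _ _ _ _ _ _ => ?_)
    (fun _ _ _ _ _ _ => ?_) (fun _ _ _ _ α β => ?_)
    hasLayerLegs_H3_swapped (fun α β hαβ => ?_) fun α β _ => ?_
  · simp only [swapped, H3]
    refine ⟨?_, ?_, ?_, ?_⟩ <;> ring
  · simp only [swapped, H3]
    ring
  · simp only [swapped, H3, ← neg_sub α β, Complex.sinh_neg, add_comm β α]
    ring
  · by_contra! d
    refine hαβ ?_
    have d₀ := d 0 0
    have d₁ := d 1 0
    have d₂ := d 0 1
    have d₃ := d 1 1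
    simp only [swapped, H3] at d₀ d₁ d₂ d₃
    have h : Complex.exp α ^ 2 - Complex.exp β ^ 2 = 0 := by linear_combination d₃ - d₁ - d₂ + d₀
    rw [Complex.sinh, neg_sub, Complex.exp_sub, Complex.exp_sub]
    have hα := Complex.exp_ne_zero α
    have hβ := Complex.exp_ne_zero β
    field_simp
    linear_combination h
  · by_contra! d
    have d₀ := d 0 0
    have d₁ := d 1 0
    have d₂ := d (-1) 0
    simp only [swapped, H3] at d₀ d₁ d₂
    refine mul_ne_zero (mul_ne_zero (two_ne_zero (α := ℂ)) (Complex.exp_ne_zero α))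
      (Complex.exp_ne_zero β) ?_
    linear_combination -d₁ - d₂ + 2 * d₀

/-! ### Systems of type-Q and type-H equations on the four-dimensional cube -/

/-- The quad equation of a face in the directions of parameters `α`, `β`. The flags say whether
these directions connect the two layers; the first one must be no larger than the second one. -/
def layerFace (Q H : QuadPoly) (t₁ t₂ : Bool) : QuadPoly := fun x u v w α β =>
  match t₁, t₂ with
  | false, false => Q x u v w α β
  | false, true => H x w v u (β - α) β
  | true, _ => H x u v w α β

/-- The relation between the values at the vertices of a tetrahedron inscribed in a 3-face whose
directions have the parameters `a`, `b`, `c` and the flags `false`, `t₂`, `t₃`. It is of type Q if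
all four vertices are in one layer. Otherwise it is of type H, and the vertex in the layer of `x`
is the one of `d₁₂` or `d₂₃`. -/
def layerTet (Q H : QuadPoly) (t₂ t₃ : Bool) (x d₁₂ d₁₃ d₂₃ a b c : ℂ) : ℂ :=
  match t₂, t₃ with
  | false, false => Q x d₁₃ d₁₂ d₂₃ (a - c) (a - b)
  | false, true => H x d₁₃ d₂₃ d₁₂ (c - a) (c - b)
  | true, _ => H x d₁₂ d₁₃ d₂₃ (b - a) (c - a)

namespace LayerLaws

variable {Q H : QuadPoly} {nd : ℂ → Prop}

lemma swap_iff (h : LayerLaws Q H nd) {x u v w α β : ℂ} :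
    H x v u w β α = 0 ↔ H x u v w α β = 0 := by
  rw [h.swapH, neg_eq_zero]

lemma nd_sub (h : LayerLaws Q H nd) {α β : ℂ} (hαβ : nd (α - β)) : nd (β - α) := by
  rw [← neg_sub]
  exact h.nd_neg _ hαβ

lemma moebiusH₂ (h : LayerLaws Q H nd) {α β : ℂ} (hαβ : nd (α - β)) :
    Moebius fun x v u w => H x u v w α β := by
  refine cast (congrArg Moebius ?_) (h.moebiusH β α (h.nd_sub hαβ)).neg
  funext x v u w
  rw [h.swapH x u v w, neg_neg]

lemma moebius_face (h : LayerLaws Q H nd) {t₁ t₂ : Bool} {α β : ℂ} (hα : nd α)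
    (hβ : nd β) (hαβ : nd (α - β)) :
    Moebius (fun x u v w => layerFace Q H t₁ t₂ x u v w α β) ∧
    Moebius (fun x v u w => layerFace Q H t₁ t₂ x u v w α β) ∧
    Moebius (fun x w u v => layerFace Q H t₁ t₂ x u v w α β) := by
  match t₁, t₂ with
  | false, false => exact ⟨h.moebius _ _ hα hβ hαβ, h.moebius₂ hα hβ hαβ, h.moebius₃ hα hβ hαβ⟩
  | false, true =>
    have : nd (β - α - β) := by rw [sub_sub_cancel_left]; exact h.nd_neg _ hα
    exact ⟨(h.moebiusH' _ _ this).flip', (h.moebiusH₂ this).flip', (h.moebiusH _ _ this).flip'⟩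
  | true, _ => exact ⟨h.moebiusH _ _ hαβ, h.moebiusH₂ hαβ, h.moebiusH' _ _ hαβ⟩

lemma eventually_slope₃ (h : LayerLaws Q H nd) {α β : ℂ} (hαβ : nd (α - β)) {n : ℕ}
    {k l m : Fin n} (hkl : k ≠ l) (hkm : k ≠ m) (hlm : l ≠ m) :
    ∀ᶠ v in gen n, H (v k) (v l) 1 (v m) α β - H (v k) (v l) 0 (v m) α β ≠ 0 :=
  (h.moebiusH₂ hαβ).eventually_slope_ne hkl hkm hlm

lemma eventually_slope₄ (h : LayerLaws Q H nd) {α β : ℂ} (hαβ : nd (α - β)) {n : ℕ}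
    {k l m : Fin n} (hkl : k ≠ l) (hkm : k ≠ m) (hlm : l ≠ m) :
    ∀ᶠ v in gen n, H (v k) (v l) (v m) 1 α β - H (v k) (v l) (v m) 0 α β ≠ 0 :=
  (h.moebiusH' α β hαβ).eventually_slope_ne hkl hkm hlm

section

variable (h : LayerLaws Q H nd) {p₀ p₁ p₂ θ : ℂ}
include h

lemma eventually_trans (h₁ : nd (p₀ - p₁)) (h₂ : nd (p₀ - p₂)) (h₃ : nd (p₁ - p₂)) {k l m n : Fin 4}
    (hkl : k ≠ l) (hkm : k ≠ m) (hkn : k ≠ n) (hlm : l ≠ m) (hln : l ≠ n) (hmn : m ≠ n) :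
    ∀ᶠ v : Fin 4 → ℂ in gen 4, ∀ c₁ c₂ s₁₂, H (v k) (v l) c₁ (v m) p₀ p₁ = 0 →
      H (v k) (v l) c₂ (v n) p₀ p₂ = 0 →
      Q (v k) (v m) (v n) s₁₂ (p₀ - p₁) (p₀ - p₂) = 0 → H (v k) c₁ c₂ s₁₂ p₁ p₂ = 0 := by
  filter_upwards [h.eventually_slope₃ h₁ hkl hkm hlm, h.eventually_slope₃ h₂ hkl hkn hln,
    h.eventually_slope h₁ h₂ (by rw [sub_sub_sub_cancel_left]; exact h.nd_sub h₃) hkm hkn hmn]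
    with v n₁ n₂ n₃
  exact h.trans _ _ _ _ _ _ _ n₁ n₂ n₃

lemma eventually_triangle (h₁ : nd (p₀ - p₁)) (h₂ : nd (p₀ - p₂)) (h₃ : nd (p₁ - p₂)) :
    ∀ᶠ v : Fin 4 → ℂ in gen 4, ∀ s₁ s₂ s₁₂, H (v 0) (v 1) (v 2) s₁ p₀ p₁ = 0 →
      H (v 0) (v 1) (v 3) s₂ p₀ p₂ = 0 → H (v 0) (v 2) (v 3) s₁₂ p₁ p₂ = 0 →
      Q (v 0) s₁ s₂ s₁₂ (p₀ - p₁) (p₀ - p₂) = 0 := by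
  filter_upwards [h.eventually_slope₄ h₁ (k := (0 : Fin 4)) (l := 1) (m := 2) (by decide)
      (by decide) (by decide),
    h.eventually_slope₄ h₂ (k := (0 : Fin 4)) (l := 1) (m := 3) (by decide) (by decide)
      (by decide),
    h.eventually_slope₄ h₃ (k := (0 : Fin 4)) (l := 2) (m := 3) (by decide) (by decide)
      (by decide)] with v n₁ n₂ n₃
  exact h.triangle _ _ _ _ _ _ _ n₁ n₂ n₃

lemma eventually_shift (h₁ : nd (p₀ - p₁)) (h₂ : nd θ) {k l m n : Fin 4}
    (hkl : k ≠ l) (hkm : k ≠ m) (hkn : k ≠ n) (hlm : l ≠ m) (hln : l ≠ n) (hmn : m ≠ n) :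
    ∀ᶠ v : Fin 4 → ℂ in gen 4, ∀ s c₂ c₃, H (v k) (v l) (v m) s p₀ p₁ = 0 →
      H (v k) (v l) c₂ (v n) p₀ (p₀ - θ) = 0 → H (v k) (v m) c₃ (v n) p₁ (p₁ - θ) = 0 →
      H (v k) c₂ c₃ s (p₀ - θ) (p₁ - θ) = 0 := by
  filter_upwards [h.eventually_slope₄ h₁ hkl hkm hlm,
    h.eventually_slope₃ (β := p₀ - θ) (α := p₀) (by rwa [sub_sub_cancel]) hkl hkn hln,
    h.eventually_slope₃ (β := p₁ - θ) (α := p₁) (by rwa [sub_sub_cancel]) hkm hkn hmn]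
    with v n₁ n₂ n₃
  exact h.shift _ _ _ _ _ _ _ n₁ n₂ n₃

end

section

variable (h : LayerLaws Q H nd) {t₁ t₂ t₃ : Bool} (h₁ : t₁ = false) (h₂₃ : t₂ ≤ t₃) {a b c : ℂ}
  (ha : nd a) (hb : nd b) (hc : nd c) (hab : nd (a - b)) (hac : nd (a - c)) (hbc : nd (b - c))
include h h₁ h₂₃ ha hb hc hab hac hbc

/-- The equations of the three faces at a vertex imply the one of the inscribed tetrahedron. This is
`trans` if only the last direction leads to the other layer, and `shift` if the last two do. -/
lemma face_star₁ : ∀ᶠ v : Fin 4 → ℂ in gen 4, ∀ d₁₂ d₁₃ d₂₃,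
    layerFace Q H t₁ t₂ (v 0) (v 1) (v 2) d₁₂ a b = 0 →
    layerFace Q H t₁ t₃ (v 0) (v 1) (v 3) d₁₃ a c = 0 →
    layerFace Q H t₂ t₃ (v 0) (v 2) (v 3) d₂₃ b c = 0 →
    layerTet Q H t₂ t₃ (v 0) d₁₂ d₁₃ d₂₃ a b c = 0 := by
  subst h₁
  match t₂, t₃, h₂₃ with
  | false, false, _ => exact h.star₁ ha hb hc hab hac hbc
  | false, true, _ =>
    have := h.eventually_trans (p₀ := c) (p₁ := c - a) (p₂ := c - b) (by rwa [sub_sub_cancel])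
      (by rwa [sub_sub_cancel]) (by rw [sub_sub_sub_cancel_left]; exact h.nd_sub hab)
      (k := 0) (l := 3) (m := 1) (n := 2) (by decide) (by decide) (by decide) (by decide)
      (by decide) (by decide)
    simp only [sub_sub_cancel] at this
    filter_upwards [this] with v hv d₁₂ d₁₃ d₂₃ e₁ e₂ e₃
    exact hv _ _ _ (h.swap_iff.1 e₂) (h.swap_iff.1 e₃) e₁
  | true, true, _ =>
    filter_upwards [h.eventually_shift (p₀ := b) (p₁ := c) (θ := a) hbc ha (k := 0) (l := 2)
      (m := 3) (n := 1) (by decide) (by decide) (by decide) (by decide) (by decide) (by decide)]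
      with v hv d₁₂ d₁₃ d₂₃ e₁ e₂ e₃
    exact hv _ _ _ e₃ (h.swap_iff.1 e₁) (h.swap_iff.1 e₂)

/-- The equations of two faces and a tetrahedron imply the one of the face of the first and the last
direction, again by `trans` or by `shift` with relabelled parameters. -/
lemma face_star₂ : ∀ᶠ v : Fin 4 → ℂ in gen 4, ∀ b₁ b₃ d₁₃,
    layerFace Q H t₁ t₂ (v 0) b₁ (v 1) (v 2) a b = 0 →
    layerFace Q H t₂ t₃ (v 0) (v 1) b₃ (v 3) b c = 0 →
    layerTet Q H t₂ t₃ (v 0) (v 2) d₁₃ (v 3) a b c = 0 →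
    layerFace Q H t₁ t₃ (v 0) b₁ b₃ d₁₃ a c = 0 := by
  subst h₁
  match t₂, t₃, h₂₃ with
  | false, false, _ => exact h.star₂ ha hb hc hab hac hbc
  | false, true, _ =>
    have := h.eventually_trans (p₀ := c - b) (p₁ := c - a) (p₂ := c)
      (by rwa [sub_sub_sub_cancel_left]) (by rw [sub_sub_cancel_left]; exact h.nd_neg _ hb)
      (by rw [sub_sub_cancel_left]; exact h.nd_neg _ ha) (k := 0) (l := 3) (m := 2) (n := 1)
      (by decide) (by decide) (by decide) (by decide) (by decide) (by decide)
    simp only [sub_sub_sub_cancel_left, sub_sub_cancel_left] at this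
    filter_upwards [this] with v hv b₁ b₃ d₁₃ e₁ e₂ e₃
    refine hv _ _ _ (h.swap_iff.1 e₃) e₂ ?_
    rw [← neg_sub b a, h.even, h.turn, neg_eq_zero]
    exact e₁
  | true, true, _ =>
    have := h.eventually_shift (p₀ := b - a) (p₁ := b) (θ := b - c)
      (by rw [sub_sub_cancel_left]; exact h.nd_neg _ ha) hbc (k := 0) (l := 2) (m := 1) (n := 3)
      (by decide) (by decide) (by decide) (by decide) (by decide) (by decide)
    simp only [sub_sub_cancel, show b - a - (b - c) = c - a by ring] at this
    filter_upwards [this] with v hv b₁ b₃ d₁₃ e₁ e₂ e₃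
    exact hv _ _ _ e₁ e₃ e₂

/-- The equations of two faces and a tetrahedron imply the one of the face of the first two
directions. This is `triangle` if only the last direction leads to the other layer, because the
missing face lies inside a layer, and `shift` if the last two do. -/
lemma face_star₃ : ∀ᶠ v : Fin 4 → ℂ in gen 4, ∀ b₁ b₂ d₁₂,
    layerFace Q H t₁ t₃ (v 0) b₁ (v 1) (v 2) a c = 0 →
    layerFace Q H t₂ t₃ (v 0) b₂ (v 1) (v 3) b c = 0 →
    layerTet Q H t₂ t₃ (v 0) d₁₂ (v 2) (v 3) a b c = 0 →
    layerFace Q H t₁ t₂ (v 0) b₁ b₂ d₁₂ a b = 0 := by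
  subst h₁
  match t₂, t₃, h₂₃ with
  | false, false, _ => exact h.star₃ ha hb hc hab hac hbc
  | false, true, _ =>
    have := h.eventually_triangle (p₀ := c) (p₁ := c - a) (p₂ := c - b) (by rwa [sub_sub_cancel])
      (by rwa [sub_sub_cancel]) (by rw [sub_sub_sub_cancel_left]; exact h.nd_sub hab)
    simp only [sub_sub_cancel] at this
    filter_upwards [this] with v hv b₁ b₂ d₁₂ e₁ e₂ e₃
    exact hv _ _ _ (h.swap_iff.1 e₁) (h.swap_iff.1 e₂) e₃
  | true, true, _ =>
    have := h.eventually_shift (p₀ := c - a) (p₁ := c) (θ := c - b)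
      (by rw [sub_sub_cancel_left]; exact h.nd_neg _ ha) (h.nd_sub hbc) (k := 0) (l := 2) (m := 1)
      (n := 3) (by decide) (by decide) (by decide) (by decide) (by decide) (by decide)
    simp only [sub_sub_cancel, show c - a - (c - b) = b - a by ring] at this
    filter_upwards [this] with v hv b₁ b₂ d₁₂ e₁ e₂ e₃
    exact hv _ _ _ e₁ (h.swap_iff.1 e₃) (h.swap_iff.1 e₂)

end

end LayerLaws

/-- Which directions of the 4-cube connect the two layers. They are the last ones, at most two. -/
structure IsLayering (t : Fin 4 → Bool) (col : Fin 16 → Bool) : Prop where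
  mono : ∀ i j, i < j → t i ≤ t j
  pair : ∀ i j k, i < j → j < k → t i = false
  col_nb : ∀ s i, col (nb s i) = xor (col s) (t i)

/-- The combination with the roles of the two layers interchanged. -/
def TypeC.exchanged (T : TypeC) : TypeC := ⟨T.Cbar, T.C, swapped T.H, T.Qstar, T.Q⟩

/-- The combination as it is seen from a vertex of the layer `c`. In the layer `false` the vertices
carry the face-centered polynomial `Cbar` and the type-Q polynomial `Qstar`. -/
def TypeC.layer (T : TypeC) (c : Bool) : TypeC := bif c then T.exchanged else T

/-- The quad equations of a type-C combination on the 4-cube. -/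
def TypeC.face (T : TypeC) (t : Fin 4 → Bool) (col : Fin 16 → Bool) (a : Fin 4 → ℂ) (s : Fin 16)
    (i j : Fin 4) (x u v w : ℂ) : ℂ :=
  layerFace (T.layer (col s)).Qstar (T.layer (col s)).H (t i) (t j) x u v w (a i) (a j)

/-- The quad equations of a type-C combination on the 4-cube are consistent. -/
theorem TypeC.cubeSystem {T : TypeC} {nd : ℂ → Prop}
    (h : ∀ c, LayerLaws (T.layer c).Qstar (T.layer c).H nd) {t : Fin 4 → Bool} {col : Fin 16 → Bool}
    (ht : IsLayering t col) {a : Fin 4 → ℂ} (ha : ∀ i, nd (a i))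
    (ha' : ∀ i j, i < j → nd (a i - a j)) : CubeSystem (T.face t col a) := by
  -- seen from the other layer, the two inner variables of a type-H equation are the outer ones
  have hs : ∀ c x u v w α β, (T.layer (!c)).H x u v w α β = (T.layer c).H u x w v α β := by
    rintro (_ | _) <;> intros <;> rfl
  refine StarSystem.cubeSystem (T := fun s i j k x d₁₂ d₁₃ d₂₃ =>
    layerTet (T.layer (col s)).Qstar (T.layer (col s)).H (t j) (t k) x d₁₂ d₁₃ d₂₃
      (a i) (a j) (a k) = 0)
    ⟨?_, ?_, ?_, ?_, ?_, ?_, ?_, ?_⟩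
  · exact fun s i j hij => (h (col s)).moebius_face (ha i) (ha j) (ha' i j hij)
  · intro s i j hij x u v w
    have h' := ht.mono i j hij
    unfold face
    rw [ht.col_nb]
    generalize t i = t₁ at *
    generalize t j = t₂ at *
    match t₁, t₂ with
    | false, false => simpa [layerFace] using (h (col s)).flip ..
    | false, true => simpa [layerFace] using (h (col s)).flipH ..
    | true, true => simp [layerFace, hs]
  · intro s i j hij x u v w
    have h' := ht.mono i j hij
    unfold face
    rw [ht.col_nb]
    generalize t i = t₁ at *
    generalize t j = t₂ at *
    match t₁, t₂ with
    | false, false => simpa [layerFace] using (h (col s)).flip' ..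
    | false, true => simpa [layerFace, hs] using (h (col s)).flipH ..
    | true, true => simpa [layerFace, hs] using (h (col s)).flipH ..
  · intro s i j k hij hjk x d₁₂ d₁₃ d₂₃ h₀
    have h' := ht.mono j k hjk
    rw [ht.col_nb, ht.col_nb, ht.pair i j k hij hjk, Bool.xor_false]
    generalize t j = t₂ at *
    generalize t k = t₃ at *
    match t₂, t₃ with
    | false, false =>
      simp only [layerTet, Bool.xor_false] at h₀ ⊢
      rwa [(h (col s)).flip'] at h₀
    | false, true =>
      simp only [layerTet, Bool.xor_false] at h₀ ⊢
      rwa [(h (col s)).flipH] at h₀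
    | true, true => simpa [layerTet, hs] using h₀
  · intro s i j k hij hjk x d₁₂ d₁₃ d₂₃ h₀
    have h' := ht.mono j k hjk
    rw [ht.col_nb, ht.col_nb, ht.pair i j k hij hjk, Bool.xor_false]
    generalize t j = t₂ at *
    generalize t k = t₃ at *
    match t₂, t₃ with
    | false, false =>
      simp only [layerTet, Bool.xor_false] at h₀ ⊢
      rwa [(h (col s)).flip] at h₀
    | false, true => simpa [layerTet, hs] using h₀
    | true, true =>
      simp only [layerTet, Bool.xor_true, hs] at h₀ ⊢
      rwa [(h (col s)).flipH] at h₀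
  · exact fun s i j k hij hjk => (h (col s)).face_star₁ (ht.pair i j k hij hjk) (ht.mono j k hjk)
      (ha i) (ha j) (ha k) (ha' i j hij) (ha' i k (hij.trans hjk)) (ha' j k hjk)
  · exact fun s i j k hij hjk => (h (col s)).face_star₂ (ht.pair i j k hij hjk) (ht.mono j k hjk)
      (ha i) (ha j) (ha k) (ha' i j hij) (ha' i k (hij.trans hjk)) (ha' j k hjk)
  · exact fun s i j k hij hjk => (h (col s)).face_star₃ (ht.pair i j k hij hjk) (ht.mono j k hjk)
      (ha i) (ha j) (ha k) (ha' i j hij) (ha' i k (hij.trans hjk)) (ha' j k hjk)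

/-! ### Type-C equations on hexagons -/

/-- The properties of a combination, as it is seen from a vertex of the layer `false`, on which
consistency around the hexagonal prism rests: the polynomial `Cbar` results in two ways by
elimination, from equations on faces of different kinds and from two type-H equations. -/
structure TypeC.IsPair (T : TypeC) (nd : ℂ → Prop) : Prop where
  laws : LayerLaws T.Qstar T.H nd
  elim : ∀ p q r, nd r → ∀ x, IsElimination (fun x x₁ x₂ x₃ x₄ => T.Cbar x x₁ x₂ x₃ x₄ p q r)
    (fun x x₁ o x₂ => T.Qstar x x₁ o x₂ q r) (fun x x₃ o x₄ => T.H x x₄ x₃ o (p - r) p) x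
  elim' : ∀ α β γ x, IsElimination
    (fun x x₁ x₃ x₂ x₄ => T.Cbar x x₁ x₂ x₃ x₄ (γ - α) (-α) (β - α))
    (fun x x₁ o x₃ => T.H x x₃ o x₁ (γ - α) γ) (fun x x₂ o x₄ => T.H x x₄ o x₂ (γ - β) γ) x

/-- Along the cyclically ordered vertices of the hexagon the directions of `γ`, `α`, `β` alternate:
they are `3`, `0`, `1` in this order, starting from the edge of the first two vertices. -/
lemma nb_hexVert (z : Fin 16) :
    (nb (hexVert 0 ^^^ z) 1 = hexVert 5 ^^^ z ∧
    nb (hexVert 1 ^^^ z) 0 = hexVert 2 ^^^ z ∧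
    nb (hexVert 3 ^^^ z) 1 = hexVert 2 ^^^ z ∧
    nb (hexVert 4 ^^^ z) 0 = hexVert 5 ^^^ z ∧
    nb (hexVert 2 ^^^ z) 0 = hexVert 1 ^^^ z ∧
    nb (hexVert 2 ^^^ z) 1 = hexVert 3 ^^^ z ∧
    nb (hexVert 5 ^^^ z) 0 = hexVert 4 ^^^ z ∧
    nb (hexVert 5 ^^^ z) 1 = hexVert 0 ^^^ z ∧
    nb (hexVert 0 ^^^ z) 3 = hexVert 1 ^^^ z ∧
    nb (hexVert 1 ^^^ z) 3 = hexVert 0 ^^^ z ∧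
    nb (hexVert 3 ^^^ z) 3 = hexVert 4 ^^^ z ∧
    nb (hexVert 4 ^^^ z) 3 = hexVert 3 ^^^ z) ∧
    nb (nb (hexVert 0 ^^^ z) 1) 0 = hexVert 4 ^^^ z ∧
    nb (nb (hexVert 0 ^^^ z) 0) 3 = hexVert 2 ^^^ z ∧
    nb (nb (hexVert 1 ^^^ z) 0) 1 = hexVert 3 ^^^ z ∧
    nb (nb (hexVert 1 ^^^ z) 1) 3 = hexVert 5 ^^^ z ∧
    nb (nb (hexVert 3 ^^^ z) 1) 0 = hexVert 1 ^^^ z ∧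
    nb (nb (hexVert 3 ^^^ z) 0) 3 = hexVert 5 ^^^ z ∧
    nb (nb (hexVert 4 ^^^ z) 0) 1 = hexVert 0 ^^^ z ∧
    nb (nb (hexVert 4 ^^^ z) 1) 3 = hexVert 2 ^^^ z ∧
    nb (nb (hexVert 2 ^^^ z) 0) 3 = hexVert 0 ^^^ z ∧
    nb (nb (hexVert 2 ^^^ z) 1) 3 = hexVert 4 ^^^ z ∧
    nb (nb (hexVert 5 ^^^ z) 0) 3 = hexVert 3 ^^^ z ∧
    nb (nb (hexVert 5 ^^^ z) 1) 3 = hexVert 1 ^^^ z := by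
  revert z
  decide

section

variable {T : TypeC} {nd : ℂ → Prop} (h : ∀ c, (T.layer c).IsPair nd) {t : Fin 4 → Bool}
  {col : Fin 16 → Bool} (ht : IsLayering t col) (ht₁ : t 1 = false) (ht₃ : t 3 = true)
  {α β γ ρ : ℂ} (ha : ∀ i, nd (dirParam α β γ ρ i))
  (ha' : ∀ i j, i ≠ j → nd (dirParam α β γ ρ i - dirParam α β γ ρ j)) {X : Fin 16 → ℂ}
  (hX : IsRegular (T.face t col (dirParam α β γ ρ)) X)
include h ht ht₁ ht₃ ha ha' hX

/-- The equation of a vertex with both type-Q and type-H faces. -/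
lemma cbar_eq_zero_iff (s : Fin 16) {i j : Fin 4} (hij : i = 0 ∧ j = 1 ∨ i = 1 ∧ j = 0) :
    (∀ z, (T.layer (col s)).Cbar (X s) (X (nb s j)) (X (nb (nb s j) i)) (X (nb s 3)) z
      γ (dirParam α β γ ρ j) (dirParam α β γ ρ i) = 0 ↔ z = X (nb (nb s i) 3)) ∧
    (∀ z, (T.layer (col s)).Cbar (X s) (X (nb s j)) (X (nb (nb s j) i)) z (X (nb (nb s i) 3))
      γ (dirParam α β γ ρ j) (dirParam α β γ ρ i) = 0 ↔ z = X (nb s 3)) := by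
  have hF := TypeC.cubeSystem (fun c => (h c).laws) ht ha fun i j hij => ha' i j hij.ne
  have t₀ : t 0 = false := ht.pair 0 1 2 (by decide) (by decide)
  have hi : t i = false ∧ i < 3 := by rcases hij with ⟨rfl, -⟩ | ⟨rfl, -⟩ <;> simp [t₀, ht₁]
  have f₀ : ∀ o, (T.layer (col s)).Qstar (X s) (X (nb s j)) o (X (nb (nb s j) i))
      (dirParam α β γ ρ j) (dirParam α β γ ρ i) = 0 ↔ o = X (nb s i) := by
    intro o
    rcases hij with ⟨rfl, rfl⟩ | ⟨rfl, rfl⟩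
    · rw [(h _).laws.swap, neg_eq_zero, ← hX.slot₂ hF s (show (0 : Fin 4) < 1 by decide),
        nb_comm s 1 0]
      simp only [TypeC.face, t₀, ht₁, layerFace]
    · rw [← hX.slot₃ hF s (show (0 : Fin 4) < 1 by decide)]
      simp only [TypeC.face, t₀, ht₁, layerFace]
  have g₄ := hX.slot₄ s hi.2
  have g₃ := hX.slot₃ hF s hi.2
  simp only [TypeC.face, hi.1, ht₃, layerFace] at g₄ g₃
  have hE := (h (col s)).elim γ (dirParam α β γ ρ j) _ (ha i) (X s)
  have hne : ∃ o', (T.layer (col s)).Qstar (X s) (X (nb s j)) o' (X (nb (nb s j) i))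
      (dirParam α β γ ρ j) (dirParam α β γ ρ i) ≠ 0 :=
    ⟨X (nb s i) + 1, fun h0 => by simpa using (f₀ _).1 h0⟩
  constructor
  · intro z
    rw [← g₄]
    exact (hE _ _ _ _ _).1 ((f₀ _).2 rfl) hne
  · intro z
    rw [← g₃]
    exact (hE _ _ _ _ _).1 ((f₀ _).2 rfl) hne

/-- The equation of a vertex with two type-H faces. -/
lemma cbar_eq_zero_iff' (s : Fin 16) (z : ℂ) :
    (T.layer (col s)).Cbar (X s) (X (nb s 0)) (X (nb s 1)) z (X (nb (nb s 1) 3))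
      (γ - α) (-α) (β - α) = 0 ↔ z = X (nb (nb s 0) 3) := by
  have hF := TypeC.cubeSystem (fun c => (h c).laws) ht ha fun i j hij => ha' i j hij.ne
  have t₀ : t 0 = false := ht.pair 0 1 2 (by decide) (by decide)
  have f₄ := hX.slot₄ s (show (0 : Fin 4) < 3 by decide)
  have g₃ := hX.slot₃ hF s (show (1 : Fin 4) < 3 by decide)
  simp only [TypeC.face, t₀, ht₁, ht₃, layerFace] at f₄ g₃
  rw [← f₄]
  exact ((h (col s)).elim' α β γ (X s) _ _ _ _ _).2 ((g₃ _).2 rfl)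
    ⟨X (nb s 3) + 1, fun h0 => by simpa using (g₃ _).1 h0⟩

/-- The hex equations on six vertices of a 3-cube of a regular solution hold, and they determine the
values at the third and the fourth vertex, and the one at the first vertex, from the others. -/
lemma hexC_iff (z : Fin 16)
    (hz : ∀ k, col (hexVert k ^^^ z) = (![false, true, true, true, false, false] : _ → _) k) :
    let x := fun k => X (hexVert k ^^^ z)
    (∀ p q, HexC T.C T.Cbar α β γ ![x 0, x 1, p, q, x 4, x 5] ↔ p = x 2 ∧ q = x 3) ∧
    ∀ p, HexC T.C T.Cbar α β γ ![p, x 1, x 2, x 3, x 4, x 5] ↔ p = x 0 := by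
  intro x
  obtain ⟨⟨n1, n2, n3, n4, n5, n6, n7, n8, n9, n10, n11, n12⟩, m1, m2, m3, m4, m5, m6, m7, m8, m9,
    m10, m11, m12⟩ := nb_hexVert z
  have eA := cbar_eq_zero_iff h ht ht₁ ht₃ ha ha' hX (hexVert 0 ^^^ z) (.inl ⟨rfl, rfl⟩)
  have eB := cbar_eq_zero_iff h ht ht₁ ht₃ ha ha' hX (hexVert 1 ^^^ z) (.inr ⟨rfl, rfl⟩)
  have eC := cbar_eq_zero_iff' h ht ht₁ ht₃ ha ha' hX (hexVert 2 ^^^ z)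
  have eD := cbar_eq_zero_iff h ht ht₁ ht₃ ha ha' hX (hexVert 3 ^^^ z) (.inl ⟨rfl, rfl⟩)
  have eE := cbar_eq_zero_iff h ht ht₁ ht₃ ha ha' hX (hexVert 4 ^^^ z) (.inr ⟨rfl, rfl⟩)
  have eF := cbar_eq_zero_iff' h ht ht₁ ht₃ ha ha' hX (hexVert 5 ^^^ z)
  rw [m1, m2, n1, n9, hz 0] at eA
  rw [m3, m4, n2, n10, hz 1] at eB
  rw [m9, m10, n5, n6, hz 2] at eC
  rw [m5, m6, n3, n11, hz 3] at eD
  rw [m7, m8, n4, n12, hz 4] at eE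
  rw [m11, m12, n7, n8, hz 5] at eF
  have hx : HexC T.C T.Cbar α β γ x :=
    ⟨(eA.1 _).2 rfl, (eB.1 _).2 rfl, (eC _).2 rfl, (eD.1 _).2 rfl, (eE.1 _).2 rfl, (eF _).2 rfl⟩
  have hx' : x = ![x 0, x 1, x 2, x 3, x 4, x 5] := by
    ext k
    fin_cases k <;> rfl
  refine ⟨fun p q => ⟨fun h' => ?_, ?_⟩, fun p => ⟨fun h' => ?_, ?_⟩⟩
  · obtain ⟨e₀, -, -, -, -, e₅⟩ := h'
    exact ⟨(eA.1 _).1 e₀, (eF _).1 e₅⟩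
  · rintro ⟨rfl, rfl⟩
    rwa [← hx']
  · obtain ⟨-, e₁, -⟩ := h'
    exact (eB.2 _).1 e₁
  · rintro rfl
    rwa [← hx']

end

/-! ### Consistency of type-C combinations -/

lemma exists_eq_of_init {S : (Fin 6 → ℂ) → (Fin 6 → ℂ) → Prop} {v : Fin 5 → ℂ}
    {xc xd yb yc yd ye yf : ℂ}
    (h : S ![v 0, v 1, xc, xd, v 2, v 3] ![v 4, yb, yc, yd, ye, yf])
    (h' : ∀ p q r s t u w, S ![v 0, v 1, p, q, v 2, v 3] ![v 4, r, s, t, u, w] →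
      p = xc ∧ q = xd ∧ r = yb ∧ s = yc ∧ t = yd ∧ u = ye ∧ w = yf) : UniquelySolvable S v := by
  refine ⟨(![v 0, v 1, xc, xd, v 2, v 3], ![v 4, yb, yc, yd, ye, yf]),
    ⟨h, rfl, rfl, rfl, rfl, rfl⟩, ?_⟩
  rintro ⟨x, y⟩ ⟨hs, h0, h1, h4, h5, hy⟩
  simp only at hs h0 h1 h4 h5 hy
  have ex : x = ![v 0, v 1, x 2, x 3, v 2, v 3] := by
    rw [← h0, ← h1, ← h4, ← h5]
    ext k
    fin_cases k <;> rfl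
  have ey : y = ![v 4, y 1, y 2, y 3, y 4, y 5] := by
    rw [← hy]
    ext k
    fin_cases k <;> rfl
  rw [ex, ey] at hs
  obtain ⟨e1, e2, e3, e4, e5, e6, e7⟩ := h' _ _ _ _ _ _ _ hs
  rw [ex, ey, e1, e2, e3, e4, e5, e6, e7]

/-- The stepwise evolution yields the unique solution. -/
lemma Stepwise₁.uniquelySolvable {T : TypeC} {α β γ ρ : ℂ} {v : Fin 5 → ℂ}
    (h : Stepwise₁ T α β γ ρ (v 0) (v 1) (v 2) (v 3) (v 4)) :
    UniquelySolvable (PrismC₁ T α β γ ρ) v := by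
  obtain ⟨xc, xd, yb, yc, yd, ye, yf, hx, hb, hf, hc, he, hy, h5, h6⟩ := h
  refine exists_eq_of_init (xc := xc) (xd := xd) (yb := yb) (yc := yc) (yd := yd) (ye := ye)
    (yf := yf) ⟨(hx _ _).2 ⟨rfl, rfl⟩, (hy _).2 rfl, (hb _).2 rfl, (hf _).2 rfl, (hc _).2 rfl,
      (he _).2 rfl, (h5 _).2 rfl, (h6 _).2 rfl⟩ ?_
  rintro p q r s t u w ⟨ex, ey, eb, ef, ec, ee, e5, -⟩
  obtain ⟨rfl, rfl⟩ := (hx _ _).1 ex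
  obtain rfl := (hb _).1 eb
  obtain rfl := (hf _).1 ef
  obtain rfl := (hc _).1 ec
  obtain rfl := (he _).1 ee
  exact ⟨rfl, rfl, rfl, rfl, (h5 _).1 e5, rfl, rfl⟩

lemma Stepwise₂.uniquelySolvable {T : TypeC} {α β γ ρ : ℂ} {v : Fin 5 → ℂ}
    (h : Stepwise₂ T α β γ ρ (v 0) (v 1) (v 2) (v 3) (v 4)) :
    UniquelySolvable (PrismC₂ T α β γ ρ) v := by
  obtain ⟨xc, xd, yb, yc, yd, ye, yf, hx, hb, hf, hc, he, hy, h5, h6⟩ := h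
  refine exists_eq_of_init (xc := xc) (xd := xd) (yb := yb) (yc := yc) (yd := yd) (ye := ye)
    (yf := yf) ⟨(hx _ _).2 ⟨rfl, rfl⟩, (hy _).2 rfl, (hb _).2 rfl, (hf _).2 rfl, (hc _).2 rfl,
      (he _).2 rfl, (h5 _).2 rfl, (h6 _).2 rfl⟩ ?_
  rintro p q r s t u w ⟨ex, ey, eb, ef, ec, ee, e5, -⟩
  obtain ⟨rfl, rfl⟩ := (hx _ _).1 ex
  obtain rfl := (hb _).1 eb
  obtain rfl := (hf _).1 ef
  obtain rfl := (hc _).1 ec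
  obtain rfl := (he _).1 ee
  exact ⟨rfl, rfl, rfl, rfl, (h5 _).1 e5, rfl, rfl⟩

/-- The directions that connect the two layers in the first arrangement. -/
def cross₁ : Fin 4 → Bool := ![false, false, false, true]

/-- The directions that connect the two layers in the second arrangement. -/
def cross₂ : Fin 4 → Bool := ![false, false, true, true]

/-- The layers of the vertices in the first arrangement. -/
def col₁ (s : Fin 16) : Bool := s.val.testBit 3

/-- The layers of the vertices in the second arrangement. -/
def col₂ (s : Fin 16) : Bool := xor (s.val.testBit 2) (s.val.testBit 3)

lemma isLayering₁ : IsLayering cross₁ col₁ := ⟨by decide, by decide, by decide⟩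

lemma isLayering₂ : IsLayering cross₂ col₂ := ⟨by decide, by decide, by decide⟩

section

variable {T : TypeC} {nd : ℂ → Prop} (hnd : IsThin (degenerate nd))
  (h : ∀ c, (T.layer c).IsPair nd)
include hnd h

/-- The first arrangement is the regular solution on the 4-cube with layers `col₁`. The initial
values are those at `1, 9, 2, 3` and `5`, and the top hexagon is the bottom one moved in the
direction of `ρ`. -/
theorem cahp₁_of_isPair : CAHP₁ T := by
  refine ⟨_, hnd, fun q hq => eventually_gen.1 ?_⟩
  obtain ⟨ha, ha'⟩ := nd_of_notMem hq
  have hF := TypeC.cubeSystem (fun c => (h c).laws) isLayering₁ ha fun i j hij => ha' i j hij.ne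
  filter_upwards [exists_isRegular hF (K := fun _ _ => True) (fun _ => .of_forall fun _ => trivial)
    [(3, 0, 1, 5), (4, 0, 1, 9), (0, 1, 2, 3)] ![1, 4, 2, 0, 3] ![1, 9, 2, 3, 5] (by decide)]
    with v hv
  obtain ⟨X, hX, -, hv⟩ := hv
  refine (fun h => ⟨Stepwise₁.uniquelySolvable h, h⟩) ?_
  have hbot := (hexC_iff h isLayering₁ rfl rfl ha ha' hX 0 (by decide)).1
  have htop := (hexC_iff h isLayering₁ rfl rfl ha ha' hX 4 (by decide)).1
  rw [← hv 0, ← hv 1, ← hv 2, ← hv 3, ← hv 4]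
  have q1 := hX.slot₄ 1 (show (2 : Fin 4) < 3 by decide)
  have q2 := hX.slot₂ hF 5 (show (1 : Fin 4) < 2 by decide)
  have q3 := hX.slot₂ hF 13 (show (0 : Fin 4) < 2 by decide)
  have q4 := hX.slot₂ hF 7 (show (0 : Fin 4) < 2 by decide)
  have q5 := hX.slot₂ hF 12 (show (1 : Fin 4) < 2 by decide)
  have q6 := hX.slot₄ 2 (show (2 : Fin 4) < 3 by decide)
  exact ⟨X 8, X 10, X 13, X 12, X 14, X 6, X 7, hbot, q1, q2, q3, q4,
    fun t => (htop _ t).trans (and_iff_right rfl), q5, q6⟩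

/-- The second arrangement is the regular solution on the 4-cube with layers `col₂`. The top hexagon
starts at the vertex above the fourth bottom vertex, as `hexVert k ^^^ 15` does. -/
theorem cahp₂_of_isPair : CAHP₂ T := by
  refine ⟨_, hnd, fun q hq => eventually_gen.1 ?_⟩
  obtain ⟨ha, ha'⟩ := nd_of_notMem hq
  have hF := TypeC.cubeSystem (fun c => (h c).laws) isLayering₂ ha fun i j hij => ha' i j hij.ne
  filter_upwards [exists_isRegular hF (K := fun _ _ => True) (fun _ => .of_forall fun _ => trivial)
    [(3, 0, 1, 5), (4, 0, 1, 9), (0, 1, 2, 3)] ![1, 4, 2, 0, 3] ![1, 9, 2, 3, 5] (by decide)]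
    with v hv
  obtain ⟨X, hX, -, hv⟩ := hv
  refine (fun h => ⟨Stepwise₂.uniquelySolvable h, h⟩) ?_
  have hbot := (hexC_iff h isLayering₂ rfl rfl ha ha' hX 0 (by decide)).1
  have htop := (hexC_iff h isLayering₂ rfl rfl ha ha' hX 15 (by decide)).2
  rw [← hv 0, ← hv 1, ← hv 2, ← hv 3, ← hv 4]
  have q1 := hX.slot₁ hF 13 (show (2 : Fin 4) < 3 by decide)
  have q2 := hX.slot₃ hF 3 (show (1 : Fin 4) < 2 by decide)
  have q3 := hX.slot₂ hF 13 (show (0 : Fin 4) < 2 by decide)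
  have q4 := hX.slot₃ hF 2 (show (0 : Fin 4) < 2 by decide)
  have q5 := hX.slot₂ hF 12 (show (1 : Fin 4) < 2 by decide)
  have q6 := hX.slot₁ hF 14 (show (2 : Fin 4) < 3 by decide)
  exact ⟨X 8, X 10, X 13, X 12, X 14, X 6, X 7, hbot,
    fun t => (h false).laws.swap_iff.trans (q1 t), q2, q3, q4, htop, q5,
    fun t => (h false).laws.swap_iff.trans (q6 t)⟩

end

/-! ### The type-C polynomials -/

/-- A face-centered polynomial that is, up to a factor, the resultant of two quad polynomials in the
variable of the hidden vertex is the result of an elimination in the sense of `IsElimination`. -/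
lemma TypeC.isPair_of_resultant {T : TypeC} {nd : ℂ → Prop} (h : LayerLaws T.Qstar T.H nd)
    {κ : ℂ → ℂ → ℂ} {κ' : ℂ → ℂ → ℂ} (hκ : ∀ p r, nd r → κ p r ≠ 0) (hκ' : ∀ β γ, κ' β γ ≠ 0)
    (e : ∀ x x₁ x₂ x₃ x₄ p q r, κ p r * T.Cbar x x₁ x₂ x₃ x₄ p q r =
      (T.Qstar x x₁ 1 x₂ q r - T.Qstar x x₁ 0 x₂ q r) * T.H x x₄ x₃ 0 (p - r) p -
        (T.H x x₄ x₃ 1 (p - r) p - T.H x x₄ x₃ 0 (p - r) p) * T.Qstar x x₁ 0 x₂ q r)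
    (e' : ∀ x x₁ x₂ x₃ x₄ α β γ, κ' β γ * T.Cbar x x₁ x₂ x₃ x₄ (γ - α) (-α) (β - α) =
      (T.H x x₃ 1 x₁ (γ - α) γ - T.H x x₃ 0 x₁ (γ - α) γ) * T.H x x₄ 0 x₂ (γ - β) γ -
        (T.H x x₄ 1 x₂ (γ - β) γ - T.H x x₄ 0 x₂ (γ - β) γ) * T.H x x₃ 0 x₁ (γ - α) γ) :
    T.IsPair nd where
  laws := h
  elim p q r hr _ := .of_resultant (h.multiAffine q r)
    (fun x x₃ o x₄ => ⟨(h.multiAffineH _ _ x x₄ x₃ o).1, (h.multiAffineH _ _ x x₄ x₃ o).2.2.1,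
      (h.multiAffineH _ _ x x₄ x₃ o).2.2.2, (h.multiAffineH _ _ x x₄ x₃ o).2.1⟩) (hκ p r hr)
    fun _ _ _ _ => e ..
  elim' _ β γ _ := .of_resultant
    (fun x x₁ o x₃ => ⟨(h.multiAffineH _ _ x x₃ o x₁).1, (h.multiAffineH _ _ x x₃ o x₁).2.2.2,
      (h.multiAffineH _ _ x x₃ o x₁).2.2.1, (h.multiAffineH _ _ x x₃ o x₁).2.1⟩)
    (fun x x₂ o x₄ => ⟨(h.multiAffineH _ _ x x₄ o x₂).1, (h.multiAffineH _ _ x x₄ o x₂).2.2.2,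
      (h.multiAffineH _ _ x x₄ o x₂).2.2.1, (h.multiAffineH _ _ x x₄ o x₂).2.1⟩) (hκ' β γ)
    fun _ _ _ _ => e' ..

lemma isPair_H3_left : TypeC.IsPair
    ⟨C3 (1 / 2) (1 / 2) 0, C3 (1 / 2) 0 (1 / 2), H3 1 1, Q3 1, Q3 0⟩ (Complex.sinh · ≠ 0) := by
  refine TypeC.isPair_of_resultant (layerLaws_H3 1 1)
    (κ := fun p r => Complex.sinh r * Complex.exp (p - r))
    (κ' := fun β γ => -Complex.exp (2 * γ - β)) (fun _ _ h => mul_ne_zero h (Complex.exp_ne_zero _))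
    (fun _ _ => neg_ne_zero.2 (Complex.exp_ne_zero _)) (fun x x₁ x₂ x₃ x₄ p q r => ?_)
    fun x x₁ x₂ x₃ x₄ α β γ => ?_
  · dsimp only
    simp only [C3, Q3, H3, Complex.sinh, Complex.exp_sub, Complex.exp_neg, Complex.exp_add, two_mul]
    have hA := Complex.exp_ne_zero p
    have hB := Complex.exp_ne_zero q
    have hC := Complex.exp_ne_zero r
    generalize Complex.exp p = A at *
    generalize Complex.exp q = B at *
    generalize Complex.exp r = C at *
    field_simp
    ring
  · dsimp only
    simp only [C3, H3, Complex.sinh, Complex.exp_sub, Complex.exp_neg, Complex.exp_add, two_mul]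
    have hA := Complex.exp_ne_zero α
    have hB := Complex.exp_ne_zero β
    have hC := Complex.exp_ne_zero γ
    generalize Complex.exp α = A at *
    generalize Complex.exp β = B at *
    generalize Complex.exp γ = C at *
    field_simp
    ring

lemma isPair_H3_right : TypeC.IsPair
    ⟨C3 (1 / 2) 0 (1 / 2), C3 (1 / 2) (1 / 2) 0, swapped (H3 1 1), Q3 0, Q3 1⟩
    (Complex.sinh · ≠ 0) := by
  refine TypeC.isPair_of_resultant layerLaws_H3_swapped
    (κ := fun p r => Complex.sinh r * Complex.exp (p - r))
    (κ' := fun β γ => -Complex.exp (2 * γ - β)) (fun _ _ h => mul_ne_zero h (Complex.exp_ne_zero _))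
    (fun _ _ => neg_ne_zero.2 (Complex.exp_ne_zero _)) (fun x x₁ x₂ x₃ x₄ p q r => ?_)
    fun x x₁ x₂ x₃ x₄ α β γ => ?_
  · dsimp only
    simp only [swapped, C3, Q3, H3, Complex.sinh, Complex.exp_sub, Complex.exp_neg,
      Complex.exp_add, two_mul]
    have hA := Complex.exp_ne_zero p
    have hB := Complex.exp_ne_zero q
    have hC := Complex.exp_ne_zero r
    generalize Complex.exp p = A at *
    generalize Complex.exp q = B at *
    generalize Complex.exp r = C at *
    field_simp
    ring
  · dsimp only
    simp only [swapped, C3, H3, Complex.sinh, Complex.exp_sub, Complex.exp_neg, Complex.exp_add,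
      two_mul]
    have hA := Complex.exp_ne_zero α
    have hB := Complex.exp_ne_zero β
    have hC := Complex.exp_ne_zero γ
    generalize Complex.exp α = A at *
    generalize Complex.exp β = B at *
    generalize Complex.exp γ = C at *
    field_simp
    ring

lemma isPair_H3_one_zero : TypeC.IsPair
    ⟨C3 1 0 0, C3 1 0 0, H3 1 0, Q3 0, Q3 0⟩ (Complex.sinh · ≠ 0) := by
  refine TypeC.isPair_of_resultant (layerLaws_H3 1 0)
    (κ := fun p r => Complex.sinh r * Complex.exp (p - r))
    (κ' := fun β γ => -Complex.exp (2 * γ - β)) (fun _ _ h => mul_ne_zero h (Complex.exp_ne_zero _))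
    (fun _ _ => neg_ne_zero.2 (Complex.exp_ne_zero _)) (fun x x₁ x₂ x₃ x₄ p q r => ?_)
    fun x x₁ x₂ x₃ x₄ α β γ => ?_
  · dsimp only
    simp only [C3, Q3, H3, Complex.sinh, Complex.exp_sub, Complex.exp_neg, Complex.exp_add, two_mul]
    have hA := Complex.exp_ne_zero p
    have hB := Complex.exp_ne_zero q
    have hC := Complex.exp_ne_zero r
    generalize Complex.exp p = A at *
    generalize Complex.exp q = B at *
    generalize Complex.exp r = C at *
    field_simp
    ring
  · dsimp only
    simp only [C3, H3, Complex.sinh, Complex.exp_sub, Complex.exp_neg, Complex.exp_add, two_mul]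
    have hA := Complex.exp_ne_zero α
    have hB := Complex.exp_ne_zero β
    have hC := Complex.exp_ne_zero γ
    generalize Complex.exp α = A at *
    generalize Complex.exp β = B at *
    generalize Complex.exp γ = C at *
    field_simp
    ring

lemma isPair_H3_zero : TypeC.IsPair
    ⟨C3 0 0 0, C3 0 0 0, H3 0 0, Q3 0, Q3 0⟩ (Complex.sinh · ≠ 0) := by
  refine TypeC.isPair_of_resultant (layerLaws_H3 0 0)
    (κ := fun p r => Complex.sinh r * Complex.exp (p - r))
    (κ' := fun β γ => -Complex.exp (2 * γ - β)) (fun _ _ h => mul_ne_zero h (Complex.exp_ne_zero _))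
    (fun _ _ => neg_ne_zero.2 (Complex.exp_ne_zero _)) (fun x x₁ x₂ x₃ x₄ p q r => ?_)
    fun x x₁ x₂ x₃ x₄ α β γ => ?_
  · dsimp only
    simp only [C3, Q3, H3, Complex.sinh, Complex.exp_sub, Complex.exp_neg, Complex.exp_add, two_mul]
    have hA := Complex.exp_ne_zero p
    have hB := Complex.exp_ne_zero q
    have hC := Complex.exp_ne_zero r
    generalize Complex.exp p = A at *
    generalize Complex.exp q = B at *
    generalize Complex.exp r = C at *
    field_simp
    ring
  · dsimp only
    simp only [C3, H3, Complex.sinh, Complex.exp_sub, Complex.exp_neg, Complex.exp_add, two_mul]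
    have hA := Complex.exp_ne_zero α
    have hB := Complex.exp_ne_zero β
    have hC := Complex.exp_ne_zero γ
    generalize Complex.exp α = A at *
    generalize Complex.exp β = B at *
    generalize Complex.exp γ = C at *
    field_simp
    ring

lemma isPair_H2_left : TypeC.IsPair
    ⟨C2 1 1 0, C2 1 0 1, H2 1, Q2, Q1 1⟩ (· ≠ 0) := by
  refine TypeC.isPair_of_resultant layerLaws_H2_one (κ := fun _ r => -r) (κ' := fun _ _ => -1)
    (fun _ _ h => neg_ne_zero.2 h) (fun _ _ => by simp)
    (fun x x₁ x₂ x₃ x₄ p q r => ?_) fun x x₁ x₂ x₃ x₄ α β γ => ?_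
  · simp only [C2, H2, Q1, pow_one, pow_zero, Nat.cast_one, Nat.cast_zero]
    ring
  · simp only [C2, H2, pow_one, pow_zero, Nat.cast_one, Nat.cast_zero]
    ring

lemma isPair_H2_right : TypeC.IsPair
    ⟨C2 1 0 1, C2 1 1 0, swapped (H2 1), Q1 1, Q2⟩ (· ≠ 0) := by
  refine TypeC.isPair_of_resultant layerLaws_H2_swapped (κ := fun _ r => -r) (κ' := fun _ _ => -1)
    (fun _ _ h => neg_ne_zero.2 h) (fun _ _ => by simp)
    (fun x x₁ x₂ x₃ x₄ p q r => ?_) fun x x₁ x₂ x₃ x₄ α β γ => ?_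
  · simp only [swapped, C2, H2, Q2, Q1, pow_one, pow_zero, Nat.cast_one, Nat.cast_zero]
    ring
  · simp only [swapped, C2, H2, pow_one, pow_zero, Nat.cast_one, Nat.cast_zero]
    ring

lemma isPair_H2_zero : TypeC.IsPair
    ⟨C2 1 0 0, C2 1 0 0, H2 0, Q1 1, Q1 1⟩ (· ≠ 0) := by
  refine TypeC.isPair_of_resultant layerLaws_H2_zero (κ := fun _ r => -r) (κ' := fun _ _ => -1)
    (fun _ _ h => neg_ne_zero.2 h) (fun _ _ => by simp)
    (fun x x₁ x₂ x₃ x₄ p q r => ?_) fun x x₁ x₂ x₃ x₄ α β γ => ?_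
  · simp only [C2, H2, Q1, pow_zero, Nat.cast_one, Nat.cast_zero]
    ring
  · simp only [C2, H2, pow_zero, Nat.cast_one, Nat.cast_zero]
    ring

lemma isPair_H1_left : TypeC.IsPair
    ⟨C1 1, C2 0 0 0, H1 1, Q1 1, Q1 0⟩ (· ≠ 0) := by
  refine TypeC.isPair_of_resultant layerLaws_H1_one (κ := fun _ r => -r) (κ' := fun _ _ => -1)
    (fun _ _ h => neg_ne_zero.2 h) (fun _ _ => by simp)
    (fun x x₁ x₂ x₃ x₄ p q r => ?_) fun x x₁ x₂ x₃ x₄ α β γ => ?_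
  · simp only [C2, H1, Q1, pow_zero, Nat.cast_zero]
    ring
  · simp only [C2, H1, pow_zero, Nat.cast_zero]
    ring

lemma isPair_H1_right : TypeC.IsPair
    ⟨C2 0 0 0, C1 1, swapped (H1 1), Q1 0, Q1 1⟩ (· ≠ 0) := by
  refine TypeC.isPair_of_resultant layerLaws_H1_swapped (κ := fun _ r => r) (κ' := fun _ _ => 1)
    (fun _ _ h => h) (fun _ _ => by simp)
    (fun x x₁ x₂ x₃ x₄ p q r => ?_) fun x x₁ x₂ x₃ x₄ α β γ => ?_
  · simp only [swapped, C1, H1, Q1, pow_one, Nat.cast_one]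
    ring
  · simp only [swapped, C1, H1, pow_one, Nat.cast_one]
    ring

lemma isPair_H1_zero : TypeC.IsPair
    ⟨C1 0, C1 0, H1 0, Q1 0, Q1 0⟩ (· ≠ 0) := by
  refine TypeC.isPair_of_resultant layerLaws_H1_zero (κ := fun _ r => r) (κ' := fun _ _ => 1)
    (fun _ _ h => h) (fun _ _ => by simp)
    (fun x x₁ x₂ x₃ x₄ p q r => ?_) fun x x₁ x₂ x₃ x₄ α β γ => ?_
  · simp only [C1, H1, Q1, pow_zero, Nat.cast_zero]
    ring
  · simp only [C1, H1, pow_zero, Nat.cast_zero]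
    ring

lemma swapped_H3_zero (δ : ℂ) : swapped (H3 δ 0) = H3 δ 0 := by
  funext x u v w α β
  simp only [swapped, H3]
  ring

lemma swapped_H2_zero : swapped (H2 0) = H2 0 := by
  funext x u v w α β
  simp only [swapped, H2]
  ring

lemma swapped_H1_zero : swapped (H1 0) = H1 0 := by
  funext x u v w α β
  simp only [swapped, H1]
  ring

theorem cahp_typeC (k : Fin 10) : CAHP₁ (typeCTable k) ∧ CAHP₂ (typeCTable k) := by
  have key : ∀ {T : TypeC} {nd : ℂ → Prop}, IsThin (degenerate nd) → T.IsPair nd →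
      T.exchanged.IsPair nd → CAHP₁ T ∧ CAHP₂ T := fun hnd h h' =>
    have h : ∀ c, (TypeC.layer _ c).IsPair _ := Bool.rec h h'
    ⟨cahp₁_of_isPair hnd h, cahp₂_of_isPair hnd h⟩
  have key' : ∀ {C : FacePoly} {H Q : QuadPoly} {nd : ℂ → Prop}, IsThin (degenerate nd) →
      swapped H = H → TypeC.IsPair ⟨C, C, H, Q, Q⟩ nd →
      CAHP₁ ⟨C, C, H, Q, Q⟩ ∧ CAHP₂ ⟨C, C, H, Q, Q⟩ := fun hnd e h => key hnd h (by
    rw [TypeC.exchanged]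
    simp only [e]
    exact h)
  fin_cases k
  · exact key isThin_degenerate_sinh isPair_H3_left isPair_H3_right
  · exact key isThin_degenerate_sinh isPair_H3_right isPair_H3_left
  · exact key' isThin_degenerate_sinh (swapped_H3_zero 1) isPair_H3_one_zero
  · exact key' isThin_degenerate_sinh (swapped_H3_zero 0) isPair_H3_zero
  · exact key isThin_degenerate_id isPair_H2_left isPair_H2_right
  · exact key isThin_degenerate_id isPair_H2_right isPair_H2_left
  · exact key' isThin_degenerate_id swapped_H2_zero isPair_H2_zero
  · exact key isThin_degenerate_id isPair_H1_left isPair_H1_right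
  · exact key isThin_degenerate_id isPair_H1_right isPair_H1_left
  · exact key' isThin_degenerate_id swapped_H1_zero isPair_H1_zero

end HexPrism

end

theorem mainTheorem2 :
    (∀ k : Fin 10, HexPrism.CAHP₁ (HexPrism.typeCTable k) ∧
      HexPrism.CAHP₂ (HexPrism.typeCTable k)) ∧
    (∀ k : Fin 5, HexPrism.CAHPA (HexPrism.typeATable k).1 (HexPrism.typeATable k).2) ∧
    (∀ L : PeriodPair, HexPrism.CAHPA (HexPrism.A4 L) (HexPrism.Q4 L)) := by
  exact ⟨HexPrism.cahp_typeC, HexPrism.cahpA_nonelliptic, HexPrism.cahpA_A4⟩
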